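/- Let $n\ge 2$, let $\Lambda=\bigoplus_{i=1}^n\mathbb{Z}\epsilon_i$ with $W=S_n\ltimes\{\pm1\}^n$ acting by permutations and sign changes, let $\Lambda^+=\{\lambda\in\Lambda:\lambda_1\ge\dots\ge\lambda_n\ge0\}$, and let $\mathcal{A}=\mathbb{C}[\Lambda]$, with basis $x^\lambda$, be the algebra of Laurent polynomials in $x_i=x^{\epsilon_i}$. Let $q^{1/2},t_0,t,t_n,t_0^\vee,t_n^\vee$ be nonzero complex numbers, put $q=(q^{1/2})^2$ and $t_i=t$ for $0<i<n$, and assume that the parameters are generic in the following sense: $q$ is not a root of unity and, for all $m\in\mathbb{Z}$, $t^{2k}q^m\ne1$ for $1\le k\le n$; $t_0^2t_n^2t^{2k}q^m\ne1$ for $0\le k\le 2n-2$; $t_0^2t^{2k}q^m\ne-1$ and $t_n^2t^{2k}q^m\ne-1$ for $0\le k\le n-1$. Let $a_0=\delta-2\epsilon_1$, $a_i=\epsilon_i-\epsilon_{i+1}$ $(0<i<n)$, $a_n=2\epsilon_n$ be the simple roots of the affine root system of type $\widetilde C_n$, with reflections $s_0,\dots,s_n$ acting on $\Lambda\oplus\mathbb{Z}\delta$;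 for $\mu\in\Lambda$ let $\tau(\mu)$ be the translation $f\mapsto f+\langle\mu,f\rangle\delta$. The $s_i$ act on $\mathcal{A}$ by $s_i(x^\mu)=x^{s_i\mu}$, where $x^{\mu+c\delta}=q^cx^\mu$. Let $H$ be the affine Hecke algebra: the unital associative $\mathbb{C}$-algebra with generators $T_0,\dots,T_n$, relations $(T_i-t_i)(T_i+t_i^{-1})=0$ and the braid relations of type $\widetilde C_n$. For $\lambda\in\Lambda^+$ put $Y^\lambda=T_{\tau(\lambda)}=T_{i_1}\cdots T_{i_r}$ for a reduced expression $\tau(\lambda)=s_{i_1}\cdots s_{i_r}$; for $\lambda=\mu-\nu$ with $\mu,\nu\in\Lambda^+$ put $Y^\lambda=Y^\mu(Y^\nu)^{-1}$; and for $f=\sum c_\lambda x^\lambda\in\mathcal{A}$ put $f(Y)=\sum c_\lambda Y^\lambda$. Let $\mathcal{A}_Y^W=\{f(Y): f\in\mathcal{A}^W\}$. Put $v_{a_i}(x)=(1-t^2x^{a_i})/(1-x^{a_i})$ for $0<i<n$ and $$v_{a_0}(x)=\frac{(1-t_0t_0^\vee q^{1/2}x_1^{-1})(1+t_0(t_0^\vee)^{-1}q^{1/2}x_1^{-1})}{1-qx_1^{-2}},\qquad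 v_{a_n}(x)=\frac{(1-t_nt_n^\vee x_n)(1+t_n(t_n^\vee)^{-1}x_n)}{1-x_n^2}.$$ For $\lambda\in\Lambda$ let $\gamma_\lambda\in(\mathbb{C}\setminus\{0\})^n$ have components $(\gamma_\lambda)_j=(t_0t_n)^{\rho_l(\lambda)_j}t^{\rho_m(\lambda)_j}q^{\lambda_j}$, where $\rho_l(\lambda)=\sum_i\varepsilon(\lambda_i)\epsilon_i$, $\rho_m(\lambda)=\sum_{i<j}\bigl(\varepsilon(\lambda_i-\lambda_j)(\epsilon_i-\epsilon_j)+\varepsilon(\lambda_i+\lambda_j)(\epsilon_i+\epsilon_j)\bigr)$, and $\varepsilon(m)=1$ if $m\ge0$, $\varepsilon(m)=-1$ if $m<0$. For $\lambda,\mu\in\Lambda$ write $\lambda\le\mu$ if $\mu-\lambda$ is a sum of elements of $\{\epsilon_1-\epsilon_2,\dots,\epsilon_{n-1}-\epsilon_n,\epsilon_n\}$; let $\lambda^+$ be the dominant weight in $W\lambda$; and write $\lambda\prec\mu$ if $\lambda\neq\mu$ and either $\lambda^+<\mu^+$, or $\lambda^+=\mu^+$ and $\lambda\le\mu$. Then there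 is a unique algebra homomorphism $\pi:H\to\mathrm{End}_{\mathbb{C}}(\mathcal{A})$ (the Noumi representation) with $\pi(T_i)=t_i+t_i^{-1}v_{a_i}(x)(s_i-\mathrm{id})$ for $0\le i\le n$, and there is a unique basis $\{P_\lambda\}_{\lambda\in\Lambda}$ of $\mathcal{A}$ (the monic non-symmetric Koornwinder polynomials) such that $P_\lambda\in x^\lambda+\mathrm{span}\{x^\mu:\mu\prec\lambda\}$ and $\pi(f(Y))P_\lambda=f(\gamma_\lambda)P_\lambda$ for all $f\in\mathcal{A}$ and $\lambda\in\Lambda$. Regard $\mathcal{A}$ as an $H$-module through $\pi$ and put $\mathcal{A}(\lambda)=\mathrm{span}\{P_\mu:\mu\in W\lambda\}$ for $\lambda\in\Lambda^+$. Then: 1. The $\mathcal{A}(\lambda)$ are $H$-submodules, $\mathcal{A}=\bigoplus_{\lambda\in\Lambda^+}\mathcal{A}(\lambda)$, every $\mathcal{A}(\lambda)$ is irreducible, and $\mathcal{A}(\lambda)\not\cong\mathcal{A}(\mu)$ as $H$-modules for $\lambda\ne\mu$ in $\Lambda^+$. 2. The map $f\mapsto f(Y)$ is injective, the center of $H$ is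 $\mathcal{Z}(H)=\mathcal{A}_Y^W$, and the $\mathcal{A}(\lambda)$, $\lambda\in\Lambda^+$, are exactly the isotypical components of $\mathcal{A}$ as a $\mathcal{Z}(H)$-module. 3. For every $\lambda\in\Lambda^+$ and $f\in\mathcal{A}^W$, the central element $f(Y)$ acts on $\mathcal{A}(\lambda)$ as multiplication by $f(\gamma_\lambda)$. -/

import Mathlib

namespace Koornwinder

noncomputable section

/-! ### The affine root system of type `C^∨C_n`: lattice, simple roots, affine Weyl group -/

/-- The weight lattice `Λ = ℤε₁ ⊕ ⋯ ⊕ ℤεₙ` of the root system of type `C_n`. -/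
abbrev Weight (n : ℕ) : Type := Fin n → ℤ

/-- The lattice `Λ ⊕ ℤδ` of affine linear functions; `(μ, c)` stands for `μ + c δ`. -/
abbrev AffWeight (n : ℕ) : Type := Weight n × ℤ

/-- The basis vector `ε_k` for `1 ≤ k ≤ n` (numbered from `1`; it is `0` for other `k`). -/
def eps (n k : ℕ) : Weight n := fun j => if (j : ℕ) + 1 = k then 1 else 0

/-- The simple roots `a_0 = δ - 2ε_1`, `a_i = ε_i - ε_{i+1}` (`0 < i < n`), `a_n = 2ε_n`. -/
def simpleRoot (n : ℕ) (i : Fin (n + 1)) : AffWeight n :=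
  if (i : ℕ) = 0 then (-(2 • eps n 1), 1)
  else if (i : ℕ) < n then (eps n i - eps n (i + 1), 0)
  else (2 • eps n n, 0)

/-- The gradients of the simple co-roots `a_i^∨`: `-ε_1`, `ε_i - ε_{i+1}`, `ε_n`. -/
def simpleCoroot (n : ℕ) (i : Fin (n + 1)) : Weight n :=
  if (i : ℕ) = 0 then -eps n 1
  else if (i : ℕ) < n then eps n i - eps n (i + 1)
  else eps n n

/-- The functional `g ↦ ⟨g, v⟩` on `Λ ⊕ ℤδ`, where `δ` is in the radical. -/
def pairing {n : ℕ} (v : Weight n) : AffWeight n →ₗ[ℤ] ℤ where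
  toFun g := ∑ j, g.1 j * v j
  map_add' g h := by simp [add_mul, Finset.sum_add_distrib]
  map_smul' c g := by simp [mul_assoc, Finset.mul_sum]

/-- The simple reflection `s_i(g) = g - ⟨g, a_i^∨⟩ a_i`, `0 ≤ i ≤ n`, on `Λ ⊕ ℤδ`. -/
def simpleRefl (n : ℕ) (i : Fin (n + 1)) : Module.End ℤ (AffWeight n) :=
  Module.preReflection (simpleRoot n i) (pairing (simpleCoroot n i))

/-- The translation operator `τ(v) f = f + ⟨v, f⟩ δ`. -/
def tau {n : ℕ} (v : Weight n) : Module.End ℤ (AffWeight n) where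
  toFun g := (g.1, g.2 + pairing v g)
  map_add' g h := by
    ext1
    · rfl
    · simp only [Prod.snd_add, map_add]; ring
  map_smul' c g := by
    ext1
    · rfl
    · simp only [Prod.smul_snd, map_smul, smul_add, RingHom.id_apply]

/-- `l = [i_1, …, i_r]` is a reduced expression of `w`: one has `w = s_{i_1} ⋯ s_{i_r}`,
with `r` minimal. -/
def IsReducedWord {n : ℕ} (l : List (Fin (n + 1))) (w : Module.End ℤ (AffWeight n)) : Prop :=
  (l.map (simpleRefl n)).prod = w ∧
    ∀ l' : List (Fin (n + 1)), (l'.map (simpleRefl n)).prod = w → l.length ≤ l'.length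

/-- The change of sign of the `k`-th coordinate. -/
def signChange (n k : ℕ) : Module.End ℤ (AffWeight n) :=
  Module.preReflection ((2 • eps n k, 0) : AffWeight n) (pairing (eps n k))

lemma pairing_eps {n k : ℕ} (hk : k < n) (g : AffWeight n) :
    pairing (eps n (k + 1)) g = g.1 ⟨k, hk⟩ := by
  have h : ∀ j : Fin n, (j : ℕ) = k ↔ j = ⟨k, hk⟩ := fun j => by rw [Fin.ext_iff]
  simp [pairing, eps, h]

lemma eps_eq_single {n k : ℕ} (hk : k < n) : eps n (k + 1) = Pi.single ⟨k, hk⟩ 1 := by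
  ext j
  simp [eps, Pi.single_apply, Fin.ext_iff]

lemma pairing_single {n : ℕ} (j : Fin n) (g : AffWeight n) :
    pairing (Pi.single j 1) g = g.1 j := by
  simp [pairing, Pi.single_apply]

lemma pairing_add {n : ℕ} (v w : Weight n) (g : AffWeight n) :
    pairing (v + w) g = pairing v g + pairing w g := by
  simp [pairing, mul_add, Finset.sum_add_distrib]

lemma pairing_neg {n : ℕ} (v : Weight n) (g : AffWeight n) :
    pairing (-v) g = -pairing v g := by
  simp [pairing]

lemma pairing_sub {n : ℕ} (v w : Weight n) (g : AffWeight n) :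
    pairing (v - w) g = pairing v g - pairing w g := by
  rw [sub_eq_add_neg, pairing_add, pairing_neg, sub_eq_add_neg]

lemma tau_apply {n : ℕ} (v : Weight n) (g : AffWeight n) :
    tau v g = (g.1, g.2 + pairing v g) := rfl

lemma tau_zero {n : ℕ} : tau (0 : Weight n) = 1 := by
  refine LinearMap.ext fun g => ?_
  simp [tau_apply, pairing]

lemma tau_add {n : ℕ} (v w : Weight n) : tau (v + w) = tau v * tau w := by
  refine LinearMap.ext fun g => ?_
  rw [Module.End.mul_apply, tau_apply, tau_apply, tau_apply, pairing_add]
  ext1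
  · rfl
  · have : pairing v (g.1, g.2 + pairing w g) = pairing v g := rfl
    simp only [this]
    ring

/-- The monoid generated by the simple reflections. -/
def affineWeyl (n : ℕ) : Submonoid (Module.End ℤ (AffWeight n)) :=
  Submonoid.closure (Set.range (simpleRefl n))

lemma simpleRefl_mem (n : ℕ) (i : Fin (n + 1)) : simpleRefl n i ∈ affineWeyl n :=
  Submonoid.subset_closure ⟨i, rfl⟩

lemma simpleRefl_middle {n k : ℕ} (hk : k + 1 < n) (g : AffWeight n) :
    simpleRefl n ⟨k + 1, by omega⟩ g =
      (fun j => g.1 (Equiv.swap ⟨k, by omega⟩ ⟨k + 1, hk⟩ j), g.2) := by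
  have h1 : k < n := by omega
  simp only [simpleRefl, simpleRoot, simpleCoroot, Module.preReflection_apply, pairing_sub,
    Nat.add_eq_zero_iff, one_ne_zero, and_false, if_false, hk, if_true, pairing_single,
    eps_eq_single hk, eps_eq_single h1]
  ext j
  · rcases eq_or_ne j ⟨k, h1⟩ with rfl | hj
    · simp
    · rcases eq_or_ne j ⟨k + 1, hk⟩ with rfl | hj'
      · simp
      · simp [Equiv.swap_apply_of_ne_of_ne hj hj', hj, hj']
  · simp

lemma signChange_apply {n k : ℕ} (hk : k < n) (g : AffWeight n) :
    signChange n (k + 1) g =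
      (fun j => if j = ⟨k, hk⟩ then -g.1 j else g.1 j, g.2) := by
  simp only [signChange, Module.preReflection_apply, pairing_single, eps_eq_single hk]
  ext j
  · rcases eq_or_ne j ⟨k, hk⟩ with rfl | hj
    · simp; ring
    · simp [hj]
  · simp

lemma signChange_mem (n m : ℕ) : ∀ k, k + m + 1 = n → signChange n (k + 1) ∈ affineWeyl n := by
  induction m with
  | zero =>
    intro k hk
    have : signChange n (k + 1) = simpleRefl n (Fin.last n) := by
      simp [signChange, simpleRefl, simpleRoot, simpleCoroot, ← hk]
    rw [this]
    exact simpleRefl_mem n _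
  | succ m ih =>
    intro k hk
    have h1 : k + 1 < n := by omega
    have h0 : k < n := by omega
    have h := ih (k + 1) (by omega)
    have : signChange n (k + 1) = simpleRefl n ⟨k + 1, by omega⟩ * signChange n (k + 1 + 1) *
        simpleRefl n ⟨k + 1, by omega⟩ := by
      refine LinearMap.ext fun g => ?_
      simp only [Module.End.mul_apply, simpleRefl_middle h1, signChange_apply h1,
        signChange_apply h0]
      ext j
      · rcases eq_or_ne j ⟨k, h0⟩ with rfl | hj
        · simp
        · rcases eq_or_ne j ⟨k + 1, h1⟩ with rfl | hj'
          · simp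
          · simp [Equiv.swap_apply_of_ne_of_ne hj hj', hj, hj']
      · rfl
    rw [this]
    exact mul_mem (mul_mem (simpleRefl_mem n _) h) (simpleRefl_mem n _)

lemma simpleRefl_zero {n : ℕ} (hn : 0 < n) (g : AffWeight n) :
    simpleRefl n 0 g =
      (fun j => if j = ⟨0, hn⟩ then -g.1 j else g.1 j, g.2 + g.1 ⟨0, hn⟩) := by
  have e := eps_eq_single hn
  rw [zero_add] at e
  simp only [simpleRefl, simpleRoot, simpleCoroot, Module.preReflection_apply, pairing_neg, pairing_single, e,
    Fin.val_zero, if_true]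
  ext j
  · rcases eq_or_ne j ⟨0, hn⟩ with rfl | hj
    · simp; ring
    · simp [hj]
  · simp

lemma tau_eps_mem (n : ℕ) : ∀ k, k < n →
    tau (eps n (k + 1)) ∈ affineWeyl n ∧ tau (-eps n (k + 1)) ∈ affineWeyl n := by
  intro k
  induction k with
  | zero =>
    intro hn
    have hs := signChange_mem n (n - 1) 0 (by omega)
    have h1 : tau (eps n (0 + 1)) = signChange n (0 + 1) * simpleRefl n 0 := by
      refine LinearMap.ext fun g => ?_
      rw [Module.End.mul_apply, simpleRefl_zero hn, signChange_apply hn, tau_apply,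
        pairing_eps hn]
      ext j
      · rcases eq_or_ne j ⟨0, hn⟩ with rfl | hj
        · simp
        · simp [hj]
      · rfl
    have h2 : tau (-eps n (0 + 1)) = simpleRefl n 0 * signChange n (0 + 1) := by
      refine LinearMap.ext fun g => ?_
      rw [Module.End.mul_apply, simpleRefl_zero hn, signChange_apply hn, tau_apply,
        pairing_neg, pairing_eps hn]
      ext j
      · rcases eq_or_ne j ⟨0, hn⟩ with rfl | hj
        · simp
        · simp [hj]
      · simp
    rw [h1, h2]
    exact ⟨mul_mem hs (simpleRefl_mem n _), mul_mem (simpleRefl_mem n _) hs⟩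
  | succ k ih =>
    intro hk
    have h0 : k < n := by omega
    obtain ⟨i1, i2⟩ := ih h0
    have h1 : tau (eps n (k + 1 + 1)) = simpleRefl n ⟨k + 1, by omega⟩ * tau (eps n (k + 1)) *
        simpleRefl n ⟨k + 1, by omega⟩ := by
      refine LinearMap.ext fun g => ?_
      simp only [Module.End.mul_apply, simpleRefl_middle hk, tau_apply, pairing_eps hk,
        pairing_eps h0]
      ext j <;> simp
    have h2 : tau (-eps n (k + 1 + 1)) = simpleRefl n ⟨k + 1, by omega⟩ *
        tau (-eps n (k + 1)) * simpleRefl n ⟨k + 1, by omega⟩ := by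
      refine LinearMap.ext fun g => ?_
      simp only [Module.End.mul_apply, simpleRefl_middle hk, tau_apply, pairing_neg,
        pairing_eps hk, pairing_eps h0]
      ext j <;> simp
    rw [h1, h2]
    exact ⟨mul_mem (mul_mem (simpleRefl_mem n _) i1) (simpleRefl_mem n _),
      mul_mem (mul_mem (simpleRefl_mem n _) i2) (simpleRefl_mem n _)⟩

lemma tau_mem (n : ℕ) (v : Weight n) : tau v ∈ affineWeyl n := by
  have hsum : v = ∑ j : Fin n, v j • eps n ((j : ℕ) + 1) := by
    ext i
    simp [Finset.sum_apply, eps_eq_single, Pi.single_apply]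
  have key : ∀ (c : ℤ) (j : Fin n), tau (c • eps n ((j : ℕ) + 1)) ∈ affineWeyl n := by
    intro c j
    have nat : ∀ (w : Weight n) (m : ℕ), tau w ∈ affineWeyl n → tau (m • w) ∈ affineWeyl n := by
      intro w m hw
      induction m with
      | zero => rw [zero_smul, tau_zero]; exact one_mem _
      | succ m ih => rw [succ_nsmul, tau_add]; exact mul_mem ih hw
    obtain ⟨m, rfl | rfl⟩ := c.eq_nat_or_neg
    · rw [natCast_zsmul]
      exact nat _ m (tau_eps_mem n j j.2).1
    · rw [neg_smul, ← smul_neg, natCast_zsmul]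
      exact nat _ m (tau_eps_mem n j j.2).2
  rw [hsum]
  have : ∀ s : Finset (Fin n), tau (∑ j ∈ s, v j • eps n ((j : ℕ) + 1)) ∈ affineWeyl n := by
    classical
    intro s
    induction s using Finset.induction_on with
    | empty => rw [Finset.sum_empty, tau_zero]; exact one_mem _
    | insert a s ha ih => rw [Finset.sum_insert ha, tau_add]; exact mul_mem (key _ _) ih
  exact this _

/-- Every translation `τ(v)`, `v ∈ Λ`, has a reduced expression in the simple reflections. -/
lemma exists_reducedWord_tau {n : ℕ} (v : Weight n) : ∃ l, IsReducedWord l (tau v) := by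
  classical
  have h : ∃ r, ∃ l : List (Fin (n + 1)), (l.map (simpleRefl n)).prod = tau v ∧ l.length = r := by
    obtain ⟨l, hl, hp⟩ := Submonoid.exists_list_of_mem_closure (tau_mem n v)
    have : ∃ l' : List (Fin (n + 1)), l'.map (simpleRefl n) = l := by
      clear hp
      induction l with
      | nil => exact ⟨[], rfl⟩
      | cons a l ih =>
        obtain ⟨l', hl'⟩ := ih fun y hy => hl y (List.mem_cons_of_mem _ hy)
        obtain ⟨i, hi⟩ := hl a List.mem_cons_self
        exact ⟨i :: l', by rw [List.map_cons, hi, hl']⟩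
    obtain ⟨l', rfl⟩ := this
    exact ⟨_, l', hp, rfl⟩
  obtain ⟨l, hl, hr⟩ := Nat.find_spec h
  exact ⟨l, hl, fun l' hl' => hr ▸ Nat.find_min' h ⟨l', hl', rfl⟩⟩

/-! ### Parameters -/

/-- The parameters: a square root `q12` of `q`, and the five values `t_0`, `t`, `t_n`, `t_0^∨`,
`t_n^∨` that determine a multiplicity function on the affine root system of type `C^∨C_n`
(`t` is the common value at `a_i`, `0 < i < n`). All are nonzero complex numbers. -/
structure Params where
  q12 : ℂˣ
  t0 : ℂˣ
  t : ℂˣ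
  tn : ℂˣ
  t0v : ℂˣ
  tnv : ℂˣ

/-- The deformation parameter `q`. -/
def Params.q (p : Params) : ℂˣ := p.q12 ^ 2

/-- The value `t_i = t_{a_i}`, `0 ≤ i ≤ n`. -/
def Params.tRoot (p : Params) (n : ℕ) (i : Fin (n + 1)) : ℂˣ :=
  if (i : ℕ) = 0 then p.t0 else if (i : ℕ) < n then p.t else p.tn

/-- The genericity assumption: `q` is not a root of unity, and for the exponents `k` in the finite
ranges below and all integers `m` one has `t^{2k} q^m ≠ 1`, `t_0² t_n² t^{2k} q^m ≠ 1`,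
`t_0² t^{2k} q^m ≠ -1` and `t_n² t^{2k} q^m ≠ -1`. This excludes countably many proper
hypersurfaces in the parameter space. -/
structure Params.IsGeneric (p : Params) (n : ℕ) : Prop where
  q_pow_ne : ∀ m : ℤ, m ≠ 0 → p.q ^ m ≠ 1
  t_pow_ne : ∀ k : ℕ, 1 ≤ k → k ≤ n → ∀ m : ℤ, p.t ^ (2 * k) * p.q ^ m ≠ 1
  t0tn_ne : ∀ k : ℕ, k + 2 ≤ 2 * n → ∀ m : ℤ,
    p.t0 ^ 2 * p.tn ^ 2 * p.t ^ (2 * k) * p.q ^ m ≠ 1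
  t0_ne : ∀ k : ℕ, k < n → ∀ m : ℤ, p.t0 ^ 2 * p.t ^ (2 * k) * p.q ^ m ≠ -1
  tn_ne : ∀ k : ℕ, k < n → ∀ m : ℤ, p.tn ^ 2 * p.t ^ (2 * k) * p.q ^ m ≠ -1

/-! ### The affine Hecke algebra and the elements `Y^λ` -/

/-- The defining relations of the affine Hecke algebra of type `C̃_n`. -/
inductive HeckeRel (n : ℕ) (p : Params) :
    FreeAlgebra ℂ (Fin (n + 1)) → FreeAlgebra ℂ (Fin (n + 1)) → Prop
  | quadratic (i : Fin (n + 1)) :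
      HeckeRel n p
        ((FreeAlgebra.ι ℂ i - algebraMap ℂ _ (p.tRoot n i : ℂ)) *
          (FreeAlgebra.ι ℂ i + algebraMap ℂ _ ((p.tRoot n i : ℂ)⁻¹))) 0
  | braid_four (i j : Fin (n + 1)) (hij : (j : ℕ) = i + 1) (h : (i : ℕ) = 0 ∨ (j : ℕ) = n) :
      HeckeRel n p
        (FreeAlgebra.ι ℂ i * FreeAlgebra.ι ℂ j * FreeAlgebra.ι ℂ i * FreeAlgebra.ι ℂ j)
        (FreeAlgebra.ι ℂ j * FreeAlgebra.ι ℂ i * FreeAlgebra.ι ℂ j * FreeAlgebra.ι ℂ i)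
  | braid_three (i j : Fin (n + 1)) (hij : (j : ℕ) = i + 1) (hi : 0 < (i : ℕ))
      (hj : (j : ℕ) < n) :
      HeckeRel n p
        (FreeAlgebra.ι ℂ i * FreeAlgebra.ι ℂ j * FreeAlgebra.ι ℂ i)
        (FreeAlgebra.ι ℂ j * FreeAlgebra.ι ℂ i * FreeAlgebra.ι ℂ j)
  | commute (i j : Fin (n + 1)) (hij : (i : ℕ) + 2 ≤ j) :
      HeckeRel n p
        (FreeAlgebra.ι ℂ i * FreeAlgebra.ι ℂ j)
        (FreeAlgebra.ι ℂ j * FreeAlgebra.ι ℂ i)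

/-- The affine Hecke algebra `H(R; 𝐤)` of type `C̃_n`. -/
abbrev AffineHecke (n : ℕ) (p : Params) : Type := RingQuot (HeckeRel n p)

/-- The generator `T_i` of the affine Hecke algebra. -/
def heckeT (n : ℕ) (p : Params) (i : Fin (n + 1)) : AffineHecke n p :=
  RingQuot.mkAlgHom ℂ (HeckeRel n p) (FreeAlgebra.ι ℂ i)

/-- `T_{τ(v)} = T_{i_1} ⋯ T_{i_r}` for a reduced expression `τ(v) = s_{i_1} ⋯ s_{i_r}`. -/
def heckeTau {n : ℕ} (p : Params) (v : Weight n) : AffineHecke n p :=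
  ((exists_reducedWord_tau v).choose.map (heckeT n p)).prod

/-- The coefficients `m_i` in the expansion `λ = ∑ m_i ω_i` in the fundamental weights
`ω_i = ε_1 + ⋯ + ε_i`. -/
def fundCoeff {n : ℕ} (v : Weight n) (i : Fin n) : ℤ :=
  v i - if h : (i : ℕ) + 1 < n then v ⟨i + 1, h⟩ else 0

/-- The dominant weight `∑ max(m_i, 0) ω_i`, where `λ = ∑ m_i ω_i`. -/
def dominantPart {n : ℕ} (v : Weight n) : Weight n :=
  fun j => ∑ i : Fin n, if j ≤ i then max (fundCoeff v i) 0 else 0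

/-- `Y^λ = Y^μ (Y^ν)⁻¹` for `λ = μ - ν` with `μ`, `ν` dominant, and `Y^μ = T_{τ(μ)}` for `μ`
dominant. Here `μ = ∑ max(m_i, 0) ω_i` and `ν = ∑ max(-m_i, 0) ω_i` if `λ = ∑ m_i ω_i`. -/
def yElt {n : ℕ} (p : Params) (v : Weight n) : AffineHecke n p :=
  heckeTau p (dominantPart v) * Ring.inverse (heckeTau p (dominantPart (-v)))

/-- The algebra `𝒜` of Laurent polynomials: the group algebra of the weight lattice. -/
abbrev Laurent (n : ℕ) : Type := AddMonoidAlgebra ℂ (Weight n)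

/-- The map `f(x) = ∑ c_λ x^λ ↦ f(Y) = ∑ c_λ Y^λ`. -/
def yMap (n : ℕ) (p : Params) : Laurent n →ₗ[ℂ] AffineHecke n p :=
  (Finsupp.linearCombination ℂ (yElt p)) ∘ₗ
    (AddMonoidAlgebra.coeffLinearEquiv ℂ).toLinearMap

/-! ### The Noumi representation -/

/-- The monomial `x^{μ + c δ} = q^c x^μ`. -/
def affMonomial {n : ℕ} (p : Params) (g : AffWeight n) : Laurent n :=
  AddMonoidAlgebra.single g.1 ((p.q ^ g.2 : ℂˣ) : ℂ)

/-- The action of the simple reflection `s_i` on Laurent polynomials,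
`s_i(x^μ) = x^{s_i μ}`. -/
def reflAct {n : ℕ} (p : Params) (i : Fin (n + 1)) : Laurent n →ₗ[ℂ] Laurent n :=
  (Finsupp.linearCombination ℂ fun μ : Weight n => affMonomial p (simpleRefl n i (μ, 0))) ∘ₗ
    (AddMonoidAlgebra.coeffLinearEquiv ℂ).toLinearMap

/-- The numerator of `v_{a_i}`: it is
`(1 - t_β t_{β/2} x^{β/2}) (1 + t_β t_{β/2}⁻¹ x^{β/2})` for `β = a_i`, which is to be read as
`1 - t_β² x^β` if `β/2` is not a root. Note `a_0/2 = δ/2 - ε_1` and `a_n/2 = ε_n`. -/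
def vNum (n : ℕ) (p : Params) (i : Fin (n + 1)) : Laurent n :=
  if (i : ℕ) = 0 then
    (1 - AddMonoidAlgebra.single (-eps n 1) ((p.t0 * p.t0v * p.q12 : ℂˣ) : ℂ)) *
      (1 + AddMonoidAlgebra.single (-eps n 1) ((p.t0 * p.t0v⁻¹ * p.q12 : ℂˣ) : ℂ))
  else if (i : ℕ) < n then 1 - ((p.t : ℂ) ^ 2) • affMonomial p (simpleRoot n i)
  else
    (1 - AddMonoidAlgebra.single (eps n n) ((p.tn * p.tnv : ℂˣ) : ℂ)) *
      (1 + AddMonoidAlgebra.single (eps n n) ((p.tn * p.tnv⁻¹ : ℂˣ) : ℂ))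

/-- The rational function `v_{a_i}(x) = vNum / (1 - x^{a_i})`. -/
def vFun (n : ℕ) (p : Params) (i : Fin (n + 1)) : FractionRing (Laurent n) :=
  algebraMap (Laurent n) _ (vNum n p i) /
    algebraMap (Laurent n) _ (1 - affMonomial p (simpleRoot n i))

/-- `π` is the Noumi representation: `π(T_i) = t_i + t_i⁻¹ v_{a_i}(x) (s_i - id)`. -/
def IsNoumiRep (n : ℕ) (p : Params) (π : AffineHecke n p →ₐ[ℂ] Module.End ℂ (Laurent n)) :
    Prop :=
  ∀ (i : Fin (n + 1)) (f : Laurent n),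
    algebraMap (Laurent n) (FractionRing (Laurent n)) (π (heckeT n p i) f) =
      algebraMap (Laurent n) _ ((p.tRoot n i : ℂ) • f) +
        vFun n p i * algebraMap (Laurent n) _ ((p.tRoot n i : ℂ)⁻¹ • (reflAct p i f - f))

/-- The `H(R; 𝐤)`-module structure on `𝒜` defined by a representation. -/
abbrev repModule {n : ℕ} {p : Params} (π : AffineHecke n p →ₐ[ℂ] Module.End ℂ (Laurent n)) :
    Module (AffineHecke n p) (Laurent n) :=
  Module.compHom (Laurent n) (π : AffineHecke n p →+* Module.End ℂ (Laurent n))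

/-! ### Finite Weyl group, partial orders, spectrum, non-symmetric Koornwinder polynomials -/

/-- The action of the element `(σ, e)` of the Weyl group `W = S_n ⋉ {±1}^n` on weights. -/
def weylAct {n : ℕ} (σ : Equiv.Perm (Fin n)) (e : Fin n → ℤˣ) (v : Weight n) : Weight n :=
  fun j => (e j : ℤ) * v (σ j)

/-- `μ ∈ Wλ`. -/
def InOrbit {n : ℕ} (lam mu : Weight n) : Prop :=
  ∃ (σ : Equiv.Perm (Fin n)) (e : Fin n → ℤˣ), mu = weylAct σ e lam

/-- Dominant weights: `λ_1 ≥ ⋯ ≥ λ_n ≥ 0`. -/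
def IsDominant {n : ℕ} (v : Weight n) : Prop := Antitone v ∧ ∀ j, 0 ≤ v j

/-- `Λ⁺`. -/
abbrev DominantWeight (n : ℕ) : Type := {v : Weight n // IsDominant v}

/-- `λ ≤ μ`: the difference `μ - λ` is a sum of simple co-roots `a_i^∨`, `1 ≤ i ≤ n`. -/
def domLE {n : ℕ} (lam mu : Weight n) : Prop :=
  mu - lam ∈ AddSubmonoid.closure (simpleCoroot n '' {i | i ≠ 0})

/-- `λ ≺ μ`: `λ ≠ μ`, and either `λ⁺ < μ⁺`, or `λ⁺ = μ⁺` and `λ ≤ μ`, with `λ⁺` the dominant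
weight in the orbit `Wλ`. -/
def Prec {n : ℕ} (lam mu : Weight n) : Prop :=
  lam ≠ mu ∧ ∃ lam' mu' : Weight n, IsDominant lam' ∧ InOrbit lam lam' ∧
    IsDominant mu' ∧ InOrbit mu mu' ∧
      ((domLE lam' mu' ∧ lam' ≠ mu') ∨ (lam' = mu' ∧ domLE lam mu))

/-- The sign function with `ε(m) = 1` for `m ≥ 0` and `ε(m) = -1` for `m < 0`. -/
def sgn (m : ℤ) : ℤ := if 0 ≤ m then 1 else -1

/-- `ρ_m(λ) = ∑ ε(⟨λ, α⟩) α^∨` over the roots `α = ε_i - ε_j, ε_i + ε_j` with `i < j`. -/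
def rhoM {n : ℕ} (v : Weight n) : Weight n :=
  ∑ i : Fin n, ∑ j : Fin n, if i < j then
    sgn (v i - v j) • (Pi.single i 1 - Pi.single j 1) +
      sgn (v i + v j) • (Pi.single i 1 + Pi.single j 1) else 0

/-- `ρ_l(λ) = ∑ ε(⟨λ, α⟩) α^∨` over the roots `α = 2ε_i`. -/
def rhoL {n : ℕ} (v : Weight n) : Weight n :=
  ∑ i : Fin n, sgn (2 * v i) • Pi.single i 1

/-- The spectral point `γ_λ = t_0^{ρ_l(λ)} t_n^{ρ_l(λ)} t^{ρ_m(λ)} q^λ`. -/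
def gam {n : ℕ} (p : Params) (v : Weight n) : Fin n → ℂˣ :=
  fun j => p.t0 ^ rhoL v j * p.tn ^ rhoL v j * p.t ^ rhoM v j * p.q ^ v j

/-- The value `f(y)` of a Laurent polynomial at a point of `(ℂ ∖ {0})^n`. -/
def evalAt {n : ℕ} (y : Fin n → ℂˣ) (f : Laurent n) : ℂ :=
  f.coeff.sum fun v c => c * ((∏ j, y j ^ v j : ℂˣ) : ℂ)

/-- The subalgebra `𝒜^W` of `W`-invariant Laurent polynomials (as a set). -/
def weylInvariants (n : ℕ) : Set (Laurent n) :=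
  {f | ∀ (σ : Equiv.Perm (Fin n)) (e : Fin n → ℤˣ),
    AddMonoidAlgebra.mapDomain (weylAct σ e) f = f}

/-- `P` is the family of monic non-symmetric Koornwinder polynomials: it is a basis of `𝒜`,
`P_λ = x^λ + ∑_{μ ≺ λ} c_{λ,μ} x^μ`, and `f(Y) P_λ = f(γ_λ) P_λ` for all `f`. -/
def IsKoornwinderBasis {n : ℕ} {p : Params}
    (π : AffineHecke n p →ₐ[ℂ] Module.End ℂ (Laurent n))
    (P : Module.Basis (Weight n) ℂ (Laurent n)) : Prop :=
  ∀ lam : Weight n,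
    P lam - AddMonoidAlgebra.single lam 1 ∈
        Submodule.span ℂ ((fun mu => AddMonoidAlgebra.single mu (1 : ℂ)) '' {mu | Prec mu lam}) ∧
      ∀ f : Laurent n, π (yMap n p f) (P lam) = evalAt (gam p lam) f • P lam

end

end Koornwinder

namespace Koornwinder

noncomputable section

set_option linter.unusedSectionVars false

section

/-! ### Positive affine roots -/

section RootSystem

variable {n : ℕ} [hn : Fact (2 ≤ n)]

/-! The commuting elements Y^λ act diagonalisably in the Noumi representation with simple joint
spectrum {γ_λ}. Everything else is read off from how the T_i move the eigenlines.

Hecke side. Among the positive affine roots, a simple reflection makes only its own simple root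
negative (`eq_simpleRoot_of_neg`). This gives the exchange condition and Matsumoto's theorem
(`matsumoto`). Hence T_w is well defined, T_{gh} = T_g T_h when no inversion is undone
(`tProd_mul`), and λ ↦ Y^λ is a homomorphism (`yU_add`). The explicit words for the Y^{ε_k}
(`yE_zero`, `yE_succ`) yield the Bernstein relations: for i ≠ 0, T_i f(Y) - (s_i f)(Y) T_i is again
a Laurent polynomial in Y (`exists_bernstein`).

Representation. At a generic point of the torus the Hecke relations for the operators t_i + t_i⁻¹ v
(s_i - 1) become rational identities of rank at most two (`noumiOp_quadratic`, `braidRel_noumiOp`).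
If the word for Y^{ε_j} is read letter by letter and each letter is twisted by the affine Weyl group
element reached so far, every letter is triangular for ≺: the intermediate monomials of a divided
difference lie strictly inside a segment joining two weights of one orbit, hence are lower
(`Between.prec`). The diagonal entries multiply to γ_μ (`lowTri_gam`). Genericity makes λ ↦ γ_λ
injective (`Params.IsGeneric.gam_inj`), so there is a unique monic eigenbasis P_λ.

Submodules. The Bernstein relation applied to P_μ shows that T_i P_μ lies in the span of P_μ and
P_{s_i μ} (`exists_heckeT_koorn`). The second coefficient is nonzero when s_i μ ≠ μ, since otherwise
P_μ would be an eigenvector of T_i and γ_μ would satisfy an equation excluded by genericity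
(`heckeT_koorn_ne_smul`). The T_i with i ≠ 0 and the f(Y) generate H, so each 𝒜(λ) is a submodule.
It is irreducible because polynomials in Y extract a single P_κ from any nonzero vector and the T_i
carry it through the orbit. Different 𝒜(λ) have disjoint spectra.

Center. A Laurent polynomial vanishing at γ_λ for all regular dominant λ is zero
(`eq_zero_of_evalA_gam`). This gives injectivity of f ↦ f(Y), and it kills the Bernstein remainder
of an invariant f, so that f(Y) is central. Conversely, write a central z as ∑ T_u f_u(Y) over the
finite Weyl group. It acts diagonally on the P_λ, while for the longest u ≠ 1 that occurs the
coefficient of P_{uλ} in z P_λ is a nonzero multiple of f_u(γ_λ); hence f_u = 0. So z = f(Y), and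
commutation with the T_i forces f to be invariant.

Central characters. The invariants ∏ (c - x_j - x_j⁻¹) distinguish γ_κ from γ_μ for different orbits
(`inOrbit_of_forall_evalA`), so the 𝒜(λ) are the isotypic components over the center
(`range_eq_isotypicComponents`). -/

lemma index_cases (i : Fin (n + 1)) :
    i = 0 ∨ (∃ k, ∃ hk : k + 1 < n, i = ⟨k + 1, by omega⟩) ∨ i = Fin.last n := by
  rcases Nat.eq_zero_or_pos (i : ℕ) with h | h
  · exact Or.inl (Fin.ext h)
  · rcases Nat.lt_or_ge i n with h' | h'
    · exact Or.inr (Or.inl ⟨i - 1, by omega, Fin.ext (by simp; omega)⟩)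
    · exact Or.inr (Or.inr (Fin.ext (by simp; omega)))

/-- The first index. -/
def fstIdx (n : ℕ) [hn : Fact (2 ≤ n)] : Fin n := ⟨0, by have := hn.out; omega⟩

/-- The last index. -/
def lstIdx (n : ℕ) [hn : Fact (2 ≤ n)] : Fin n := ⟨n - 1, by have := hn.out; omega⟩

lemma simpleRoot_zero : simpleRoot n 0 = (-(2 • Pi.single (fstIdx n) 1), 1) := by
  have h := eps_eq_single (n := n) (k := 0) (fstIdx n).2
  simp only [zero_add] at h
  simp [simpleRoot, h, fstIdx]

lemma simpleRoot_last : simpleRoot n (Fin.last n) = (2 • Pi.single (lstIdx n) 1, 0) := by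
  have h0 := hn.out
  have h := eps_eq_single (n := n) (k := n - 1) (lstIdx n).2
  rw [Nat.sub_add_cancel (by omega)] at h
  have : n ≠ 0 := by omega
  simp [simpleRoot, h, lstIdx, this]

lemma simpleRoot_mid {k : ℕ} (hk : k + 1 < n) : simpleRoot n ⟨k + 1, by omega⟩ =
    (Pi.single ⟨k, by omega⟩ 1 - Pi.single ⟨k + 1, hk⟩ 1, 0) := by
  simp [simpleRoot, hk, eps_eq_single hk, eps_eq_single (show k < n by omega)]

lemma pairing_coroot_zero (g : AffWeight n) :
    pairing (simpleCoroot n 0) g = -g.1 (fstIdx n) := by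
  have h := eps_eq_single (n := n) (k := 0) (fstIdx n).2
  simp only [zero_add] at h
  simp [simpleCoroot, h, pairing_neg, pairing_single, fstIdx]

lemma pairing_coroot_last (g : AffWeight n) :
    pairing (simpleCoroot n (Fin.last n)) g = g.1 (lstIdx n) := by
  have h0 := hn.out
  have h := eps_eq_single (n := n) (k := n - 1) (lstIdx n).2
  rw [Nat.sub_add_cancel (by omega)] at h
  have : n ≠ 0 := by omega
  simp [simpleCoroot, h, pairing_single, lstIdx, this]

lemma pairing_coroot_mid {k : ℕ} (hk : k + 1 < n) (g : AffWeight n) :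
    pairing (simpleCoroot n ⟨k + 1, by omega⟩) g = g.1 ⟨k, by omega⟩ - g.1 ⟨k + 1, hk⟩ := by
  simp [simpleCoroot, hk, eps_eq_single hk, eps_eq_single (show k < n by omega), pairing_sub,
    pairing_single]

/-- The invariant bilinear form on `Λ ⊕ ℤδ`. -/
def form (g h : AffWeight n) : ℤ := ∑ j, g.1 j * h.1 j

lemma form_eq_pairing (g h : AffWeight n) : form g h = pairing h.1 g := rfl

lemma form_comm (g h : AffWeight n) : form g h = form h g := by
  simp [form, mul_comm]

lemma form_root_pos (i : Fin (n + 1)) : 0 < form (simpleRoot n i) (simpleRoot n i) := by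
  rcases index_cases i with rfl | ⟨k, hk, rfl⟩ | rfl
  · simp [form, simpleRoot_zero, Pi.single_apply]
  · rw [simpleRoot_mid hk, form_eq_pairing, pairing_sub, pairing_single, pairing_single]
    simp
  · simp [form, simpleRoot_last, Pi.single_apply]

/-- The formula a^∨ = 2a/(a,a) with the denominator cleared, so that it holds over ℤ and treats the
three normalisations of the simple co-roots alike. -/
lemma form_root_mul (i : Fin (n + 1)) (g : AffWeight n) :
    form (simpleRoot n i) (simpleRoot n i) * pairing (simpleCoroot n i) g =
      2 * form g (simpleRoot n i) := by
  rcases index_cases i with rfl | ⟨k, hk, rfl⟩ | rfl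
  · rw [pairing_coroot_zero]
    simp [form, simpleRoot_zero, Pi.single_apply]; ring
  · rw [pairing_coroot_mid hk, form_eq_pairing, form_eq_pairing, simpleRoot_mid hk]
    simp only [pairing_sub, pairing_single]
    simp
  · rw [pairing_coroot_last]
    simp [form, simpleRoot_last, Pi.single_apply]; ring

lemma pairing_coroot_root (i : Fin (n + 1)) :
    pairing (simpleCoroot n i) (simpleRoot n i) = 2 := by
  have h := form_root_mul i (simpleRoot n i)
  have h' := form_root_pos i
  rw [mul_comm] at h
  exact mul_right_cancel₀ h'.ne' h

/-- The simple reflections as invertible operators. -/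
def sRefl (i : Fin (n + 1)) : AffWeight n ≃ₗ[ℤ] AffWeight n :=
  Module.reflection (pairing_coroot_root i)

lemma sRefl_apply (i : Fin (n + 1)) (g : AffWeight n) :
    sRefl i g = g - pairing (simpleCoroot n i) g • simpleRoot n i :=
  Module.reflection_apply ..

lemma coe_sRefl (i : Fin (n + 1)) (g : AffWeight n) : sRefl i g = simpleRefl n i g := rfl

lemma sRefl_mul_self (i : Fin (n + 1)) : (sRefl i : AffWeight n ≃ₗ[ℤ] AffWeight n) * sRefl i = 1 :=
  LinearEquiv.ext fun g => Module.involutive_reflection (pairing_coroot_root i) g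

lemma sRefl_inv (i : Fin (n + 1)) : (sRefl i : AffWeight n ≃ₗ[ℤ] AffWeight n)⁻¹ = sRefl i :=
  inv_eq_of_mul_eq_one_left (sRefl_mul_self i)

lemma sRefl_root (i : Fin (n + 1)) : sRefl i (simpleRoot n i) = -simpleRoot n i := by
  rw [sRefl_apply, pairing_coroot_root, two_smul]; abel

lemma sRefl_zero (g : AffWeight n) : sRefl 0 g =
    (fun j => if j = fstIdx n then -g.1 j else g.1 j, g.2 + g.1 (fstIdx n)) :=
  simpleRefl_zero (fstIdx n).2 g

lemma sRefl_mid {k : ℕ} (hk : k + 1 < n) (g : AffWeight n) :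
    sRefl ⟨k + 1, by omega⟩ g =
      (fun j => g.1 (Equiv.swap ⟨k, by omega⟩ ⟨k + 1, hk⟩ j), g.2) :=
  simpleRefl_middle hk g

lemma sRefl_last (g : AffWeight n) : sRefl (Fin.last n) g =
    (fun j => if j = lstIdx n then -g.1 j else g.1 j, g.2) := by
  rw [sRefl_apply, pairing_coroot_last, simpleRoot_last]
  ext j
  · by_cases h : j = lstIdx n
    · subst h; simp; ring
    · simp [h]
  · simp

/-! ### Height, positivity and affine roots. -/

/-- The height of a weight. -/
def ht (v : Weight n) : ℤ := ∑ j : Fin n, ((n : ℤ) - j) * v j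

lemma ht_add (v w : Weight n) : ht (v + w) = ht v + ht w := by
  simp [ht, mul_add, Finset.sum_add_distrib]

lemma ht_neg (v : Weight n) : ht (-v) = -ht v := by simp [ht]

lemma ht_single (p : Fin n) (c : ℤ) : ht (Pi.single p c) = ((n : ℤ) - p) * c := by
  simp [ht, Pi.single_apply]

/-- Positivity with respect to the fundamental alcove. -/
def Pos (g : AffWeight n) : Prop := 0 < g.2 ∨ g.2 = 0 ∧ 0 < ht g.1

/-- The affine roots `α + kδ`, with `α = ±ε_p ± ε_r ≠ 0`. -/
def IsRt (g : AffWeight n) : Prop :=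
  ∃ p r : Fin n, ∃ e e' : ℤˣ, g.1 = Pi.single p (e : ℤ) + Pi.single r (e' : ℤ) ∧ g.1 ≠ 0

lemma Pos.add {g h : AffWeight n} (hg : Pos g) (hh : Pos h) : Pos (g + h) := by
  simp only [Pos, Prod.fst_add, Prod.snd_add, ht_add] at *
  omega

lemma Pos.not_neg {g : AffWeight n} (hg : Pos g) : ¬ Pos (-g) := by
  simp only [Pos, Prod.fst_neg, Prod.snd_neg, ht_neg] at *
  omega

/-- The coefficients n - j of the height are positive and pairwise distinct, so ±ε_p ± ε_r has
height zero only when it vanishes. Hence each affine root is positive or negative. -/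
lemma IsRt.ht_ne {g : AffWeight n} (hg : IsRt g) : ht g.1 ≠ 0 := by
  obtain ⟨p, r, e, e', h, h0⟩ := hg
  intro hh
  apply h0
  rw [h, ht_add, ht_single, ht_single] at hh
  have hp := p.2
  have hr := r.2
  rcases Int.units_eq_one_or e with rfl | rfl <;> rcases Int.units_eq_one_or e' with rfl | rfl
  · simp at hh; omega
  · simp at hh
    have : p = r := Fin.ext (by omega)
    rw [h, this]; ext j; simp [Pi.single_apply]; split_ifs <;> simp
  · simp at hh
    have : p = r := Fin.ext (by omega)
    rw [h, this]; ext j; simp [Pi.single_apply]; split_ifs <;> simp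
  · simp at hh; omega

lemma IsRt.pos_or {g : AffWeight n} (hg : IsRt g) : Pos g ∨ Pos (-g) := by
  have := hg.ht_ne
  simp only [Pos, Prod.fst_neg, Prod.snd_neg, ht_neg]
  omega

lemma IsRt.neg {g : AffWeight n} (hg : IsRt g) : IsRt (-g) := by
  obtain ⟨p, r, e, e', h, h0⟩ := hg
  refine ⟨p, r, -e, -e', ?_, by simpa using h0⟩
  rw [Prod.fst_neg, h, neg_add]
  simp [Pi.single_neg]

lemma isRt_simpleRoot (i : Fin (n + 1)) : IsRt (simpleRoot n i) := by
  rcases index_cases i with rfl | ⟨k, hk, rfl⟩ | rfl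
  · refine ⟨fstIdx n, fstIdx n, -1, -1, ?_, ?_⟩ <;> rw [simpleRoot_zero]
    · simp [Pi.single_neg, two_mul]
    · intro h; have := congrFun h (fstIdx n); simp at this
  · refine ⟨⟨k, by omega⟩, ⟨k + 1, hk⟩, 1, -1, ?_, ?_⟩ <;> rw [simpleRoot_mid hk]
    · simp [Pi.single_neg, sub_eq_add_neg]
    · intro h; have := congrFun h ⟨k + 1, hk⟩; simp at this
  · refine ⟨lstIdx n, lstIdx n, 1, 1, ?_, ?_⟩ <;> rw [simpleRoot_last]
    · simp [two_mul]
    · intro h; have := congrFun h (lstIdx n); simp at this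

lemma pos_simpleRoot (i : Fin (n + 1)) : Pos (simpleRoot n i) := by
  have h2 := hn.out
  rcases index_cases i with rfl | ⟨k, hk, rfl⟩ | rfl
  · rw [simpleRoot_zero]; exact Or.inl one_pos
  · rw [simpleRoot_mid hk]; right
    simp [sub_eq_add_neg, ht_add, ht_neg, ht_single]
    omega
  · rw [simpleRoot_last]; right
    rw [two_smul, ht_add, ht_single]
    refine ⟨rfl, ?_⟩
    have : ((lstIdx n : Fin n) : ℕ) = n - 1 := rfl
    rw [this]; push_cast [show 1 ≤ n by omega]; omega

lemma single_swap (a b p : Fin n) (c : ℤ) :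
    (fun j => (Pi.single p c : Weight n) (Equiv.swap a b j)) = Pi.single (Equiv.swap a b p) c := by
  ext j
  by_cases h : Equiv.swap a b j = p
  · subst h; simp
  · have : j ≠ Equiv.swap a b p := fun h' => h (by rw [h', Equiv.swap_apply_self])
    simp [h, this]

lemma single_flip (a p : Fin n) (c : ℤ) :
    (fun j => if j = a then -(Pi.single p c : Weight n) j else (Pi.single p c : Weight n) j) =
      Pi.single p (if p = a then -c else c) := by
  ext j
  by_cases h : j = p
  · subst h; split_ifs <;> simp
  · simp [h]

lemma IsRt.sRefl {g : AffWeight n} (hg : IsRt g) (i : Fin (n + 1)) : IsRt (sRefl i g) := by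
  have hne : (Koornwinder.sRefl i g).1 ≠ 0 := by
    intro h
    obtain ⟨p, r, e, e', -, h0⟩ := hg
    have h1 : (Koornwinder.sRefl i (Koornwinder.sRefl i g)).1 = 0 := by
      rcases index_cases i with rfl | ⟨k, hk, rfl⟩ | rfl
      · rw [sRefl_zero (Koornwinder.sRefl _ g), h]; ext; simp
      · rw [sRefl_mid hk (Koornwinder.sRefl _ g), h]; ext; simp
      · rw [sRefl_last (Koornwinder.sRefl _ g), h]; ext; simp
    rw [← LinearEquiv.mul_apply, sRefl_mul_self] at h1
    exact h0 h1
  obtain ⟨p, r, e, e', h, -⟩ := hg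
  rcases index_cases i with rfl | ⟨k, hk, rfl⟩ | rfl
  · refine ⟨p, r, if p = fstIdx n then -e else e, if r = fstIdx n then -e' else e', ?_, hne⟩
    have h1 := single_flip (fstIdx n) p e
    have h2 := single_flip (fstIdx n) r e'
    rw [sRefl_zero, h]
    ext j
    have h1 := congrFun h1 j
    have h2 := congrFun h2 j
    simp only [Pi.add_apply] at *
    push_cast [apply_ite]
    rw [← h1, ← h2]; split_ifs <;> ring
  · refine ⟨Equiv.swap ⟨k, by omega⟩ ⟨k + 1, hk⟩ p, Equiv.swap ⟨k, by omega⟩ ⟨k + 1, hk⟩ r, e, e',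
      ?_, hne⟩
    rw [sRefl_mid hk, h, ← single_swap, ← single_swap]
    rfl
  · refine ⟨p, r, if p = lstIdx n then -e else e, if r = lstIdx n then -e' else e', ?_, hne⟩
    have h1 := single_flip (lstIdx n) p e
    have h2 := single_flip (lstIdx n) r e'
    rw [sRefl_last, h]
    ext j
    have h1 := congrFun h1 j
    have h2 := congrFun h2 j
    simp only [Pi.add_apply] at *
    push_cast [apply_ite]
    rw [← h1, ← h2]; split_ifs <;> ring

/-- The fact on which the Coxeter combinatorics rests: s_i permutes the positive roots other than
a_i. Since 2ε_p is a root here but ε_p is not, the exception is a_i itself and not a multiple of it.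
-/
lemma eq_simpleRoot_of_neg {b : AffWeight n} (hb : IsRt b) (hp : Pos b) (i : Fin (n + 1))
    (hneg : Pos (-sRefl i b)) : b = simpleRoot n i := by
  have h2 := hn.out
  obtain ⟨p, r, e, e', h, h0⟩ := hb
  have hpp := p.2
  have hrr := r.2
  have hht : ht b.1 = ((n : ℤ) - p) * e + ((n : ℤ) - r) * e' := by
    rw [h, ht_add, ht_single, ht_single]
  have hc : ∀ j, b.1 j = (if j = p then (e : ℤ) else 0) + if j = r then (e' : ℤ) else 0 := by
    intro j; rw [h]; simp [Pi.single_apply]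
  have hsm : ∀ (c : ℤ) (v : Weight n), ht (c • v) = c * ht v := by
    intro c v; simp only [ht, Pi.smul_apply, smul_eq_mul, Finset.mul_sum]
    exact Finset.sum_congr rfl fun _ _ => by ring
  -- The sign of s_i b depends only on its δ-coefficient and its height. Both are linear in the data
  -- of b, which leaves finitely many cases for linear arithmetic.
  have h2' : (-sRefl i b).2 =
      -(b.2 - pairing (simpleCoroot n i) b * (simpleRoot n i).2) := by
    rw [sRefl_apply]; simp
  have h1' : ht (-sRefl i b).1 =
      -(ht b.1 - pairing (simpleCoroot n i) b * ht (simpleRoot n i).1) := by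
    rw [sRefl_apply, Prod.fst_neg, ht_neg, Prod.fst_sub, sub_eq_add_neg, ht_add, ht_neg,
      Prod.smul_fst, hsm, ← sub_eq_add_neg]
  rw [Pos, h2', h1'] at hneg
  rw [Pos] at hp
  have hext : ∀ c : AffWeight n, b.2 = c.2 → (∀ j, b.1 j = c.1 j) → b = c :=
    fun c h1 h2 => Prod.ext (funext h2) h1
  rcases index_cases i with rfl | ⟨k, hk, rfl⟩ | rfl
  · rw [pairing_coroot_zero, hc] at hneg
    rw [simpleRoot_zero] at hneg ⊢
    simp only [two_smul, ht_neg, ht_add, ht_single, fstIdx, Fin.ext_iff] at hneg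
    rcases Int.units_eq_one_or e with rfl | rfl <;> rcases Int.units_eq_one_or e' with rfl | rfl <;>
    · simp at hneg hht hc
      split_ifs at hneg <;> first
        | (exfalso; omega)
        | (refine hext _ (by simp; omega) fun j => ?_
           rw [hc]
           simp [Pi.single_apply, fstIdx, Fin.ext_iff]
           split_ifs <;> omega)
  · rw [pairing_coroot_mid hk, hc, hc] at hneg
    rw [simpleRoot_mid hk] at hneg ⊢
    rw [sub_eq_add_neg (Pi.single _ _)] at hneg
    simp only [ht_neg, ht_add, ht_single, Fin.ext_iff] at hneg
    rcases Int.units_eq_one_or e with rfl | rfl <;> rcases Int.units_eq_one_or e' with rfl | rfl <;>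
    · simp at hneg hht hc
      split_ifs at hneg <;> first
        | (exfalso; omega)
        | (refine hext _ (by simp; omega) fun j => ?_
           rw [hc]
           simp [Pi.single_apply, Fin.ext_iff]
           split_ifs <;> omega)
  · rw [pairing_coroot_last, hc] at hneg
    rw [simpleRoot_last] at hneg ⊢
    simp only [two_smul, ht_add, ht_single, lstIdx, Fin.ext_iff] at hneg
    rcases Int.units_eq_one_or e with rfl | rfl <;> rcases Int.units_eq_one_or e' with rfl | rfl <;>
    · simp [Nat.cast_sub (show 1 ≤ n by omega)] at hneg hht hc
      split_ifs at hneg <;> first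
        | (exfalso; omega)
        | (refine hext _ (by simp; omega) fun j => ?_
           rw [hc]
           simp [Pi.single_apply, lstIdx, Fin.ext_iff]
           split_ifs <;> omega)

end RootSystem

end

section

/-! ### Reduced words and Matsumoto's theorem -/

section Words

variable {n : ℕ} [hn : Fact (2 ≤ n)]

/-- The element of the affine Weyl group represented by a word. -/
def wprod (l : List (Fin (n + 1))) : AffWeight n ≃ₗ[ℤ] AffWeight n := (l.map sRefl).prod

@[simp] lemma wprod_nil : wprod ([] : List (Fin (n + 1))) = 1 := rfl

@[simp] lemma wprod_cons (i : Fin (n + 1)) (l : List (Fin (n + 1))) :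
    wprod (i :: l) = sRefl i * wprod l := by simp [wprod]

@[simp] lemma wprod_append (l l' : List (Fin (n + 1))) :
    wprod (l ++ l') = wprod l * wprod l' := by simp [wprod]

lemma wprod_reverse (l : List (Fin (n + 1))) : wprod l.reverse = (wprod l)⁻¹ := by
  induction l with
  | nil => simp
  | cons i l ih => simp [ih, sRefl_inv]

lemma form_add_left (g g' h : AffWeight n) : form (g + g') h = form g h + form g' h := by
  simp [form, add_mul, Finset.sum_add_distrib]

lemma form_smul_left (c : ℤ) (g h : AffWeight n) : form (c • g) h = c * form g h := by
  simp [form, Finset.mul_sum, mul_assoc]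

lemma form_add_right (g g' h : AffWeight n) : form h (g + g') = form h g + form h g' := by
  rw [form_comm, form_add_left, form_comm g, form_comm g']

lemma form_smul_right (c : ℤ) (g h : AffWeight n) : form h (c • g) = c * form h g := by
  rw [form_comm, form_smul_left, form_comm]

lemma form_sRefl (i : Fin (n + 1)) (g h : AffWeight n) :
    form (sRefl i g) (sRefl i h) = form g h := by
  have hg := form_root_mul i g
  have hh := form_root_mul i h
  have key : form (sRefl i g) (sRefl i h) = form g h
      - pairing (simpleCoroot n i) h * form g (simpleRoot n i)
      - pairing (simpleCoroot n i) g * form h (simpleRoot n i)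
      + pairing (simpleCoroot n i) g * pairing (simpleCoroot n i) h *
        form (simpleRoot n i) (simpleRoot n i) := by
    simp only [sRefl_apply, sub_eq_add_neg, ← neg_smul, form_add_left, form_smul_left,
      form_add_right, form_smul_right]
    rw [form_comm (simpleRoot n i) h]
    ring
  rw [key]
  linarith [congrArg (pairing (simpleCoroot n i) h * ·) hg,
    congrArg (pairing (simpleCoroot n i) g * ·) hh]

lemma form_wprod (l : List (Fin (n + 1))) (g h : AffWeight n) :
    form (wprod l g) (wprod l h) = form g h := by
  induction l with
  | nil => rfl
  | cons i l ih => simp [LinearEquiv.mul_apply, form_sRefl, ih]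

lemma IsRt.wprod {b : AffWeight n} (hb : IsRt b) (l : List (Fin (n + 1))) : IsRt (wprod l b) := by
  induction l with
  | nil => exact hb
  | cons i l ih => rw [wprod_cons, LinearEquiv.mul_apply]; exact ih.sRefl i

/-- u s_j u⁻¹ is the reflection in u a_j. The co-root pairings agree because u preserves the form
and the squared lengths can be cancelled. -/
lemma conj_sRefl {u : AffWeight n ≃ₗ[ℤ] AffWeight n} (hu : ∃ l, wprod l = u)
    {i j : Fin (n + 1)} (h : u (simpleRoot n j) = simpleRoot n i) :
    u * sRefl j = sRefl i * u := by
  obtain ⟨l, rfl⟩ := hu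
  refine LinearEquiv.ext fun g => ?_
  rw [LinearEquiv.mul_apply, LinearEquiv.mul_apply, sRefl_apply, sRefl_apply, map_sub, map_smul, h]
  congr 2
  have h1 := form_root_mul j g
  have h2 := form_root_mul i (wprod l g)
  rw [← h, form_wprod, form_wprod, ← h1] at h2
  exact (mul_left_cancel₀ (form_root_pos j).ne' h2).symm

/-- Along the word the root passes from positive to negative. Just before the letter where the sign
changes it must be the simple root of that letter. -/
lemma exists_split {b : AffWeight n} (hb : IsRt b) (hp : Pos b) (l : List (Fin (n + 1)))
    (h : Pos (-(wprod l)⁻¹ b)) :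
    ∃ l1 k l2, l = l1 ++ k :: l2 ∧ (wprod l1)⁻¹ b = simpleRoot n k := by
  induction l generalizing b with
  | nil => exact absurd h hp.not_neg
  | cons k l ih =>
    rcases (hb.sRefl k).pos_or with h' | h'
    · have : Pos (-(wprod l)⁻¹ (sRefl k b)) := by
        simpa [sRefl_inv, LinearEquiv.mul_apply] using h
      obtain ⟨l1, m, l2, h1, h2⟩ := ih (hb.sRefl k) h' this
      exact ⟨k :: l1, m, l2, by simp [h1], by simpa [sRefl_inv, LinearEquiv.mul_apply] using h2⟩
    · exact ⟨[], k, l, rfl, by simpa using eq_simpleRoot_of_neg hb hp k h'⟩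

/-- The exchange condition: by `conj_sRefl`, the letter found by `exists_split` can be moved to the
front, where it becomes s_i. -/
lemma exists_shorter (i : Fin (n + 1)) (l : List (Fin (n + 1)))
    (h : Pos (-(wprod l)⁻¹ (simpleRoot n i))) :
    ∃ l', l'.length + 1 = l.length ∧ wprod l = sRefl i * wprod l' := by
  obtain ⟨l1, k, l2, rfl, h2⟩ := exists_split (isRt_simpleRoot i) (pos_simpleRoot i) l h
  refine ⟨l1 ++ l2, by simp; omega, ?_⟩
  have := conj_sRefl (u := wprod l1) ⟨l1, rfl⟩ (i := i) (j := k) (by rw [← h2]; simp)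
  rw [wprod_append, wprod_cons, wprod_append, ← mul_assoc, ← mul_assoc, this]

/-- A word of minimal length. -/
def Red (l : List (Fin (n + 1))) : Prop := ∀ l', wprod l' = wprod l → l.length ≤ l'.length

lemma Red.tail {i : Fin (n + 1)} {l : List (Fin (n + 1))} (h : Red (i :: l)) : Red l := by
  intro l' hl'
  have := h (i :: l') (by simp [hl'])
  simpa using this

lemma Red.of_eq {l l' : List (Fin (n + 1))} (h : Red l) (hl : l'.length = l.length)
    (hw : wprod l' = wprod l) : Red l' := fun m hm => hl ▸ h m (hm.trans hw)

lemma exists_red (l : List (Fin (n + 1))) : ∃ l', Red l' ∧ wprod l' = wprod l := by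
  classical
  have h : ∃ r, ∃ l', wprod l' = wprod l ∧ l'.length = r := ⟨_, l, rfl, rfl⟩
  obtain ⟨l', h1, h2⟩ := Nat.find_spec h
  exact ⟨l', fun m hm => h2 ▸ Nat.find_min' h ⟨m, hm.trans h1, rfl⟩, h1⟩

/-- If the root were negative, exchange would produce a shorter word in which the two letters i
cancel. With `Red.cons` this is the length criterion for s_i w. -/
lemma Red.pos {i : Fin (n + 1)} {l : List (Fin (n + 1))} (h : Red (i :: l)) :
    Pos ((wprod l)⁻¹ (simpleRoot n i)) := by
  rcases ((isRt_simpleRoot i).wprod l.reverse).pos_or with h' | h'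
  · rwa [wprod_reverse] at h'
  · rw [wprod_reverse] at h'
    obtain ⟨l', h1, h2⟩ := exists_shorter i l h'
    have := h l' (by rw [wprod_cons, h2, ← mul_assoc, sRefl_mul_self, one_mul])
    simp at this; omega

lemma Red.neg {i : Fin (n + 1)} {l : List (Fin (n + 1))} (h : Red (i :: l)) :
    Pos (-(wprod (i :: l))⁻¹ (simpleRoot n i)) := by
  have := h.pos
  rw [wprod_cons, mul_inv_rev, LinearEquiv.mul_apply, sRefl_inv, sRefl_root, map_neg, neg_neg]
  exact this

/-- Every word for s_i w makes a_i negative, so exchange removes one of its letters and leaves a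
word for w. Thus it is longer than a shortest word for w. -/
lemma Red.cons {i : Fin (n + 1)} {l : List (Fin (n + 1))} (h : Red l)
    (hp : Pos ((wprod l)⁻¹ (simpleRoot n i))) : Red (i :: l) := by
  intro l' hl'
  have : Pos (-(wprod l')⁻¹ (simpleRoot n i)) := by
    rw [hl', wprod_cons, mul_inv_rev, LinearEquiv.mul_apply, sRefl_inv, sRefl_root, map_neg,
      neg_neg]
    exact hp
  obtain ⟨l1, h1, h2⟩ := exists_shorter i l' this
  have h3 := h l1 (by
    rw [hl', wprod_cons] at h2
    exact (mul_left_cancel h2).symm)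
  simp; omega

/-! ### Braid relations and rank-two subsystems. -/

/-- The braid relations of type `C̃_n`. -/
structure BraidRel {M : Type*} [Monoid M] (T : Fin (n + 1) → M) : Prop where
  four : ∀ i j : Fin (n + 1), (j : ℕ) = i + 1 → ((i : ℕ) = 0 ∨ (j : ℕ) = n) →
    T i * T j * T i * T j = T j * T i * T j * T i
  three : ∀ i j : Fin (n + 1), (j : ℕ) = i + 1 → 0 < (i : ℕ) → (j : ℕ) < n →
    T i * T j * T i = T j * T i * T j
  comm : ∀ i j : Fin (n + 1), (i : ℕ) + 2 ≤ j → T i * T j = T j * T i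

lemma sRefl_root_of_pairing {i j : Fin (n + 1)} {c : ℤ}
    (h : pairing (simpleCoroot n i) (simpleRoot n j) = -c) :
    sRefl i (simpleRoot n j) = simpleRoot n j + c • simpleRoot n i := by
  rw [sRefl_apply, h, neg_smul, sub_neg_eq_add]

lemma cartan_comm {i j : Fin (n + 1)} (h : (i : ℕ) + 2 ≤ j) :
    pairing (simpleCoroot n i) (simpleRoot n j) = 0 ∧
      pairing (simpleCoroot n j) (simpleRoot n i) = 0 := by
  have h2 := hn.out
  rcases index_cases i with rfl | ⟨k, hk, rfl⟩ | rfl <;>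
    rcases index_cases j with rfl | ⟨m, hm, rfl⟩ | rfl <;> simp at h
  · simp only [pairing_coroot_zero, pairing_coroot_mid hm, simpleRoot_zero, simpleRoot_mid hm]
    simp [Pi.single_apply, fstIdx]; omega
  · simp only [pairing_coroot_zero, pairing_coroot_last, simpleRoot_zero, simpleRoot_last]
    simp [Pi.single_apply, fstIdx, lstIdx]; omega
  · simp only [pairing_coroot_mid hm, pairing_coroot_mid hk, simpleRoot_mid hm, simpleRoot_mid hk]
    simp [Pi.single_apply]
    split_ifs <;> omega
  · simp only [pairing_coroot_mid hk, pairing_coroot_last, simpleRoot_mid hk, simpleRoot_last]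
    simp [Pi.single_apply, lstIdx]
    split_ifs <;> omega
  · omega

lemma cartan_three {i j : Fin (n + 1)} (h : (j : ℕ) = i + 1) (h0 : 0 < (i : ℕ)) (h1 : (j : ℕ) < n) :
    pairing (simpleCoroot n i) (simpleRoot n j) = -1 ∧
      pairing (simpleCoroot n j) (simpleRoot n i) = -1 := by
  rcases index_cases i with rfl | ⟨k, hk, rfl⟩ | rfl <;>
    rcases index_cases j with rfl | ⟨m, hm, rfl⟩ | rfl <;> simp at h h0 h1
  · subst h
    simp only [pairing_coroot_mid hm, pairing_coroot_mid hk, simpleRoot_mid hm, simpleRoot_mid hk]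
    simp [Pi.single_apply]
    omega
  · omega

lemma cartan_zero {j : Fin (n + 1)} (h : (j : ℕ) = 1) :
    pairing (simpleCoroot n 0) (simpleRoot n j) = -1 ∧
      pairing (simpleCoroot n j) (simpleRoot n 0) = -2 := by
  have h2 := hn.out
  have hj : j = ⟨0 + 1, by omega⟩ := Fin.ext h
  rw [hj]
  have hm : 0 + 1 < n := by omega
  simp only [pairing_coroot_zero, pairing_coroot_mid hm, simpleRoot_zero, simpleRoot_mid hm]
  simp [Pi.single_apply, fstIdx]

lemma cartan_last {i : Fin (n + 1)} (h : (i : ℕ) + 1 = n) :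
    pairing (simpleCoroot n i) (simpleRoot n (Fin.last n)) = -2 ∧
      pairing (simpleCoroot n (Fin.last n)) (simpleRoot n i) = -1 := by
  have h2 := hn.out
  obtain ⟨k, hk⟩ : ∃ k, n = k + 2 := ⟨n - 2, by omega⟩
  have hi : i = ⟨k + 1, by omega⟩ := Fin.ext (by simp; omega)
  rw [hi]
  have hm : k + 1 < n := by omega
  have hl : lstIdx n = ⟨k + 1, hm⟩ := Fin.ext (by simp [lstIdx, hk])
  simp only [pairing_coroot_last, pairing_coroot_mid hm, simpleRoot_last, simpleRoot_mid hm]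
  simp [Pi.single_apply, hl]

/-- The three possible types of rank two subsystems. -/
inductive RankTwo (i j : Fin (n + 1)) : Prop
  | comm (h : pairing (simpleCoroot n i) (simpleRoot n j) = 0)
      (h' : pairing (simpleCoroot n j) (simpleRoot n i) = 0)
      (hT : ∀ {M : Type} [Monoid M] {T : Fin (n + 1) → M}, BraidRel T → T i * T j = T j * T i)
  | three (h : pairing (simpleCoroot n i) (simpleRoot n j) = -1)
      (h' : pairing (simpleCoroot n j) (simpleRoot n i) = -1)
      (hT : ∀ {M : Type} [Monoid M] {T : Fin (n + 1) → M}, BraidRel T →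
        T i * T j * T i = T j * T i * T j)
  | four (h : pairing (simpleCoroot n i) (simpleRoot n j) = -1)
      (h' : pairing (simpleCoroot n j) (simpleRoot n i) = -2)
      (hT : ∀ {M : Type} [Monoid M] {T : Fin (n + 1) → M}, BraidRel T →
        T i * T j * T i * T j = T j * T i * T j * T i)

lemma rankTwo_of_lt {i j : Fin (n + 1)} (h : i < j) : RankTwo i j ∨ RankTwo j i := by
  have h2 := hn.out
  have hj := j.2
  rw [Fin.lt_def] at h
  by_cases hc : (i : ℕ) + 2 ≤ j
  · exact Or.inl (.comm (cartan_comm hc).1 (cartan_comm hc).2 fun hT => hT.comm i j hc)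
  have hij : (j : ℕ) = i + 1 := by omega
  by_cases h0 : (i : ℕ) = 0
  · obtain rfl : i = 0 := Fin.ext h0
    have := cartan_zero (n := n) (j := j) (by simpa using hij)
    exact Or.inl (.four this.1 this.2 fun hT => hT.four 0 j hij (Or.inl rfl))
  by_cases h1 : (j : ℕ) = n
  · obtain rfl : j = Fin.last n := Fin.ext h1
    have := cartan_last (n := n) (i := i) (by simp at hij; omega)
    exact Or.inr (.four this.2 this.1 fun hT => (hT.four i _ hij (Or.inr h1)).symm)
  have := cartan_three hij (by omega) (by omega)
  exact Or.inl (.three this.1 this.2 fun hT => hT.three i j hij (by omega) (by omega))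

lemma rankTwo_or {i j : Fin (n + 1)} (h : i ≠ j) : RankTwo i j ∨ RankTwo j i := by
  rcases lt_or_gt_of_ne h with h | h
  · exact rankTwo_of_lt h
  · exact (rankTwo_of_lt h).symm

/-- Each relation is an instance of `conj_sRefl`: the word without its last letter carries one
simple root of the pair to a simple root of the pair. -/
lemma braidRel_sRefl : BraidRel (sRefl : Fin (n + 1) → AffWeight n ≃ₗ[ℤ] AffWeight n) where
  comm i j h := by
    refine conj_sRefl ⟨[i], by simp⟩ ?_
    rw [sRefl_apply, (cartan_comm h).1, zero_smul, sub_zero]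
  three i j hij h0 h1 := by
    have hc := cartan_three hij h0 h1
    rw [conj_sRefl (u := sRefl i * sRefl j) ⟨[i, j], by simp⟩ (i := j), ← mul_assoc]
    rw [LinearEquiv.mul_apply, sRefl_root_of_pairing hc.2, map_add, map_smul, sRefl_root,
      sRefl_root_of_pairing hc.1]
    simp
  four i j hij h := by
    have h2 := hn.out
    suffices h : sRefl i * sRefl j * sRefl i * sRefl j =
        sRefl j * (sRefl i * sRefl j * sRefl i : AffWeight n ≃ₗ[ℤ] AffWeight n) by
      rw [h]; simp only [mul_assoc]
    refine conj_sRefl ⟨[i, j, i], by simp [mul_assoc]⟩ ?_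
    have : pairing (simpleCoroot n i) (simpleRoot n j) = -1 ∧
        pairing (simpleCoroot n j) (simpleRoot n i) = -2 ∨
        pairing (simpleCoroot n i) (simpleRoot n j) = -2 ∧
        pairing (simpleCoroot n j) (simpleRoot n i) = -1 := by
      rcases h with h | h
      · obtain rfl : i = 0 := Fin.ext h
        exact Or.inl (cartan_zero (by simpa using hij))
      · obtain rfl : j = Fin.last n := Fin.ext h
        exact Or.inr (cartan_last (by simp at hij; omega))
    rcases this with hc | hc
    all_goals
      simp only [LinearEquiv.mul_apply, sRefl_root_of_pairing hc.1, map_add, map_smul, sRefl_root,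
        sRefl_root_of_pairing hc.2, map_neg]
      module

/-- Removing a left descent. -/
lemma Red.exists_cons {l : List (Fin (n + 1))} {i : Fin (n + 1)} (hl : Red l)
    (h : Pos (-(wprod l)⁻¹ (simpleRoot n i))) :
    ∃ l', Red (i :: l') ∧ (i :: l').length = l.length ∧ wprod (i :: l') = wprod l := by
  obtain ⟨l', h1, h2⟩ := exists_shorter i l h
  have : wprod (i :: l') = wprod l := by rw [h2, wprod_cons]
  exact ⟨l', hl.of_eq h1 this, h1, this⟩

lemma inv_apply_of_cons {i : Fin (n + 1)} {l m : List (Fin (n + 1))}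
    (h : wprod m = wprod (i :: l)) (g : AffWeight n) :
    (wprod l)⁻¹ g = (wprod m)⁻¹ (sRefl i g) := by
  rw [h, wprod_cons, mul_inv_rev, LinearEquiv.mul_apply, sRefl_inv, ← LinearEquiv.mul_apply (sRefl i),
    sRefl_mul_self]
  rfl

/-- If both i and j are left descents, the longest element of the dihedral group they generate
splits off on the left. The letters are peeled off alternately: the root tested at each stage is a
nonnegative combination of a_i and a_j, so its image stays negative. The two resulting words differ
by one braid move. -/
lemma RankTwo.exists_common {i j : Fin (n + 1)} (hij : RankTwo i j) {m : List (Fin (n + 1))}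
    (hm : Red m) (hi : Pos (-(wprod m)⁻¹ (simpleRoot n i)))
    (hj : Pos (-(wprod m)⁻¹ (simpleRoot n j))) :
    ∃ l l' : List (Fin (n + 1)), Red (i :: l) ∧ Red (j :: l') ∧ wprod (i :: l) = wprod m ∧
      wprod (j :: l') = wprod m ∧ ∀ {M : Type} [Monoid M] {T : Fin (n + 1) → M}, BraidRel T →
        ((i :: l).map T).prod = ((j :: l').map T).prod := by
  obtain ⟨l1, r1, e1, w1⟩ := hm.exists_cons hi
  have q1 := inv_apply_of_cons w1.symm
  have neg_add : ∀ {g h : AffWeight n}, Pos (-g) → Pos (-h) → Pos (-(g + h)) := by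
    intro g h hg hh; rw [neg_add]; exact hg.add hh
  rcases hij with ⟨h, h', hT⟩ | ⟨h, h', hT⟩ | ⟨h, h', hT⟩
  · have hs := hT braidRel_sRefl
    obtain ⟨l2, r2, e2, w2⟩ := r1.tail.exists_cons (i := j) (by
      rw [q1, sRefl_apply, h, zero_smul, sub_zero]; exact hj)
    have w : wprod (i :: j :: l2) = wprod m := by rw [wprod_cons, w2, ← wprod_cons, w1]
    have w' : wprod (j :: i :: l2) = wprod m := by
      rw [← w]; simp only [wprod_cons, ← mul_assoc, hs]
    have hlen : (i :: j :: l2).length = m.length := by simp at e1 e2 ⊢; omega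
    refine ⟨j :: l2, i :: l2, hm.of_eq hlen w, hm.of_eq hlen w', w, w', fun {M _ T} hB => ?_⟩
    simp only [List.map_cons, List.prod_cons, ← mul_assoc, hT hB]
  · have hs := hT braidRel_sRefl
    have ri := sRefl_root_of_pairing h
    have rj := sRefl_root_of_pairing h'
    obtain ⟨l2, r2, e2, w2⟩ := r1.tail.exists_cons (i := j) (by
      rw [q1, ri, one_smul, map_add]; exact neg_add hj hi)
    have q2 := inv_apply_of_cons w2.symm
    obtain ⟨l3, r3, e3, w3⟩ := r2.tail.exists_cons (i := i) (by
      have : sRefl i (sRefl j (simpleRoot n i)) = simpleRoot n j := by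
        simp only [rj, map_add, map_smul, sRefl_root, ri]; module
      rw [q2, q1, this]; exact hj)
    have w : wprod (i :: j :: i :: l3) = wprod m := by
      rw [wprod_cons, wprod_cons, w3, ← wprod_cons, w2, ← wprod_cons, w1]
    have w' : wprod (j :: i :: j :: l3) = wprod m := by
      rw [← w]; simp only [wprod_cons, ← mul_assoc, hs]
    have hlen : (i :: j :: i :: l3).length = m.length := by simp at e1 e2 e3 ⊢; omega
    refine ⟨j :: i :: l3, i :: j :: l3, hm.of_eq hlen w, hm.of_eq hlen w', w, w', fun {M _ T} hB => ?_⟩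
    simp only [List.map_cons, List.prod_cons, ← mul_assoc, hT hB]
  · have hs := hT braidRel_sRefl
    have ri := sRefl_root_of_pairing h
    have rj := sRefl_root_of_pairing h'
    obtain ⟨l2, r2, e2, w2⟩ := r1.tail.exists_cons (i := j) (by
      rw [q1, ri, one_smul, map_add]; exact neg_add hj hi)
    have q2 := inv_apply_of_cons w2.symm
    obtain ⟨l3, r3, e3, w3⟩ := r2.tail.exists_cons (i := i) (by
      have : sRefl i (sRefl j (simpleRoot n i)) = simpleRoot n i + simpleRoot n j + simpleRoot n j := by
        simp only [rj, map_add, map_smul, sRefl_root, ri]; module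
      rw [q2, q1, this, map_add, map_add]; exact neg_add (neg_add hi hj) hj)
    have q3 := inv_apply_of_cons w3.symm
    obtain ⟨l4, r4, e4, w4⟩ := r3.tail.exists_cons (i := j) (by
      have : sRefl i (sRefl j (sRefl i (simpleRoot n j))) = simpleRoot n j := by
        simp only [rj, map_add, map_smul, sRefl_root, ri, map_neg]; module
      rw [q3, q2, q1, this]; exact hj)
    have w : wprod (i :: j :: i :: j :: l4) = wprod m := by
      rw [wprod_cons, wprod_cons, wprod_cons, w4, ← wprod_cons, w3, ← wprod_cons, w2, ← wprod_cons,
        w1]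
    have w' : wprod (j :: i :: j :: i :: l4) = wprod m := by
      rw [← w]; simp only [wprod_cons, ← mul_assoc, hs]
    have hlen : (i :: j :: i :: j :: l4).length = m.length := by simp at e1 e2 e3 e4 ⊢; omega
    refine ⟨j :: i :: j :: l4, i :: j :: i :: l4, hm.of_eq hlen w, hm.of_eq hlen w', w, w', fun {M _ T} hB => ?_⟩
    simp only [List.map_cons, List.prod_cons, ← mul_assoc, hT hB]

/-- Matsumoto's theorem. -/
theorem matsumoto {M : Type} [Monoid M] {T : Fin (n + 1) → M} (hT : BraidRel T)
    {l l' : List (Fin (n + 1))} (hl : Red l) (hl' : Red l') (h : wprod l = wprod l') :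
    (l.map T).prod = (l'.map T).prod := by
  induction hN : l.length generalizing l l' with
  | zero =>
    have := hl' [] (by rw [List.length_eq_zero_iff.1 hN] at h; exact h)
    rw [List.length_eq_zero_iff.1 hN, List.length_eq_zero_iff.1 (Nat.le_zero.1 this)]
  | succ N ih =>
    have hlen : l'.length = l.length := le_antisymm (hl' l h) (hl l' h.symm)
    match l, l', hN, hlen with
    | i :: l, j :: l', hN, hlen =>
      have step : ∀ {k : Fin (n + 1)} {m m' : List (Fin (n + 1))}, Red (k :: m) → Red (k :: m') →
          (k :: m).length = N + 1 → wprod (k :: m) = wprod (k :: m') →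
          ((k :: m).map T).prod = ((k :: m').map T).prod := by
        intro k m m' h1 h2 h3 h4
        rw [List.map_cons, List.prod_cons, List.map_cons, List.prod_cons]
        rw [ih h1.tail h2.tail (by simpa using h4) (by simpa using h3)]
      by_cases hij : i = j
      · subst hij
        exact step hl hl' hN h
      -- With different first letters, both are descents of the same element. One inserts two
      -- intermediate words related by a braid move, each sharing its first letter with one of the
      -- given words.
      · have common : ∃ m m' : List (Fin (n + 1)), Red (i :: m) ∧ Red (j :: m') ∧
            wprod (i :: m) = wprod (i :: l) ∧ wprod (j :: m') = wprod (i :: l) ∧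
            ((i :: m).map T).prod = ((j :: m').map T).prod := by
          have d1 := hl.neg
          have d2 := hl'.neg
          rw [← h] at d2
          rcases rankTwo_or hij with hr | hr
          · obtain ⟨m, m', h1, h2, h3, h4, h5⟩ := hr.exists_common hl d1 d2
            exact ⟨m, m', h1, h2, h3, h4, h5 hT⟩
          · obtain ⟨m, m', h1, h2, h3, h4, h5⟩ := hr.exists_common hl d2 d1
            exact ⟨m', m, h2, h1, h4, h3, (h5 hT).symm⟩
        obtain ⟨m, m', h1, h2, h3, h4, h5⟩ := common
        rw [step hl h1 hN h3.symm, h5]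
        exact (step hl' h2 (hlen.trans hN) (by rw [← h, h4])).symm

end Words

end

section

/-! ### Products of generators along reduced words -/

section ReducedProducts

variable {n : ℕ} [hn : Fact (2 ≤ n)]

/-- The product of the `T_i` along a reduced word of `w`. -/
def tProd {M : Type} [Monoid M] (T : Fin (n + 1) → M) (w : AffWeight n ≃ₗ[ℤ] AffWeight n) : M :=
  open Classical in if h : ∃ l, Red l ∧ wprod l = w then (h.choose.map T).prod else 1

/-- Membership in the affine Weyl group. -/
def InW (w : AffWeight n ≃ₗ[ℤ] AffWeight n) : Prop := ∃ l, wprod l = w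

lemma InW.mul {v w : AffWeight n ≃ₗ[ℤ] AffWeight n} (hv : InW v) (hw : InW w) : InW (v * w) := by
  obtain ⟨l, rfl⟩ := hv
  obtain ⟨m, rfl⟩ := hw
  exact ⟨l ++ m, wprod_append l m⟩

lemma InW.inv {v : AffWeight n ≃ₗ[ℤ] AffWeight n} (hv : InW v) : InW v⁻¹ := by
  obtain ⟨l, rfl⟩ := hv
  exact ⟨l.reverse, wprod_reverse l⟩

lemma inW_sRefl (i : Fin (n + 1)) : InW (sRefl i : AffWeight n ≃ₗ[ℤ] AffWeight n) :=
  ⟨[i], by simp⟩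

lemma inW_one : InW (1 : AffWeight n ≃ₗ[ℤ] AffWeight n) := ⟨[], rfl⟩

lemma InW.isRt {w : AffWeight n ≃ₗ[ℤ] AffWeight n} (hw : InW w) {b : AffWeight n} (hb : IsRt b) :
    IsRt (w b) := by
  obtain ⟨l, rfl⟩ := hw
  exact hb.wprod l

variable {M : Type} [Monoid M] {T : Fin (n + 1) → M}

lemma tProd_wprod (hT : BraidRel T) {l : List (Fin (n + 1))} (hl : Red l) :
    tProd T (wprod l) = (l.map T).prod := by
  have h : ∃ l', Red l' ∧ wprod l' = wprod l := ⟨l, hl, rfl⟩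
  rw [tProd, dif_pos h]
  exact matsumoto hT h.choose_spec.1 hl h.choose_spec.2

lemma red_nil : Red ([] : List (Fin (n + 1))) := fun _ _ => Nat.zero_le _

lemma tProd_one (hT : BraidRel T) : tProd T 1 = 1 := by
  simpa using tProd_wprod hT red_nil

lemma tProd_mul_left (hT : BraidRel T) {w : AffWeight n ≃ₗ[ℤ] AffWeight n} (hw : InW w)
    {i : Fin (n + 1)} (h : Pos (w⁻¹ (simpleRoot n i))) :
    tProd T (sRefl i * w) = T i * tProd T w := by
  obtain ⟨l, rfl⟩ := hw
  obtain ⟨l', h1, h2⟩ := exists_red l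
  rw [← h2] at h ⊢
  rw [← wprod_cons, tProd_wprod hT (h1.cons h), tProd_wprod hT h1, List.map_cons, List.prod_cons]

lemma tProd_mul_left_of_neg (hT : BraidRel T) {w : AffWeight n ≃ₗ[ℤ] AffWeight n} (hw : InW w)
    {i : Fin (n + 1)} (h : Pos (-w⁻¹ (simpleRoot n i))) :
    tProd T w = T i * tProd T (sRefl i * w) := by
  rw [← tProd_mul_left hT ((inW_sRefl i).mul hw), ← mul_assoc, sRefl_mul_self, one_mul]
  rw [mul_inv_rev, LinearEquiv.mul_apply, sRefl_inv, sRefl_root, map_neg]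
  exact h

lemma InW.induction {P : (AffWeight n ≃ₗ[ℤ] AffWeight n) → Prop} (one : P 1)
    (cons : ∀ (w : AffWeight n ≃ₗ[ℤ] AffWeight n) (i : Fin (n + 1)), InW w →
      Pos (w⁻¹ (simpleRoot n i)) → P w → P (sRefl i * w))
    {w : AffWeight n ≃ₗ[ℤ] AffWeight n} (hw : InW w) : P w := by
  obtain ⟨l, rfl⟩ := hw
  obtain ⟨l', h1, h2⟩ := exists_red l
  rw [← h2]
  clear h2
  induction l' with
  | nil => exact one
  | cons i l ih => rw [wprod_cons]; exact cons _ i ⟨l, rfl⟩ h1.pos (ih h1.tail)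

/-- The condition says that h does not undo any inversion of g, so lengths add. The proof strips
letters of g from the left. -/
lemma tProd_mul (hT : BraidRel T) {g h : AffWeight n ≃ₗ[ℤ] AffWeight n} (hg : InW g) (hh : InW h)
    (H : ∀ b, IsRt b → Pos b → Pos (-g b) → Pos (h⁻¹ b)) :
    tProd T (g * h) = tProd T g * tProd T h := by
  refine InW.induction (P := fun g => (∀ b, IsRt b → Pos b → Pos (-g b) → Pos (h⁻¹ b)) →
    tProd T (g * h) = tProd T g * tProd T h) ?_ ?_ hg H
  · intro _
    rw [tProd_one hT, one_mul, one_mul]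
  · intro w i hw hp ih H
    have hb := hw.inv.isRt (isRt_simpleRoot i)
    have h1 : Pos (h⁻¹ (w⁻¹ (simpleRoot n i))) := by
      refine H _ hb hp ?_
      rw [LinearEquiv.mul_apply, ← LinearEquiv.mul_apply w, mul_inv_cancel]
      change Pos (-sRefl i (simpleRoot n i))
      rw [sRefl_root, neg_neg]; exact pos_simpleRoot i
    rw [mul_assoc, tProd_mul_left hT (hw.mul hh) (by
      rw [mul_inv_rev, LinearEquiv.mul_apply]; exact h1), tProd_mul_left hT hw hp, mul_assoc, ih]
    intro b hb hbp hbn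
    -- An inversion b of w is also one of s_i w. Otherwise -w b would be the root a_i, contradicting
    -- w⁻¹ a_i > 0.
    rcases ((hw.isRt hb).sRefl i).pos_or with h' | h'
    · exfalso
      have h2 : -w b = simpleRoot n i :=
        eq_simpleRoot_of_neg (hw.isRt hb).neg hbn i (by rw [map_neg, neg_neg]; exact h')
      have h3 : w⁻¹ (simpleRoot n i) = -b := by
        rw [← h2, map_neg, ← LinearEquiv.mul_apply, inv_mul_cancel]; rfl
      rw [h3] at hp
      exact hbp.not_neg hp
    · exact H b hb hbp h'

lemma tProd_mul_right (hT : BraidRel T) {w : AffWeight n ≃ₗ[ℤ] AffWeight n} (hw : InW w)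
    {i : Fin (n + 1)} (h : Pos (w (simpleRoot n i))) :
    tProd T (w * sRefl i) = tProd T w * T i := by
  have h1 : tProd T (sRefl i : AffWeight n ≃ₗ[ℤ] AffWeight n) = T i := by
    have := tProd_mul_left hT inW_one (i := i) (by simpa using pos_simpleRoot i)
    rwa [mul_one, tProd_one hT, mul_one] at this
  rw [tProd_mul hT hw (inW_sRefl i), h1]
  intro b hb hbp hbn
  rw [sRefl_inv]
  rcases (hb.sRefl i).pos_or with h' | h'
  · exact h'
  · rw [eq_simpleRoot_of_neg hb hbp i h'] at hbn
    exact absurd hbn h.not_neg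

/-! ### Translations -/

/-- Translations as invertible operators. -/
def tauE (v : Weight n) : AffWeight n ≃ₗ[ℤ] AffWeight n :=
  LinearEquiv.ofLinearMap (tau v) (tau (-v))
    (by rw [← Module.End.mul_eq_comp, ← tau_add, add_neg_cancel, tau_zero]; rfl)
    (by rw [← Module.End.mul_eq_comp, ← tau_add, neg_add_cancel, tau_zero]; rfl)

lemma tauE_apply (v : Weight n) (g : AffWeight n) : tauE v g = (g.1, g.2 + pairing v g) := rfl

lemma tauE_inv_apply (v : Weight n) (g : AffWeight n) :
    (tauE v)⁻¹ g = (g.1, g.2 - pairing v g) := by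
  change tau (-v) g = _
  rw [tau_apply, pairing_neg, ← sub_eq_add_neg]

lemma tauE_add (v w : Weight n) : tauE (v + w) = tauE v * tauE w :=
  LinearEquiv.ext fun g => LinearMap.congr_fun (tau_add v w) g

lemma coe_wprod (l : List (Fin (n + 1))) (g : AffWeight n) :
    wprod l g = (l.map (simpleRefl n)).prod g := by
  induction l with
  | nil => rfl
  | cons i l ih => simp [LinearEquiv.mul_apply, ih, coe_sRefl]

lemma wprod_eq_tauE {l : List (Fin (n + 1))} {v : Weight n} :
    wprod l = tauE v ↔ (l.map (simpleRefl n)).prod = tau v := by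
  constructor
  · intro h
    refine LinearMap.ext fun g => ?_
    rw [← coe_wprod, h]; rfl
  · intro h
    refine LinearEquiv.ext fun g => ?_
    rw [coe_wprod, h]; rfl

lemma inW_tauE (v : Weight n) : InW (tauE v) := by
  obtain ⟨l, hl, -⟩ := exists_reducedWord_tau v
  exact ⟨l, wprod_eq_tauE.2 hl⟩

lemma tProd_tauE (hT : BraidRel T) (v : Weight n) :
    tProd T (tauE v) = ((exists_reducedWord_tau v).choose.map T).prod := by
  have h := (exists_reducedWord_tau v).choose_spec
  rw [← wprod_eq_tauE.2 h.1]
  refine tProd_wprod hT fun l' hl' => h.2 l' ?_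
  rw [wprod_eq_tauE.2 h.1] at hl'
  exact wprod_eq_tauE.1 hl'

lemma IsRt.pairing_nonneg {b : AffWeight n} (hb : IsRt b) {v : Weight n} (hv : IsDominant v)
    (h : 0 < ht b.1) : 0 ≤ pairing v b := by
  obtain ⟨p, r, e, e', hb1, -⟩ := hb
  have h1 : pairing v b = e * v p + e' * v r := by
    simp [pairing, hb1, add_mul, Finset.sum_add_distrib, Pi.single_apply]
  rw [hb1, ht_add, ht_single, ht_single] at h
  rw [h1]
  have hp := hv.2 p
  have hr := hv.2 r
  rcases Int.units_eq_one_or e with rfl | rfl <;> rcases Int.units_eq_one_or e' with rfl | rfl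
  · simp; omega
  · simp at h ⊢
    exact hv.1 (Fin.le_def.2 (by omega))
  · simp at h ⊢
    exact hv.1 (Fin.le_def.2 (by omega))
  · have := p.2
    have := r.2
    simp at h; omega

lemma IsRt.pairing_nonpos {b : AffWeight n} (hb : IsRt b) {v : Weight n} (hv : IsDominant v)
    (h : ht b.1 < 0) : pairing v b ≤ 0 := by
  have := hb.neg.pairing_nonneg hv (by rw [Prod.fst_neg, ht_neg]; omega)
  rw [map_neg] at this; omega

/-- A positive root inverted by τ(v) pairs negatively with the dominant v, so its gradient is
negative. Then τ(w)⁻¹ can only raise its δ-coefficient, and lengths add. -/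
lemma tProd_tauE_add (hT : BraidRel T) {v w : Weight n} (hv : IsDominant v) (hw : IsDominant w) :
    tProd T (tauE (v + w)) = tProd T (tauE v) * tProd T (tauE w) := by
  rw [tauE_add]
  refine tProd_mul hT (inW_tauE v) (inW_tauE w) fun b hb hbp hbn => ?_
  have h1 := hb.ht_ne
  have h2 := fun h => hb.pairing_nonneg hv h
  have h3 := fun h => hb.pairing_nonpos hw h
  rw [tauE_apply] at hbn
  rw [tauE_inv_apply]
  simp only [Pos, Prod.fst_neg, Prod.snd_neg, ht_neg] at *
  omega

lemma sRefl_snd {i : Fin (n + 1)} (hi : i ≠ 0) (g : AffWeight n) : (sRefl i g).2 = g.2 := by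
  rcases index_cases i with rfl | ⟨k, hk, rfl⟩ | rfl
  · exact absurd rfl hi
  · rw [sRefl_mid hk]
  · rw [sRefl_last]

lemma simpleRoot_snd {i : Fin (n + 1)} (hi : i ≠ 0) : (simpleRoot n i).2 = 0 := by
  have : (i : ℕ) ≠ 0 := fun h => hi (Fin.ext h)
  simp only [simpleRoot, this, if_false]
  split_ifs <;> rfl

lemma ht_simpleRoot {i : Fin (n + 1)} (hi : i ≠ 0) : 0 < ht (simpleRoot n i).1 := by
  have h := pos_simpleRoot i
  rw [Pos, simpleRoot_snd hi] at h
  omega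

lemma sRefl_fst_of_fst_eq {i : Fin (n + 1)} {g h : AffWeight n} (hgh : g.1 = h.1) :
    (sRefl i g).1 = (sRefl i h).1 := by
  have : pairing (simpleCoroot n i) g = pairing (simpleCoroot n i) h := by
    simp [pairing, hgh]
  rw [sRefl_apply, sRefl_apply, Prod.fst_sub, Prod.fst_sub, hgh, this]

lemma ht_sRefl_pos {i : Fin (n + 1)} (hi : i ≠ 0) {b : AffWeight n} (hb : IsRt b)
    (h : 0 < ht b.1) (h' : b.1 ≠ (simpleRoot n i).1) : 0 < ht (sRefl i b).1 := by
  have hb0 : IsRt ((b.1, 0) : AffWeight n) := hb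
  have h1 := (hb.sRefl i).ht_ne
  by_contra hc
  apply h'
  rw [← eq_simpleRoot_of_neg hb0 (Or.inr ⟨rfl, h⟩) i (Or.inr ⟨?_, ?_⟩)]
  · rw [Prod.snd_neg, sRefl_snd hi, neg_zero]
  · rw [Prod.fst_neg, ht_neg, sRefl_fst_of_fst_eq (g := (b.1, 0)) (h := b) rfl]; omega

lemma pairing_of_fst_eq (v : Weight n) {g h : AffWeight n} (hgh : g.1 = h.1) :
    pairing v g = pairing v h := by simp [pairing, hgh]

/-- The translation fixes a_i, so it commutes with s_i, and multiplying by s_i on either side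
increases the length. -/
lemma tProd_tauE_comm (hT : BraidRel T) {v : Weight n} {i : Fin (n + 1)}
    (h : pairing v (simpleRoot n i) = 0) :
    T i * tProd T (tauE v) = tProd T (tauE v) * T i := by
  have h1 : tauE v (simpleRoot n i) = simpleRoot n i := by rw [tauE_apply, h, add_zero]
  have h2 : (tauE v)⁻¹ (simpleRoot n i) = simpleRoot n i := by rw [tauE_inv_apply, h, sub_zero]
  rw [← tProd_mul_left hT (inW_tauE v) (by rw [h2]; exact pos_simpleRoot i),
    ← tProd_mul_right hT (inW_tauE v) (by rw [h1]; exact pos_simpleRoot i),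
    conj_sRefl (inW_tauE v) h1]

/-- The element X is T_u for u = s_i τ(v): one has ℓ(τ(v)) = 1 + ℓ(u) and ℓ(u²) = 2ℓ(u). Since u² is
the translation by s_i v + v, this is the source of the relation between T_i, Y^v and Y^{s_i v}. -/
lemma exists_sq_eq_tProd (hT : BraidRel T) {v : Weight n} (hv : IsDominant v) {i : Fin (n + 1)}
    (hi : i ≠ 0) (h : pairing v (simpleRoot n i) = 1) :
    ∃ X, tProd T (tauE v) = T i * X ∧ X * X = tProd T (sRefl i * tauE v * (sRefl i * tauE v)) := by
  have hw := (inW_sRefl i).mul (inW_tauE v)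
  have ha := simpleRoot_snd (n := n) hi
  have hta := ht_simpleRoot (n := n) hi
  refine ⟨tProd T (sRefl i * tauE v), tProd_mul_left_of_neg hT (inW_tauE v) ?_, ?_⟩
  · rw [tauE_inv_apply, h]
    left
    simp [ha]
  · rw [tProd_mul hT hw hw]
    intro b hb hbp hbn
    have e1 : (sRefl i * tauE v) b = ((sRefl i b).1, b.2 + pairing v b) := by
      rw [LinearEquiv.mul_apply]
      exact Prod.ext (sRefl_fst_of_fst_eq rfl) (by rw [sRefl_snd hi, tauE_apply])
    have e2 : (sRefl i * tauE v)⁻¹ b = ((sRefl i b).1, b.2 - pairing v (sRefl i b)) := by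
      rw [mul_inv_rev, LinearEquiv.mul_apply, sRefl_inv, tauE_inv_apply, sRefl_snd hi]
    rw [e1] at hbn
    rw [e2]
    have n1 := hb.ht_ne
    have n2 := (hb.sRefl i).ht_ne
    have p1 := fun h => hb.pairing_nonneg hv h
    have p2 := fun h => (hb.sRefl i).pairing_nonpos hv h
    have q1 := fun h1 h2 => ht_sRefl_pos hi hb h1 h2
    have q2 := fun h1 h2 => ht_sRefl_pos hi hb.neg h1 h2
    have r1 : b.1 = (simpleRoot n i).1 → pairing v b = 1 := fun h' => by
      rw [pairing_of_fst_eq v h', h]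
    have r2 : (-b).1 = (simpleRoot n i).1 → pairing v b = -1 ∧ pairing v (sRefl i b) = 1 := by
      intro h'
      have h3 : pairing v (-b) = 1 := by rw [pairing_of_fst_eq v h', h]
      have h4 : (sRefl i (-b)).1 = (-simpleRoot n i).1 := by
        rw [sRefl_fst_of_fst_eq h', sRefl_root]
      have h5 := pairing_of_fst_eq v h4
      rw [map_neg, map_neg, map_neg, h] at h5
      rw [map_neg] at h3
      omega
    simp only [Pos, Prod.fst_neg, Prod.snd_neg, ht_neg, map_neg] at *
    -- The finite reflection s_i preserves the sign of every gradient except ±a_i, so these two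
    -- gradients are treated separately.
    by_cases c1 : b.1 = (simpleRoot n i).1
    · have := r1 c1
      rw [c1] at *
      omega
    · by_cases c2 : -b.1 = (simpleRoot n i).1
      · have := r2 c2
        have h6 : ht b.1 < 0 := by
          have : ht (-b.1) > 0 := by rw [c2]; exact hta
          rw [ht_neg] at this; omega
        have h7 : (sRefl i b).1 = (simpleRoot n i).1 := by
          have : (sRefl i (-b)).1 = (-simpleRoot n i).1 := by
            rw [sRefl_fst_of_fst_eq (h := simpleRoot n i) c2, sRefl_root]
          rw [map_neg, Prod.fst_neg, Prod.fst_neg, neg_inj] at this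
          exact this
        rw [h7] at *
        omega
      · have := fun h1 => q1 h1 c1
        have := fun h1 => q2 h1 c2
        omega

end ReducedProducts

end

section

/-! ### The commuting elements `Y^v` -/

section YElements

variable {n : ℕ} [hn : Fact (2 ≤ n)] (p : Params)

/-- The difference `t_i - t_i⁻¹`. -/
def Params.c (p : Params) (n : ℕ) (i : Fin (n + 1)) : ℂ := p.tRoot n i - (p.tRoot n i : ℂ)⁻¹

lemma heckeT_quadratic (i : Fin (n + 1)) :
    heckeT n p i * heckeT n p i = p.c n i • heckeT n p i + 1 := by
  have h := RingQuot.mkAlgHom_rel ℂ (HeckeRel.quadratic (p := p) i)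
  have ht : (p.tRoot n i : ℂ) ≠ 0 := (p.tRoot n i).ne_zero
  simp only [map_mul, map_sub, map_add, map_zero, AlgHom.commutes] at h
  change (heckeT n p i - _) * (heckeT n p i + _) = 0 at h
  rw [sub_mul, mul_add, mul_add, ← map_mul, mul_inv_cancel₀ ht, map_one,
    ← Algebra.commutes, ← Algebra.smul_def, ← Algebra.smul_def] at h
  rw [Params.c, show ∀ x : AffineHecke n p, ((p.tRoot n i : ℂ) - (p.tRoot n i : ℂ)⁻¹) • x =
    (p.tRoot n i : ℂ) • x - (p.tRoot n i : ℂ)⁻¹ • x from fun x => sub_smul _ _ x]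
  rw [sub_eq_zero] at h
  rw [sub_add_eq_add_sub, ← h, add_sub_cancel_right]

/-- The generators as units. -/
def uT (i : Fin (n + 1)) : (AffineHecke n p)ˣ where
  val := heckeT n p i
  inv := heckeT n p i - p.c n i • 1
  val_inv := by rw [mul_sub, heckeT_quadratic, mul_smul_comm, mul_one]; abel
  inv_val := by rw [sub_mul, heckeT_quadratic, smul_mul_assoc, one_mul]; abel

@[simp] lemma coe_uT (i : Fin (n + 1)) : (uT p i : AffineHecke n p) = heckeT n p i := rfl

lemma coe_uT_inv (i : Fin (n + 1)) :
    ((uT p i)⁻¹ : (AffineHecke n p)ˣ) = heckeT n p i - p.c n i • (1 : AffineHecke n p) := rfl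

lemma braidRel_uT : BraidRel (uT (n := n) p) where
  four i j h h' := Units.ext <| by
    have := RingQuot.mkAlgHom_rel ℂ (HeckeRel.braid_four (p := p) i j h h')
    simp only [map_mul] at this
    exact this
  three i j h h0 h1 := Units.ext <| by
    have := RingQuot.mkAlgHom_rel ℂ (HeckeRel.braid_three (p := p) i j h h0 h1)
    simp only [map_mul] at this
    exact this
  comm i j h := Units.ext <| by
    have := RingQuot.mkAlgHom_rel ℂ (HeckeRel.commute (p := p) i j h)
    simp only [map_mul] at this
    exact this

/-- `T_{τ(v)}` as a unit. -/
def zU (v : Weight n) : (AffineHecke n p)ˣ := tProd (uT p) (tauE v)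

lemma coe_zU (v : Weight n) : (zU p v : AffineHecke n p) = heckeTau p v := by
  rw [zU, tProd_tauE (braidRel_uT p), heckeTau, ← Units.coeHom_apply, map_list_prod, List.map_map]
  rfl

lemma zU_add {v w : Weight n} (hv : IsDominant v) (hw : IsDominant w) :
    zU p (v + w) = zU p v * zU p w := tProd_tauE_add (braidRel_uT p) hv hw

lemma zU_comm {v w : Weight n} (hv : IsDominant v) (hw : IsDominant w) :
    zU p v * zU p w = zU p w * zU p v := by
  rw [← zU_add p hv hw, ← zU_add p hw hv, add_comm v w]

lemma IsDominant.add {v w : Weight n} (hv : IsDominant v) (hw : IsDominant w) :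
    IsDominant (v + w) :=
  ⟨hv.1.add hw.1, fun j => add_nonneg (hv.2 j) (hw.2 j)⟩

lemma isDominant_dominantPart (v : Weight n) : IsDominant (dominantPart v) := by
  constructor
  · intro i j hij
    refine Finset.sum_le_sum fun k _ => ?_
    have := le_max_right (fundCoeff v k) 0
    split_ifs with h1 h2 h2
    · exact le_rfl
    · exact absurd (hij.trans h1) h2
    · exact this
    · exact le_rfl
  · intro j
    refine Finset.sum_nonneg fun k _ => ?_
    have := le_max_right (fundCoeff v k) 0
    split_ifs <;> simp

lemma fundCoeff_neg (v : Weight n) (i : Fin n) : fundCoeff (-v) i = -fundCoeff v i := by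
  simp only [fundCoeff, Pi.neg_apply]
  split_ifs <;> ring

lemma sum_fundCoeff (v : Weight n) (j : Fin n) :
    ∑ i : Fin n, (if j ≤ i then fundCoeff v i else 0) = v j := by
  have key : ∀ m k : ℕ, (hk : k < n) → n = k + m + 1 →
      ∑ i : Fin n, (if k ≤ (i : ℕ) then fundCoeff v i else 0) = v ⟨k, hk⟩ := by
    intro m
    induction m with
    | zero =>
      intro k hk hm
      rw [Finset.sum_eq_single ⟨k, hk⟩]
      · simp [fundCoeff]; intro h; omega
      · intro b _ hb
        have : (b : ℕ) ≠ k := fun h => hb (Fin.ext h)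
        have := b.2
        rw [if_neg (by omega)]
      · simp
    | succ m ih =>
      intro k hk hm
      have hk' : k + 1 < n := by omega
      have := ih (k + 1) hk' (by omega)
      rw [← Finset.add_sum_erase _ _ (Finset.mem_univ (⟨k, hk⟩ : Fin n))] at this ⊢
      rw [if_neg (by simp), zero_add] at this
      rw [if_pos le_rfl]
      have h2 : ∑ i ∈ Finset.univ.erase (⟨k, hk⟩ : Fin n), (if k ≤ (i : ℕ) then fundCoeff v i else 0)
          = v ⟨k + 1, hk'⟩ := by
        rw [← this]
        refine Finset.sum_congr rfl fun i hi => ?_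
        have : (i : ℕ) ≠ k := fun h => (Finset.mem_erase.1 hi).1 (Fin.ext h)
        by_cases h : k ≤ (i : ℕ)
        · rw [if_pos h, if_pos (by omega)]
        · rw [if_neg h, if_neg (by omega)]
      rw [h2]
      simp [fundCoeff, hk']
  have h2 := j.2
  exact key (n - j - 1) j j.2 (by omega)

lemma dominantPart_sub (v : Weight n) : dominantPart v - dominantPart (-v) = v := by
  ext j
  rw [Pi.sub_apply, dominantPart, dominantPart, ← Finset.sum_sub_distrib]
  conv_rhs => rw [← sum_fundCoeff v j]
  refine Finset.sum_congr rfl fun i _ => ?_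
  rw [fundCoeff_neg]
  split_ifs
  · rcases le_total (fundCoeff v i) 0 with h | h
    · rw [max_eq_right h, max_eq_left (by omega)]; ring
    · rw [max_eq_left h, max_eq_right (by omega)]; ring
  · simp

/-- `Y^v` as a unit. -/
def yU (v : Weight n) : (AffineHecke n p)ˣ :=
  zU p (dominantPart v) * (zU p (dominantPart (-v)))⁻¹

lemma coe_yU (v : Weight n) : (yU p v : AffineHecke n p) = yElt p v := by
  rw [yU, yElt, Units.val_mul, coe_zU, ← Ring.inverse_unit, coe_zU]

/-- The quotient does not depend on how the weight is written as a difference of dominant weights,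
because T_τ is additive, and hence commutative, on dominant weights. -/
lemma yU_sub {v w : Weight n} (hv : IsDominant v) (hw : IsDominant w) :
    yU p (v - w) = zU p v * (zU p w)⁻¹ := by
  set d := dominantPart (v - w)
  set e := dominantPart (-(v - w))
  have hd : IsDominant d := isDominant_dominantPart _
  have he : IsDominant e := isDominant_dominantPart _
  have h : d + w = v + e := by
    have : d - e = v - w := dominantPart_sub _
    rw [sub_eq_sub_iff_add_eq_add] at this
    exact this
  have h1 : zU p d * zU p w = zU p v * zU p e := by rw [← zU_add p hd hw, h, zU_add p hv he]
  have h2 : (zU p w)⁻¹ * (zU p e)⁻¹ = (zU p e)⁻¹ * (zU p w)⁻¹ := by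
    rw [← mul_inv_rev, ← mul_inv_rev, zU_comm p hw he]
  calc yU p (v - w) = zU p d * zU p w * ((zU p w)⁻¹ * (zU p e)⁻¹) := by
        change zU p d * (zU p e)⁻¹ = _; group
    _ = zU p v * (zU p w)⁻¹ := by rw [h1, h2]; group

lemma isDominant_zero : IsDominant (0 : Weight n) := ⟨fun _ _ _ => le_rfl, fun _ => le_rfl⟩

lemma tauE_zero : tauE (0 : Weight n) = 1 := LinearEquiv.ext fun g => LinearMap.congr_fun tau_zero g

lemma zU_zero : zU p (0 : Weight n) = 1 := by
  rw [zU, tauE_zero, tProd_one (braidRel_uT p)]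

lemma yU_of_dominant {v : Weight n} (hv : IsDominant v) : yU p v = zU p v := by
  have := yU_sub p hv isDominant_zero
  rwa [sub_zero, zU_zero, inv_one, mul_one] at this

lemma yU_zero : yU p (0 : Weight n) = 1 := by
  rw [yU_of_dominant p isDominant_zero, zU_zero]

lemma yU_add (v w : Weight n) : yU p (v + w) = yU p v * yU p w := by
  have h1 := isDominant_dominantPart v
  have h2 := isDominant_dominantPart (-v)
  have h3 := isDominant_dominantPart w
  have h4 := isDominant_dominantPart (-w)
  have h : v + w = dominantPart v + dominantPart w - (dominantPart (-v) + dominantPart (-w)) := by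
    conv_lhs => rw [← dominantPart_sub v, ← dominantPart_sub w]
    abel
  have h5 : (zU p (dominantPart (-v)))⁻¹ * zU p (dominantPart w) =
      zU p (dominantPart w) * (zU p (dominantPart (-v)))⁻¹ :=
    (Commute.inv_left (zU_comm p h2 h3)).eq
  conv_lhs => rw [h]
  rw [yU_sub p (h1.add h3) (h2.add h4), zU_add p h1 h3, zU_add p h2 h4, zU_comm p h2 h4, yU, yU]
  calc _ = zU p (dominantPart v) * (zU p (dominantPart w) * (zU p (dominantPart (-v)))⁻¹) *
        (zU p (dominantPart (-w)))⁻¹ := by group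
    _ = _ := by rw [← h5]; group

lemma yU_neg (v : Weight n) : yU p (-v) = (yU p v)⁻¹ := by
  rw [eq_inv_iff_mul_eq_one, ← yU_add, neg_add_cancel, yU_zero]

lemma pairing_simpleRoot_mid {k : ℕ} (hk : k + 1 < n) (v : Weight n) :
    pairing v (simpleRoot n ⟨k + 1, by omega⟩) = v ⟨k, by omega⟩ - v ⟨k + 1, hk⟩ := by
  simp [simpleRoot_mid hk, pairing, sub_mul, Pi.single_apply]

lemma pairing_simpleRoot_last (v : Weight n) :
    pairing v (simpleRoot n (Fin.last n)) = 2 * v (lstIdx n) := by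
  simp [simpleRoot_last, pairing, Pi.single_apply]

lemma dominantPart_pairing (v : Weight n) {i : Fin (n + 1)}
    (hi : i ≠ 0) (h : pairing (simpleCoroot n i) (v, 0) = 0) :
    pairing (dominantPart v) (simpleRoot n i) = 0 := by
  have h2 := hn.out
  rcases index_cases i with rfl | ⟨k, hk, rfl⟩ | rfl
  · exact absurd rfl hi
  · rw [pairing_coroot_mid hk] at h
    rw [pairing_simpleRoot_mid hk, dominantPart, dominantPart, ← Finset.sum_sub_distrib]
    refine Finset.sum_eq_zero fun i _ => ?_
    simp only [Fin.le_def]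
    by_cases hik : (i : ℕ) = k
    · have : fundCoeff v i = 0 := by
        rw [show i = ⟨k, by omega⟩ from Fin.ext hik]
        simpa [fundCoeff, hk] using h
      simp [this]
    · split_ifs <;> omega
  · rw [pairing_coroot_last] at h
    rw [pairing_simpleRoot_last, dominantPart, Finset.sum_eq_zero, mul_zero]
    intro i _
    by_cases hik : i = lstIdx n
    · have : fundCoeff v i = 0 := by
        subst hik
        have : ¬ (n - 1 + 1 < n) := by omega
        simpa [fundCoeff, lstIdx, this] using h
      simp [this]
    · rw [if_neg]
      intro hc
      apply hik
      have := i.2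
      exact Fin.ext (by simp [lstIdx, Fin.le_def] at hc ⊢; omega)

/-- If s_i fixes v, the i-th fundamental coefficient of v vanishes, so both canonical dominant parts
are orthogonal to a_i and T_i commutes with each factor of Y^v. -/
lemma uT_comm_yU {v : Weight n} {i : Fin (n + 1)} (hi : i ≠ 0)
    (h : pairing (simpleCoroot n i) (v, 0) = 0) : uT p i * yU p v = yU p v * uT p i := by
  have h1 := tProd_tauE_comm (braidRel_uT p) (dominantPart_pairing v hi h)
  have h2 := tProd_tauE_comm (braidRel_uT p) (dominantPart_pairing (-v) hi (by
    rw [show ((-v, 0) : AffWeight n) = -(v, 0) by simp, map_neg, h, neg_zero]))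
  exact (Commute.mul_right (a := uT p i) h1 (Commute.inv_right h2)).eq

lemma sRefl_tauE_sRefl (v : Weight n) {i : Fin (n + 1)} (hi : i ≠ 0) :
    sRefl i * tauE v * sRefl i = tauE (sRefl i (v, 0)).1 := by
  have hd : sRefl i ((0, 1) : AffWeight n) = (0, 1) := by
    rw [sRefl_apply]; simp [pairing]
  refine LinearEquiv.ext fun g => ?_
  have h1 : pairing v (sRefl i g) = pairing (sRefl i (v, 0)).1 g := by
    have : form (sRefl i g) (v, 0) = form g (sRefl i (v, 0)) := by
      rw [← form_sRefl i, ← LinearEquiv.mul_apply, sRefl_mul_self]; rfl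
    exact this
  have h2 : tauE v (sRefl i g) = sRefl i g + pairing v (sRefl i g) • (0, 1) := by
    rw [tauE_apply]; exact Prod.ext (by simp) (by simp)
  rw [LinearEquiv.mul_apply, LinearEquiv.mul_apply, h2, map_add, map_smul, hd,
    ← LinearEquiv.mul_apply, sRefl_mul_self, h1, tauE_apply]
  exact Prod.ext (by simp) (by simp)

/-- Write Y^v = T_i X with X² = Y^{s_i v + v} = Y^{s_i v} T_i X. Cancelling X gives X = Y^{s_i v}
T_i. Dominance of s_i v + v is what identifies T_τ of this weight with its Y. -/
lemma uT_inv_yU_uT_inv {v : Weight n} (hv : IsDominant v) {i : Fin (n + 1)} (hi : i ≠ 0)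
    (h : pairing v (simpleRoot n i) = 1) (hv' : IsDominant ((sRefl i (v, 0)).1 + v)) :
    (uT p i)⁻¹ * yU p v * (uT p i)⁻¹ = yU p (sRefl i (v, 0)).1 := by
  obtain ⟨X, h1, h2⟩ := exists_sq_eq_tProd (braidRel_uT p) hv hi h
  rw [← mul_assoc, sRefl_tauE_sRefl v hi, ← tauE_add] at h2
  change zU p v = _ at h1
  change _ = zU p _ at h2
  rw [← yU_of_dominant p hv', yU_add, yU_of_dominant p hv, h1] at h2
  rw [yU_of_dominant p hv, h1, inv_mul_cancel_left, mul_inv_eq_iff_eq_mul]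
  rw [← mul_assoc] at h2
  exact mul_right_cancel h2

/-- The element `Y^{ε_k}`. -/
abbrev yE (k : Fin n) : (AffineHecke n p)ˣ := yU p (Pi.single k 1)

/-- The fundamental weights. -/
def omg (m : ℕ) : Weight n := fun j => if (j : ℕ) < m then 1 else 0

lemma isDominant_omg (m : ℕ) : IsDominant (omg m : Weight n) := by
  constructor
  · intro i j hij
    rw [Fin.le_def] at hij
    simp only [omg]
    split_ifs <;> omega
  · intro j
    simp only [omg]
    split_ifs <;> simp

lemma omg_succ {k : ℕ} (hk : k < n) :
    (Pi.single ⟨k, hk⟩ 1 : Weight n) = omg (k + 1) - omg k := by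
  ext j
  simp only [omg, Pi.single_apply, Fin.ext_iff, Pi.sub_apply]
  split_ifs <;> omega

/-- The relation above is applied to the fundamental weight ω_{k+1}, whose reflection is ε_{k+2} +
ω_k in the numbering from one. The factor Y^{-ω_k} commutes with T_{k+1}, and the sum of the two
weights is the dominant ω_{k+2} + ω_k. -/
lemma yE_succ {k : ℕ} (hk : k + 1 < n) :
    yE p ⟨k + 1, hk⟩ = (uT p ⟨k + 1, by omega⟩)⁻¹ * yE p ⟨k, by omega⟩ *
      (uT p ⟨k + 1, by omega⟩)⁻¹ := by
  set i : Fin (n + 1) := ⟨k + 1, by omega⟩ with hi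
  have hi0 : i ≠ 0 := by simp [hi, Fin.ext_iff]
  have e2 : (sRefl i ((omg (k + 1) : Weight n), 0)).1 = Pi.single ⟨k + 1, hk⟩ 1 + omg k := by
    rw [hi, sRefl_mid hk]
    ext j
    simp only [omg, Pi.add_apply, Pi.single_apply, Fin.ext_iff, Equiv.swap_apply_def]
    split_ifs <;> simp at * <;> omega
  have e1 : pairing (omg (k + 1) : Weight n) (simpleRoot n i) = 1 := by
    rw [hi, pairing_simpleRoot_mid hk]
    simp [omg]
  have e3 : IsDominant ((sRefl i ((omg (k + 1) : Weight n), 0)).1 + omg (k + 1)) := by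
    have : (sRefl i ((omg (k + 1) : Weight n), 0)).1 + omg (k + 1) = omg (k + 2) + omg k := by
      rw [e2, omg_succ hk]; abel
    rw [this]
    exact (isDominant_omg _).add (isDominant_omg _)
  have h := uT_inv_yU_uT_inv p (isDominant_omg (k + 1)) hi0 e1 e3
  have hc : uT p i * yU p (-omg k) = yU p (-omg k) * uT p i := by
    refine uT_comm_yU p hi0 ?_
    rw [hi, pairing_coroot_mid hk]
    simp [omg]
  have hc' : yU p (-omg k) * (uT p i)⁻¹ = (uT p i)⁻¹ * yU p (-omg k) :=
    (Commute.inv_right (Commute.symm hc)).eq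
  rw [e2, yU_add] at h
  rw [yE, yE, omg_succ (show k < n by omega), sub_eq_add_neg, yU_add]
  rw [mul_assoc, mul_assoc (yU p (omg (k + 1))), hc', ← mul_assoc, ← mul_assoc, h, mul_assoc,
    ← yU_add, add_neg_cancel, yU_zero, mul_one]

end YElements

end

section

/-! ### Explicit words for the elements `Y^{ε_k}` -/

section ExplicitWords

variable {n : ℕ} [hn : Fact (2 ≤ n)]

/-- The element `ε_m`, numbered from zero, of `Λ ⊕ ℤδ`. -/
def affE (n m : ℕ) : AffWeight n := (eps n (m + 1), 0)

/-- The element `δ`. -/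
def affD (n : ℕ) : AffWeight n := (0, 1)

lemma affE_eq {m : ℕ} (hm : m < n) : affE n m = (Pi.single ⟨m, hm⟩ 1, 0) := by
  rw [affE, eps_eq_single hm]

/-- The index `k ≤ n`. -/
def idx (n k : ℕ) : Fin (n + 1) := Fin.ofNat (n + 1) k

lemma val_idx {k : ℕ} (hk : k ≤ n) : (idx n k : ℕ) = k :=
  Nat.mod_eq_of_lt (Nat.lt_succ_of_le hk)

lemma idx_eq {k : ℕ} (hk : k ≤ n) : idx n k = ⟨k, by omega⟩ := Fin.ext (val_idx hk)

lemma idx_last : idx n n = Fin.last n := Fin.ext (val_idx le_rfl)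

lemma root_idx_mid {k : ℕ} (hk : k + 1 < n) :
    simpleRoot n (idx n (k + 1)) = affE n k - affE n (k + 1) := by
  rw [idx_eq hk.le, simpleRoot_mid hk, affE_eq hk, affE_eq (show k < n by omega)]
  simp

lemma root_idx_zero : simpleRoot n 0 = affD n - (2 : ℤ) • affE n 0 := by
  rw [simpleRoot_zero, affE_eq (show 0 < n from (fstIdx n).2), affD]
  ext <;> simp [fstIdx]

lemma root_idx_last : simpleRoot n (idx n n) = (2 : ℤ) • affE n (n - 1) := by
  rw [idx_last, simpleRoot_last, affE_eq (show n - 1 < n from (lstIdx n).2)]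
  ext <;> simp [lstIdx]

lemma sRefl_affD (i : Fin (n + 1)) : sRefl i (affD n) = affD n := by
  rw [sRefl_apply]; simp [pairing, affD]

lemma sRefl_mid_affE {k m : ℕ} (hk : k + 1 < n) (hm : m < n) : sRefl (idx n (k + 1)) (affE n m) =
    if m = k then affE n (k + 1) else if m = k + 1 then affE n k else affE n m := by
  rw [sRefl_apply, root_idx_mid hk, idx_eq hk.le, pairing_coroot_mid hk, affE_eq hm]
  simp only [Pi.single_apply, Fin.mk.injEq]
  split_ifs <;> first | (exfalso; omega) | skip
  · obtain rfl : k = m := by assumption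
    rw [affE_eq hm]; simp
  · obtain rfl : k + 1 = m := by assumption
    rw [affE_eq hm]; simp
  · simp

lemma sRefl_zero_affE {m : ℕ} (hm : m < n) : sRefl 0 (affE n m) =
    if m = 0 then affD n - affE n 0 else affE n m := by
  rw [sRefl_apply, root_idx_zero, pairing_coroot_zero, affE_eq hm]
  simp only [Pi.single_apply, fstIdx, Fin.mk.injEq]
  split_ifs with h1 h2 h3 <;> first | (exfalso; omega) | skip
  · subst h1; rw [affE_eq hm]; module
  · simp

lemma sRefl_last_affE {m : ℕ} (hm : m < n) : sRefl (idx n n) (affE n m) =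
    if m = n - 1 then -affE n m else affE n m := by
  rw [sRefl_apply, root_idx_last, idx_last, pairing_coroot_last, affE_eq hm]
  simp only [Pi.single_apply, lstIdx, Fin.mk.injEq]
  split_ifs with h1 h2 h3 <;> first | (exfalso; omega) | skip
  · subst h1; rw [affE_eq hm]; module
  · simp

/-- The linear automorphism `u` fixes `δ` and has values `E m` at `ε_m`. -/
def IsTrack (u : AffWeight n ≃ₗ[ℤ] AffWeight n) (E : ℕ → AffWeight n) : Prop :=
  (∀ m < n, u (affE n m) = E m) ∧ u (affD n) = affD n

/-- The values `ε_0, …, ε_{n-1}`, with `ε_j` omitted and `x` inserted at position `k`. -/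
def pat (x : AffWeight n) (j k m : ℕ) : AffWeight n :=
  if m = k then x else if m < k then (if m < j then affE n m else affE n (m + 1))
  else (if m ≤ j then affE n (m - 1) else affE n m)

/-- The `k`-th of the `ε_m`, `m ≠ j`. -/
def oth (n j k : ℕ) : AffWeight n := if k < j then affE n k else affE n (k + 1)

lemma isTrack_one (j : ℕ) : IsTrack (1 : AffWeight n ≃ₗ[ℤ] AffWeight n) (pat (affE n j) j j) := by
  refine ⟨fun m hm => ?_, rfl⟩
  change affE n m = _
  rw [pat]
  split_ifs <;> first | omega | rfl | (congr 1)

variable {u : AffWeight n ≃ₗ[ℤ] AffWeight n} {x : AffWeight n} {j k : ℕ}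

/-- Bookkeeping for long words. Right multiplication by s_{k+1} moves the inserted vector x by one
place, s_0 replaces it by δ - x and s_n by -x. The `root_*` lemmas record the image of the simple
root met on the way, whose sign decides whether the word stays reduced. -/
lemma IsTrack.root_up (h : IsTrack u (pat x j k)) (hk : k + 1 < n) :
    u (simpleRoot n (idx n (k + 1))) = x - oth n j k := by
  rw [root_idx_mid hk, map_sub, h.1 _ (by omega), h.1 _ hk, oth]
  simp only [pat]
  split_ifs <;> first | omega | rfl

lemma IsTrack.root_down (h : IsTrack u (pat x j (k + 1))) (hk : k + 1 < n) :
    u (simpleRoot n (idx n (k + 1))) = oth n j k - x := by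
  rw [root_idx_mid hk, map_sub, h.1 _ (by omega), h.1 _ hk, oth]
  simp only [pat]
  split_ifs <;> first | omega | rfl

lemma IsTrack.up (h : IsTrack u (pat x j k)) (hk : k + 1 < n) :
    IsTrack (u * sRefl (idx n (k + 1))) (pat x j (k + 1)) := by
  refine ⟨fun m hm => ?_, by rw [LinearEquiv.mul_apply, sRefl_affD, h.2]⟩
  rw [LinearEquiv.mul_apply, sRefl_mid_affE hk hm]
  split_ifs with h1 h2
  · subst h1
    rw [h.1 _ hk]; simp only [pat]; split_ifs <;> first | omega | rfl
  · subst h2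
    rw [h.1 _ (by omega)]; simp only [pat]; split_ifs <;> first | omega | rfl
  · rw [h.1 _ hm]; simp only [pat]; split_ifs <;> first | omega | rfl

lemma IsTrack.down (h : IsTrack u (pat x j (k + 1))) (hk : k + 1 < n) :
    IsTrack (u * sRefl (idx n (k + 1))) (pat x j k) := by
  refine ⟨fun m hm => ?_, by rw [LinearEquiv.mul_apply, sRefl_affD, h.2]⟩
  rw [LinearEquiv.mul_apply, sRefl_mid_affE hk hm]
  split_ifs with h1 h2
  · subst h1
    rw [h.1 _ hk]; simp only [pat]; split_ifs <;> first | omega | rfl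
  · subst h2
    rw [h.1 _ (by omega)]; simp only [pat]; split_ifs <;> first | omega | rfl
  · rw [h.1 _ hm]; simp only [pat]; split_ifs <;> first | omega | rfl

lemma IsTrack.root_zero (h : IsTrack u (pat x j 0)) :
    u (simpleRoot n 0) = affD n - (2 : ℤ) • x := by
  have h2 := hn.out
  rw [root_idx_zero, map_sub, map_smul, h.2, h.1 0 (by omega)]
  rfl

lemma IsTrack.zero (h : IsTrack u (pat x j 0)) :
    IsTrack (u * sRefl 0) (pat (affD n - x) j 0) := by
  have h2 := hn.out
  refine ⟨fun m hm => ?_, by rw [LinearEquiv.mul_apply, sRefl_affD, h.2]⟩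
  rw [LinearEquiv.mul_apply, sRefl_zero_affE hm]
  split_ifs with h1
  · rw [map_sub, h.2, h.1 0 (by omega), h1]; rfl
  · rw [h.1 _ hm, pat, pat, if_neg h1, if_neg h1]

lemma IsTrack.root_last (h : IsTrack u (pat x j (n - 1))) :
    u (simpleRoot n (idx n n)) = (2 : ℤ) • x := by
  have h2 := hn.out
  rw [root_idx_last, map_smul, h.1 _ (by omega), pat, if_pos rfl]

lemma IsTrack.last (h : IsTrack u (pat x j (n - 1))) :
    IsTrack (u * sRefl (idx n n)) (pat (-x) j (n - 1)) := by
  refine ⟨fun m hm => ?_, by rw [LinearEquiv.mul_apply, sRefl_affD, h.2]⟩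
  rw [LinearEquiv.mul_apply, sRefl_last_affE hm]
  split_ifs with h1
  · rw [map_neg, h.1 _ hm, pat, pat, if_pos h1, if_pos h1]
  · rw [h.1 _ hm, pat, pat, if_neg h1, if_neg h1]

lemma affWeight_eq_sum (g : AffWeight n) :
    g = ∑ m : Fin n, g.1 m • affE n m + g.2 • affD n := by
  have : ∀ m : Fin n, affE n m = (Pi.single m 1, 0) := fun m => affE_eq m.2
  refine Prod.ext ?_ ?_
  · simp only [Prod.fst_add, Prod.fst_sum, Prod.smul_fst, this, affD]
    ext j
    simp [Finset.sum_apply, Pi.single_apply]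
  · simp [Prod.snd_sum, this, affD]

lemma IsTrack.ext {v : AffWeight n ≃ₗ[ℤ] AffWeight n} {E : ℕ → AffWeight n}
    (h : IsTrack u E) (h' : IsTrack v E) : u = v := by
  refine LinearEquiv.ext fun g => ?_
  rw [affWeight_eq_sum g]
  simp only [map_add, map_sum, map_smul, h.2, h'.2]
  congr 1
  exact Finset.sum_congr rfl fun m _ => by rw [h.1 _ m.2, h'.1 _ m.2]

lemma IsTrack.eq_tauE {j : ℕ} (hj : j < n) (h : IsTrack u (pat (affE n j - affD n) j j)) :
    u = tauE (-Pi.single ⟨j, hj⟩ 1) := by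
  refine h.ext ⟨fun m hm => ?_, ?_⟩
  · rw [tauE_apply, pairing_neg, pairing_single, affE_eq hm]
    simp only [pat]
    split_ifs with h1 h2 h3 <;> first | omega | skip
    · subst h1; rw [affE_eq hm]; simp [affD]
    · rw [affE_eq hm]
      have : (⟨j, hj⟩ : Fin n) ≠ ⟨m, hm⟩ := fun h => h1 (congrArg Fin.val h).symm
      simp [this]
    · rw [affE_eq hm]
      have : (⟨j, hj⟩ : Fin n) ≠ ⟨m, hm⟩ := fun h => h1 (congrArg Fin.val h).symm
      simp [this]
  · rw [tauE_apply]; simp [pairing, affD]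

variable (p : Params)

/-- `T_k ⋯ T_1`. -/
def prodDown (n : ℕ) [hn : Fact (2 ≤ n)] (p : Params) : ℕ → (AffineHecke n p)ˣ
  | 0 => 1
  | k + 1 => uT p (idx n (k + 1)) * prodDown n p k

/-- `T_1 ⋯ T_k`. -/
def prodUp (n : ℕ) [hn : Fact (2 ≤ n)] (p : Params) : ℕ → (AffineHecke n p)ˣ
  | 0 => 1
  | k + 1 => prodUp n p k * uT p (idx n (k + 1))

lemma oth_pos (k : ℕ) : Pos (affD n - affE n 0 - oth n 0 k) := by
  left; simp [affD, affE, oth]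

lemma tProd_step {u : AffWeight n ≃ₗ[ℤ] AffWeight n} (hu : InW u) (i : Fin (n + 1))
    (h : Pos (u (simpleRoot n i))) :
    InW (u * sRefl i) ∧ tProd (uT p) (u * sRefl i)⁻¹ = uT p i * tProd (uT p) u⁻¹ := by
  refine ⟨hu.mul (inW_sRefl i), ?_⟩
  rw [mul_inv_rev, sRefl_inv, tProd_mul_left (braidRel_uT p) hu.inv (by rwa [inv_inv])]

/-- τ(ε_1) = s_1 ⋯ s_{n-1} s_n s_{n-1} ⋯ s_1 s_0. After s_0 the inserted vector δ - ε_1 travels up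
to the last place, changes sign there and travels back. Every root met has positive δ-coefficient,
so lengths add at each letter. -/
lemma yE_zero : yE p (fstIdx n) = prodUp n p (n - 1) * uT p (idx n n) * prodDown n p (n - 1) *
    uT p 0 := by
  have h2 := hn.out
  have up : ∀ k < n, ∃ u : AffWeight n ≃ₗ[ℤ] AffWeight n, IsTrack u (pat (affD n - affE n 0) 0 k) ∧
      InW u ∧ tProd (uT p) u⁻¹ = prodDown n p k * uT p 0 := by
    intro k
    induction k with
    | zero =>
      intro _
      have h1 := isTrack_one (n := n) 0
      obtain ⟨h3, h4⟩ := tProd_step p inW_one 0 (by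
        rw [h1.root_zero]; left; simp [affD, affE])
      refine ⟨_, h1.zero, h3, ?_⟩
      rw [h4, inv_one, tProd_one (braidRel_uT p), mul_one, prodDown, one_mul]
    | succ k ih =>
      intro hk
      obtain ⟨u, h1, h2, h3⟩ := ih (by omega)
      obtain ⟨h5, h4⟩ := tProd_step p h2 (idx n (k + 1)) (by
        rw [h1.root_up hk]; exact oth_pos k)
      exact ⟨_, h1.up hk, h5, by rw [h4, h3, prodDown, mul_assoc]⟩
  -- The part of the word built so far is written as the full word with its prefix T_1 ⋯ T_k
  -- removed, so that k = 0 gives the claim.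
  have down : ∀ m k, n = k + m + 1 → ∃ u : AffWeight n ≃ₗ[ℤ] AffWeight n,
      IsTrack u (pat (affE n 0 - affD n) 0 k) ∧ InW u ∧ tProd (uT p) u⁻¹ =
        (prodUp n p k)⁻¹ * (prodUp n p (n - 1) * uT p (idx n n) * prodDown n p (n - 1) *
        uT p 0) := by
    intro m
    induction m with
    | zero =>
      intro k hk
      obtain rfl : k = n - 1 := by omega
      obtain ⟨u, h1, h2, h3⟩ := up (n - 1) (by omega)
      obtain ⟨h5, h4⟩ := tProd_step p h2 (idx n n) (by
        rw [h1.root_last]; left; simp [affD, affE])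
      have h6 := h1.last
      rw [neg_sub] at h6
      exact ⟨_, h6, h5, by rw [h4, h3]; group⟩
    | succ m ih =>
      intro k hk
      have hk' : k + 1 < n := by omega
      obtain ⟨u, h1, h2, h3⟩ := ih (k + 1) (by omega)
      obtain ⟨h5, h4⟩ := tProd_step p h2 (idx n (k + 1)) (by
        rw [h1.root_down hk']; left; simp [affD, affE, oth])
      exact ⟨_, h1.down hk', h5, by rw [h4, h3, prodUp]; group⟩
  obtain ⟨u, h1, -, h3⟩ := down (n - 1) 0 (by omega)
  have h4 : u⁻¹ = tauE (Pi.single (fstIdx n) 1) := by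
    rw [h1.eq_tauE (by omega), inv_eq_iff_mul_eq_one, ← tauE_add, fstIdx, neg_add_cancel, tauE_zero]
  rw [h4, prodUp, inv_one, one_mul] at h3
  have hd : IsDominant (Pi.single (fstIdx n) 1 : Weight n) := by
    rw [fstIdx, omg_succ]
    have : (omg 0 : Weight n) = 0 := by ext; simp [omg]
    rw [this, sub_zero]; exact isDominant_omg _
  rw [yE, yU_of_dominant p hd, ← h3, zU]

lemma yE_eq {j : ℕ} (hj : j < n) : yE p ⟨j, hj⟩ =
    (prodUp n p j)⁻¹ * yE p (fstIdx n) * (prodDown n p j)⁻¹ := by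
  induction j with
  | zero => simp [prodUp, prodDown, fstIdx]
  | succ j ih =>
    rw [yE_succ p hj, ih (by omega), prodUp, prodDown, idx_eq hj.le]
    group

/-- The conjugate of `T_0` that gives the reflection at `δ - 2ε_n`. -/
lemma yE_last : yE p (lstIdx n) =
    uT p (Fin.last n) * (prodDown n p (n - 1) * uT p 0 * (prodDown n p (n - 1))⁻¹) := by
  rw [lstIdx, yE_eq, yE_zero, idx_last]
  group

end ExplicitWords

end

section

/-! ### Braid relations for operators of Demazure–Lusztig type -/

section RankTwoBraid

variable {V Ω : Type*} {ev : V → Ω → ℂ} {S R : V → V} {s r : Ω → Ω} {c d : Ω → ℂ} {G : Set Ω}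
  {t t' : ℂ}

/-- Both sides are expanded over the eight points of the dihedral orbit of x. By invariance only the
coefficients c(x), c(rx), d(x), d(sx) remain, and one rank-two identity suffices. G is a stable set
of points off the poles. -/
lemma braid_four_of_values (hGs : ∀ x ∈ G, s x ∈ G) (hGr : ∀ x ∈ G, r x ∈ G)
    (hs : ∀ x, s (s x) = x) (hr : ∀ x, r (r x) = x) (hsr : ∀ x, s (r (s (r x))) = r (s (r (s x))))
    (hS : ∀ f, ∀ x ∈ G, ev (S f) x = t * ev f x + c x * (ev f (s x) - ev f x))
    (hR : ∀ f, ∀ x ∈ G, ev (R f) x = t' * ev f x + d x * (ev f (r x) - ev f x))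
    (hcs : ∀ x ∈ G, c (s x) = t + t⁻¹ - c x) (hdr : ∀ x ∈ G, d (r x) = t' + t'⁻¹ - d x)
    (hcr : ∀ x ∈ G, c (r (s x)) = c (r x)) (hds : ∀ x ∈ G, d (s (r x)) = d (s x))
    (hrel : ∀ x ∈ G, c x * (d x - d (s x)) + (t + t⁻¹) * d (s x) - (t⁻¹ * t' + t * t'⁻¹) +
      (t' + t'⁻¹) * c (r x) - c (r x) * (d x + d (s x)) = 0)
    (f : V) {x : Ω} (hx : x ∈ G) : ev (S (R (S (R f)))) x = ev (R (S (R (S f)))) x := by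
  have g1 := hGs x hx
  have g2 := hGr x hx
  have g3 := hGs _ g2
  have g4 := hGr _ g1
  have g5 := hGs _ g4
  have g6 := hGr _ g3
  have e1 : c (r (s (r x))) = c x := by
    rw [hcr _ g2, hr]
  have e2 : d (s (r (s x))) = d x := by
    rw [hds _ g1, hs]
  have e3 : s (r (s (r x))) = r (s (r (s x))) := hsr x
  have k1 := hcs x hx
  have k2 := hcs _ g2
  have k3 := hcr x hx
  have k4 := hds x hx
  have k5 := hdr x hx
  have k6 := hdr _ g1
  have hrel := hrel x hx
  simp only [hS, hR, hx, g1, g2, g3, g4, g5, g6, hs, hr]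
  simp only [e1, e2, e3, k1, k2, k3, k4, k5, k6]
  generalize c x = A at *
  generalize c (r x) = B at *
  generalize d x = C at *
  generalize d (s x) = D at *
  clear e1 e2 e3 k1 k2 k3 k4 k5 k6 hS hR hcs hdr hcr hds hs hr hsr hGs hGr g1 g2 g3 g4 g5 g6
  generalize ev f x = f0
  generalize ev f (s x) = f1
  generalize ev f (r x) = f2
  generalize ev f (s (r x)) = f3
  generalize ev f (r (s x)) = f4
  generalize ev f (r (s (r x))) = f5
  generalize ev f (s (r (s x))) = f6
  generalize ev f (r (s (r (s x)))) = f7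
  -- The two expansions differ only in the values at s x, r x, r s x and s r x, each time by a
  -- multiple of `hrel`.
  linear_combination (C * (B - A) * f2 + A * (C - D) * f1 + A * D * f4 - B * C * f3) * hrel

lemma braid_three_of_values (hGs : ∀ x ∈ G, s x ∈ G) (hGr : ∀ x ∈ G, r x ∈ G)
    (hs : ∀ x, s (s x) = x) (hr : ∀ x, r (r x) = x) (hsr : ∀ x, s (r (s x)) = r (s (r x)))
    (ht : t ≠ 0)
    (hS : ∀ f, ∀ x ∈ G, ev (S f) x = t * ev f x + c x * (ev f (s x) - ev f x))
    (hR : ∀ f, ∀ x ∈ G, ev (R f) x = t * ev f x + d x * (ev f (r x) - ev f x))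
    (hcs : ∀ x ∈ G, c (s x) = t + t⁻¹ - c x) (hdr : ∀ x ∈ G, d (r x) = t + t⁻¹ - d x)
    (hcd : ∀ x ∈ G, c (r x) = d (s x)) (hcr : ∀ x ∈ G, c (r (s x)) = d x)
    (hds : ∀ x ∈ G, d (s (r x)) = c x)
    (hrel : ∀ x ∈ G, c x * d x - c (r x) * (c x + d x) + (t + t⁻¹) * c (r x) - 1 = 0)
    (f : V) {x : Ω} (hx : x ∈ G) : ev (S (R (S f))) x = ev (R (S (R f))) x := by
  have g1 := hGs x hx
  have g2 := hGr x hx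
  have g3 := hGs _ g2
  have g4 := hGr _ g1
  have k1 := hcs x hx
  have k2 := hcr x hx
  have k3 := hds x hx
  have k4 := hdr x hx
  have k5 := (hcd x hx).symm
  have hrel := hrel x hx
  have h1 : t * t⁻¹ = 1 := mul_inv_cancel₀ ht
  simp only [hS, hR, hx, g1, g2, g3, g4, hs, hr]
  simp only [hsr x, k1, k2, k3, k4, k5]
  linear_combination ((c x - d x) * ev f x - c x * ev f (s x) + d x * ev f (r x)) * (-hrel + h1)

lemma commute_of_values (hGs : ∀ x ∈ G, s x ∈ G) (hGr : ∀ x ∈ G, r x ∈ G)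
    (hsr : ∀ x, s (r x) = r (s x))
    (hS : ∀ f, ∀ x ∈ G, ev (S f) x = t * ev f x + c x * (ev f (s x) - ev f x))
    (hR : ∀ f, ∀ x ∈ G, ev (R f) x = t' * ev f x + d x * (ev f (r x) - ev f x))
    (hcr : ∀ x ∈ G, c (r x) = c x) (hds : ∀ x ∈ G, d (s x) = d x)
    (f : V) {x : Ω} (hx : x ∈ G) : ev (S (R f)) x = ev (R (S f)) x := by
  have g1 := hGs x hx
  have g2 := hGr x hx
  simp only [hS, hR, hx, g1, g2, hcr x hx, hds x hx, hsr x]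
  ring

lemma quadratic_of_values (hGs : ∀ x ∈ G, s x ∈ G) (hs : ∀ x, s (s x) = x) (ht : t ≠ 0)
    (hS : ∀ f, ∀ x ∈ G, ev (S f) x = t * ev f x + c x * (ev f (s x) - ev f x))
    (hcs : ∀ x ∈ G, c (s x) = t + t⁻¹ - c x)
    (f : V) {x : Ω} (hx : x ∈ G) : ev (S (S f)) x = (t - t⁻¹) * ev (S f) x + ev f x := by
  have g1 := hGs x hx
  have h1 : t * t⁻¹ = 1 := mul_inv_cancel₀ ht
  simp only [hS, hx, g1, hcs x hx, hs x]
  linear_combination (ev f x) * h1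

end RankTwoBraid

/-! ### Rational coefficient functions and their rank-two identities. -/

/-- The value of `t⁻¹ v` for a root `β` with `x^{β/2} = W`, where the numerator of `v` is
`1 - e W - t² W²`. -/
def cHalf (t e W : ℂ) : ℂ := t⁻¹ * (1 - e * W - t ^ 2 * W ^ 2) / (1 - W ^ 2)

/-- The value of `t⁻¹ v` for a root `β` with `x^β = X`, where `v = (1 - t² X) / (1 - X)`. -/
def cFull (t X : ℂ) : ℂ := t⁻¹ * (1 - t ^ 2 * X) / (1 - X)

lemma cHalf_inv {t e W : ℂ} (ht : t ≠ 0) (hW : W ≠ 0) (h : W ^ 2 ≠ 1) :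
    cHalf t e W⁻¹ = t + t⁻¹ - cHalf t e W := by
  have h1 : 1 - W ^ 2 ≠ 0 := sub_ne_zero.2 h.symm
  have h2 : W ^ 2 - 1 ≠ 0 := sub_ne_zero.2 h
  have h3 : 1 - W⁻¹ ^ 2 = (W ^ 2 - 1) / W ^ 2 := by field_simp
  rw [cHalf, cHalf, h3]
  have h4 : 1 - W ^ 2 = - (W ^ 2 - 1) := by ring
  rw [h4]
  field_simp
  ring

lemma cFull_inv {t X : ℂ} (ht : t ≠ 0) (hX : X ≠ 0) (h : X ≠ 1) :
    cFull t X⁻¹ = t + t⁻¹ - cFull t X := by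
  have h2 : X - 1 ≠ 0 := sub_ne_zero.2 h
  have h3 : 1 - X⁻¹ = (X - 1) / X := by field_simp
  rw [cFull, cFull, h3]
  have h4 : 1 - X = - (X - 1) := by ring
  rw [h4]
  field_simp
  ring

/-- The identity required by `braid_four_of_values`. The four positive roots of the rank-two system
have values X, XW², and squares of W, XW. -/
lemma cFull_cHalf_rel {t t' e X W : ℂ} (ht : t ≠ 0) (ht' : t' ≠ 0)
    (h1 : X ≠ 1) (h2 : X * W ^ 2 ≠ 1) (h3 : W ^ 2 ≠ 1) (h4 : (X * W) ^ 2 ≠ 1) :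
    cFull t X * (cHalf t' e W - cHalf t' e (X * W)) + (t + t⁻¹) * cHalf t' e (X * W) -
      (t⁻¹ * t' + t * t'⁻¹) + (t' + t'⁻¹) * cFull t (X * W ^ 2) -
      cFull t (X * W ^ 2) * (cHalf t' e W + cHalf t' e (X * W)) = 0 := by
  have h1 : 1 - X ≠ 0 := sub_ne_zero.2 h1.symm
  have h2 : 1 - X * W ^ 2 ≠ 0 := sub_ne_zero.2 h2.symm
  have h3 : 1 - W ^ 2 ≠ 0 := sub_ne_zero.2 h3.symm
  have h4 : 1 - (X * W) ^ 2 ≠ 0 := sub_ne_zero.2 h4.symm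
  have h4' : 1 - X ^ 2 * W ^ 2 ≠ 0 := by rwa [← mul_pow]
  simp only [cFull, cHalf]
  field_simp
  ring

lemma cFull_rel {t X Z : ℂ} (ht : t ≠ 0) (h1 : X ≠ 1) (h2 : Z ≠ 1) (h3 : X * Z ≠ 1) :
    cFull t X * cFull t Z - cFull t (X * Z) * (cFull t X + cFull t Z) +
      (t + t⁻¹) * cFull t (X * Z) - 1 = 0 := by
  have h1 : 1 - X ≠ 0 := sub_ne_zero.2 h1.symm
  have h2 : 1 - Z ≠ 0 := sub_ne_zero.2 h2.symm
  have h3 : 1 - X * Z ≠ 0 := sub_ne_zero.2 h3.symm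
  simp only [cFull]
  field_simp
  ring

/-! ### Points of the torus -/

section Points

variable {n : ℕ} [hn : Fact (2 ≤ n)] (p : Params)

/-- The character `g ↦ y^g` of `Λ ⊕ ℤδ`, with `y^δ = q`. -/
def chr (y : Fin n → ℂˣ) (g : AffWeight n) : ℂˣ := (∏ j, y j ^ g.1 j) * p.q ^ g.2

lemma chr_add (y : Fin n → ℂˣ) (g h : AffWeight n) : chr p y (g + h) = chr p y g * chr p y h := by
  simp only [chr, Prod.fst_add, Pi.add_apply, zpow_add, Finset.prod_mul_distrib, Prod.snd_add]
  ac_rfl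

/-- `chr` as an additive homomorphism. -/
def chrHom (y : Fin n → ℂˣ) : AffWeight n →+ Additive ℂˣ :=
  AddMonoidHom.mk' (fun g => Additive.ofMul (chr p y g)) fun g h => by rw [chr_add]; rfl

lemma chr_neg (y : Fin n → ℂˣ) (g : AffWeight n) : chr p y (-g) = (chr p y g)⁻¹ :=
  (chrHom p y).map_neg g

lemma chr_sub (y : Fin n → ℂˣ) (g h : AffWeight n) : chr p y (g - h) = chr p y g / chr p y h :=
  (chrHom p y).map_sub g h

lemma chr_zsmul (y : Fin n → ℂˣ) (k : ℤ) (g : AffWeight n) :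
    chr p y (k • g) = chr p y g ^ k :=
  (chrHom p y).map_zsmul k g

lemma chr_affD (y : Fin n → ℂˣ) : chr p y (affD n) = p.q := by simp [chr, affD]

lemma chr_single (y : Fin n → ℂˣ) (j : Fin n) : chr p y (Pi.single j 1, 0) = y j := by
  rw [chr, Finset.prod_eq_single j] <;> simp +contextual

/-- The action of `s_i` on points. -/
def refPt (i : Fin (n + 1)) (y : Fin n → ℂˣ) : Fin n → ℂˣ :=
  fun j => chr p y (sRefl i (Pi.single j 1, 0))

/-- Points of the torus are the characters of Λ ⊕ ℤδ with value q at δ. Since s_i fixes δ, the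
pulled-back character is again of this kind and is determined by its values at the ε_j. -/
lemma chr_refPt (i : Fin (n + 1)) (y : Fin n → ℂˣ) (g : AffWeight n) :
    chr p (refPt p i y) g = chr p y (sRefl i g) := by
  have h : ∀ z : Fin n → ℂˣ, ∀ F : AffWeight n →+ Additive ℂˣ, F (affD n) = Additive.ofMul p.q →
      (∀ j : Fin n, F (Pi.single j 1, 0) = Additive.ofMul (z j)) →
      F g = Additive.ofMul (chr p z g) := by
    intro z F h0 h1
    have : F g = chrHom p z g := by
      rw [affWeight_eq_sum g]
      simp only [map_add, map_sum, map_zsmul, h0]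
      congr 1
      · refine Finset.sum_congr rfl fun j _ => ?_
        rw [affE_eq j.2, h1, chrHom, AddMonoidHom.mk'_apply, chr_single]
      · rw [chrHom, AddMonoidHom.mk'_apply, chr_affD]
    exact this
  refine (congrArg Additive.toMul (h (refPt p i y)
    ((chrHom p y).comp (sRefl i : AffWeight n →+ AffWeight n)) ?_ fun j => rfl)).symm
  change chrHom p y (sRefl i (affD n)) = _
  rw [sRefl_affD]
  exact congrArg Additive.ofMul (chr_affD p y)

lemma point_ext {y z : Fin n → ℂˣ} (h : ∀ g, chr p y g = chr p z g) : y = z := by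
  ext1 j
  rw [← chr_single p y, h, chr_single]

lemma refPt_refPt (i : Fin (n + 1)) (y : Fin n → ℂˣ) : refPt p i (refPt p i y) = y := by
  refine point_ext p fun g => ?_
  rw [chr_refPt, chr_refPt, ← LinearEquiv.mul_apply, sRefl_mul_self]
  rfl

end Points

end

section

/-! ### Laurent polynomials and their values -/

section Values

variable {n : ℕ} [hn : Fact (2 ≤ n)] (p : Params)

/-- The linear map on Laurent polynomials with prescribed values at the monomials. -/
def monoLin {M : Type*} [AddCommGroup M] [Module ℂ M] (F : Weight n → M) : Laurent n →ₗ[ℂ] M :=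
  (Finsupp.linearCombination ℂ F) ∘ₗ (AddMonoidAlgebra.coeffLinearEquiv ℂ).toLinearMap

lemma monoLin_single {M : Type*} [AddCommGroup M] [Module ℂ M] (F : Weight n → M) (v : Weight n)
    (a : ℂ) : monoLin F (AddMonoidAlgebra.single v a) = a • F v := by
  rw [monoLin, LinearMap.comp_apply]
  exact Finsupp.linearCombination_single ℂ a v

lemma laurent_hom_ext {M : Type*} [AddCommGroup M] [Module ℂ M] {φ ψ : Laurent n →ₗ[ℂ] M}
    (h : ∀ v, φ (AddMonoidAlgebra.single v 1) = ψ (AddMonoidAlgebra.single v 1)) : φ = ψ :=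
  (AddMonoidAlgebra.basis (Weight n) ℂ).ext h

lemma affMonomial_add (g h : AffWeight n) :
    affMonomial p (g + h) = affMonomial p g * affMonomial p h := by
  rw [affMonomial, affMonomial, affMonomial, AddMonoidAlgebra.single_mul_single, Prod.snd_add,
    zpow_add, Units.val_mul, Prod.fst_add]

lemma affMonomial_eq_smul (g : AffWeight n) :
    affMonomial p g = ((p.q ^ g.2 : ℂˣ) : ℂ) • AddMonoidAlgebra.single g.1 1 := by
  rw [affMonomial, AddMonoidAlgebra.smul_single, smul_eq_mul, mul_one]

lemma affMonomial_fst (v : Weight n) : affMonomial p (v, 0) = AddMonoidAlgebra.single v 1 := by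
  simp [affMonomial]

/-- Evaluation at a point of the torus, as a homomorphism of algebras. -/
def evalA (y : Fin n → ℂˣ) : Laurent n →ₐ[ℂ] ℂ :=
  AddMonoidAlgebra.lift ℂ ℂ (Weight n)
    { toFun := fun v => ((∏ j, y j ^ (v.toAdd j) : ℂˣ) : ℂ)
      map_one' := by simp
      map_mul' := fun v w => by
        simp only [toAdd_mul, Pi.add_apply, zpow_add, Finset.prod_mul_distrib, Units.val_mul] }

lemma evalA_single (y : Fin n → ℂˣ) (v : Weight n) (a : ℂ) :
    evalA y (AddMonoidAlgebra.single v a) = a * ((∏ j, y j ^ v j : ℂˣ) : ℂ) := by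
  rw [evalA, AddMonoidAlgebra.lift_single, smul_eq_mul]; rfl

lemma evalA_eq (y : Fin n → ℂˣ) (f : Laurent n) : evalA y f = evalAt y f := by
  rw [evalA, AddMonoidAlgebra.lift_apply]; rfl

lemma evalA_affMonomial (y : Fin n → ℂˣ) (g : AffWeight n) :
    evalA y (affMonomial p g) = (chr p y g : ℂ) := by
  rw [affMonomial, evalA_single, chr, Units.val_mul, mul_comm]

/-- Different weights give different characters of the torus, as evaluation at 2 in one coordinate
shows, and different characters are linearly independent. -/
lemma eq_zero_of_evalA {f : Laurent n} (h : ∀ y, evalA y f = 0) : f = 0 := by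
  let Φ : Weight n → ((Fin n → ℂˣ) →* ℂ) := fun v =>
    { toFun := fun y => ((∏ j, y j ^ v j : ℂˣ) : ℂ)
      map_one' := by simp
      map_mul' := fun y z => by
        simp only [Pi.mul_apply, mul_zpow, Finset.prod_mul_distrib, Units.val_mul] }
  have hΦ : Function.Injective Φ := by
    intro v w hvw
    ext j
    have h2 : (2 : ℂ) ≠ 0 := two_ne_zero
    have := DFunLike.congr_fun hvw (Pi.mulSingle j (Units.mk0 2 h2))
    simp only [Φ, MonoidHom.coe_mk, OneHom.coe_mk, Units.val_inj] at this
    rw [Finset.prod_eq_single j, Finset.prod_eq_single j] at this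
    · simp only [Pi.mulSingle_eq_same, Units.ext_iff, Units.val_zpow_eq_zpow_val,
        Units.val_mk0] at this
      -- Injectivity of the integer powers of 2 is taken from the ordered field ℝ.
      have h3 : ((2 : ℝ) : ℂ) ^ v j = ((2 : ℝ) : ℂ) ^ w j := by
        rw [Complex.ofReal_ofNat]; exact this
      rw [← Complex.ofReal_zpow, ← Complex.ofReal_zpow, Complex.ofReal_inj] at h3
      exact zpow_right_injective₀ (by norm_num) (by norm_num) h3
    all_goals simp +contextual
  have hli := (linearIndependent_monoidHom (Fin n → ℂˣ) ℂ).comp Φ hΦ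
  have := (linearIndependent_iff.1 hli) f.coeff (by
    ext y
    have := h y
    rw [evalA_eq, evalAt] at this
    simpa [Finsupp.linearCombination_apply, Finsupp.sum, Φ] using this)
  exact AddMonoidAlgebra.coeff_injective this

lemma one_sub_affMonomial_ne_zero {g : AffWeight n} (hg : g.1 ≠ 0) : 1 - affMonomial p g ≠ 0 := by
  intro h
  have := congrArg (fun f : Laurent n => f.coeff g.1) h
  rw [AddMonoidAlgebra.one_def] at this
  simp only [affMonomial, AddMonoidAlgebra.coeff_sub, AddMonoidAlgebra.coeff_single,
    Finsupp.coe_sub, Pi.sub_apply, Finsupp.single_eq_same, Finsupp.single_eq_of_ne hg,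
    AddMonoidAlgebra.coeff_zero, Finsupp.coe_zero, Pi.zero_apply, zero_sub] at this
  exact Units.ne_zero _ (neg_eq_zero.1 this)

/-- Multiplying f by ∏ (1 - x^g) makes it vanish at the excluded points too, and Laurent polynomials
form a domain. Operator identities may therefore be checked away from finitely many root
hypersurfaces. -/
lemma eq_zero_of_evalA_off {f : Laurent n} (Γ : Finset (AffWeight n)) (hΓ : ∀ g ∈ Γ, g.1 ≠ 0)
    (h : ∀ y, (∀ g ∈ Γ, chr p y g ≠ 1) → evalA y f = 0) : f = 0 := by
  have h1 : f * ∏ g ∈ Γ, (1 - affMonomial p g) = 0 := by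
    refine eq_zero_of_evalA fun y => ?_
    by_cases hy : ∀ g ∈ Γ, chr p y g ≠ 1
    · rw [map_mul, h y hy, zero_mul]
    · push Not at hy
      obtain ⟨g, hg, e⟩ := hy
      rw [map_mul, map_prod, Finset.prod_eq_zero hg, mul_zero]
      rw [map_sub, map_one, evalA_affMonomial, e, Units.val_one, sub_self]
  exact (mul_eq_zero.1 h1).resolve_right
    (Finset.prod_ne_zero_iff.2 fun g hg => one_sub_affMonomial_ne_zero p (hΓ g hg))

lemma eq_of_evalA_off {f g : Laurent n} (Γ : Finset (AffWeight n)) (hΓ : ∀ g ∈ Γ, g.1 ≠ 0)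
    (h : ∀ y, (∀ g ∈ Γ, chr p y g ≠ 1) → evalA y f = evalA y g) : f = g :=
  sub_eq_zero.1 <| eq_zero_of_evalA_off p Γ hΓ fun y hy => by rw [map_sub, h y hy, sub_self]

lemma reflAct_affMonomial (i : Fin (n + 1)) (g : AffWeight n) :
    reflAct p i (affMonomial p g) = affMonomial p (sRefl i g) := by
  have h : sRefl i g = sRefl i (g.1, 0) + g.2 • affD n := by
    conv_lhs => rw [show g = (g.1, 0) + g.2 • affD n by ext <;> simp [affD]]
    rw [map_add, map_zsmul, sRefl_affD]
  have h2 : affMonomial p (g.2 • affD n) = ((p.q ^ g.2 : ℂˣ) : ℂ) • (1 : Laurent n) := by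
    rw [affMonomial_eq_smul]; simp [affD, AddMonoidAlgebra.one_def]
  rw [h, affMonomial_add, h2, mul_smul_comm, mul_one, affMonomial]
  exact monoLin_single _ _ _

lemma evalA_reflAct (i : Fin (n + 1)) (y : Fin n → ℂˣ) (f : Laurent n) :
    evalA y (reflAct p i f) = evalA (refPt p i y) f := by
  have : (evalA y).toLinearMap ∘ₗ reflAct p i = (evalA (refPt p i y)).toLinearMap := by
    refine laurent_hom_ext fun v => ?_
    rw [← affMonomial_fst p, LinearMap.comp_apply, reflAct_affMonomial]
    simp only [AlgHom.toLinearMap_apply]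
    rw [evalA_affMonomial, evalA_affMonomial, chr_refPt]
  exact LinearMap.congr_fun this f

end Values

/-! ### Divided differences and the operators of the Noumi representation -/

section Operators

variable {n : ℕ} [hn : Fact (2 ≤ n)] (p : Params)

lemma simpleRoot_fst_ne_zero (i : Fin (n + 1)) : (simpleRoot n i).1 ≠ 0 := by
  obtain ⟨_, _, _, _, _, h⟩ := isRt_simpleRoot i
  exact h

/-- The divided difference of `x^g`. -/
def divMono (i : Fin (n + 1)) (g : AffWeight n) : Laurent n :=
  if 0 ≤ pairing (simpleCoroot n i) g then
    ∑ k ∈ Finset.range (pairing (simpleCoroot n i) g).toNat,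
      affMonomial p (sRefl i g + k • simpleRoot n i)
  else -∑ k ∈ Finset.range (-pairing (simpleCoroot n i) g).toNat,
      affMonomial p (g + k • simpleRoot n i)

lemma one_sub_mul_sum (g a : AffWeight n) (m : ℕ) :
    (1 - affMonomial p a) * ∑ k ∈ Finset.range m, affMonomial p (g + k • a) =
      affMonomial p g - affMonomial p (g + m • a) := by
  induction m with
  | zero => simp
  | succ m ih =>
    rw [Finset.sum_range_succ, mul_add, ih, sub_mul, one_mul, ← affMonomial_add, succ_nsmul,
      add_comm a, ← add_assoc]
    abel

/-- A telescoping geometric sum along the a_i-string, which starts at s_i g or at g according to the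
sign of ⟨g, a_i^∨⟩. -/
lemma one_sub_mul_divMono (i : Fin (n + 1)) (g : AffWeight n) :
    (1 - affMonomial p (simpleRoot n i)) * divMono p i g =
      affMonomial p (sRefl i g) - affMonomial p g := by
  rw [divMono]
  split_ifs with h
  · rw [one_sub_mul_sum, sRefl_apply, ← natCast_zsmul, Int.toNat_of_nonneg h, sub_add_cancel]
  · rw [mul_neg, one_sub_mul_sum, sRefl_apply, ← natCast_zsmul, Int.toNat_of_nonneg (by omega),
      neg_smul, ← sub_eq_add_neg]
    abel

/-- The divided difference `f ↦ (s_i f - f) / (1 - x^{a_i})`. -/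
def divDiff (i : Fin (n + 1)) : Laurent n →ₗ[ℂ] Laurent n := monoLin fun v => divMono p i (v, 0)

lemma one_sub_mul_divDiff (i : Fin (n + 1)) (f : Laurent n) :
    (1 - affMonomial p (simpleRoot n i)) * divDiff p i f = reflAct p i f - f := by
  have : LinearMap.mulLeft ℂ (1 - affMonomial p (simpleRoot n i)) ∘ₗ divDiff p i =
      reflAct p i - LinearMap.id := by
    refine laurent_hom_ext fun v => ?_
    rw [LinearMap.comp_apply, divDiff, monoLin_single, one_smul, LinearMap.mulLeft_apply,
      one_sub_mul_divMono, LinearMap.sub_apply, LinearMap.id_apply, ← affMonomial_fst p,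
      reflAct_affMonomial]
  exact LinearMap.congr_fun this f

lemma divDiff_affMonomial (i : Fin (n + 1)) (g : AffWeight n) :
    divDiff p i (affMonomial p g) = divMono p i g := by
  refine mul_left_cancel₀ (one_sub_affMonomial_ne_zero p (simpleRoot_fst_ne_zero i)) ?_
  rw [one_sub_mul_divDiff, reflAct_affMonomial, one_sub_mul_divMono]

/-- The operator by which `T_i` acts in the Noumi representation. -/
def noumiOp (i : Fin (n + 1)) : Module.End ℂ (Laurent n) :=
  (p.tRoot n i : ℂ) • 1 +
    (p.tRoot n i : ℂ)⁻¹ • (LinearMap.mulLeft ℂ (vNum n p i) ∘ₗ divDiff p i)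

lemma noumiOp_apply (i : Fin (n + 1)) (f : Laurent n) :
    noumiOp p i f = (p.tRoot n i : ℂ) • f + (p.tRoot n i : ℂ)⁻¹ • (vNum n p i * divDiff p i f) :=
  rfl

lemma one_sub_smul_noumiOp (i : Fin (n + 1)) (f : Laurent n) :
    (1 - affMonomial p (simpleRoot n i)) * noumiOp p i f =
      (p.tRoot n i : ℂ) • ((1 - affMonomial p (simpleRoot n i)) * f) +
        (p.tRoot n i : ℂ)⁻¹ • (vNum n p i * (reflAct p i f - f)) := by
  rw [noumiOp_apply, mul_add, ← one_sub_mul_divDiff, mul_smul_comm, mul_smul_comm, mul_left_comm]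

/-- The coefficient of `s_i - 1` in `π(T_i)`, at a point. -/
def cVal (i : Fin (n + 1)) (y : Fin n → ℂˣ) : ℂ :=
  (p.tRoot n i : ℂ)⁻¹ * evalA y (vNum n p i) / (1 - (chr p y (simpleRoot n i) : ℂ))

lemma evalA_noumiOp (i : Fin (n + 1)) (f : Laurent n) {y : Fin n → ℂˣ}
    (hy : chr p y (simpleRoot n i) ≠ 1) :
    evalA y (noumiOp p i f) = (p.tRoot n i : ℂ) * evalA y f +
      cVal p i y * (evalA (refPt p i y) f - evalA y f) := by
  have h0 : 1 - (chr p y (simpleRoot n i) : ℂ) ≠ 0 := by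
    intro h
    exact hy (Units.ext (sub_eq_zero.1 h).symm)
  have := congrArg (evalA y) (one_sub_smul_noumiOp p i f)
  simp only [map_mul, map_add, map_sub, map_smul, evalA_reflAct, evalA_affMonomial, map_one,
    smul_eq_mul] at this
  refine mul_left_cancel₀ h0 ?_
  rw [this, cVal]
  field_simp

lemma cVal_mid {k : ℕ} (hk : k + 1 < n) (y : Fin n → ℂˣ) :
    cVal p (idx n (k + 1)) y = cFull p.t (chr p y (affE n k - affE n (k + 1))) := by
  have h1 : ((idx n (k + 1) : Fin (n + 1)) : ℕ) = k + 1 := val_idx hk.le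
  rw [cVal, vNum, Params.tRoot, h1, if_neg (by omega), if_pos hk, if_neg (by omega), if_pos hk,
    cFull, map_sub, map_smul, map_one, evalA_affMonomial, root_idx_mid hk, smul_eq_mul]

/-- (1 - t t^∨ W)(1 + t (t^∨)⁻¹ W) = 1 - e W - t² W² with e = t (t^∨ - (t^∨)⁻¹). The dual parameter
enters only through e, which the braid identities treat as arbitrary. -/
lemma cVal_last (y : Fin n → ℂˣ) :
    cVal p (idx n n) y = cHalf p.tn (p.tn * (p.tnv - (p.tnv : ℂ)⁻¹)) (chr p y (affE n (n - 1))) := by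
  have h2 := hn.out
  have h1 : ((idx n n : Fin (n + 1)) : ℕ) = n := val_idx le_rfl
  have h3 : eps n n = eps n (n - 1 + 1) := by rw [Nat.sub_add_cancel (by omega)]
  have h4 : ∀ a : ℂ, AddMonoidAlgebra.single (eps n n) a = a • affMonomial p (affE n (n - 1)) := by
    intro a
    rw [h3, affE, affMonomial_fst, AddMonoidAlgebra.smul_single, smul_eq_mul, mul_one]
  rw [cVal, vNum, Params.tRoot, h1, if_neg (by omega), if_neg (by omega), if_neg (by omega),
    if_neg (by omega), root_idx_last, chr_zsmul, h4, h4]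
  simp only [map_mul, map_sub, map_add, map_one, map_smul, smul_eq_mul, evalA_affMonomial, cHalf]
  push_cast
  rw [zpow_ofNat]
  have := p.tnv.ne_zero
  congr 2
  field_simp
  ring

/-- `q^{1/2} y_1⁻¹`, the square root of the value of `a_0`. -/
def halfZero (y : Fin n → ℂˣ) : ℂˣ := p.q12 * (chr p y (affE n 0))⁻¹

lemma halfZero_sq (y : Fin n → ℂˣ) : halfZero p y ^ 2 = chr p y (simpleRoot n 0) := by
  rw [root_idx_zero, chr_sub, chr_zsmul, chr_affD, halfZero, Params.q, mul_pow, inv_pow,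
    zpow_ofNat, div_eq_mul_inv]

lemma cVal_zero (y : Fin n → ℂˣ) :
    cVal p 0 y = cHalf p.t0 (p.t0 * (p.t0v - (p.t0v : ℂ)⁻¹)) (halfZero p y) := by
  have h4 : ∀ a : ℂ, AddMonoidAlgebra.single (-eps n 1) a = a • affMonomial p (-affE n 0) := by
    intro a
    rw [affE, show -((eps n (0 + 1), 0) : AffWeight n) = (-eps n 1, 0) by ext <;> simp,
      affMonomial_fst, AddMonoidAlgebra.smul_single, smul_eq_mul, mul_one]
  rw [cVal, vNum, Params.tRoot, ← halfZero_sq, Fin.val_zero, if_pos rfl, if_pos rfl, h4, h4]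
  simp only [map_mul, map_sub, map_add, map_one, map_smul, smul_eq_mul, evalA_affMonomial, cHalf,
    chr_neg, halfZero]
  push_cast
  have := p.t0v.ne_zero
  congr 2
  field_simp
  ring

end Operators

end

section

/-! ### The Noumi representation -/

section Noumi

variable {n : ℕ} [hn : Fact (2 ≤ n)] (p : Params)

lemma val_ne_one {a : ℂˣ} (h : a ≠ 1) : (a : ℂ) ≠ 1 := fun h' => h (Units.ext h')

lemma tRoot_mid {k : ℕ} (hk : k + 1 < n) : p.tRoot n (idx n (k + 1)) = p.t := by
  have h1 : ((idx n (k + 1) : Fin (n + 1)) : ℕ) = k + 1 := val_idx hk.le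
  rw [Params.tRoot, h1, if_neg (by omega), if_pos hk]

lemma tRoot_zero : p.tRoot n 0 = p.t0 := by
  rw [Params.tRoot, Fin.val_zero, if_pos rfl]

lemma tRoot_last : p.tRoot n (idx n n) = p.tn := by
  have h1 : ((idx n n : Fin (n + 1)) : ℕ) = n := val_idx le_rfl
  have h2 := hn.out
  rw [Params.tRoot, h1, if_neg (by omega), if_neg (by omega)]

lemma halfZero_refPt (y : Fin n → ℂˣ) : halfZero p (refPt p 0 y) = (halfZero p y)⁻¹ := by
  have h2 := hn.out
  rw [halfZero, halfZero, chr_refPt, sRefl_zero_affE (by omega), if_pos rfl, chr_sub, chr_affD,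
    Params.q, mul_inv, inv_inv, inv_div, sq, div_eq_mul_inv, mul_inv]
  rw [mul_comm (chr p y (affE n 0)), ← mul_assoc, mul_inv_cancel_left]

lemma cVal_refPt (i : Fin (n + 1)) {y : Fin n → ℂˣ} (hy : chr p y (simpleRoot n i) ≠ 1) :
    cVal p i (refPt p i y) = p.tRoot n i + (p.tRoot n i : ℂ)⁻¹ - cVal p i y := by
  have h2 := hn.out
  rcases index_cases i with rfl | ⟨k, hk, rfl⟩ | rfl
  · rw [cVal_zero, cVal_zero, halfZero_refPt, Units.val_inv_eq_inv_val, tRoot_zero,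
      cHalf_inv p.t0.ne_zero (Units.ne_zero _)]
    rw [← halfZero_sq] at hy
    exact fun h => hy (Units.ext (by simpa using h))
  · rw [← idx_eq hk.le] at hy ⊢
    rw [root_idx_mid hk] at hy
    rw [cVal_mid p hk, cVal_mid p hk, tRoot_mid p hk, chr_refPt, map_sub,
      sRefl_mid_affE hk (by omega), sRefl_mid_affE hk hk, if_pos rfl, if_neg (by omega),
      if_pos rfl, ← neg_sub, chr_neg, Units.val_inv_eq_inv_val,
      cFull_inv p.t.ne_zero (Units.ne_zero _)]
    exact fun h => hy (Units.ext (by simpa using h))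
  · rw [← idx_last] at hy ⊢
    rw [root_idx_last, chr_zsmul] at hy
    rw [cVal_last, cVal_last, tRoot_last, chr_refPt, sRefl_last_affE (by omega), if_pos rfl,
      chr_neg, Units.val_inv_eq_inv_val, cHalf_inv p.tn.ne_zero (Units.ne_zero _)]
    exact fun h => hy (Units.ext (by simpa using h))

lemma chr_refPt_self_ne (i : Fin (n + 1)) {y : Fin n → ℂˣ} (hy : chr p y (simpleRoot n i) ≠ 1) :
    chr p (refPt p i y) (simpleRoot n i) ≠ 1 := by
  rw [chr_refPt, sRefl_root, chr_neg]
  simpa using hy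

lemma noumiOp_quadratic (i : Fin (n + 1)) :
    noumiOp p i * noumiOp p i = ((p.tRoot n i : ℂ) - (p.tRoot n i : ℂ)⁻¹) • noumiOp p i + 1 := by
  refine LinearMap.ext fun f => ?_
  refine eq_of_evalA_off p {simpleRoot n i} (by simpa using simpleRoot_fst_ne_zero i) fun y hy => ?_
  rw [LinearMap.add_apply, LinearMap.smul_apply, map_add, map_smul, smul_eq_mul]
  exact quadratic_of_values (G := {y | chr p y (simpleRoot n i) ≠ 1}) (S := noumiOp p i)
    (ev := fun f y => evalA y f)
    (fun y hy => chr_refPt_self_ne p i hy) (refPt_refPt p i) (Units.ne_zero _)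
    (fun f y hy => evalA_noumiOp p i f hy) (fun y hy => cVal_refPt p i hy) f (x := y)
    (by simpa using hy)

/-- X and W stand for x^{a_i} and x^{a_j/2}, with j an end node of the diagram and i its neighbour.
In this abstract form one proof serves both ends, although the half roots look different there. -/
lemma noumiOp_braid_four {i j : Fin (n + 1)}
    (hij : sRefl i * sRefl j * sRefl i * sRefl j = (sRefl j * sRefl i * sRefl j * sRefl i :
      AffWeight n ≃ₗ[ℤ] AffWeight n))
    {X W : (Fin n → ℂˣ) → ℂˣ} (hX : ∀ y, chr p y (simpleRoot n i) = X y)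
    (hW : ∀ y, chr p y (simpleRoot n j) = W y ^ 2)
    (hXi : ∀ y, X (refPt p i y) = (X y)⁻¹) (hWi : ∀ y, W (refPt p i y) = X y * W y)
    (hXj : ∀ y, X (refPt p j y) = X y * W y ^ 2) (hWj : ∀ y, W (refPt p j y) = (W y)⁻¹)
    (h0 : (simpleRoot n i + simpleRoot n j).1 ≠ 0)
    (h1 : ((2 : ℤ) • simpleRoot n i + simpleRoot n j).1 ≠ 0) {e : ℂ}
    (hc : ∀ y, cVal p i y = cFull (p.tRoot n i) (X y))
    (hd : ∀ y, cVal p j y = cHalf (p.tRoot n j) e (W y)) :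
    noumiOp p i * noumiOp p j * noumiOp p i * noumiOp p j =
      noumiOp p j * noumiOp p i * noumiOp p j * noumiOp p i := by
  refine LinearMap.ext fun f => ?_
  refine eq_of_evalA_off p {simpleRoot n i, simpleRoot n j, simpleRoot n i + simpleRoot n j,
    (2 : ℤ) • simpleRoot n i + simpleRoot n j} ?_ fun y hy => ?_
  · simp only [Finset.mem_insert, Finset.mem_singleton]
    rintro g (rfl | rfl | rfl | rfl)
    exacts [simpleRoot_fst_ne_zero i, simpleRoot_fst_ne_zero j, h0, h1]
  refine braid_four_of_values (G := {y | X y ≠ 1 ∧ X y * W y ^ 2 ≠ 1 ∧ W y ^ 2 ≠ 1 ∧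
    (X y * W y) ^ 2 ≠ 1}) (S := noumiOp p i) (R := noumiOp p j) (ev := fun f y => evalA y f)
    (s := refPt p i) (r := refPt p j) (t := p.tRoot n i) (t' := p.tRoot n j)
    (c := cVal p i) (d := cVal p j)
    ?_ ?_ (refPt_refPt p i) (refPt_refPt p j) ?_ ?_ ?_ ?_ ?_ ?_ ?_ ?_ f (x := y) ?_
  · rintro y ⟨a, b, c, d⟩
    refine ⟨?_, ?_, ?_, ?_⟩
    · rw [hXi]; simpa using a
    · rw [hXi, hWi, show (X y)⁻¹ * (X y * W y) ^ 2 = X y * W y ^ 2 by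
        rw [mul_pow, sq (X y)]; simp [mul_assoc]]
      exact b
    · rw [hWi]; exact d
    · rw [hXi, hWi, inv_mul_cancel_left]; exact c
  · rintro y ⟨a, b, c, d⟩
    refine ⟨?_, ?_, ?_, ?_⟩
    · rw [hXj]; exact b
    · rw [hWj, hXj, inv_pow, mul_inv_cancel_right]; exact a
    · rw [hWj, inv_pow]; simpa using c
    · rw [hWj, hXj, sq (W y), ← mul_assoc, mul_inv_cancel_right]; exact d
  · intro y
    refine point_ext p fun g => ?_
    simp only [chr_refPt]
    exact congrArg _ (LinearEquiv.congr_fun hij.symm g)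
  · rintro f y ⟨a, -⟩
    exact evalA_noumiOp p i f (by rwa [hX])
  · rintro f y ⟨-, -, a, -⟩
    exact evalA_noumiOp p j f (by rwa [hW])
  · rintro y ⟨a, -⟩
    exact cVal_refPt p i (by rwa [hX])
  · rintro y ⟨-, -, a, -⟩
    exact cVal_refPt p j (by rwa [hW])
  · rintro y -
    rw [hc, hc, hXj, hXj, hXi, hWi]
    congr 2
    rw [mul_pow, sq (X y)]; simp [mul_assoc]
  · rintro y -
    rw [hd, hd, hWi, hWi, hXj, hWj]
    congr 2
    rw [sq, ← mul_assoc, mul_inv_cancel_right]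
  · rintro y ⟨a, b, c, d⟩
    rw [hc, hc, hd, hd, hXj, hWi]
    push_cast
    refine cFull_cHalf_rel (Units.ne_zero _) (Units.ne_zero _) ?_ ?_ ?_ ?_
    · exact val_ne_one a
    · have := val_ne_one b; push_cast at this; exact this
    · have := val_ne_one c; push_cast at this; exact this
    · have := val_ne_one d; push_cast at this; exact this
  · simp only [Finset.mem_insert, Finset.mem_singleton, forall_eq_or_imp, forall_eq, hX, hW,
      chr_add, chr_zsmul] at hy
    obtain ⟨a, b, c, d⟩ := hy
    refine ⟨a, c, b, ?_⟩
    rw [mul_pow]; exact d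

lemma noumiOp_braid_three {i j : Fin (n + 1)}
    (hij : sRefl i * sRefl j * sRefl i = (sRefl j * sRefl i * sRefl j :
      AffWeight n ≃ₗ[ℤ] AffWeight n))
    {X Z : (Fin n → ℂˣ) → ℂˣ} (hX : ∀ y, chr p y (simpleRoot n i) = X y)
    (hZ : ∀ y, chr p y (simpleRoot n j) = Z y)
    (hXi : ∀ y, X (refPt p i y) = (X y)⁻¹) (hZi : ∀ y, Z (refPt p i y) = X y * Z y)
    (hXj : ∀ y, X (refPt p j y) = X y * Z y) (hZj : ∀ y, Z (refPt p j y) = (Z y)⁻¹)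
    (h0 : (simpleRoot n i + simpleRoot n j).1 ≠ 0) (ht : p.tRoot n i = p.tRoot n j)
    (hc : ∀ y, cVal p i y = cFull (p.tRoot n i) (X y))
    (hd : ∀ y, cVal p j y = cFull (p.tRoot n i) (Z y)) :
    noumiOp p i * noumiOp p j * noumiOp p i = noumiOp p j * noumiOp p i * noumiOp p j := by
  refine LinearMap.ext fun f => ?_
  refine eq_of_evalA_off p {simpleRoot n i, simpleRoot n j, simpleRoot n i + simpleRoot n j} ?_
    fun y hy => ?_
  · simp only [Finset.mem_insert, Finset.mem_singleton]
    rintro g (rfl | rfl | rfl)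
    exacts [simpleRoot_fst_ne_zero i, simpleRoot_fst_ne_zero j, h0]
  refine braid_three_of_values (G := {y | X y ≠ 1 ∧ Z y ≠ 1 ∧ X y * Z y ≠ 1})
    (S := noumiOp p i) (R := noumiOp p j) (ev := fun f y => evalA y f)
    (s := refPt p i) (r := refPt p j) (t := p.tRoot n i) (c := cVal p i) (d := cVal p j)
    ?_ ?_ (refPt_refPt p i) (refPt_refPt p j) ?_ (Units.ne_zero _) ?_ ?_ ?_ ?_ ?_ ?_ ?_ ?_ f
    (x := y) ?_
  · rintro y ⟨a, b, c⟩
    refine ⟨?_, ?_, ?_⟩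
    · rw [hXi]; simpa using a
    · rw [hZi]; exact c
    · rw [hXi, hZi, inv_mul_cancel_left]; exact b
  · rintro y ⟨a, b, c⟩
    refine ⟨?_, ?_, ?_⟩
    · rw [hXj]; exact c
    · rw [hZj]; simpa using b
    · rw [hXj, hZj, mul_inv_cancel_right]; exact a
  · intro y
    refine point_ext p fun g => ?_
    simp only [chr_refPt]
    exact congrArg _ (LinearEquiv.congr_fun hij g)
  · rintro f y ⟨a, -⟩
    exact evalA_noumiOp p i f (by rwa [hX])
  · rintro f y ⟨-, a, -⟩
    rw [ht]
    exact evalA_noumiOp p j f (by rwa [hZ])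
  · rintro y ⟨a, -⟩
    exact cVal_refPt p i (by rwa [hX])
  · rintro y ⟨-, a, -⟩
    rw [ht]
    exact cVal_refPt p j (by rwa [hZ])
  · rintro y -
    rw [hc, hd, hXj, hZi]
  · rintro y -
    rw [hc, hd, hXj, hXi, hZi, inv_mul_cancel_left]
  · rintro y -
    rw [hc, hd, hZi, hXj, hZj, mul_inv_cancel_right]
  · rintro y ⟨a, b, c⟩
    rw [hc, hc, hd, hXj]
    push_cast
    refine cFull_rel (Units.ne_zero _) ?_ ?_ ?_
    · exact val_ne_one a
    · exact val_ne_one b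
    · have := val_ne_one c; push_cast at this; exact this
  · simp only [Finset.mem_insert, Finset.mem_singleton, forall_eq_or_imp, forall_eq, hX, hZ,
      chr_add] at hy
    exact hy

lemma sRefl_affE_of_ne {j : Fin (n + 1)} {m : ℕ} (hm : m < n) (h1 : (j : ℕ) ≠ m)
    (h2 : (j : ℕ) ≠ m + 1) : sRefl j (affE n m) = affE n m := by
  rcases index_cases j with rfl | ⟨k, hk, rfl⟩ | rfl
  · rw [sRefl_zero_affE hm, if_neg]
    exact fun h => h1 (by simp [h])
  · simp only at h1 h2
    rw [← idx_eq hk.le, sRefl_mid_affE hk hm, if_neg (by omega), if_neg (by omega)]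
  · simp only [Fin.val_last] at h1 h2
    rw [← idx_last, sRefl_last_affE hm, if_neg (by omega)]

lemma sRefl_root_of_far {i j : Fin (n + 1)} (h : (i : ℕ) + 2 ≤ j ∨ (j : ℕ) + 2 ≤ i) :
    sRefl j (simpleRoot n i) = simpleRoot n i := by
  have h2 := hn.out
  rcases index_cases i with rfl | ⟨k, hk, rfl⟩ | rfl
  · simp only [Fin.val_zero] at h
    rw [root_idx_zero, map_sub, map_zsmul, sRefl_affD, sRefl_affE_of_ne] <;> omega
  · simp only at h
    rw [← idx_eq hk.le, root_idx_mid hk, map_sub, sRefl_affE_of_ne, sRefl_affE_of_ne] <;> omega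
  · simp only [Fin.val_last] at h
    rw [← idx_last, root_idx_last, map_zsmul, sRefl_affE_of_ne] <;> omega

lemma cVal_of_far {i j : Fin (n + 1)} (h : (i : ℕ) + 2 ≤ j ∨ (j : ℕ) + 2 ≤ i) (y : Fin n → ℂˣ) :
    cVal p i (refPt p j y) = cVal p i y := by
  have h2 := hn.out
  rcases index_cases i with rfl | ⟨k, hk, rfl⟩ | rfl
  · simp only [Fin.val_zero] at h
    rw [cVal_zero, cVal_zero, halfZero, halfZero, chr_refPt, sRefl_affE_of_ne] <;> omega
  · simp only at h
    rw [← idx_eq hk.le, cVal_mid p hk, cVal_mid p hk, chr_refPt, map_sub, sRefl_affE_of_ne,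
      sRefl_affE_of_ne] <;> omega
  · simp only [Fin.val_last] at h
    rw [← idx_last, cVal_last, cVal_last, chr_refPt, sRefl_affE_of_ne] <;> omega

lemma noumiOp_comm {i j : Fin (n + 1)} (h : (i : ℕ) + 2 ≤ j) :
    noumiOp p i * noumiOp p j = noumiOp p j * noumiOp p i := by
  refine LinearMap.ext fun f => ?_
  refine eq_of_evalA_off p {simpleRoot n i, simpleRoot n j} ?_ fun y hy => ?_
  · simp only [Finset.mem_insert, Finset.mem_singleton]
    rintro g (rfl | rfl)
    exacts [simpleRoot_fst_ne_zero i, simpleRoot_fst_ne_zero j]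
  refine commute_of_values
    (G := {y | chr p y (simpleRoot n i) ≠ 1 ∧ chr p y (simpleRoot n j) ≠ 1})
    (S := noumiOp p i) (R := noumiOp p j) (ev := fun f y => evalA y f)
    (s := refPt p i) (r := refPt p j) (t := p.tRoot n i) (t' := p.tRoot n j) (c := cVal p i)
    (d := cVal p j) ?_ ?_ ?_ ?_ ?_ ?_ ?_ f (x := y) ?_
  · rintro y ⟨a, b⟩
    refine ⟨chr_refPt_self_ne p i a, ?_⟩
    rw [chr_refPt, sRefl_root_of_far (Or.inr h)]
    exact b
  · rintro y ⟨a, b⟩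
    refine ⟨?_, chr_refPt_self_ne p j b⟩
    rw [chr_refPt, sRefl_root_of_far (Or.inl h)]
    exact a
  · intro y
    refine point_ext p fun g => ?_
    simp only [chr_refPt]
    exact congrArg _ (LinearEquiv.congr_fun (braidRel_sRefl.comm i j h).symm g)
  · exact fun f y hy => evalA_noumiOp p i f hy.1
  · exact fun f y hy => evalA_noumiOp p j f hy.2
  · exact fun y _ => cVal_of_far p (Or.inl h) y
  · exact fun y _ => cVal_of_far p (Or.inr h) y
  · simp only [Finset.mem_insert, Finset.mem_singleton, forall_eq_or_imp, forall_eq] at hy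
    exact hy

lemma braidRel_noumiOp : BraidRel (noumiOp p : Fin (n + 1) → Module.End ℂ (Laurent n)) where
  comm i j h := noumiOp_comm p h
  three i j hij hi hj := by
    obtain ⟨k, hk⟩ : ∃ k, (i : ℕ) = k + 1 := ⟨i - 1, by omega⟩
    have hk2 : k + 1 + 1 < n := by omega
    have hk1 : k + 1 < n := by omega
    have b := braidRel_sRefl.three i j hij hi hj
    obtain rfl : i = idx n (k + 1) := by rw [idx_eq hk1.le]; exact Fin.ext hk
    obtain rfl : j = idx n (k + 1 + 1) := by rw [idx_eq hk2.le]; exact Fin.ext (by rw [hij, hk])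
    refine noumiOp_braid_three p b (X := fun y => chr p y (affE n k - affE n (k + 1)))
      (Z := fun y => chr p y (affE n (k + 1) - affE n (k + 1 + 1))) ?_ ?_ ?_ ?_ ?_ ?_ ?_ ?_ ?_ ?_
    · intro y; rw [root_idx_mid hk1]
    · intro y; rw [root_idx_mid hk2]
    · intro y
      rw [chr_refPt, ← root_idx_mid hk1, sRefl_root, chr_neg]
    · intro y
      rw [chr_refPt, map_sub, sRefl_mid_affE hk1 hk1, sRefl_mid_affE hk1 hk2, if_neg (by omega),
        if_pos rfl, if_neg (by omega), if_neg (by omega), ← chr_add, sub_add_sub_cancel]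
    · intro y
      rw [chr_refPt, map_sub, sRefl_mid_affE hk2 hk1, sRefl_mid_affE hk2 (by omega),
        if_neg (by omega), if_neg (by omega), if_pos rfl, ← chr_add, sub_add_sub_cancel]
    · intro y
      rw [chr_refPt, ← root_idx_mid hk2, sRefl_root, chr_neg]
    · rw [root_idx_mid hk1, root_idx_mid hk2, sub_add_sub_cancel, affE_eq (by omega), affE_eq hk2]
      intro h
      have := congrFun h ⟨k, by omega⟩
      simp [show k ≠ k + 1 + 1 by omega] at this
    · rw [tRoot_mid p hk1, tRoot_mid p hk2]
    · intro y; rw [cVal_mid p hk1, tRoot_mid p hk1]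
    · intro y; rw [cVal_mid p hk2, tRoot_mid p hk1]
  four i j hij h := by
    have h2 := hn.out
    have b := braidRel_sRefl.four i j hij h
    rcases h with h | h
    · obtain rfl : i = 0 := Fin.ext h
      obtain rfl : j = idx n (0 + 1) := by
        rw [idx_eq (by omega)]; exact Fin.ext (by rw [hij, Fin.val_zero])
      have hk : 0 + 1 < n := by omega
      -- The end node 0 has to play the role of the second index, so the relation is used with its
      -- sides exchanged.
      refine (noumiOp_braid_four p b.symm (X := fun y => chr p y (affE n 0 - affE n (0 + 1)))
        (W := halfZero p) ?_ ?_ ?_ ?_ ?_ ?_ ?_ ?_ (e := p.t0 * (p.t0v - (p.t0v : ℂ)⁻¹)) ?_ ?_).symm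
      · intro y; rw [root_idx_mid hk]
      · intro y; rw [halfZero_sq]
      · intro y
        rw [chr_refPt, ← root_idx_mid hk, sRefl_root, chr_neg]
      · intro y
        rw [halfZero, chr_refPt, sRefl_mid_affE hk (by omega), if_pos rfl, halfZero, chr_sub,
          div_eq_mul_inv, mul_comm, mul_comm p.q12, mul_mul_mul_comm, ← mul_assoc,
          mul_comm (chr p y (affE n 0)), mul_assoc, mul_assoc, inv_mul_cancel_left]
      · intro y
        rw [chr_refPt, halfZero_sq, ← chr_add, map_sub, sRefl_zero_affE (by omega), if_pos rfl,
          sRefl_zero_affE hk, if_neg (by omega), root_idx_zero]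
        congr 1
        module
      · exact fun y => halfZero_refPt p y
      · rw [root_idx_mid hk, root_idx_zero, affE_eq (by omega), affE_eq hk]
        intro h
        have := congrFun h ⟨0 + 1, hk⟩
        simp [affD] at this
      · rw [root_idx_mid hk, root_idx_zero, affE_eq (by omega), affE_eq hk]
        intro h
        have := congrFun h ⟨0 + 1, hk⟩
        simp [affD] at this
      · intro y; rw [cVal_mid p hk, tRoot_mid p hk]
      · intro y; rw [cVal_zero, tRoot_zero]
    · obtain ⟨k, hkn⟩ : ∃ k, n = k + 1 + 1 := ⟨n - 2, by omega⟩
      have hk : k + 1 < n := by omega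
      have hk' : n - 1 = k + 1 := by omega
      obtain rfl : i = idx n (k + 1) := by rw [idx_eq hk.le]; exact Fin.ext (by simp; omega)
      obtain rfl : j = idx n n := by rw [idx_last]; exact Fin.ext h
      refine noumiOp_braid_four p b (X := fun y => chr p y (affE n k - affE n (k + 1)))
        (W := fun y => chr p y (affE n (k + 1))) ?_ ?_ ?_ ?_ ?_ ?_ ?_ ?_
        (e := p.tn * (p.tnv - (p.tnv : ℂ)⁻¹)) ?_ ?_
      · intro y; rw [root_idx_mid hk]
      · intro y; rw [root_idx_last, chr_zsmul, zpow_ofNat, hk']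
      · intro y
        rw [chr_refPt, ← root_idx_mid hk, sRefl_root, chr_neg]
      · intro y
        rw [chr_refPt, sRefl_mid_affE hk hk, if_neg (by omega), if_pos rfl, ← chr_add,
          sub_add_cancel]
      · intro y
        rw [chr_refPt, ← zpow_ofNat, ← chr_zsmul, ← chr_add, map_sub, sRefl_last_affE (by omega),
          if_neg (by omega), sRefl_last_affE hk, if_pos hk'.symm]
        congr 1
        module
      · intro y
        rw [chr_refPt, sRefl_last_affE hk, if_pos hk'.symm, chr_neg]
      · rw [root_idx_mid hk, root_idx_last, hk', affE_eq (by omega), affE_eq hk]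
        intro h
        have := congrFun h ⟨k, by omega⟩
        simp at this
      · rw [root_idx_mid hk, root_idx_last, hk', affE_eq (by omega), affE_eq hk]
        intro h
        have := congrFun h ⟨k, by omega⟩
        simp at this
      · intro y; rw [cVal_mid p hk, tRoot_mid p hk]
      · intro y; rw [cVal_last, tRoot_last, hk']

/-- The Noumi representation. -/
def noumiRep : AffineHecke n p →ₐ[ℂ] Module.End ℂ (Laurent n) :=
  RingQuot.liftAlgHom ℂ ⟨FreeAlgebra.lift ℂ (noumiOp p), by
    intro x y h
    induction h with
    | quadratic i =>
      simp only [map_mul, map_sub, map_add, FreeAlgebra.lift_ι_apply, AlgHom.commutes, map_zero]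
      have h := noumiOp_quadratic p i
      have e : (p.tRoot n i : ℂ) * (p.tRoot n i : ℂ)⁻¹ = 1 := mul_inv_cancel₀ (Units.ne_zero _)
      rw [sub_mul, mul_add, mul_add, h, ← map_mul, e, map_one, ← Algebra.commutes,
        ← Algebra.smul_def, ← Algebra.smul_def]
      module
    | braid_four i j hij h =>
      simpa only [map_mul, FreeAlgebra.lift_ι_apply] using (braidRel_noumiOp p).four i j hij h
    | braid_three i j hij hi hj =>
      simpa only [map_mul, FreeAlgebra.lift_ι_apply] using (braidRel_noumiOp p).three i j hij hi hj
    | commute i j hij =>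
      simpa only [map_mul, FreeAlgebra.lift_ι_apply] using (braidRel_noumiOp p).comm i j hij⟩

lemma noumiRep_heckeT (i : Fin (n + 1)) : noumiRep p (heckeT n p i) = noumiOp p i := by
  rw [noumiRep, heckeT, RingQuot.liftAlgHom_mkAlgHom_apply, FreeAlgebra.lift_ι_apply]

lemma isNoumiRep_noumiRep : IsNoumiRep n p (noumiRep p) := by
  intro i f
  have h0 : algebraMap (Laurent n) (FractionRing (Laurent n))
      (1 - affMonomial p (simpleRoot n i)) ≠ 0 := by
    rw [Ne, FaithfulSMul.algebraMap_eq_zero_iff]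
    exact one_sub_affMonomial_ne_zero p (simpleRoot_fst_ne_zero i)
  refine mul_left_cancel₀ h0 ?_
  rw [noumiRep_heckeT, ← map_mul, one_sub_smul_noumiOp, vFun, mul_add, ← mul_assoc,
    mul_div_cancel₀ _ h0, ← map_mul, ← map_mul, ← map_add, mul_smul_comm, mul_smul_comm]

lemma noumiRep_unique {π : AffineHecke n p →ₐ[ℂ] Module.End ℂ (Laurent n)}
    (h : IsNoumiRep n p π) : π = noumiRep p := by
  refine RingQuot.ringQuot_ext' ℂ _ _ (FreeAlgebra.hom_ext (funext fun i => ?_))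
  refine LinearMap.ext fun f => ?_
  refine FaithfulSMul.algebraMap_injective (Laurent n) (FractionRing (Laurent n)) ?_
  exact (h i f).trans (isNoumiRep_noumiRep p i f).symm

end Noumi

end

section

/-! ### Orbits and orders on the weight lattice -/

section Order

variable {n : ℕ} [hn : Fact (2 ≤ n)]

/-- The sum of the first `m` coordinates. -/
def psum (v : Weight n) (m : ℕ) : ℤ := ∑ j : Fin n, if (j : ℕ) < m then v j else 0

lemma psum_add (v w : Weight n) (m : ℕ) : psum (v + w) m = psum v m + psum w m := by
  simp only [psum, ← Finset.sum_add_distrib, Pi.add_apply]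
  refine Finset.sum_congr rfl fun j _ => ?_
  split_ifs <;> simp

lemma psum_smul (c : ℤ) (v : Weight n) (m : ℕ) : psum (c • v) m = c * psum v m := by
  simp only [psum, Finset.mul_sum, Pi.smul_apply, smul_eq_mul]
  refine Finset.sum_congr rfl fun j _ => ?_
  split_ifs <;> simp

lemma psum_sub (v w : Weight n) (m : ℕ) : psum (v - w) m = psum v m - psum w m := by
  have := psum_add (v - w) w m
  rw [sub_add_cancel] at this
  omega

lemma psum_single (j : Fin n) (c : ℤ) (m : ℕ) :
    psum (Pi.single j c) m = if (j : ℕ) < m then c else 0 := by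
  rw [psum, Finset.sum_eq_single j] <;> simp +contextual

lemma psum_succ (v : Weight n) (j : Fin n) : psum v (j + 1) = psum v j + v j := by
  have h : v j = ∑ i : Fin n, if i = j then v i else 0 := by simp
  refine Eq.trans ?_ (congrArg (psum v j + ·) h).symm
  simp only [psum]
  rw [← Finset.sum_add_distrib]
  refine Finset.sum_congr rfl fun i _ => ?_
  rcases lt_trichotomy i j with hh | rfl | hh
  · rw [if_pos, if_pos, if_neg hh.ne, add_zero]
    · exact hh
    · have : (i : ℕ) < j := hh
      omega
  · simp
  · have : (j : ℕ) < i := hh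
    rw [if_neg (by omega), if_neg (by omega), if_neg hh.ne', add_zero]

lemma simpleCoroot_succ (k : Fin n) (j : Fin n) : simpleCoroot n k.succ j =
    (if j = k then 1 else 0) - (if (j : ℕ) = k + 1 then 1 else 0) := by
  rw [simpleCoroot, if_neg (by simp), Fin.val_succ]
  have hj := j.2
  split_ifs with h1 h2 h3 h3 h3 h4 h4 <;> simp_all [eps, Fin.ext_iff] <;> omega

/-- Partial sums are the coordinates dual to the simple co-roots: the coefficient of the k-th
co-root in w - v is the partial sum of its first k entries. -/
lemma domLE_iff {v w : Weight n} : domLE v w ↔ ∀ m, psum v m ≤ psum w m := by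
  constructor
  · intro h m
    have : 0 ≤ psum (w - v) m := by
      refine AddSubmonoid.closure_induction (motive := fun D _ => 0 ≤ psum D m) ?_ ?_ ?_ h
      · rintro _ ⟨i, hi, rfl⟩
        obtain ⟨k, rfl⟩ := Fin.exists_succ_eq.2 hi
        simp only [psum, simpleCoroot_succ]
        by_cases h : (k : ℕ) + 1 < n
        · have : ∀ j : Fin n, (if (j : ℕ) < m then (if j = k then 1 else 0) -
              (if (j : ℕ) = k + 1 then 1 else 0) else (0 : ℤ)) =
              (if j = k then (if (k : ℕ) < m then 1 else 0) else 0) -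
              (if j = ⟨k + 1, h⟩ then (if (k : ℕ) + 1 < m then 1 else 0) else 0) := by
            intro j
            simp only [Fin.ext_iff]
            split_ifs <;> simp_all
          simp only [this, Finset.sum_sub_distrib, Finset.sum_ite_eq', Finset.mem_univ, if_true]
          split_ifs <;> simp_all <;> omega
        · refine Finset.sum_nonneg fun j _ => ?_
          have := j.2
          split_ifs <;> omega
      · simp [psum]
      · intro a b _ _ ha hb
        rw [psum_add]; omega
    rw [psum_sub] at this
    omega
  · intro h
    have e : w - v = ∑ k : Fin n, (psum (w - v) (k + 1)).toNat • simpleCoroot n k.succ := by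
      ext j
      have h0 : ∀ m, 0 ≤ psum (w - v) m := fun m => by rw [psum_sub]; have := h m; omega
      simp only [← natCast_zsmul, Int.toNat_of_nonneg (h0 _), Finset.sum_apply, Pi.smul_apply,
        simpleCoroot_succ, smul_eq_mul, mul_sub, Finset.sum_sub_distrib, mul_ite, mul_one, mul_zero,
        Finset.sum_ite_eq, Finset.mem_univ, if_true]
      rw [psum_succ]
      suffices h2 : ∑ x : Fin n, (if (j : ℕ) = x + 1 then psum (w - v) (x + 1) else 0) =
          psum (w - v) j by rw [h2]; ring
      obtain ⟨j, hj⟩ := j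
      cases j with
      | zero => simp [psum]
      | succ j =>
        rw [Finset.sum_eq_single ⟨j, by omega⟩]
        · simp
        · intro b _ hb
          rw [if_neg]
          intro h
          exact hb (Fin.ext (by simp at h ⊢; omega))
        · simp
    rw [domLE, e]
    refine sum_mem fun k _ => nsmul_mem ?_ _
    exact AddSubmonoid.subset_closure (Set.mem_image_of_mem _ (Fin.succ_ne_zero k))

lemma domLE_refl (v : Weight n) : domLE v v := domLE_iff.2 fun _ => le_rfl

lemma domLE.trans {u v w : Weight n} (h : domLE u v) (h' : domLE v w) : domLE u w :=
  domLE_iff.2 fun m => (domLE_iff.1 h m).trans (domLE_iff.1 h' m)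

lemma domLE.antisymm {v w : Weight n} (h : domLE v w) (h' : domLE w v) : v = w := by
  have : ∀ m, psum v m = psum w m := fun m => le_antisymm (domLE_iff.1 h m) (domLE_iff.1 h' m)
  ext j
  have h1 := psum_succ v j
  have h2 := psum_succ w j
  rw [this, this] at h1
  omega

lemma weylAct_one (v : Weight n) : weylAct 1 1 v = v := by
  ext j; simp [weylAct]

lemma weylAct_weylAct (σ σ' : Equiv.Perm (Fin n)) (e e' : Fin n → ℤˣ) (v : Weight n) :
    weylAct σ e (weylAct σ' e' v) = weylAct (σ' * σ) (fun j => e j * e' (σ j)) v := by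
  ext j; simp [weylAct, mul_assoc]

lemma weylAct_symm (σ : Equiv.Perm (Fin n)) (e : Fin n → ℤˣ) (v : Weight n) :
    weylAct σ⁻¹ (fun j => e (σ⁻¹ j)) (weylAct σ e v) = v := by
  ext j
  simp only [weylAct, show σ (σ⁻¹ j) = j from σ.apply_symm_apply j]
  rw [← mul_assoc, ← Units.val_mul, Int.units_mul_self, Units.val_one, one_mul]

lemma inOrbit_refl (v : Weight n) : InOrbit v v := ⟨1, 1, (weylAct_one v).symm⟩

lemma InOrbit.symm {v w : Weight n} (h : InOrbit v w) : InOrbit w v := by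
  obtain ⟨σ, e, rfl⟩ := h
  exact ⟨_, _, (weylAct_symm σ e v).symm⟩

lemma InOrbit.trans {u v w : Weight n} (h : InOrbit u v) (h' : InOrbit v w) : InOrbit u w := by
  obtain ⟨σ, e, rfl⟩ := h
  obtain ⟨σ', e', rfl⟩ := h'
  exact ⟨_, _, weylAct_weylAct σ' σ e' e u⟩

/-- After subtracting a threshold c from all coordinates, the sum of the first m entries is at most
∑ max(v_j - c, 0). This bound is invariant under permutations and is attained by v itself. -/
lemma domLE_weylAct {v : Weight n} (hv : IsDominant v) (σ : Equiv.Perm (Fin n)) (e : Fin n → ℤˣ) :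
    domLE (weylAct σ e v) v := by
  refine domLE_iff.2 fun m => ?_
  -- The threshold is the m-th coordinate of v. For m > n zero serves, as all coordinates are
  -- nonnegative; for m = 0 truncated subtraction yields the largest coordinate, which serves as
  -- well.
  set c : ℤ := if h : m - 1 < n then v ⟨m - 1, h⟩ else 0 with hc
  have h1 : ∀ j : Fin n, (j : ℕ) < m → c ≤ v j := by
    intro j hj
    rw [hc]
    split_ifs with h
    · exact hv.1 (show (j : ℕ) ≤ m - 1 by omega)
    · exact hv.2 j
  have h2 : ∀ j : Fin n, ¬ (j : ℕ) < m → v j ≤ c := by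
    intro j hj
    have := j.2
    rw [hc, dif_pos (by omega)]
    exact hv.1 (show m - 1 ≤ (j : ℕ) by omega)
  have key : psum (weylAct σ e v - fun _ => c) m ≤ psum (v - fun _ => c) m := by
    calc psum (weylAct σ e v - fun _ => c) m ≤ ∑ j : Fin n, max (v (σ j) - c) 0 := by
          refine Finset.sum_le_sum fun j _ => ?_
          simp only [Pi.sub_apply, weylAct]
          have h3 : ((e j : ℤˣ) : ℤ) * v (σ j) ≤ v (σ j) := by
            have := hv.2 (σ j)
            rcases Int.units_eq_one_or (e j) with h | h <;> rw [h] <;> push_cast <;> omega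
          split_ifs <;> omega
      _ = ∑ j : Fin n, max (v j - c) 0 := Equiv.sum_comp σ fun j => max (v j - c) 0
      _ = psum (v - fun _ => c) m := by
          refine Finset.sum_congr rfl fun j _ => ?_
          simp only [Pi.sub_apply]
          split_ifs with h
          · have := h1 j h; omega
          · have := h2 j h; omega
  rw [psum_sub, psum_sub] at key
  omega

lemma exists_dominant (v : Weight n) : ∃ w, IsDominant w ∧ InOrbit v w := by
  let σ := Tuple.sort fun j => -|v j|
  have hσ : Monotone ((fun j => -|v j|) ∘ σ) := Tuple.monotone_sort _
  refine ⟨fun j => |v (σ j)|, ⟨fun i j hij => ?_, fun j => abs_nonneg _⟩, σ,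
    fun j => if 0 ≤ v (σ j) then 1 else -1, ?_⟩
  · have := hσ hij
    simpa using this
  · ext j
    simp only [weylAct]
    split_ifs with h
    · simp [abs_of_nonneg h]
    · simp [abs_of_neg (not_le.1 h)]

/-- The dominant weight in the orbit of `v`. -/
def dom (v : Weight n) : Weight n := (exists_dominant v).choose

lemma isDominant_dom (v : Weight n) : IsDominant (dom v) := (exists_dominant v).choose_spec.1

lemma inOrbit_dom (v : Weight n) : InOrbit v (dom v) := (exists_dominant v).choose_spec.2

lemma IsDominant.eq_of_inOrbit {v w : Weight n} (hv : IsDominant v) (hw : IsDominant w)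
    (h : InOrbit v w) : v = w := by
  obtain ⟨σ, e, h1⟩ := h
  obtain ⟨σ', e', h2⟩ := InOrbit.symm ⟨σ, e, h1⟩
  have h3 := domLE_weylAct hv σ e
  have h4 := domLE_weylAct hw σ' e'
  rw [← h1] at h3
  rw [← h2] at h4
  exact h4.antisymm h3

lemma dom_eq {v w : Weight n} (hw : IsDominant w) (h : InOrbit v w) : dom v = w :=
  (isDominant_dom v).eq_of_inOrbit hw ((inOrbit_dom v).symm.trans h)

lemma inOrbit_iff {v w : Weight n} : InOrbit v w ↔ dom v = dom w := by
  constructor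
  · exact fun h => dom_eq (isDominant_dom w) (h.trans (inOrbit_dom w))
  · exact fun h => (inOrbit_dom v).trans (h ▸ (inOrbit_dom w).symm)

lemma domLE_dom (v : Weight n) : domLE v (dom v) := by
  obtain ⟨σ, e, h⟩ := (inOrbit_dom v).symm
  have := domLE_weylAct (isDominant_dom v) σ e
  rwa [← h] at this

lemma prec_iff {v w : Weight n} : Prec v w ↔ v ≠ w ∧
    ((domLE (dom v) (dom w) ∧ dom v ≠ dom w) ∨ (dom v = dom w ∧ domLE v w)) := by
  constructor
  · rintro ⟨h, v', w', hv, hv', hw, hw', h'⟩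
    rw [dom_eq hv hv', dom_eq hw hw']
    exact ⟨h, h'⟩
  · rintro ⟨h, h'⟩
    exact ⟨h, dom v, dom w, isDominant_dom v, inOrbit_dom v, isDominant_dom w, inOrbit_dom w, h'⟩

lemma Prec.trans {u v w : Weight n} (h : Prec u v) (h' : Prec v w) : Prec u w := by
  rw [prec_iff] at *
  obtain ⟨h1, h2⟩ := h
  obtain ⟨h3, h4⟩ := h'
  rcases h2 with ⟨h2, h5⟩ | ⟨h2, h5⟩ <;> rcases h4 with ⟨h4, h6⟩ | ⟨h4, h6⟩
  · have h7 : dom u ≠ dom w := fun h => h6 (h4.antisymm (h ▸ h2))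
    exact ⟨fun h => h7 (h ▸ rfl), Or.inl ⟨h2.trans h4, h7⟩⟩
  · exact ⟨fun h => h5 (h ▸ h4.symm), Or.inl ⟨h4 ▸ h2, h4 ▸ h5⟩⟩
  · exact ⟨fun h => h6 (h ▸ h2.symm), Or.inl ⟨h2 ▸ h4, h2 ▸ h6⟩⟩
  · refine ⟨?_, Or.inr ⟨h2.trans h4, h5.trans h6⟩⟩
    rintro rfl
    exact h1 (h5.antisymm h6)

lemma Prec.irrefl (v : Weight n) : ¬ Prec v v := fun h => h.1 rfl

lemma Prec.domLE_dom {v w : Weight n} (h : Prec v w) : domLE (dom v) (dom w) := by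
  rw [prec_iff] at h
  rcases h.2 with h | h
  · exact h.1
  · rw [h.1]; exact domLE_refl _

/-- v⁺ ≤ w⁺ bounds every coordinate of v in absolute value by the sum of the coordinates of w⁺. -/
lemma finite_prec (w : Weight n) : {v | Prec v w}.Finite := by
  set M := psum (dom w) n
  refine (Set.finite_Icc (fun _ : Fin n => -M) (fun _ => M)).subset fun v hv => ?_
  have h1 : ∀ j, dom v j ≤ M := by
    intro j
    refine le_trans ?_ (domLE_iff.1 hv.domLE_dom n)
    rw [psum]
    refine le_trans ?_ (Finset.single_le_sum (s := Finset.univ) (a := j) (fun i _ => ?_)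
      (Finset.mem_univ j))
    · simp
    · simpa using (isDominant_dom v).2 i
  obtain ⟨σ, e, h⟩ := (inOrbit_dom v).symm
  have h2 := fun j => (isDominant_dom v).2 j
  have h3 : ∀ j, -M ≤ v j ∧ v j ≤ M := by
    intro j
    rw [h]
    have := h1 (σ j)
    have := h2 (σ j)
    simp only [weylAct]
    rcases Int.units_eq_one_or (e j) with h | h <;> rw [h] <;> push_cast <;> omega
  exact ⟨fun j => (h3 j).1, fun j => (h3 j).2⟩

lemma prec_wellFounded : WellFounded (Prec : Weight n → Weight n → Prop) := by
  refine Subrelation.wf (r := InvImage (· < ·) fun v => {u | Prec u v}.ncard) ?_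
    (InvImage.wf _ wellFounded_lt)
  intro v w h
  refine Set.ncard_lt_ncard ⟨fun u hu => Prec.trans hu h, fun hh => ?_⟩ (finite_prec w)
  exact Prec.irrefl v (hh h)

/-! ### Convexity: weights strictly inside a segment. -/

/-- `κ` is strictly between `ν` and `ν'` on a line. -/
def Between (κ ν ν' : Weight n) : Prop :=
  ∃ a b : ℤ, 0 < a ∧ 0 < b ∧ (a + b) • κ = a • ν + b • ν'

lemma dot_weylAct (σ : Equiv.Perm (Fin n)) (e : Fin n → ℤˣ) (v w : Weight n) :
    weylAct σ e v ⬝ᵥ weylAct σ e w = v ⬝ᵥ w := by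
  rw [dotProduct, dotProduct, ← Equiv.sum_comp σ fun j => v j * w j]
  refine Finset.sum_congr rfl fun j _ => ?_
  simp only [weylAct]
  rcases Int.units_eq_one_or (e j) with h | h <;> rw [h] <;> push_cast <;> ring

lemma InOrbit.dot_self {v w : Weight n} (h : InOrbit v w) : v ⬝ᵥ v = w ⬝ᵥ w := by
  obtain ⟨σ, e, rfl⟩ := h
  rw [dot_weylAct]

lemma weylAct_add (σ : Equiv.Perm (Fin n)) (e : Fin n → ℤˣ) (v w : Weight n) :
    weylAct σ e (v + w) = weylAct σ e v + weylAct σ e w := by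
  ext j; simp [weylAct, mul_add]

lemma weylAct_smul (σ : Equiv.Perm (Fin n)) (e : Fin n → ℤˣ) (c : ℤ) (v : Weight n) :
    weylAct σ e (c • v) = c • weylAct σ e v := by
  ext j; simp [weylAct, mul_left_comm]

/-- By strict convexity of the norm, κ is shorter than the endpoints, so it lies in another orbit.
After κ is moved to its dominant representative, its partial sums are averages of those of the moved
endpoints, which are at most those of μ⁺. -/
lemma Between.prec {κ ν ν' μ : Weight n} (h : Between κ ν ν') (h1 : InOrbit μ ν) (h2 : InOrbit μ ν')
    (hne : ν ≠ ν') : Prec κ μ := by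
  obtain ⟨a, b, ha, hb, e⟩ := h
  have hd : dom κ ≠ dom μ := by
    intro hd
    have n0 := (inOrbit_iff.2 hd).symm.dot_self
    have n1 := h1.dot_self
    have n2 := h2.dot_self
    have e2 : ((a + b) • κ) ⬝ᵥ ((a + b) • κ) = (a • ν + b • ν') ⬝ᵥ (a • ν + b • ν') := by rw [e]
    simp only [add_dotProduct, dotProduct_add, smul_dotProduct, dotProduct_smul, smul_eq_mul,
      dotProduct_comm ν' ν] at e2
    have e3 : a * b * ((ν - ν') ⬝ᵥ (ν - ν')) = 0 := by
      simp only [sub_dotProduct, dotProduct_sub, dotProduct_comm ν' ν]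
      rw [← n0, ← n1, ← n2] at e2
      rw [← n1, ← n2]
      linarith
    have e4 := (mul_eq_zero.1 e3).resolve_left (mul_pos ha hb).ne'
    exact hne (sub_eq_zero.1 (dotProduct_self_eq_zero.1 e4))
  rw [prec_iff]
  refine ⟨fun h => hd (h ▸ rfl), Or.inl ⟨domLE_iff.2 fun m => ?_, hd⟩⟩
  obtain ⟨σ, s, hσ⟩ := inOrbit_dom κ
  have e2 := congrArg (fun v => psum (weylAct σ s v) m) e
  simp only [weylAct_add, weylAct_smul, ← hσ, psum_add, psum_smul] at e2
  have k1 : ∀ v, InOrbit μ v → psum (weylAct σ s v) m ≤ psum (dom μ) m := by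
    intro v hv
    have : dom (weylAct σ s v) = dom μ := (inOrbit_iff.1 (hv.trans ⟨σ, s, rfl⟩)).symm
    rw [← this]
    exact domLE_iff.1 (Koornwinder.domLE_dom _) m
  have := mul_le_mul_of_nonneg_left (k1 ν h1) ha.le
  have := mul_le_mul_of_nonneg_left (k1 ν' h2) hb.le
  have h5 : (a + b) * psum (dom κ) m ≤ (a + b) * psum (dom μ) m := by linarith
  exact le_of_mul_le_mul_left h5 (by omega)

lemma prec_of_inOrbit {v w : Weight n} (h : InOrbit v w) (hne : v ≠ w)
    (hd : ∀ m, psum v m ≤ psum w m) : Prec v w :=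
  prec_iff.2 ⟨hne, Or.inr ⟨inOrbit_iff.1 h, domLE_iff.2 hd⟩⟩

lemma inOrbit_sRefl (i : Fin (n + 1)) (g : AffWeight n) : InOrbit g.1 (sRefl i g).1 := by
  have h2 := hn.out
  rcases index_cases i with rfl | ⟨k, hk, rfl⟩ | rfl
  · refine ⟨1, fun j => if j = ⟨0, by omega⟩ then -1 else 1, ?_⟩
    rw [coe_sRefl, simpleRefl_zero (by omega)]
    ext j
    simp only [weylAct]
    split_ifs with h <;> simp
  · refine ⟨Equiv.swap ⟨k, by omega⟩ ⟨k + 1, hk⟩, 1, ?_⟩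
    rw [coe_sRefl, simpleRefl_middle hk]
    ext j
    simp [weylAct]
  · refine ⟨1, fun j => if j = lstIdx n then -1 else 1, ?_⟩
    rw [sRefl_apply, pairing_coroot_last, simpleRoot_last]
    ext j
    simp only [weylAct]
    rcases eq_or_ne j (lstIdx n) with rfl | h <;> (simp_all; try ring)

lemma InW.inOrbit {u : AffWeight n ≃ₗ[ℤ] AffWeight n} (hu : InW u) (g : AffWeight n) :
    InOrbit g.1 (u g).1 :=
  InW.induction (P := fun u => InOrbit g.1 (u g).1) (inOrbit_refl _)
    (fun _ i _ _ ih => ih.trans (inOrbit_sRefl i _)) hu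

lemma InW.affD {u : AffWeight n ≃ₗ[ℤ] AffWeight n} (hu : InW u) : u (affD n) = affD n :=
  InW.induction (P := fun u => u (Koornwinder.affD n) = Koornwinder.affD n) rfl
    (fun w i _ _ ih => by rw [LinearEquiv.mul_apply, ih, sRefl_affD]) hu

lemma InW.apply_eq {u : AffWeight n ≃ₗ[ℤ] AffWeight n} (hu : InW u) (g : AffWeight n) :
    u g = u (g.1, 0) + g.2 • Koornwinder.affD n := by
  conv_lhs => rw [show g = (g.1, 0) + g.2 • Koornwinder.affD n by ext <;> simp [Koornwinder.affD]]
  rw [map_add, map_zsmul, hu.affD]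

lemma InW.fst_congr {u : AffWeight n ≃ₗ[ℤ] AffWeight n} (hu : InW u) {g h : AffWeight n}
    (e : g.1 = h.1) : (u g).1 = (u h).1 := by
  rw [hu.apply_eq g, hu.apply_eq h, e]
  simp [Koornwinder.affD]

lemma InW.form {u : AffWeight n ≃ₗ[ℤ] AffWeight n} (hu : InW u) (g h : AffWeight n) :
    form (u g) (u h) = form g h :=
  InW.induction (P := fun u => Koornwinder.form (u g) (u h) = Koornwinder.form g h) rfl
    (fun w i _ _ ih => by rw [LinearEquiv.mul_apply, LinearEquiv.mul_apply, form_sRefl, ih]) hu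

end Order

end

section

/-! ### Triangular operators -/

section Triangular

variable {n : ℕ} [hn : Fact (2 ≤ n)] (p : Params)

/-- The span of the monomials `x^κ`, `κ ≺ μ`. -/
def lowSpan (μ : Weight n) : Submodule ℂ (Laurent n) :=
  Submodule.span ℂ ((fun κ => AddMonoidAlgebra.single κ (1 : ℂ)) '' {κ | Prec κ μ})

lemma single_mem_lowSpan {κ μ : Weight n} (h : Prec κ μ) (a : ℂ) :
    AddMonoidAlgebra.single κ a ∈ lowSpan μ := by
  have := (lowSpan μ).smul_mem a (Submodule.subset_span ⟨κ, h, rfl⟩)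
  simpa using this

lemma affMonomial_mem_lowSpan {g : AffWeight n} {μ : Weight n} (h : Prec g.1 μ) :
    affMonomial p g ∈ lowSpan μ := single_mem_lowSpan h _

lemma lowSpan_mono {κ μ : Weight n} (h : Prec κ μ) : lowSpan κ ≤ lowSpan μ :=
  Submodule.span_mono (Set.image_mono fun _ h' => Prec.trans h' h)

/-- `A x^μ = d(μ) x^μ + lower terms`. -/
def LowTri (A : Module.End ℂ (Laurent n)) (d : Weight n → ℂ) : Prop :=
  ∀ μ, A (AddMonoidAlgebra.single μ 1) - d μ • AddMonoidAlgebra.single μ (1 : ℂ) ∈ lowSpan μ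

variable {p}

lemma LowTri.map_single_mem {A : Module.End ℂ (Laurent n)} {d : Weight n → ℂ} (h : LowTri A d)
    {κ μ : Weight n} (hκ : Prec κ μ) : A (AddMonoidAlgebra.single κ 1) ∈ lowSpan μ := by
  have := (lowSpan μ).add_mem (lowSpan_mono hκ (h κ))
    ((lowSpan μ).smul_mem (d κ) (single_mem_lowSpan hκ 1))
  simpa using this

lemma LowTri.map_lowSpan {A : Module.End ℂ (Laurent n)} {d : Weight n → ℂ} (h : LowTri A d)
    {μ : Weight n} {f : Laurent n} (hf : f ∈ lowSpan μ) : A f ∈ lowSpan μ := by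
  refine Submodule.span_induction ?_ ?_ ?_ ?_ hf
  · rintro _ ⟨κ, hκ, rfl⟩
    exact h.map_single_mem hκ
  · rw [map_zero]; exact zero_mem _
  · intro x y _ _ hx hy
    rw [map_add]; exact add_mem hx hy
  · intro a x _ hx
    rw [map_smul]; exact Submodule.smul_mem _ _ hx

lemma lowTri_one : LowTri (1 : Module.End ℂ (Laurent n)) (fun _ => 1) := by
  intro μ
  rw [one_smul, Module.End.one_apply, sub_self]
  exact zero_mem _

lemma LowTri.mul {A B : Module.End ℂ (Laurent n)} {d e : Weight n → ℂ} (hA : LowTri A d)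
    (hB : LowTri B e) : LowTri (A * B) (fun μ => d μ * e μ) := by
  intro μ
  have h1 := hA.map_lowSpan (hB μ)
  have h2 := (lowSpan μ).smul_mem (e μ) (hA μ)
  have := add_mem h1 h2
  rw [map_sub, map_smul] at this
  convert this using 1
  rw [Module.End.mul_apply]
  module

variable (p)

/-! ### Leading terms of the twisted operators. -/

/-- The operator `x^g ↦ x^{u g}`. -/
def hatOp (u : AffWeight n ≃ₗ[ℤ] AffWeight n) : Module.End ℂ (Laurent n) :=
  monoLin fun v => affMonomial p (u (v, 0))

variable {p} {u : AffWeight n ≃ₗ[ℤ] AffWeight n}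

lemma hatOp_affMonomial (hu : InW u) (g : AffWeight n) :
    hatOp p u (affMonomial p g) = affMonomial p (u g) := by
  have h : affMonomial p (g.2 • affD n) = ((p.q ^ g.2 : ℂˣ) : ℂ) • (1 : Laurent n) := by
    rw [affMonomial_eq_smul]; simp [affD, AddMonoidAlgebra.one_def]
  rw [hu.apply_eq, affMonomial_add, h, mul_smul_comm, mul_one, affMonomial_eq_smul p g, map_smul,
    hatOp, monoLin_single, one_smul]

lemma hatOp_one : hatOp p (1 : AffWeight n ≃ₗ[ℤ] AffWeight n) = 1 := by
  refine laurent_hom_ext fun v => ?_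
  rw [← affMonomial_fst p, hatOp_affMonomial inW_one]
  rfl

lemma hatOp_inv_mul (hu : InW u) : hatOp p u⁻¹ * hatOp p u = 1 := by
  refine laurent_hom_ext fun v => ?_
  rw [Module.End.mul_apply, ← affMonomial_fst p, hatOp_affMonomial hu, hatOp_affMonomial hu.inv]
  exact congrArg _ (u.symm_apply_apply _)

lemma vNum_eq (i : Fin (n + 1)) : ∃ (e : ℂ) (η : Weight n),
    vNum n p i = 1 - AddMonoidAlgebra.single η e -
      (p.tRoot n i : ℂ) ^ 2 • affMonomial p (simpleRoot n i) ∧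
    (e = 0 ∨ (2 : ℤ) • η = (simpleRoot n i).1) := by
  have h2 := hn.out
  have key : ∀ (η : Weight n) (a b : ℂ), (1 - AddMonoidAlgebra.single η a) *
      (1 + AddMonoidAlgebra.single η b) = 1 - AddMonoidAlgebra.single η (a - b) -
        AddMonoidAlgebra.single (η + η) (a * b) := by
    intro η a b
    rw [sub_mul, one_mul, mul_add, mul_one, AddMonoidAlgebra.single_mul_single,
      AddMonoidAlgebra.single_sub]
    abel
  rcases index_cases i with rfl | ⟨k, hk, rfl⟩ | rfl
  · refine ⟨p.t0 * p.t0v * p.q12 - p.t0 * (p.t0v : ℂ)⁻¹ * p.q12, -eps n 1, ?_, Or.inr ?_⟩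
    · rw [vNum, Fin.val_zero, if_pos rfl, key, tRoot_zero, affMonomial,
        AddMonoidAlgebra.smul_single]
      have h3 : -eps n 1 + -eps n 1 = (simpleRoot n 0).1 := by
        rw [simpleRoot, Fin.val_zero, if_pos rfl]
        simp only
        module
      rw [h3]
      congr 2
      · push_cast; ring
      · simp only [simpleRoot, Fin.val_zero, if_pos, zpow_one, Params.q, smul_eq_mul]
        push_cast
        have := p.t0v.ne_zero
        field_simp
    · rw [simpleRoot, Fin.val_zero, if_pos rfl]
      simp only
      module
  · refine ⟨0, 0, ?_, Or.inl rfl⟩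
    rw [vNum, Params.tRoot, if_neg (by simp), if_pos hk, if_neg (by simp), if_pos hk,
      AddMonoidAlgebra.single_zero, sub_zero]
  · refine ⟨p.tn * p.tnv - p.tn * (p.tnv : ℂ)⁻¹, eps n n, ?_, Or.inr ?_⟩
    · have h4 : ((Fin.last n : Fin (n + 1)) : ℕ) = n := Fin.val_last n
      rw [vNum, Params.tRoot, h4, if_neg (by omega), if_neg (by omega), if_neg (by omega),
        if_neg (by omega), key, affMonomial, AddMonoidAlgebra.smul_single, simpleRoot, h4,
        if_neg (by omega), if_neg (by omega)]
      congr 2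
      · push_cast; ring
      · simp only; module
      · push_cast
        have := p.tnv.ne_zero
        simp only [zpow_zero, smul_eq_mul]
        field_simp
    · rw [simpleRoot, if_neg (by simp; omega), if_neg (by simp)]
      simp only
      module

/-- The span of the monomials strictly between two weights. -/
def midSpan (ν ν' : Weight n) : Submodule ℂ (Laurent n) :=
  Submodule.span ℂ ((fun κ => AddMonoidAlgebra.single κ (1 : ℂ)) '' {κ | Between κ ν ν'})

lemma single_mem_midSpan {κ ν ν' : Weight n} (h : Between κ ν ν') (a : ℂ) :
    AddMonoidAlgebra.single κ a ∈ midSpan ν ν' := by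
  have := (midSpan ν ν').smul_mem a (Submodule.subset_span ⟨κ, h, rfl⟩)
  simpa using this

lemma midSpan_comm (ν ν' : Weight n) : midSpan ν ν' = midSpan ν' ν := by
  have : ∀ κ, Between κ ν ν' ↔ Between κ ν' ν := by
    intro κ
    constructor <;> rintro ⟨a, b, ha, hb, h⟩ <;> exact ⟨b, a, hb, ha, by rw [add_comm b, h, add_comm]⟩
  simp only [midSpan, this]

/-- These are the contributions of the three terms of the numerator 1 - e x^η - t² x^a to a string
sum. Modulo interior monomials the first leaves one endpoint and the last leaves the other; the
middle term, a shift by half a root, lands entirely in the interior. -/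
lemma string_mem (h a : AffWeight n) {M : ℕ} (hM : 0 < M) :
    (∑ k ∈ Finset.range M, affMonomial p (h + k • a) - affMonomial p h ∈
      midSpan h.1 (h + M • a).1) ∧
    (affMonomial p a * ∑ k ∈ Finset.range M, affMonomial p (h + k • a) -
      affMonomial p (h + M • a) ∈ midSpan h.1 (h + M • a).1) ∧
    ∀ (η : Weight n) (e : ℂ), (e = 0 ∨ (2 : ℤ) • η = a.1) →
      AddMonoidAlgebra.single η e * ∑ k ∈ Finset.range M, affMonomial p (h + k • a) ∈
        midSpan h.1 (h + M • a).1 := by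
  obtain ⟨M, rfl⟩ := Nat.exists_eq_add_of_lt hM
  rw [zero_add]
  have key : ∑ k ∈ Finset.range M, affMonomial p (h + (k + 1) • a) ∈
      midSpan h.1 (h + (M + 1) • a).1 := by
    refine sum_mem fun k hk => single_mem_midSpan ⟨M + 1 - (k + 1), k + 1, ?_, ?_, ?_⟩ _
    · have := Finset.mem_range.1 hk; omega
    · omega
    · simp only [Prod.fst_add, Prod.smul_fst, ← natCast_zsmul]
      push_cast
      module
  refine ⟨?_, ?_, ?_⟩
  · rw [Finset.sum_range_succ', zero_smul, add_zero, add_sub_cancel_right]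
    exact key
  · rw [Finset.mul_sum]
    have : ∀ k ∈ Finset.range (M + 1), affMonomial p a * affMonomial p (h + k • a) =
        affMonomial p (h + (k + 1) • a) := by
      intro k _
      rw [← affMonomial_add]
      congr 1
      module
    rw [Finset.sum_congr rfl this, Finset.sum_range_succ, add_sub_cancel_right]
    exact key
  · intro η e he
    rcases he with rfl | he
    · rw [AddMonoidAlgebra.single_zero, zero_mul]; exact zero_mem _
    rw [Finset.mul_sum]
    refine sum_mem fun k hk => ?_
    rw [affMonomial, AddMonoidAlgebra.single_mul_single]
    refine single_mem_midSpan ⟨2 * (M + 1) - 2 * k - 1, 2 * k + 1, ?_, ?_, ?_⟩ _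
    · have := Finset.mem_range.1 hk; omega
    · omega
    · simp only [Prod.fst_add, Prod.smul_fst, ← natCast_zsmul, ← he]
      push_cast
      module

/-- Here the string runs from s_i g to g, and the endpoint term -t_i x^g cancels the summand t_i
x^g. For a negative pairing (`noumiOp_of_neg`) the string runs the other way and a multiple of x^g
survives. -/
lemma noumiOp_of_pos (i : Fin (n + 1)) {g : AffWeight n} (hg : 0 < pairing (simpleCoroot n i) g) :
    noumiOp p i (affMonomial p g) - (p.tRoot n i : ℂ)⁻¹ • affMonomial p (sRefl i g) ∈
      midSpan g.1 (sRefl i g).1 := by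
  obtain ⟨e, η, hv, he⟩ := vNum_eq (p := p) i
  have ht : (p.tRoot n i : ℂ) ≠ 0 := Units.ne_zero _
  obtain ⟨M, hM⟩ := Int.eq_ofNat_of_zero_le hg.le
  have h1 : sRefl i g + M • simpleRoot n i = g := by
    rw [sRefl_apply, hM, natCast_zsmul, sub_add_cancel]
  obtain ⟨a, b, c⟩ := string_mem (p := p) (sRefl i g) (simpleRoot n i) (M := M) (by omega)
  have c := c η e he
  rw [noumiOp_apply, divDiff_affMonomial, divMono, if_pos hg.le, hM, Int.toNat_natCast, hv]
  rw [h1] at a b c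
  generalize ∑ k ∈ Finset.range M, affMonomial p (sRefl i g + k • simpleRoot n i) = S at *
  rw [midSpan_comm]
  have := sub_mem (sub_mem (Submodule.smul_mem _ (p.tRoot n i : ℂ)⁻¹ a)
    (Submodule.smul_mem _ (p.tRoot n i : ℂ)⁻¹ c)) (Submodule.smul_mem _ (p.tRoot n i : ℂ) b)
  convert this using 1
  rw [sub_mul, sub_mul, one_mul, smul_mul_assoc, smul_sub, smul_sub, smul_sub, smul_sub, smul_smul,
    show (p.tRoot n i : ℂ)⁻¹ * (p.tRoot n i : ℂ) ^ 2 = p.tRoot n i by field_simp]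
  abel

lemma noumiOp_of_zero (i : Fin (n + 1)) {g : AffWeight n}
    (hg : pairing (simpleCoroot n i) g = 0) :
    noumiOp p i (affMonomial p g) = (p.tRoot n i : ℂ) • affMonomial p g := by
  rw [noumiOp_apply, divDiff_affMonomial, divMono, if_pos hg.ge, hg]
  simp

lemma noumiOp_of_neg (i : Fin (n + 1)) {g : AffWeight n} (hg : pairing (simpleCoroot n i) g < 0) :
    noumiOp p i (affMonomial p g) - (((p.tRoot n i : ℂ) - (p.tRoot n i : ℂ)⁻¹) • affMonomial p g +
      (p.tRoot n i : ℂ) • affMonomial p (sRefl i g)) ∈ midSpan g.1 (sRefl i g).1 := by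
  obtain ⟨e, η, hv, he⟩ := vNum_eq (p := p) i
  have ht : (p.tRoot n i : ℂ) ≠ 0 := Units.ne_zero _
  obtain ⟨M, hM⟩ := Int.eq_ofNat_of_zero_le (show 0 ≤ -pairing (simpleCoroot n i) g by omega)
  have h1 : g + M • simpleRoot n i = sRefl i g := by
    rw [sRefl_apply, ← natCast_zsmul, ← hM, neg_smul, sub_eq_add_neg]
  obtain ⟨a, b, c⟩ := string_mem (p := p) g (simpleRoot n i) (M := M) (by omega)
  have c := c η e he
  rw [noumiOp_apply, divDiff_affMonomial, divMono, if_neg (by omega), hM, Int.toNat_natCast, hv]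
  rw [h1] at a b c
  generalize ∑ k ∈ Finset.range M, affMonomial p (g + k • simpleRoot n i) = S at *
  have := add_mem (sub_mem (Submodule.smul_mem _ (p.tRoot n i : ℂ)⁻¹ c)
    (Submodule.smul_mem _ (p.tRoot n i : ℂ)⁻¹ a)) (Submodule.smul_mem _ (p.tRoot n i : ℂ) b)
  convert this using 1
  rw [mul_neg, sub_mul, sub_mul, one_mul, smul_mul_assoc, smul_neg, smul_sub, smul_sub, smul_sub,
    smul_sub, smul_smul,
    show (p.tRoot n i : ℂ)⁻¹ * (p.tRoot n i : ℂ) ^ 2 = p.tRoot n i by field_simp, sub_smul]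
  abel

lemma Between.apply (hu : InW u) {g h h' : AffWeight n} (hb : Between g.1 h.1 h'.1) :
    Between (u g).1 (u h).1 (u h').1 := by
  obtain ⟨a, b, ha, hb, e⟩ := hb
  refine ⟨a, b, ha, hb, ?_⟩
  have := hu.fst_congr (g := (a + b) • g) (h := a • h + b • h') (by simpa using e)
  simpa only [map_add, map_smul, Prod.fst_add, Prod.smul_fst] using this

lemma hatOp_midSpan (hu : InW u) {g h : AffWeight n} {μ : Weight n} (hg : InOrbit μ g.1)
    (hh : InOrbit μ h.1) (hne : g.1 ≠ h.1) {f : Laurent n} (hf : f ∈ midSpan g.1 h.1) :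
    hatOp p u f ∈ lowSpan μ := by
  refine Submodule.span_induction ?_ ?_ ?_ ?_ hf
  · rintro _ ⟨κ, hκ, rfl⟩
    simp only
    rw [← affMonomial_fst p, hatOp_affMonomial hu]
    refine affMonomial_mem_lowSpan p ?_
    have := Between.apply hu (g := (κ, 0)) hκ
    refine this.prec (hg.trans (hu.inOrbit g)) (hh.trans (hu.inOrbit h)) fun e => hne ?_
    have := hu.inv.fst_congr e
    rwa [← LinearEquiv.mul_apply, ← LinearEquiv.mul_apply, inv_mul_cancel] at this
  · rw [map_zero]; exact zero_mem _
  · intro x y _ _ hx hy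
    rw [map_add]; exact add_mem hx hy
  · intro a x _ hx
    rw [map_smul]; exact Submodule.smul_mem _ _ hx

lemma pairing_inv_sign (hu : InW u) (i : Fin (n + 1)) (μ : Weight n) :
    form (simpleRoot n i) (simpleRoot n i) * pairing (simpleCoroot n i) (u⁻¹ (μ, 0)) =
      2 * form (μ, 0) (u (simpleRoot n i)) := by
  rw [form_root_mul, ← hu.form (u⁻¹ (μ, 0)), ← LinearEquiv.mul_apply, mul_inv_cancel]
  rfl

/-- The common set-up for the two steps below. -/
lemma conj_setup (hu : InW u) (i : Fin (n + 1)) (μ : Weight n) :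
    (u * sRefl i) (sRefl i (u⁻¹ (μ, 0))) = (μ, 0) ∧
    (u * sRefl i) (u⁻¹ (μ, 0)) =
      (μ, 0) - pairing (simpleCoroot n i) (u⁻¹ (μ, 0)) • u (simpleRoot n i) ∧
    InOrbit μ (u⁻¹ (μ, 0)).1 ∧ InOrbit μ (sRefl i (u⁻¹ (μ, 0))).1 ∧
    (u (simpleRoot n i)).1 ≠ 0 := by
  have h1 : u (u⁻¹ (μ, 0)) = (μ, 0) := u.apply_symm_apply _
  have h2 : InOrbit μ (u⁻¹ (μ, 0)).1 := hu.inv.inOrbit (μ, 0)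
  refine ⟨?_, ?_, h2, h2.trans (inOrbit_sRefl i _), ?_⟩
  · rw [LinearEquiv.mul_apply, ← LinearEquiv.mul_apply (f := sRefl i), sRefl_mul_self]
    exact h1
  · rw [LinearEquiv.mul_apply, sRefl_apply, map_sub, map_smul, h1]
  · obtain ⟨_, _, _, _, _, h⟩ := hu.isRt (isRt_simpleRoot i)
    exact h

lemma prec_reflected (hu : InW u) (i : Fin (n + 1)) (μ : Weight n)
    (h0 : pairing (simpleCoroot n i) (u⁻¹ (μ, 0)) ≠ 0)
    (h : ∀ m, 0 ≤ pairing (simpleCoroot n i) (u⁻¹ (μ, 0)) * psum (u (simpleRoot n i)).1 m) :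
    Prec ((u * sRefl i) (u⁻¹ (μ, 0))).1 μ := by
  obtain ⟨a, b, c, d, e⟩ := conj_setup hu i μ
  have hne : pairing (simpleCoroot n i) (u⁻¹ (μ, 0)) • (u (simpleRoot n i)).1 ≠ 0 :=
    smul_ne_zero h0 e
  refine prec_of_inOrbit (c.trans ((hu.mul (inW_sRefl i)).inOrbit _)).symm ?_ fun m => ?_
  · rw [b]
    intro hh
    rw [Prod.fst_sub, Prod.smul_fst, sub_eq_self] at hh
    exact hne hh
  · rw [b]
    simp only [Prod.fst_sub, Prod.smul_fst, psum_sub, psum_smul]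
    have := h m
    omega

/-- With g = u⁻¹ μ, the operator for u s_i returns s_i g to μ and sends g to the reflection of μ in
u a_i. The x^g term of T_i x^g survives only for a negative pairing, and the sign assumption on the
gradient of u a_i makes the reflected weight lower in that case. A zero pairing gives t_i, in
accordance with ε(0) = 1. -/
lemma lowTri_conj (hu : InW u) (i : Fin (n + 1)) (h : ∀ m, psum (u (simpleRoot n i)).1 m ≤ 0) :
    LowTri (hatOp p (u * sRefl i) * noumiOp p i * hatOp p u⁻¹) fun μ =>
      ((p.tRoot n i ^ sgn (-form (μ, 0) (u (simpleRoot n i))) : ℂˣ) : ℂ) := by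
  intro μ
  have hus := hu.mul (inW_sRefl i)
  obtain ⟨a, b, c, d, e⟩ := conj_setup hu i μ
  have hs := pairing_inv_sign hu i μ
  have hp := form_root_pos (n := n) i
  rw [Module.End.mul_apply, Module.End.mul_apply, ← affMonomial_fst p, hatOp_affMonomial hu.inv]
  set g := u⁻¹ (μ, 0) with hg
  beta_reduce
  have hne : pairing (simpleCoroot n i) g ≠ 0 → g.1 ≠ (sRefl i g).1 := by
    intro h0 h1
    rw [sRefl_apply, Prod.fst_sub, Prod.smul_fst, eq_comm, sub_eq_self] at h1
    exact smul_ne_zero h0 (simpleRoot_fst_ne_zero i) h1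
  rcases lt_trichotomy (pairing (simpleCoroot n i) g) 0 with h0 | h0 | h0
  · have h1 := hatOp_midSpan (p := p) hus c d (hne h0.ne) (noumiOp_of_neg (p := p) i h0)
    have h2 : form (μ, 0) (u (simpleRoot n i)) < 0 := by nlinarith
    rw [sgn, if_pos (by omega), zpow_one]
    rw [map_sub, map_add, map_smul, map_smul, hatOp_affMonomial hus, hatOp_affMonomial hus, a] at h1
    have h3 : affMonomial p ((u * sRefl i) g) ∈ lowSpan μ :=
      affMonomial_mem_lowSpan p (prec_reflected hu i μ h0.ne fun m =>
        mul_nonneg_of_nonpos_of_nonpos h0.le (h m))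
    have := add_mem h1 (Submodule.smul_mem _ ((p.tRoot n i : ℂ) - (p.tRoot n i : ℂ)⁻¹) h3)
    convert this using 1
    abel
  · have h2 : form (μ, 0) (u (simpleRoot n i)) = 0 := by rw [h0] at hs; omega
    rw [noumiOp_of_zero i h0, map_smul, hatOp_affMonomial hus, b, h0, zero_smul, sub_zero, h2, sgn,
      if_pos (by omega), zpow_one, sub_self]
    exact zero_mem _
  · have h1 := hatOp_midSpan (p := p) hus c d (hne h0.ne') (noumiOp_of_pos (p := p) i h0)
    have h2 : 0 < form (μ, 0) (u (simpleRoot n i)) := by nlinarith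
    rw [sgn, if_neg (by omega), zpow_neg_one, Units.val_inv_eq_inv_val]
    rw [map_sub, map_smul, hatOp_affMonomial hus, a] at h1
    exact h1

/-- For T_i⁻¹ = T_i - (t_i - t_i⁻¹) the surviving x^g term moves to the positive pairings, so the
sign assumption on the gradient is reversed. -/
lemma lowTri_conj_inv (hu : InW u) (i : Fin (n + 1))
    (h : ∀ m, 0 ≤ psum (u (simpleRoot n i)).1 m) :
    LowTri (hatOp p (u * sRefl i) *
      (noumiOp p i - ((p.tRoot n i : ℂ) - (p.tRoot n i : ℂ)⁻¹) • 1) * hatOp p u⁻¹) fun μ =>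
      ((p.tRoot n i ^ (-sgn (form (μ, 0) (u (simpleRoot n i)))) : ℂˣ) : ℂ) := by
  intro μ
  have hus := hu.mul (inW_sRefl i)
  obtain ⟨a, b, c, d, e⟩ := conj_setup hu i μ
  have hs := pairing_inv_sign hu i μ
  have hp := form_root_pos (n := n) i
  rw [Module.End.mul_apply, Module.End.mul_apply, ← affMonomial_fst p, hatOp_affMonomial hu.inv,
    LinearMap.sub_apply, LinearMap.smul_apply, Module.End.one_apply]
  set g := u⁻¹ (μ, 0) with hg
  beta_reduce
  have hne : pairing (simpleCoroot n i) g ≠ 0 → g.1 ≠ (sRefl i g).1 := by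
    intro h0 h1
    rw [sRefl_apply, Prod.fst_sub, Prod.smul_fst, eq_comm, sub_eq_self] at h1
    exact smul_ne_zero h0 (simpleRoot_fst_ne_zero i) h1
  rcases lt_trichotomy (pairing (simpleCoroot n i) g) 0 with h0 | h0 | h0
  · have h1 := hatOp_midSpan (p := p) hus c d (hne h0.ne) (noumiOp_of_neg (p := p) i h0)
    have h2 : form (μ, 0) (u (simpleRoot n i)) < 0 := by nlinarith
    rw [sgn, if_neg (by omega), neg_neg, zpow_one]
    rw [map_sub, map_add, map_smul, map_smul, hatOp_affMonomial hus, hatOp_affMonomial hus, a] at h1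
    convert h1 using 1
    rw [map_sub, map_smul, hatOp_affMonomial hus]
    abel
  · have h2 : form (μ, 0) (u (simpleRoot n i)) = 0 := by rw [h0] at hs; omega
    rw [noumiOp_of_zero i h0, ← sub_smul, sub_sub_cancel, map_smul, hatOp_affMonomial hus, b, h0,
      zero_smul, sub_zero, h2, sgn, if_pos le_rfl, zpow_neg_one, Units.val_inv_eq_inv_val, sub_self]
    exact zero_mem _
  · have h1 := hatOp_midSpan (p := p) hus c d (hne h0.ne') (noumiOp_of_pos (p := p) i h0)
    have h2 : 0 < form (μ, 0) (u (simpleRoot n i)) := by nlinarith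
    rw [sgn, if_pos (by omega), zpow_neg_one, Units.val_inv_eq_inv_val]
    rw [map_sub, map_smul, hatOp_affMonomial hus, a] at h1
    have h3 : affMonomial p ((u * sRefl i) g) ∈ lowSpan μ :=
      affMonomial_mem_lowSpan p (prec_reflected hu i μ h0.ne' fun m => mul_nonneg h0.le (h m))
    have := sub_mem h1 (Submodule.smul_mem _ ((p.tRoot n i : ℂ) - (p.tRoot n i : ℂ)⁻¹) h3)
    convert this using 1
    rw [map_sub, map_smul, hatOp_affMonomial hus]
    abel

end Triangular

end

section

/-! ### Triangularity of the operators `Y_j` -/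

section TriangularY

variable {n : ℕ} [hn : Fact (2 ≤ n)] (p : Params)

/-- `û π(x)` is triangular with diagonal `d`. -/
def TriT (u : AffWeight n ≃ₗ[ℤ] AffWeight n) (x : (AffineHecke n p)ˣ) (d : Weight n → ℂˣ) : Prop :=
  InW u ∧ LowTri (hatOp p u * noumiRep p x) fun μ => (d μ : ℂ)

variable {p} {u : AffWeight n ≃ₗ[ℤ] AffWeight n} {x : (AffineHecke n p)ˣ} {d : Weight n → ℂˣ}

lemma triT_one : TriT p (1 : AffWeight n ≃ₗ[ℤ] AffWeight n) 1 1 := by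
  refine ⟨inW_one, ?_⟩
  rw [hatOp_one, Units.val_one, map_one, one_mul]
  simpa using lowTri_one

lemma TriT.step (h : TriT p u x d) (i : Fin (n + 1)) {g : AffWeight n}
    (hg : u (simpleRoot n i) = g) (hp : ∀ m, psum g.1 m ≤ 0) :
    TriT p (u * sRefl i) (uT p i * x) fun μ => p.tRoot n i ^ sgn (-form (μ, 0) g) * d μ := by
  subst hg
  refine ⟨h.1.mul (inW_sRefl i), ?_⟩
  have := (lowTri_conj (p := p) h.1 i hp).mul h.2
  convert this using 1
  · rw [Units.val_mul, map_mul, coe_uT, noumiRep_heckeT, mul_assoc _ (hatOp p u⁻¹),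
      ← mul_assoc (hatOp p u⁻¹), hatOp_inv_mul h.1, one_mul, mul_assoc]
  · funext μ
    rw [Units.val_mul]

lemma TriT.step_inv (h : TriT p u x d) (i : Fin (n + 1)) {g : AffWeight n}
    (hg : u (simpleRoot n i) = g) (hp : ∀ m, 0 ≤ psum g.1 m) :
    TriT p (u * sRefl i) ((uT p i)⁻¹ * x) fun μ => p.tRoot n i ^ (-sgn (form (μ, 0) g)) * d μ := by
  subst hg
  refine ⟨h.1.mul (inW_sRefl i), ?_⟩
  have := (lowTri_conj_inv (p := p) h.1 i hp).mul h.2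
  convert this using 1
  · rw [Units.val_mul, map_mul, coe_uT_inv, map_sub, map_smul, map_one, noumiRep_heckeT, Params.c,
      mul_assoc _ (hatOp p u⁻¹), ← mul_assoc (hatOp p u⁻¹), hatOp_inv_mul h.1, one_mul, mul_assoc]
  · funext μ
    rw [Units.val_mul]

lemma TriT.congr (h : TriT p u x d) {x' : (AffineHecke n p)ˣ} {d' : Weight n → ℂˣ} (hx : x' = x)
    (hd : ∀ μ, d' μ = d μ) : TriT p u x' d' := by
  obtain rfl := hx
  obtain rfl : d' = d := funext hd
  exact h

/-- The `m`-th coordinate, numbered from zero. -/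
def co (μ : Weight n) (m : ℕ) : ℤ := form (μ, 0) (affE n m)

lemma co_eq (μ : Weight n) (j : Fin n) : co μ j = μ j := by
  rw [co, form_comm, affE_eq j.2, form_eq_pairing]
  simp [pairing, Pi.single_apply]

lemma form_sub_right (g g' h : AffWeight n) : form h (g - g') = form h g - form h g' := by
  simp [form, mul_sub, Finset.sum_sub_distrib]

lemma form_affD_right (h : AffWeight n) : form h (affD n) = 0 := by simp [form, affD]

lemma psum_affE {k : ℕ} (hk : k < n) (m : ℕ) : psum (affE n k).1 m = if k < m then 1 else 0 := by
  rw [affE_eq hk, psum_single]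

lemma psum_affD (m : ℕ) : psum (affD n).1 m = 0 := by simp [psum, affD]

lemma psum_oth {j k : ℕ} (hk : k + 1 < n) (m : ℕ) : psum (oth n j k).1 m =
    if (if k < j then k else k + 1) < m then 1 else 0 := by
  rw [oth, apply_ite Prod.fst, apply_ite (psum · m), psum_affE (by omega), psum_affE hk]
  split_ifs <;> rfl

lemma form_oth (μ : Weight n) (j k : ℕ) :
    form (μ, 0) (oth n j k) = co μ (if k < j then k else k + 1) := by
  rw [oth, co]
  split_ifs <;> rfl

/-- The word for Y^{ε_j} is read from right to left. The inverse letters come first: they bring ε_j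
to the front and meet the finite positive roots ε_k - ε_j, k < j, as `TriT.step_inv` requires. -/
lemma triT_phase_one {j : ℕ} (hj : j < n) : ∀ i ≤ j, ∃ u : AffWeight n ≃ₗ[ℤ] AffWeight n,
    IsTrack u (pat (affE n j) j (j - i)) ∧
    TriT p u (prodDown n p (j - i) * (prodDown n p j)⁻¹) fun μ =>
      p.t ^ (-∑ k ∈ Finset.Ico (j - i) j, sgn (co μ k - co μ j)) := by
  intro i
  induction i with
  | zero =>
    intro _
    exact ⟨1, isTrack_one j, triT_one.congr (by simp) (by simp)⟩
  | succ i ih =>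
    intro hi
    obtain ⟨u, h1, h2⟩ := ih (by omega)
    obtain ⟨k, hk⟩ : ∃ k, j - i = k + 1 := ⟨j - i - 1, by omega⟩
    have hk' : j - (i + 1) = k := by omega
    rw [hk']
    rw [hk] at h1 h2
    have hkn : k + 1 < n := by omega
    refine ⟨_, h1.down hkn, (h2.step_inv _ (h1.root_down hkn) fun m => ?_).congr ?_ fun μ => ?_⟩
    · rw [Prod.fst_sub, psum_sub, psum_oth hkn, psum_affE hj]
      split_ifs <;> omega
    · rw [prodDown, ← mul_assoc, inv_mul_cancel_left]
    · rw [tRoot_mid p hkn, ← zpow_add, form_sub_right, form_oth, if_pos (by omega),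
        Finset.sum_eq_sum_Ico_succ_bot (by omega : k < j), neg_add]
      rfl

/-- The letters T_0, T_1, …, T_{n-1} meet δ - 2ε_j and the δ - ε_j - ε_k, whose gradients are
negative, so `TriT.step` applies. -/
lemma triT_phase_three {j : ℕ} (hj : j < n) : ∀ k < n, ∃ u : AffWeight n ≃ₗ[ℤ] AffWeight n,
    IsTrack u (pat (affD n - affE n j) j k) ∧
    TriT p u (prodDown n p k * uT p 0 * (prodDown n p j)⁻¹) fun μ =>
      p.t ^ (∑ l ∈ Finset.range k, sgn (co μ j + co μ (if l < j then l else l + 1))) *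
        (p.t0 ^ sgn (2 * co μ j) *
          p.t ^ (-∑ k ∈ Finset.range j, sgn (co μ k - co μ j))) := by
  intro k
  induction k with
  | zero =>
    intro _
    obtain ⟨u, h1, h2⟩ := triT_phase_one (p := p) hj j le_rfl
    rw [Nat.sub_self] at h1 h2
    refine ⟨_, h1.zero, (h2.step 0 h1.root_zero fun m => ?_).congr ?_ fun μ => ?_⟩
    · rw [Prod.fst_sub, Prod.smul_fst, psum_sub, psum_smul, psum_affE hj, psum_affD]
      split_ifs <;> omega
    · simp [prodDown]
    · rw [tRoot_zero, form_sub_right, form_affD_right, form_smul_right, zero_sub, neg_neg,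
        Finset.range_zero, Finset.sum_empty, zpow_zero, one_mul, ← Finset.range_eq_Ico]
      rfl
  | succ k ih =>
    intro hk
    obtain ⟨u, h1, h2⟩ := ih (by omega)
    refine ⟨_, h1.up hk, (h2.step _ (h1.root_up hk) fun m => ?_).congr ?_ fun μ => ?_⟩
    · rw [Prod.fst_sub, Prod.fst_sub, psum_sub, psum_sub, psum_oth hk, psum_affE hj, psum_affD]
      split_ifs <;> omega
    · rw [prodDown]; group
    · rw [tRoot_mid p hk, form_sub_right, form_sub_right, form_oth, form_affD_right,
        Finset.sum_range_succ, zpow_add, zero_sub, neg_sub', neg_neg, sub_neg_eq_add,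
        mul_comm (p.t ^ _) (p.t ^ _), mul_assoc]
      rfl

/-- The exponent of `t` in the eigenvalue of `Y_j` at `x^μ`. -/
def tExp (n : ℕ) (μ : Weight n) (j : ℕ) : ℤ :=
  ∑ l ∈ Finset.Ico j (n - 1), sgn (co μ j - co μ (l + 1)) +
    (∑ l ∈ Finset.range (n - 1), sgn (co μ j + co μ (if l < j then l else l + 1)) -
      ∑ k ∈ Finset.range j, sgn (co μ k - co μ j))

/-- T_n meets 2δ - 2ε_j, and the letters leading back to place j meet δ + ε_k - ε_j with k > j. The
gradients are again negative. -/
lemma triT_phase_five {j : ℕ} (hj : j < n) : ∀ i, i + j < n → ∃ u : AffWeight n ≃ₗ[ℤ] AffWeight n,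
    IsTrack u (pat (affE n j - affD n) j (n - 1 - i)) ∧
    TriT p u ((prodUp n p (n - 1 - i))⁻¹ * (prodUp n p (n - 1) * (uT p (idx n n) *
      (prodDown n p (n - 1) * uT p 0 * (prodDown n p j)⁻¹)))) fun μ =>
      p.t ^ (∑ l ∈ Finset.Ico (n - 1 - i) (n - 1), sgn (co μ j - co μ (l + 1))) *
      (p.tn ^ sgn (2 * co μ j) *
      (p.t ^ (∑ l ∈ Finset.range (n - 1), sgn (co μ j + co μ (if l < j then l else l + 1))) *
        (p.t0 ^ sgn (2 * co μ j) *
          p.t ^ (-∑ k ∈ Finset.range j, sgn (co μ k - co μ j))))) := by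
  intro i
  induction i with
  | zero =>
    intro _
    obtain ⟨u, h1, h2⟩ := triT_phase_three (p := p) hj (n - 1) (by omega)
    have h3 := h1.last
    rw [neg_sub] at h3
    refine ⟨_, h3, (h2.step _ h1.root_last fun m => ?_).congr ?_ fun μ => ?_⟩
    · rw [Prod.smul_fst, Prod.fst_sub, psum_smul, psum_sub, psum_affE hj, psum_affD]
      split_ifs <;> omega
    · rw [Nat.sub_zero, inv_mul_cancel_left]
    · rw [tRoot_last, form_smul_right, form_sub_right, form_affD_right, zero_sub, mul_neg, neg_neg,
        Nat.sub_zero, Finset.Ico_self, Finset.sum_empty, zpow_zero, one_mul]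
      rfl
  | succ i ih =>
    intro hi
    obtain ⟨u, h1, h2⟩ := ih (by omega)
    obtain ⟨k, hk⟩ : ∃ k, n - 1 - i = k + 1 := ⟨n - 1 - i - 1, by omega⟩
    have hk' : n - 1 - (i + 1) = k := by omega
    rw [hk']
    rw [hk] at h1 h2
    have hkn : k + 1 < n := by omega
    refine ⟨_, h1.down hkn, (h2.step _ (h1.root_down hkn) fun m => ?_).congr ?_ fun μ => ?_⟩
    · rw [Prod.fst_sub, Prod.fst_sub, psum_sub, psum_sub, psum_oth hkn, psum_affE hj, psum_affD,
        if_neg (show ¬ k < j by omega)]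
      split_ifs <;> omega
    · rw [prodUp.eq_2 (n := n) (p := p) k]; group
    · rw [tRoot_mid p hkn, form_sub_right, form_sub_right, form_oth, form_affD_right,
        if_neg (show ¬ k < j by omega), Finset.sum_eq_sum_Ico_succ_bot (by omega : k < n - 1),
        zpow_add, sub_zero, neg_sub, mul_assoc]
      rfl

/-- At the end of the word the twist is the translation by -ε_j. It acts diagonally on monomials,
and removing it contributes the factor q^{μ_j}. -/
lemma lowTri_yE {j : ℕ} (hj : j < n) : LowTri (noumiRep p (yE p ⟨j, hj⟩)) fun μ =>
    ((p.t0 ^ sgn (2 * co μ j) * p.tn ^ sgn (2 * co μ j) * p.t ^ tExp n μ j * p.q ^ co μ j : ℂˣ) :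
      ℂ) := by
  obtain ⟨u, h1, h2⟩ := triT_phase_five (p := p) hj (n - 1 - j) (by omega)
  rw [show n - 1 - (n - 1 - j) = j by omega] at h1 h2
  obtain rfl := h1.eq_tauE hj
  obtain ⟨h3, h4⟩ := h2
  have e : (prodUp n p j)⁻¹ * (prodUp n p (n - 1) * (uT p (idx n n) *
      (prodDown n p (n - 1) * uT p 0 * (prodDown n p j)⁻¹))) = yE p ⟨j, hj⟩ := by
    rw [yE_eq, yE_zero]; group
  rw [e] at h4
  have hinv : LowTri (hatOp p (tauE (-Pi.single (⟨j, hj⟩ : Fin n) 1))⁻¹) fun μ =>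
      ((p.q ^ co μ j : ℂˣ) : ℂ) := by
    intro μ
    rw [← affMonomial_fst p, hatOp_affMonomial h3.inv, tauE_inv_apply, pairing_neg, pairing_single,
      affMonomial_eq_smul, affMonomial_fst]
    have := co_eq μ ⟨j, hj⟩
    simp only at this
    simp only [this, zero_sub, neg_neg, sub_self]
    exact zero_mem _
  have h5 := hinv.mul h4
  rw [← mul_assoc, hatOp_inv_mul h3, one_mul] at h5
  convert h5 using 1
  funext μ
  rw [← Units.val_mul]
  congr 1
  rw [tExp, zpow_add, sub_eq_add_neg, zpow_add]
  have ac : ∀ a b c d e f : ℂˣ, d * e * (a * (b * c)) * f = f * (a * (e * (b * (d * c)))) := by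
    intros; ac_rfl
  exact ac _ _ _ _ _ _

/-! ### Comparison of the diagonal entries with γ_μ. -/

/-- The contribution of the pair `{i, j}` to the `j`-th coordinate of `ρ_m`. -/
def rhoTerm (v : Weight n) (i j : Fin n) : ℤ :=
  if i < j then sgn (v i + v j) - sgn (v i - v j)
  else if j < i then sgn (v i + v j) + sgn (v j - v i) else 0

lemma rhoM_eq (v : Weight n) (j : Fin n) : rhoM v j = ∑ i, rhoTerm v i j := by
  rw [rhoM, Finset.sum_apply]
  simp only [Finset.sum_apply]
  have h1 : ∀ i k : Fin n, (if i < k then sgn (v i - v k) • (Pi.single i 1 - Pi.single k 1) +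
      sgn (v i + v k) • (Pi.single i 1 + Pi.single k 1) else 0 : Weight n) j =
      (if j = i then (if i < k then sgn (v i - v k) + sgn (v i + v k) else 0) else 0) +
      (if j = k then (if i < k then sgn (v i + v k) - sgn (v i - v k) else 0) else 0) := by
    intro i k
    split_ifs with h2 h3 h4 h4 <;>
      (simp_all; try ring)
  simp only [h1, Finset.sum_add_distrib]
  rw [Finset.sum_comm]
  simp only [Finset.sum_ite_eq, Finset.mem_univ, if_true]
  rw [← Finset.sum_add_distrib]
  refine Finset.sum_congr rfl fun i _ => ?_
  rw [rhoTerm]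
  rcases lt_trichotomy i j with h | rfl | h
  · rw [if_neg h.not_gt, if_pos h, if_pos h, zero_add]
  · simp
  · rw [if_pos h, if_neg h.not_gt, if_neg h.not_gt, if_pos h, add_zero, add_comm, add_comm (v i)]

lemma tExp_eq (v : Weight n) (j : Fin n) : tExp n v j = rhoM v j := by
  have h2 := hn.out
  have hj := j.2
  have h1 : ∀ i : Fin n, rhoTerm v i j = if (i : ℕ) < j then sgn (co v i + co v j) -
      sgn (co v i - co v j) else if (j : ℕ) < i then sgn (co v i + co v j) +
      sgn (co v j - co v i) else 0 := by
    intro i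
    simp only [co_eq]
    rfl
  have a0 : ∀ F : ℕ → ℤ, ∑ i ∈ Finset.Ico ((j : ℕ) + 1) n, F i =
      ∑ i ∈ Finset.Ico (j : ℕ) (n - 1), F (i + 1) := fun F => by
    rw [Finset.sum_Ico_add', Nat.sub_add_cancel (by omega)]
  rw [rhoM_eq, Finset.sum_congr rfl fun i _ => h1 i, Fin.sum_univ_eq_sum_range
    (fun i => if i < (j : ℕ) then sgn (co v i + co v j) -
      sgn (co v i - co v j) else if (j : ℕ) < i then sgn (co v i + co v j) +
      sgn (co v j - co v i) else 0), Finset.range_eq_Ico,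
    ← Finset.sum_Ico_consecutive _ (Nat.zero_le j) hj.le, Finset.sum_eq_sum_Ico_succ_bot hj,
    if_neg (lt_irrefl _), if_neg (lt_irrefl _), zero_add, tExp, Finset.range_eq_Ico,
    ← Finset.sum_Ico_consecutive _ (Nat.zero_le j) (show (j : ℕ) ≤ n - 1 by omega),
    a0]
  have a1 : ∀ i ∈ Finset.Ico 0 (j : ℕ), (if i < (j : ℕ) then sgn (co v i + co v j) -
      sgn (co v i - co v j) else if (j : ℕ) < i then sgn (co v i + co v j) +
      sgn (co v j - co v i) else 0) = sgn (co v j + co v (if i < (j : ℕ) then i else i + 1)) -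
      sgn (co v i - co v j) := by
    intro i hi
    have := (Finset.mem_Ico.1 hi).2
    rw [if_pos this, if_pos this, add_comm (co v i)]
  have a2 : ∀ i ∈ Finset.Ico (j : ℕ) (n - 1), (if i + 1 < (j : ℕ) then sgn (co v (i + 1) + co v j) -
      sgn (co v (i + 1) - co v j) else if (j : ℕ) < i + 1 then sgn (co v (i + 1) + co v j) +
      sgn (co v j - co v (i + 1)) else 0) =
      sgn (co v j + co v (if i < (j : ℕ) then i else i + 1)) + sgn (co v j - co v (i + 1)) := by
    intro i hi
    have := (Finset.mem_Ico.1 hi).1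
    rw [if_neg (by omega), if_pos (by omega), if_neg (by omega), add_comm (co v j)]
  rw [Finset.sum_congr rfl a1, Finset.sum_congr rfl a2, Finset.sum_sub_distrib,
    Finset.sum_add_distrib, Finset.range_eq_Ico]
  ring

lemma rhoL_eq (v : Weight n) (j : Fin n) : rhoL v j = sgn (2 * v j) := by
  simp [rhoL, Finset.sum_apply, Pi.single_apply]

lemma lowTri_gam (j : Fin n) :
    LowTri (noumiRep p (yE p j)) fun μ => (gam p μ j : ℂ) := by
  have := lowTri_yE (p := p) j.2
  convert this using 1
  funext μ
  rw [gam, tExp_eq, rhoL_eq, co_eq]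

end TriangularY

end

section

/-! ### The spectrum -/

section Spectrum

variable {n : ℕ} [hn : Fact (2 ≤ n)] {p : Params}

/-- The tie-breaking key. -/
def tieKey (v : Weight n) (i : Fin n) : ℤ := if 0 ≤ v i then 3 * n - i else i

/-- The linear order on the coordinates that underlies `ρ_m(v)`. -/
def Below (v : Weight n) (i j : Fin n) : Prop :=
  (v i).natAbs < (v j).natAbs ∨ (v i).natAbs = (v j).natAbs ∧ tieKey v i < tieKey v j

lemma Below.trans {v : Weight n} {i j k : Fin n} (h : Below v i j) (h' : Below v j k) :
    Below v i k := by
  simp only [Below] at *; omega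

lemma Below.irrefl (v : Weight n) (i : Fin n) : ¬ Below v i i := by simp [Below]

lemma below_total (v : Weight n) {i j : Fin n} (h : i ≠ j) : Below v i j ∨ Below v j i := by
  have hi := i.2
  have hj := j.2
  have : (i : ℕ) ≠ j := fun h' => h (Fin.ext h')
  simp only [Below, tieKey]
  split_ifs <;> omega

open Classical in
/-- The number of coordinates below the `j`-th. -/
def rk (v : Weight n) (j : Fin n) : ℕ := (Finset.univ.filter fun i => Below v i j).card

lemma rk_lt (v : Weight n) (j : Fin n) : rk v j < n := by
  classical
  conv_rhs => rw [← Fintype.card_fin n]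
  refine Finset.card_lt_univ_of_notMem (x := j) ?_
  simp [Below.irrefl]

lemma Below.rk_lt {v : Weight n} {i j : Fin n} (h : Below v i j) : rk v i < rk v j := by
  classical
  refine Finset.card_lt_card ⟨fun k hk => ?_, fun hh => ?_⟩
  · simp only [Finset.mem_filter, Finset.mem_univ, true_and] at *
    exact hk.trans h
  · have := hh (Finset.mem_filter.2 ⟨Finset.mem_univ i, h⟩)
    simp [Below.irrefl] at this

lemma rk_injective (v : Weight n) : Function.Injective (rk v) := by
  intro i j hij
  by_contra hne
  rcases below_total v hne with h | h <;> have := h.rk_lt <;> omega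

/-- Each pair of coordinates contributes ±2, with the sign of the entry, to the one of larger
absolute value and nothing to the other. `tieKey` resolves ties as the convention ε(0) = 1 dictates.
The ranks are distinct and less than n, which bounds the exponents needed for genericity. -/
lemma rhoM_eq_rk (v : Weight n) (j : Fin n) : rhoM v j = 2 * sgn (v j) * rk v j := by
  classical
  rw [rhoM_eq, rk, Finset.card_filter, Nat.cast_sum, Finset.mul_sum]
  refine Finset.sum_congr rfl fun i _ => ?_
  have hi := i.2
  have hj := j.2
  rcases eq_or_ne i j with rfl | hij
  · simp [rhoTerm, Below]
  have : (i : ℕ) ≠ j := fun h' => hij (Fin.ext h')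
  simp only [rhoTerm, Below, tieKey, Fin.lt_def, sgn]
  split_ifs <;> omega

lemma sgn_cases (m : ℤ) : 0 ≤ m ∧ sgn m = 1 ∨ m < 0 ∧ sgn m = -1 := by
  rw [sgn]; split_ifs <;> omega

lemma sgn_eq (m : ℤ) : sgn m = 1 ∨ sgn m = -1 := by rcases sgn_cases m with h | h <;> simp [h.2]

lemma gam_eq (v : Weight n) (j : Fin n) :
    gam p v j = (p.t0 * p.tn) ^ sgn (v j) * p.t ^ (2 * (sgn (v j) * rk v j)) * p.q ^ v j := by
  have : sgn (2 * v j) = sgn (v j) := by simp only [sgn]; split_ifs <;> omega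
  rw [gam, rhoM_eq_rk, rhoL_eq, this, mul_zpow, mul_assoc 2]

lemma sq_mul_eq_neg_one {a b c : ℂˣ} (h : a * b * c = -(a / b)) : b ^ 2 * c = -1 := by
  have h' := congrArg Units.val h
  push_cast at h'
  have ha := a.ne_zero
  have hb := b.ne_zero
  apply Units.ext
  push_cast
  field_simp at h'
  linear_combination h'

lemma sq_mul_inv_eq_neg_one {a b c : ℂˣ} (h : (a * b)⁻¹ * c = -(a / b)) :
    a ^ 2 * c⁻¹ = -1 := by
  have h' := congrArg Units.val h
  push_cast at h'
  have ha := a.ne_zero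
  have hb := b.ne_zero
  have hc := c.ne_zero
  apply Units.ext
  push_cast
  field_simp at h' ⊢
  linear_combination h'

lemma zpow_two_mul_natCast (a : ℂˣ) (k : ℕ) : a ^ (2 * (k : ℤ)) = a ^ (2 * k) := by
  rw [← zpow_natCast]; push_cast; rfl

/-! ### Consequences of genericity. -/

variable (hp : p.IsGeneric n)
include hp

lemma Params.IsGeneric.t_zpow {k m : ℤ} (hk : k.natAbs ≤ n) (h : p.t ^ (2 * k) * p.q ^ m = 1) :
    k = 0 ∧ m = 0 := by
  rcases lt_trichotomy k 0 with h0 | rfl | h0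
  · refine absurd ?_ (hp.t_pow_ne k.natAbs (by omega) hk (-m))
    rw [← zpow_natCast, show ((2 * k.natAbs : ℕ) : ℤ) = -(2 * k) by omega, zpow_neg, zpow_neg,
      ← mul_inv, h, inv_one]
  · refine ⟨rfl, ?_⟩
    by_contra hm
    exact hp.q_pow_ne m hm (by simpa using h)
  · refine absurd ?_ (hp.t_pow_ne k.natAbs (by omega) hk m)
    rw [← zpow_natCast, show ((2 * k.natAbs : ℕ) : ℤ) = 2 * k by omega, h]

lemma Params.IsGeneric.t0tn_zpow {k m : ℤ} (h0 : 0 ≤ k) (hk : k + 2 ≤ 2 * n) :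
    (p.t0 * p.tn) ^ (2 : ℤ) * p.t ^ (2 * k) * p.q ^ m ≠ 1 := by
  intro h
  refine hp.t0tn_ne k.natAbs (by omega) m ?_
  rw [← zpow_natCast p.t, show ((2 * k.natAbs : ℕ) : ℤ) = 2 * k by omega, ← mul_pow,
    ← zpow_ofNat (p.t0 * p.tn)]
  exact h

lemma Params.IsGeneric.t0tn_zpow_neg {k m : ℤ} (h0 : 0 ≤ k) (hk : k + 2 ≤ 2 * n) :
    (p.t0 * p.tn) ^ (-2 : ℤ) * p.t ^ (2 * -k) * p.q ^ m ≠ 1 := by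
  intro h
  refine hp.t0tn_zpow h0 hk (m := -m) ?_
  have := congrArg (·⁻¹) h
  simpa only [mul_inv, ← zpow_neg, neg_neg, inv_one, mul_neg] using this

/-- With equal signs the quotient of the two sides is t^{2(k-k')} q^{m-m'} up to inversion of the
t-part, and `t_zpow` applies. With opposite signs it contains (t_0 t_n)^{±2} t^{±2(k+k')}, which is
excluded. -/
lemma Params.IsGeneric.spectral {s s' k k' m m' : ℤ} (hs : s = 1 ∨ s = -1) (hs' : s' = 1 ∨ s' = -1)
    (h1 : s = s' → (s * k - s' * k').natAbs ≤ n)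
    (h2 : s = -s' → 0 ≤ k + k' ∧ k + k' + 2 ≤ 2 * n)
    (h : (p.t0 * p.tn) ^ s * p.t ^ (2 * (s * k)) * p.q ^ m =
      (p.t0 * p.tn) ^ s' * p.t ^ (2 * (s' * k')) * p.q ^ m') : s = s' ∧ k = k' ∧ m = m' := by
  have key : (p.t0 * p.tn) ^ (s - s') * p.t ^ (2 * (s * k - s' * k')) * p.q ^ (m - m') = 1 := by
    rw [mul_sub, zpow_sub, zpow_sub, zpow_sub, ← mul_inv_eq_one.2 h, mul_inv, mul_inv]
    ac_rfl
  rcases hs with rfl | rfl <;> rcases hs' with rfl | rfl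
  · rw [sub_self, zpow_zero, one_mul] at key
    have := hp.t_zpow (h1 rfl) key
    omega
  · obtain ⟨a, b⟩ := h2 rfl
    rw [show (1 * k - -1 * k') = k + k' by ring] at key
    exact absurd key (hp.t0tn_zpow a b)
  · obtain ⟨a, b⟩ := h2 rfl
    rw [show (-1 * k - 1 * k') = -(k + k') by ring] at key
    exact absurd key (hp.t0tn_zpow_neg a b)
  · rw [sub_self, zpow_zero, one_mul] at key
    have := hp.t_zpow (h1 rfl) key
    omega


/-- Stronger than injectivity of λ ↦ γ_λ: a single entry determines a coordinate, even across
different positions. This is needed for permuted spectra. -/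
lemma Params.IsGeneric.gam_inj {v w : Weight n} {i j : Fin n} (h : gam p v i = gam p w j) :
    v i = w j := by
  rw [gam_eq, gam_eq] at h
  have a := rk_lt v i
  have b := rk_lt w j
  refine (hp.spectral (sgn_eq _) (sgn_eq _) (fun e => ?_) (fun _ => by omega) h).2.2
  rw [e]
  rcases sgn_eq (w j) with e | e <;> rw [e] <;> omega

lemma Params.IsGeneric.gam_inj_inv {v w : Weight n} {i j : Fin n} (h : gam p v i = (gam p w j)⁻¹) :
    v i = -w j := by
  rw [gam_eq, gam_eq, mul_inv, mul_inv, ← zpow_neg, ← zpow_neg, ← zpow_neg, ← mul_neg,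
    ← neg_mul] at h
  have a := rk_lt v i
  have b := rk_lt w j
  have hs : -sgn (w j) = 1 ∨ -sgn (w j) = -1 := by rcases sgn_eq (w j) with e | e <;> omega
  refine (hp.spectral (sgn_eq _) hs (fun e => ?_) (fun _ => by omega) h).2.2
  rw [e]
  rcases sgn_eq (w j) with e | e <;> rw [e] <;> omega

lemma Params.IsGeneric.gam_injective {v w : Weight n} (h : gam p v = gam p w) : v = w := by
  ext j
  exact hp.gam_inj (congrFun h j)

lemma Params.IsGeneric.gam_ne_t_sq {v : Weight n} {i j : Fin n} (hij : v i ≠ v j) :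
    gam p v i ≠ p.t ^ (2 : ℤ) * gam p v j := by
  intro h
  have hne : i ≠ j := fun h => hij (h ▸ rfl)
  -- Two distinct ranks below n have sum between 1 and 2n - 3, which leaves room for the shift by
  -- one caused by t².
  have hr : rk v i ≠ rk v j := fun h => hne (rk_injective v h)
  have a := rk_lt v i
  have b := rk_lt v j
  have e : p.t ^ (2 : ℤ) * gam p v j = (p.t0 * p.tn) ^ sgn (v j) *
      p.t ^ (2 * (sgn (v j) * ((rk v j : ℤ) + sgn (v j)))) * p.q ^ v j := by
    rw [gam_eq, show 2 * (sgn (v j) * ((rk v j : ℤ) + sgn (v j))) =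
      2 * (sgn (v j) * (rk v j : ℤ)) + 2 by
        rcases sgn_eq (v j) with e | e <;> rw [e] <;> ring, zpow_add]
    have ac : ∀ a b c d : ℂˣ, d * (a * b * c) = a * (b * d) * c := by intros; ac_rfl
    exact ac _ _ _ _
  rw [e, gam_eq] at h
  refine hij (hp.spectral (sgn_eq _) (sgn_eq _) (fun e => ?_) (fun e => ?_) h).2.2
  · rw [e]
    rcases sgn_eq (v j) with e | e <;> rw [e] <;> omega
  · rcases sgn_eq (v j) with e | e <;> rw [e] <;> omega

/-- These are the four values of the Y_n-eigenvalue at which T_n could act by a scalar. The first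
two have the form of a spectral value with rank and weight zero; the last two contradict the
conditions on t_0² and t_n². -/
lemma Params.IsGeneric.gam_ne_last {v : Weight n} {i : Fin n} (hi : v i ≠ 0) :
    gam p v i ≠ p.t0 * p.tn ∧ gam p v i ≠ (p.t0 * p.tn)⁻¹ ∧ gam p v i ≠ -(p.t0 / p.tn) ∧
      gam p v i ≠ -(p.tn / p.t0) := by
  have a := rk_lt v i
  have e1 : p.t0 * p.tn = (p.t0 * p.tn) ^ (1 : ℤ) * p.t ^ (2 * ((1 : ℤ) * 0)) * p.q ^ (0 : ℤ) := by
    simp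
  have e2 : (p.t0 * p.tn)⁻¹ =
      (p.t0 * p.tn) ^ (-1 : ℤ) * p.t ^ (2 * ((-1 : ℤ) * 0)) * p.q ^ (0 : ℤ) := by
    simp
  refine ⟨fun h => ?_, fun h => ?_, fun h => ?_, fun h => ?_⟩
  · rw [gam_eq] at h
    have h := h.trans e1
    refine hi (hp.spectral (sgn_eq _) (Or.inl rfl) (fun e => ?_) (fun _ => by omega) h).2.2
    rw [e]; omega
  · rw [gam_eq] at h
    have h := h.trans e2
    refine hi (hp.spectral (sgn_eq _) (Or.inr rfl) (fun e => ?_) (fun _ => by omega) h).2.2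
    rw [e]; omega
  · rw [gam_eq, mul_assoc] at h
    rcases sgn_eq (v i) with e | e <;> rw [e] at h
    · rw [zpow_one, one_mul, zpow_two_mul_natCast] at h
      refine hp.tn_ne (rk v i) a (v i) ?_
      rw [mul_assoc]
      exact sq_mul_eq_neg_one h
    · rw [neg_one_mul, mul_neg, zpow_neg (p.t), zpow_neg_one, zpow_two_mul_natCast] at h
      refine hp.t0_ne (rk v i) a (-v i) ?_
      have := sq_mul_inv_eq_neg_one h
      rwa [mul_inv, inv_inv, ← zpow_neg, ← mul_assoc] at this
  · rw [gam_eq, mul_assoc, mul_comm p.t0] at h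
    rcases sgn_eq (v i) with e | e <;> rw [e] at h
    · rw [zpow_one, one_mul, zpow_two_mul_natCast] at h
      refine hp.t0_ne (rk v i) a (v i) ?_
      rw [mul_assoc]
      exact sq_mul_eq_neg_one h
    · rw [neg_one_mul, mul_neg, zpow_neg (p.t), zpow_neg_one, zpow_two_mul_natCast] at h
      refine hp.tn_ne (rk v i) a (-v i) ?_
      have := sq_mul_inv_eq_neg_one h
      rwa [mul_inv, inv_inv, ← zpow_neg, ← mul_assoc] at this

end Spectrum

end

section

/-! ### Non-symmetric Koornwinder polynomials -/

section Eigenbasis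

variable {n : ℕ} [hn : Fact (2 ≤ n)] (p : Params)

/-- The homomorphism `f ↦ f(Y)`. -/
def yA : Laurent n →ₐ[ℂ] AffineHecke n p :=
  AddMonoidAlgebra.lift ℂ (AffineHecke n p) (Weight n)
    { toFun := fun v => ((yU p v.toAdd : (AffineHecke n p)ˣ) : AffineHecke n p)
      map_one' := by rw [toAdd_one, yU_zero]; rfl
      map_mul' := fun v w => by rw [toAdd_mul, yU_add, Units.val_mul] }

lemma yA_single (v : Weight n) (a : ℂ) :
    yA p (AddMonoidAlgebra.single v a) = a • ((yU p v : (AffineHecke n p)ˣ) : AffineHecke n p) := by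
  rw [yA, AddMonoidAlgebra.lift_single]; rfl

lemma yMap_eq (f : Laurent n) : yMap n p f = yA p f := by
  have : yMap n p = (yA p).toLinearMap := by
    refine laurent_hom_ext fun v => ?_
    rw [AlgHom.toLinearMap_apply, yA_single, coe_yU]
    exact monoLin_single _ _ _
  rw [this]; rfl

variable {p}

lemma prec_induction {motive : Weight n → Prop}
    (step : ∀ μ, (∀ κ, Prec κ μ → motive κ) → motive μ) (μ : Weight n) : motive μ :=
  prec_wellFounded.induction μ step

lemma LowTri.add {A B : Module.End ℂ (Laurent n)} {d e : Weight n → ℂ} (hA : LowTri A d)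
    (hB : LowTri B e) : LowTri (A + B) (fun μ => d μ + e μ) := by
  intro μ
  convert add_mem (hA μ) (hB μ) using 1
  rw [LinearMap.add_apply]
  module

lemma LowTri.smul {A : Module.End ℂ (Laurent n)} {d : Weight n → ℂ} (hA : LowTri A d) (a : ℂ) :
    LowTri (a • A) (fun μ => a * d μ) := by
  intro μ
  convert (lowSpan μ).smul_mem a (hA μ) using 1
  rw [LinearMap.smul_apply]
  module

/-- Induction along ≺: B already preserves the lower span, so applying B to A x^μ = d(μ) x^μ + lower
terms gives its leading term. -/
lemma LowTri.of_mul_eq_one {A B : Module.End ℂ (Laurent n)} {d : Weight n → ℂ} (hA : LowTri A d)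
    (hd : ∀ μ, d μ ≠ 0) (h : B * A = 1) : LowTri B (fun μ => (d μ)⁻¹) := by
  intro μ
  induction μ using prec_induction with
  | step μ ih =>
    have hl : ∀ f ∈ lowSpan μ, B f ∈ lowSpan μ := by
      intro f hf
      refine Submodule.span_induction ?_ ?_ ?_ ?_ hf
      · rintro _ ⟨κ, hκ, rfl⟩
        have := (lowSpan μ).add_mem (lowSpan_mono hκ (ih κ hκ))
          ((lowSpan μ).smul_mem (d κ)⁻¹ (single_mem_lowSpan hκ 1))
        simpa using this
      · rw [map_zero]; exact zero_mem _
      · intro x y _ _ hx hy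
        rw [map_add]; exact add_mem hx hy
      · intro a x _ hx
        rw [map_smul]; exact Submodule.smul_mem _ _ hx
    have h1 := hl _ (hA μ)
    rw [map_sub, map_smul, ← Module.End.mul_apply, h, Module.End.one_apply] at h1
    have h2 := (lowSpan μ).smul_mem (-(d μ)⁻¹) h1
    convert h2 using 1
    rw [smul_sub, smul_smul, neg_mul, inv_mul_cancel₀ (hd μ)]
    module

lemma lowTri_gam_neg (j : Fin n) :
    LowTri (noumiRep p ((yE p j)⁻¹ : (AffineHecke n p)ˣ)) fun μ => ((gam p μ j)⁻¹ : ℂˣ) := by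
  simp only [Units.val_inv_eq_inv_val]
  refine (lowTri_gam j).of_mul_eq_one (fun μ => Units.ne_zero _) ?_
  rw [← map_mul, Units.inv_mul, map_one]

lemma lowTri_yU (v : Weight n) :
    LowTri (noumiRep p (yU p v)) fun μ => ((∏ j, gam p μ j ^ v j : ℂˣ) : ℂ) := by
  have hz : ∀ (j : Fin n) (k : ℤ), LowTri (noumiRep p (yU p (Pi.single j k))) fun μ =>
      ((gam p μ j ^ k : ℂˣ) : ℂ) := by
    intro j k
    induction k with
    | zero =>
      rw [Pi.single_zero, yU_zero, Units.val_one, map_one]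
      simpa using lowTri_one
    | succ k ih =>
      rw [Pi.single_add, yU_add, Units.val_mul, map_mul]
      convert ih.mul (lowTri_gam j) using 1
      funext μ
      rw [zpow_add_one, Units.val_mul]
    | pred k ih =>
      rw [Pi.single_sub, sub_eq_add_neg, yU_add, yU_neg, Units.val_mul, map_mul]
      convert ih.mul (lowTri_gam_neg j) using 1
      funext μ
      rw [zpow_sub_one, Units.val_mul]
  have hs : ∀ s : Finset (Fin n), LowTri (noumiRep p (yU p (∑ j ∈ s, Pi.single j (v j)))) fun μ =>
      ((∏ j ∈ s, gam p μ j ^ v j : ℂˣ) : ℂ) := by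
    classical
    intro s
    induction s using Finset.induction_on with
    | empty =>
      rw [Finset.sum_empty, yU_zero, Units.val_one, map_one]
      simpa using lowTri_one
    | insert a s ha ih =>
      rw [Finset.sum_insert ha, yU_add, Units.val_mul, map_mul]
      convert (hz a (v a)).mul ih using 1
      funext μ
      rw [Finset.prod_insert ha, Units.val_mul]
  have := hs Finset.univ
  rwa [Finset.univ_sum_single] at this

lemma lowTri_yA (f : Laurent n) : LowTri (noumiRep p (yA p f)) fun μ => evalA (gam p μ) f := by
  induction f using AddMonoidAlgebra.induction_linear with
  | zero =>
    intro μ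
    simp
  | add f g hf hg =>
    rw [map_add, map_add]
    convert hf.add hg using 1
    funext μ
    rw [map_add]
  | single v a =>
    rw [yA_single, map_smul]
    convert (lowTri_yU v).smul a using 1
    funext μ
    rw [evalA_single]

variable (hp : p.IsGeneric n)
include hp

/-- A product of linear factors, one for each κ in S, in a coordinate where γ_κ and γ_μ differ. -/
lemma exists_separating (S : Finset (Weight n)) {μ : Weight n} (hμ : μ ∉ S) :
    ∃ f : Laurent n, evalA (gam p μ) f = 1 ∧ ∀ κ ∈ S, evalA (gam p κ) f = 0 := by
  have h1 : ∀ κ ∈ S, ∃ f : Laurent n, evalA (gam p μ) f = 1 ∧ evalA (gam p κ) f = 0 := by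
    intro κ hκ
    have hne : gam p μ ≠ gam p κ := fun h => hμ (hp.gam_injective h ▸ hκ)
    obtain ⟨j, hj⟩ := Function.ne_iff.1 hne
    have hj' : (gam p μ j : ℂ) - gam p κ j ≠ 0 :=
      sub_ne_zero.2 fun h => hj (Units.ext h)
    refine ⟨((gam p μ j : ℂ) - gam p κ j)⁻¹ • (affMonomial p (Pi.single j 1, 0) -
      algebraMap ℂ _ (gam p κ j : ℂ)), ?_, ?_⟩
    · rw [map_smul, map_sub, evalA_affMonomial, chr_single, AlgHom.commutes, smul_eq_mul]
      exact inv_mul_cancel₀ hj'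
    · rw [map_smul, map_sub, evalA_affMonomial, chr_single, AlgHom.commutes, smul_eq_mul]
      simp
  choose! f hf using h1
  refine ⟨∏ κ ∈ S, f κ, ?_, fun κ hκ => ?_⟩
  · rw [map_prod]
    exact Finset.prod_eq_one fun κ hκ => (hf κ hκ).1
  · rw [map_prod]
    exact Finset.prod_eq_zero hκ (hf κ hκ).2

omit hp in
lemma yA_mul_apply (f g : Laurent n) (v : Laurent n) :
    noumiRep p (yA p (f * g)) v = noumiRep p (yA p f) (noumiRep p (yA p g) v) := by
  rw [map_mul, map_mul]; rfl

omit hp in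
-- The factor of index κ maps x^κ to lower monomials, and inductively the remaining factors kill
-- those, since T contains everything below κ.
lemma yA_prod_kill {T : Finset (Weight n)} {F : Weight n → Laurent n}
    (hF : ∀ κ, evalA (gam p κ) (F κ) = 0) {κ : Weight n} (hκ : κ ∈ T) (hT : ∀ ν, Prec ν κ → ν ∈ T) :
    noumiRep p (yA p (∏ κ ∈ T, F κ)) (AddMonoidAlgebra.single κ 1) = 0 := by
  classical
  induction κ using prec_induction generalizing T with
  | step κ ih =>
    rw [← Finset.prod_erase_mul T F hκ, yA_mul_apply]
    have h1 := lowTri_yA (p := p) (F κ) κ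
    beta_reduce at h1
    rw [hF, zero_smul, sub_zero] at h1
    have h2 : ∀ f ∈ lowSpan κ, noumiRep p (yA p (∏ κ ∈ T.erase κ, F κ)) f = 0 := by
      intro f hf
      refine Submodule.span_induction ?_ ?_ ?_ ?_ hf
      · rintro _ ⟨ν, hν, rfl⟩
        exact ih ν hν (Finset.mem_erase.2 ⟨hν.1, hT ν hν⟩) fun ν' hν' =>
          Finset.mem_erase.2 ⟨(hν'.trans hν).1, hT _ (hν'.trans hν)⟩
      · rw [map_zero]
      · intro x y _ _ hx hy
        rw [map_add, hx, hy, add_zero]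
      · intro a x _ hx
        rw [map_smul, hx, smul_zero]
    exact h2 _ h1

omit hp in
lemma single_notMem_lowSpan (μ : Weight n) : AddMonoidAlgebra.single μ (1 : ℂ) ∉ lowSpan μ := by
  rw [lowSpan, AddMonoidAlgebra.single_mem_span_single]
  exact Prec.irrefl μ

/-- Apply to x^μ the product over κ ≺ μ of polynomials F_κ(Y) with F_κ(γ_κ) = 0 and F_κ(γ_μ) = 1.
The product kills the lower span and keeps the leading coefficient. Since f(Y) x^μ - f(γ_μ) x^μ is
in the lower span, commutativity makes the result an eigenvector. -/
lemma exists_koornwinder (μ : Weight n) : ∃ P : Laurent n,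
    P - AddMonoidAlgebra.single μ 1 ∈ lowSpan μ ∧
    ∀ f : Laurent n, noumiRep p (yA p f) P = evalA (gam p μ) f • P := by
  have h1 : ∀ κ, ∃ f : Laurent n, (κ ≠ μ → evalA (gam p μ) f = 1) ∧ evalA (gam p κ) f = 0 := by
    intro κ
    by_cases h : κ = μ
    · exact ⟨0, fun h' => absurd h h', map_zero _⟩
    · obtain ⟨f, hf, hf'⟩ := exists_separating hp {κ} (μ := μ) (by simpa using Ne.symm h)
      exact ⟨f, fun _ => hf, hf' κ (by simp)⟩
  choose F hF hF' using h1
  set T := (finite_prec μ).toFinset with hT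
  have hT' : ∀ κ, κ ∈ T ↔ Prec κ μ := fun κ => by simp [hT]
  refine ⟨noumiRep p (yA p (∏ κ ∈ T, F κ)) (AddMonoidAlgebra.single μ 1), ?_, fun f => ?_⟩
  · have := lowTri_yA (p := p) (∏ κ ∈ T, F κ) μ
    beta_reduce at this
    rwa [map_prod (evalA _), Finset.prod_eq_one fun κ hκ => hF κ ((hT' κ).1 hκ).1,
      one_smul] at this
  · have h1 := lowTri_yA (p := p) f μ
    have h2 : ∀ g ∈ lowSpan μ, noumiRep p (yA p (∏ κ ∈ T, F κ)) g = 0 := by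
      intro g hg
      refine Submodule.span_induction ?_ ?_ ?_ ?_ hg
      · rintro _ ⟨ν, hν, rfl⟩
        exact yA_prod_kill hF' ((hT' ν).2 hν) fun ν' hν' => (hT' ν').2 (hν'.trans hν)
      · rw [map_zero]
      · intro x y _ _ hx hy
        rw [map_add, hx, hy, add_zero]
      · intro a x _ hx
        rw [map_smul, hx, smul_zero]
    have h3 := h2 _ h1
    rw [map_sub, map_smul, ← yA_mul_apply, mul_comm, yA_mul_apply] at h3
    exact sub_eq_zero.1 h3

/-- The monic non-symmetric Koornwinder polynomial. -/
def koorn (μ : Weight n) : Laurent n := (exists_koornwinder hp μ).choose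

lemma koorn_sub_mem (μ : Weight n) : koorn hp μ - AddMonoidAlgebra.single μ 1 ∈ lowSpan μ :=
  (exists_koornwinder hp μ).choose_spec.1

lemma yA_koorn (f : Laurent n) (μ : Weight n) :
    noumiRep p (yA p f) (koorn hp μ) = evalA (gam p μ) f • koorn hp μ :=
  (exists_koornwinder hp μ).choose_spec.2 f

omit hp in
lemma ne_zero_of_sub_mem {μ : Weight n} {P : Laurent n}
    (h : P - AddMonoidAlgebra.single μ 1 ∈ lowSpan μ) : P ≠ 0 := by
  rintro rfl
  rw [zero_sub] at h
  exact single_notMem_lowSpan μ (by simpa using neg_mem h)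

lemma linearIndependent_koorn : LinearIndependent ℂ (koorn hp) := by
  classical
  rw [linearIndependent_iff']
  intro S c hc μ hμ
  obtain ⟨f, h1, h2⟩ := exists_separating hp (S.erase μ) (Finset.notMem_erase μ S)
  have h3 := congrArg (noumiRep p (yA p f)) hc
  simp only [map_sum, map_smul, yA_koorn, map_zero] at h3
  rw [Finset.sum_eq_single_of_mem μ hμ, h1, one_smul] at h3
  · exact (smul_eq_zero.1 h3).resolve_right (ne_zero_of_sub_mem (koorn_sub_mem hp μ))
  · intro κ hκ hne
    rw [h2 κ (Finset.mem_erase.2 ⟨hne, hκ⟩), zero_smul, smul_zero]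

lemma span_koorn : ⊤ ≤ Submodule.span ℂ (Set.range (koorn hp)) := by
  have h1 : ∀ μ : Weight n, AddMonoidAlgebra.single μ (1 : ℂ) ∈
      Submodule.span ℂ (Set.range (koorn hp)) := by
    intro μ
    induction μ using prec_induction with
    | step μ ih =>
      have h2 : lowSpan μ ≤ Submodule.span ℂ (Set.range (koorn hp)) := by
        refine Submodule.span_le.2 ?_
        rintro _ ⟨κ, hκ, rfl⟩
        exact ih κ hκ
      have := sub_mem (Submodule.subset_span (R := ℂ) (Set.mem_range_self (f := koorn hp) μ))
        (h2 (koorn_sub_mem hp μ))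
      rwa [sub_sub_cancel] at this
  rw [← (AddMonoidAlgebra.basis (Weight n) ℂ).span_eq, Submodule.span_le]
  rintro _ ⟨μ, rfl⟩
  exact h1 μ

/-- The basis of non-symmetric Koornwinder polynomials. -/
def koornBasis : Module.Basis (Weight n) ℂ (Laurent n) :=
  Module.Basis.mk (linearIndependent_koorn hp) (span_koorn hp)

lemma koornBasis_apply (μ : Weight n) : koornBasis hp μ = koorn hp μ := Module.Basis.mk_apply _ _ μ

lemma repr_yA (f v : Laurent n) (κ : Weight n) :
    (koornBasis hp).repr (noumiRep p (yA p f) v) κ =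
      evalA (gam p κ) f * (koornBasis hp).repr v κ := by
  have : Finsupp.lapply κ ∘ₗ (koornBasis hp).repr.toLinearMap ∘ₗ noumiRep p (yA p f) =
      evalA (gam p κ) f • (Finsupp.lapply κ ∘ₗ (koornBasis hp).repr.toLinearMap) := by
    refine (koornBasis hp).ext fun μ => ?_
    simp only [LinearMap.comp_apply, LinearMap.smul_apply, LinearEquiv.coe_coe, koornBasis_apply,
      yA_koorn, map_smul]
    rw [← koornBasis_apply, Module.Basis.repr_self]
    simp only [Finsupp.lapply_apply, smul_eq_mul]
    rcases eq_or_ne μ κ with rfl | h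
    · rfl
    · rw [Finsupp.single_eq_of_ne h.symm, mul_zero, mul_zero]
  exact LinearMap.congr_fun this v

/-- Simultaneous eigenvectors of the `Y_j` are multiples of basis vectors. -/
lemma eigenvector_eq {y : Fin n → ℂˣ} {v : Laurent n} (hv : v ≠ 0)
    (h : ∀ j, noumiRep p (yE p j) v = (y j : ℂ) • v) :
    ∃ κ, gam p κ = y ∧ ∃ c : ℂ, c ≠ 0 ∧ v = c • koorn hp κ := by
  have hE : ∀ j : Fin n, ((yE p j : (AffineHecke n p)ˣ) : AffineHecke n p) =
      yA p (AddMonoidAlgebra.single (Pi.single j 1) 1) := by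
    intro j
    rw [yA_single, one_smul, yE]
  have h1 : ∀ κ, (koornBasis hp).repr v κ ≠ 0 → gam p κ = y := by
    intro κ hκ
    ext j
    have := congrArg (fun w => (koornBasis hp).repr w κ) (h j)
    simp only [hE, repr_yA, map_smul, Finsupp.smul_apply, smul_eq_mul] at this
    have := mul_right_cancel₀ hκ this
    rwa [← affMonomial_fst p, evalA_affMonomial, chr_single] at this
  have h2 : (koornBasis hp).repr v ≠ 0 := by simpa using hv
  obtain ⟨κ, hκ⟩ := Finsupp.ne_iff.1 h2
  have hy := h1 κ hκ
  refine ⟨κ, hy, (koornBasis hp).repr v κ, hκ, ?_⟩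
  refine (koornBasis hp).repr.injective (Finsupp.ext fun ν => ?_)
  rw [← koornBasis_apply, map_smul, Module.Basis.repr_self, Finsupp.smul_apply, smul_eq_mul]
  rcases eq_or_ne ν κ with rfl | hne
  · rw [Finsupp.single_eq_same, mul_one]
  · rw [Finsupp.single_eq_of_ne hne, mul_zero]
    by_contra h3
    exact hne (hp.gam_injective ((h1 ν h3).trans hy.symm))

lemma isKoornwinderBasis_koornBasis : IsKoornwinderBasis (noumiRep p) (koornBasis hp) := by
  intro μ
  rw [koornBasis_apply]
  refine ⟨koorn_sub_mem hp μ, fun f => ?_⟩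
  rw [yMap_eq, yA_koorn, evalA_eq]

/-- The joint eigenspaces are lines, so the two vectors are proportional, and both being monic fixes
the factor. -/
lemma koornBasis_unique {P : Module.Basis (Weight n) ℂ (Laurent n)}
    (h : IsKoornwinderBasis (noumiRep p) P) : P = koornBasis hp := by
  refine Module.Basis.eq_of_apply_eq fun μ => ?_
  rw [koornBasis_apply]
  obtain ⟨h1, h2⟩ := h μ
  change _ ∈ lowSpan μ at h1
  obtain ⟨κ, hκ, c, -, hc⟩ := eigenvector_eq hp (y := gam p μ) (ne_zero_of_sub_mem h1) (fun j => by
    have := h2 (AddMonoidAlgebra.single (Pi.single j 1) 1)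
    rw [yMap_eq, yA_single, one_smul, ← evalA_eq, ← affMonomial_fst p, evalA_affMonomial,
      chr_single] at this
    exact this)
  obtain rfl := hp.gam_injective hκ
  have h3 := sub_mem h1 ((lowSpan κ).smul_mem c (koorn_sub_mem hp κ))
  rw [hc, smul_sub, sub_sub_sub_cancel_left] at h3
  have h4 : (c - 1) • AddMonoidAlgebra.single κ (1 : ℂ) ∈ lowSpan κ := by
    convert h3 using 1
    module
  have h5 : c - 1 = 0 := by
    by_contra h5
    exact single_notMem_lowSpan κ (((lowSpan κ).smul_mem_iff h5).1 h4)
  rw [hc, sub_eq_zero.1 h5, one_smul]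

end Eigenbasis

end

section

/-! ### The Bernstein relations -/

section Bernstein

variable {n : ℕ} [hn : Fact (2 ≤ n)] {p : Params}

lemma yA_single_one (v : Weight n) :
    yA p (AddMonoidAlgebra.single v 1) = ((yU p v : (AffineHecke n p)ˣ) : AffineHecke n p) := by
  rw [yA_single, one_smul]

lemma reflAct_single {i : Fin (n + 1)} (hi : i ≠ 0) (v : Weight n) :
    reflAct p i (AddMonoidAlgebra.single v 1) = AddMonoidAlgebra.single (sRefl i (v, 0)).1 1 := by
  rw [← affMonomial_fst p, reflAct_affMonomial, ← affMonomial_fst p]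
  congr 1
  exact Prod.ext rfl (sRefl_snd hi _)

lemma sRefl_fst_add (i : Fin (n + 1)) (v w : Weight n) :
    (sRefl i (v + w, 0)).1 = (sRefl i (v, 0)).1 + (sRefl i (w, 0)).1 := by
  rw [← Prod.fst_add, ← map_add, Prod.mk_add_mk, add_zero]

lemma sRefl_fst_neg (i : Fin (n + 1)) (v : Weight n) :
    (sRefl i (-v, 0)).1 = -(sRefl i (v, 0)).1 := by
  rw [← Prod.fst_neg, ← map_neg, Prod.neg_mk, neg_zero]

lemma heckeT_mul_yE_mid {k : ℕ} (hk : k + 1 < n) :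
    heckeT n p ⟨k + 1, by omega⟩ * (yE (n := n) p ⟨k, by omega⟩).val =
      (yE p ⟨k + 1, hk⟩).val * heckeT n p ⟨k + 1, by omega⟩ +
        p.c n ⟨k + 1, by omega⟩ • (yE (n := n) p ⟨k, by omega⟩).val := by
  set i : Fin (n + 1) := ⟨k + 1, by omega⟩
  have h : yE p ⟨k + 1, hk⟩ * uT p i = (uT p i)⁻¹ * yE (n := n) p ⟨k, by omega⟩ := by
    rw [yE_succ p hk, inv_mul_cancel_right]
  have h' := congrArg Units.val h
  rw [Units.val_mul, Units.val_mul, coe_uT_inv, coe_uT] at h'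
  rw [h', sub_mul, smul_mul_assoc, one_mul]
  abel

lemma heckeT_mul_yE_mid_succ {k : ℕ} (hk : k + 1 < n) :
    heckeT n p ⟨k + 1, by omega⟩ * (yE p ⟨k + 1, hk⟩).val =
      (yE (n := n) p ⟨k, by omega⟩).val * heckeT n p ⟨k + 1, by omega⟩ -
        p.c n ⟨k + 1, by omega⟩ • (yE (n := n) p ⟨k, by omega⟩).val := by
  set i : Fin (n + 1) := ⟨k + 1, by omega⟩
  have h : uT p i * yE p ⟨k + 1, hk⟩ = yE (n := n) p ⟨k, by omega⟩ * (uT p i)⁻¹ := by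
    rw [yE_succ p hk, mul_assoc (uT p _)⁻¹, mul_inv_cancel_left]
  have h' := congrArg Units.val h
  rw [Units.val_mul, Units.val_mul, coe_uT_inv, coe_uT] at h'
  rw [h', mul_sub, mul_smul_comm, mul_one]

/-- Y_n is T_n times a conjugate of T_0. So T_n⁻¹ Y_n and Y_n⁻¹ T_n are the corresponding conjugates
of T_0 and T_0⁻¹, which differ by the scalar t_0 - t_0⁻¹. -/
lemma heckeT_mul_yE_last :
    heckeT n p (Fin.last n) * (yE p (lstIdx n)).val =
      ((yE p (lstIdx n))⁻¹).val * heckeT n p (Fin.last n) +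
        (p.c n (Fin.last n) • (yE p (lstIdx n)).val + p.c n 0 • 1) := by
  obtain ⟨D, hD⟩ : ∃ D, yE p (lstIdx n) = uT p (Fin.last n) * (D * uT p 0 * D⁻¹) := ⟨_, yE_last p⟩
  have h1 : (uT p (Fin.last n))⁻¹ * yE p (lstIdx n) = D * uT p 0 * D⁻¹ := by
    rw [hD, inv_mul_cancel_left]
  have h2 : (yE p (lstIdx n))⁻¹ * uT p (Fin.last n) = D * (uT p 0)⁻¹ * D⁻¹ := by
    rw [hD]; group
  have h1' := congrArg Units.val h1
  have h2' := congrArg Units.val h2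
  rw [Units.val_mul, coe_uT_inv, Units.val_mul, Units.val_mul, coe_uT] at h1'
  rw [Units.val_mul, coe_uT, Units.val_mul, Units.val_mul, coe_uT_inv, mul_sub, sub_mul,
    mul_smul_comm, mul_one, smul_mul_assoc, Units.mul_inv, ← h1', sub_mul, smul_mul_assoc,
    one_mul] at h2'
  rw [h2']
  abel

/-- The weights whose monomials satisfy a Bernstein relation with `T_i`. -/
def bernsteinGroup (p : Params) (i : Fin (n + 1)) : AddSubgroup (Weight n) where
  carrier := {v | ∃ g, heckeT n p i * (yU p v).val =
    (yU p (sRefl i (v, 0)).1).val * heckeT n p i + yA p g}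
  zero_mem' := by
    refine ⟨0, ?_⟩
    rw [show (((0 : Weight n), (0 : ℤ)) : AffWeight n) = 0 from rfl, map_zero, Prod.fst_zero,
      yU_zero, map_zero, add_zero, Units.val_one, mul_one, one_mul]
  add_mem' := by
    rintro v w ⟨g, hg⟩ ⟨h, hh⟩
    refine ⟨AddMonoidAlgebra.single (sRefl i (v, 0)).1 1 * h + g * AddMonoidAlgebra.single w 1, ?_⟩
    rw [sRefl_fst_add, yU_add, yU_add, Units.val_mul, Units.val_mul, ← mul_assoc, hg, add_mul,
      mul_assoc, hh, map_add, map_mul, map_mul, yA_single_one, yA_single_one]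
    noncomm_ring
  neg_mem' := by
    rintro v ⟨g, hg⟩
    refine ⟨-(AddMonoidAlgebra.single (-(sRefl i (v, 0)).1) 1 * g *
      AddMonoidAlgebra.single (-v) 1), ?_⟩
    rw [sRefl_fst_neg, map_neg, map_mul, map_mul, yA_single_one, yA_single_one, yU_neg, yU_neg]
    set A := yU p v
    set B := yU p (sRefl i (v, 0)).1
    have h := congrArg (fun x => ((B⁻¹ : (AffineHecke n p)ˣ) : AffineHecke n p) * x *
      ((A⁻¹ : (AffineHecke n p)ˣ) : AffineHecke n p)) hg
    simp only [mul_add, add_mul] at h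
    rw [← mul_assoc, Units.mul_inv_cancel_right, Units.inv_mul_cancel_left] at h
    rw [h]
    abel

lemma single_mem_bernsteinGroup {i : Fin (n + 1)} (hi : i ≠ 0) (j : Fin n) :
    Pi.single j 1 ∈ bernsteinGroup p i := by
  have hc : pairing (simpleCoroot n i) (Pi.single j 1, 0) = 0 →
      Pi.single j 1 ∈ bernsteinGroup p i := by
    intro h
    refine ⟨0, ?_⟩
    rw [sRefl_apply, h, zero_smul, sub_zero, map_zero, add_zero]
    exact congrArg Units.val (uT_comm_yU p hi h)
  rcases index_cases i with rfl | ⟨k, hk, rfl⟩ | rfl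
  · exact absurd rfl hi
  · have e : ∀ m : Fin n, (sRefl ⟨k + 1, by omega⟩ (Pi.single m 1, (0 : ℤ))).1 =
        (Pi.single (Equiv.swap ⟨k, by omega⟩ ⟨k + 1, hk⟩ m) 1 : Weight n) := by
      intro m
      rw [sRefl_mid hk]
      exact single_swap _ _ _ _
    rcases eq_or_ne j ⟨k, by omega⟩ with rfl | h1
    · refine ⟨p.c n ⟨k + 1, by omega⟩ • AddMonoidAlgebra.single (Pi.single ⟨k, by omega⟩ 1) 1, ?_⟩
      rw [e, Equiv.swap_apply_left, map_smul, yA_single_one]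
      exact heckeT_mul_yE_mid hk
    · rcases eq_or_ne j ⟨k + 1, hk⟩ with rfl | h2
      · refine ⟨-(p.c n ⟨k + 1, by omega⟩ •
          AddMonoidAlgebra.single (Pi.single ⟨k, by omega⟩ 1) 1), ?_⟩
        rw [e, Equiv.swap_apply_right, map_neg, map_smul, yA_single_one, ← sub_eq_add_neg]
        exact heckeT_mul_yE_mid_succ hk
      · refine hc ?_
        rw [pairing_coroot_mid hk]
        simp [h1.symm, h2.symm]
  · rcases eq_or_ne j (lstIdx n) with rfl | h1
    · refine ⟨p.c n (Fin.last n) • AddMonoidAlgebra.single (Pi.single (lstIdx n) 1) 1 +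
        p.c n 0 • 1, ?_⟩
      rw [sRefl_last, map_add, map_smul, yA_single_one, map_smul, map_one]
      dsimp only
      rw [single_flip, if_pos rfl, Pi.single_neg, yU_neg]
      exact heckeT_mul_yE_last
    · refine hc ?_
      rw [pairing_coroot_last]
      simp [h1.symm]

/-- The weights satisfying such a relation form a group, so the ε_j suffice. The remainder g is
never needed explicitly; only that it is a function of Y matters. -/
lemma exists_bernstein {i : Fin (n + 1)} (hi : i ≠ 0) (f : Laurent n) :
    ∃ g, heckeT n p i * yA p f = yA p (reflAct p i f) * heckeT n p i + yA p g := by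
  induction f using AddMonoidAlgebra.induction_linear with
  | zero => exact ⟨0, by simp⟩
  | add f g hf hg =>
    obtain ⟨f', hf'⟩ := hf
    obtain ⟨g', hg'⟩ := hg
    refine ⟨f' + g', ?_⟩
    simp only [map_add, mul_add, add_mul, hf', hg']
    abel
  | single v a =>
    have hv : v ∈ bernsteinGroup p i := by
      rw [show v = ∑ j, v j • (Pi.single j 1 : Weight n) by
        conv_lhs => rw [← Finset.univ_sum_single v]
        refine Finset.sum_congr rfl fun j _ => ?_
        rw [← Pi.single_smul, smul_eq_mul, mul_one]]
      exact sum_mem fun j _ => zsmul_mem (single_mem_bernsteinGroup hi j) _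
    obtain ⟨g, hg⟩ := hv
    refine ⟨a • g, ?_⟩
    have e : AddMonoidAlgebra.single v a = a • AddMonoidAlgebra.single v (1 : ℂ) := by
      rw [AddMonoidAlgebra.smul_single, smul_eq_mul, mul_one]
    rw [e, map_smul, map_smul, map_smul, map_smul, reflAct_single hi, yA_single_one, yA_single_one,
      mul_smul_comm, hg, smul_mul_assoc, smul_add]

end Bernstein

/-! ### The action of `T_i` on the eigenbasis -/

section Intertwine

variable {n : ℕ} [hn : Fact (2 ≤ n)] {p : Params}

lemma refPt_mid {k : ℕ} (hk : k + 1 < n) (y : Fin n → ℂˣ) (j : Fin n) :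
    refPt p ⟨k + 1, by omega⟩ y j = y (Equiv.swap ⟨k, by omega⟩ ⟨k + 1, hk⟩ j) := by
  rw [refPt, sRefl_mid hk]
  dsimp only
  rw [single_swap, chr_single]

lemma refPt_last (y : Fin n → ℂˣ) (j : Fin n) :
    refPt p (Fin.last n) y j = if j = lstIdx n then (y j)⁻¹ else y j := by
  rw [refPt, sRefl_last]
  dsimp only
  rw [single_flip]
  split_ifs with h
  · rw [show ((Pi.single j (-1) : Weight n), (0 : ℤ)) = -(Pi.single j 1, 0) by
      rw [Prod.neg_mk, ← Pi.single_neg, neg_zero], chr_neg, chr_single]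
  · rw [chr_single]

lemma reflAct_reflAct (i : Fin (n + 1)) (f : Laurent n) : reflAct p i (reflAct p i f) = f :=
  sub_eq_zero.1 <| eq_zero_of_evalA fun y => by
    rw [map_sub, evalA_reflAct, evalA_reflAct, refPt_refPt, sub_self]

lemma evalA_injective (p : Params) {y z : Fin n → ℂˣ} (h : ∀ f, evalA y f = evalA z f) : y = z :=
  point_ext p fun g => Units.ext <| by
    rw [← evalA_affMonomial, ← evalA_affMonomial, h]

variable (hp : p.IsGeneric n)
include hp

lemma Params.IsGeneric.eq_sRefl {i : Fin (n + 1)} (hi : i ≠ 0) {κ μ : Weight n}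
    (h : refPt p i (gam p κ) = gam p μ) : κ = (sRefl i (μ, 0)).1 := by
  suffices h' : (sRefl i (κ, 0)).1 = μ by
    rw [← h']
    have e : sRefl i ((sRefl i (κ, (0 : ℤ))).1, 0) = (κ, 0) := by
      rw [show ((sRefl i (κ, (0 : ℤ))).1, (0 : ℤ)) = sRefl i (κ, 0) from
        Prod.ext rfl (sRefl_snd hi (κ, 0)).symm, ← LinearEquiv.mul_apply, sRefl_mul_self]
      rfl
    rw [e]
  ext j
  have hj := congrFun h j
  rcases index_cases i with rfl | ⟨k, hk, rfl⟩ | rfl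
  · exact absurd rfl hi
  · rw [refPt_mid hk] at hj
    rw [sRefl_mid hk]
    exact hp.gam_inj (v := κ) hj
  · rw [refPt_last] at hj
    rw [sRefl_last]
    dsimp only
    split_ifs at hj ⊢
    · have := hp.gam_inj_inv hj.symm
      omega
    · exact hp.gam_inj hj

/-- Apply the Bernstein relation to P_μ and compare coefficients at P_κ. The remainder contributes
only to P_μ, so a nonzero coefficient forces f(γ_μ) = (s_i f)(γ_κ) for all f. -/
lemma repr_heckeT_koorn {i : Fin (n + 1)} (hi : i ≠ 0) {μ κ : Weight n} (hne : κ ≠ μ)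
    (h : (koornBasis hp).repr (noumiRep p (heckeT n p i) (koorn hp μ)) κ ≠ 0) :
    refPt p i (gam p κ) = gam p μ := by
  refine evalA_injective p fun f => ?_
  obtain ⟨g, hg⟩ := exists_bernstein (p := p) hi f
  have h1 := congrArg (fun x => (koornBasis hp).repr (noumiRep p x (koorn hp μ)) κ) hg
  simp only [map_add, map_mul, LinearMap.add_apply, Module.End.mul_apply, Finsupp.add_apply,
    repr_yA, yA_koorn, map_smul, Finsupp.smul_apply, evalA_reflAct, smul_eq_mul] at h1
  rw [← koornBasis_apply hp μ, Module.Basis.repr_self, Finsupp.single_eq_of_ne hne, mul_zero,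
    add_zero, koornBasis_apply] at h1
  exact (mul_right_cancel₀ h h1).symm

lemma exists_heckeT_koorn {i : Fin (n + 1)} (hi : i ≠ 0) (μ : Weight n) :
    ∃ a b : ℂ, noumiRep p (heckeT n p i) (koorn hp μ) =
        a • koorn hp μ + b • koorn hp (sRefl i (μ, 0)).1 ∧
      (b ≠ 0 → gam p μ = refPt p i (gam p (sRefl i (μ, 0)).1)) := by
  classical
  set μ' := (sRefl i (μ, 0)).1 with hμ'
  set v := noumiRep p (heckeT n p i) (koorn hp μ) with hv
  by_cases e : μ' = μ
  · refine ⟨(koornBasis hp).repr v μ, 0, ?_, fun h => absurd rfl h⟩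
    refine (koornBasis hp).repr.injective (Finsupp.ext fun κ => ?_)
    rw [zero_smul, add_zero, map_smul, ← koornBasis_apply, Module.Basis.repr_self,
      Finsupp.smul_single, smul_eq_mul, mul_one]
    rcases eq_or_ne κ μ with rfl | hne
    · rw [Finsupp.single_eq_same]
    · rw [Finsupp.single_eq_of_ne hne]
      by_contra h
      exact hne ((hp.eq_sRefl hi (repr_heckeT_koorn hp hi hne h)).trans e)
  · refine ⟨(koornBasis hp).repr v μ, (koornBasis hp).repr v μ', ?_,
      fun h => (repr_heckeT_koorn hp hi e h).symm⟩
    refine (koornBasis hp).repr.injective (Finsupp.ext fun κ => ?_)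
    rw [map_add, map_smul, map_smul, ← koornBasis_apply, ← koornBasis_apply,
      Module.Basis.repr_self, Module.Basis.repr_self,
      Finsupp.smul_single, Finsupp.smul_single, smul_eq_mul, mul_one, smul_eq_mul, mul_one,
      Finsupp.add_apply]
    rcases eq_or_ne κ μ with rfl | hne
    · rw [Finsupp.single_eq_same, Finsupp.single_eq_of_ne (Ne.symm e), add_zero]
    · rcases eq_or_ne κ μ' with rfl | hne'
      · rw [Finsupp.single_eq_same, Finsupp.single_eq_of_ne e, zero_add]
      · rw [Finsupp.single_eq_of_ne hne, Finsupp.single_eq_of_ne hne', add_zero]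
        by_contra h
        exact hne' (hp.eq_sRefl hi (repr_heckeT_koorn hp hi hne h))

lemma yE_koorn (j : Fin n) (μ : Weight n) :
    noumiRep p (yE p j).val (koorn hp μ) = (gam p μ j : ℂ) • koorn hp μ := by
  rw [yE, ← yA_single_one, yA_koorn, ← affMonomial_fst p, evalA_affMonomial, chr_single]

lemma yE_inv_koorn (j : Fin n) (μ : Weight n) :
    noumiRep p ((yE p j)⁻¹).val (koorn hp μ) = ((gam p μ j)⁻¹ : ℂ) • koorn hp μ := by
  have h := congrArg (noumiRep p ((yE p j)⁻¹).val) (yE_koorn hp j μ)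
  rw [← Module.End.mul_apply, ← map_mul, Units.inv_mul, map_one, map_smul,
    Module.End.one_apply] at h
  conv_rhs => rw [h]
  rw [smul_smul, inv_mul_cancel₀ (Units.ne_zero _), one_smul]

/-- The quadratic relation leaves only the scalars t_i and -t_i⁻¹. Inserting them into the Bernstein
relation gives an equation between entries of γ_μ that genericity forbids. -/
lemma heckeT_koorn_ne_smul {i : Fin (n + 1)} (hi : i ≠ 0) {μ : Weight n}
    (hμ : (sRefl i (μ, 0)).1 ≠ μ) (a : ℂ) :
    noumiRep p (heckeT n p i) (koorn hp μ) ≠ a • koorn hp μ := by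
  intro h
  have hP : koorn hp μ ≠ 0 := ne_zero_of_sub_mem (koorn_sub_mem hp μ)
  have hq := congrArg (fun x => noumiRep p x (koorn hp μ)) (heckeT_quadratic p i)
  simp only [map_add, map_mul, map_smul, map_one, LinearMap.add_apply, Module.End.mul_apply,
    LinearMap.smul_apply, Module.End.one_apply, h] at hq
  have hq' : a * a = p.c n i * a + 1 := by
    refine smul_left_injective ℂ hP ?_
    simp only [add_smul, mul_smul, one_smul, hq]
  have ht : (p.tRoot n i : ℂ) ≠ 0 := Units.ne_zero _
  have ha : a = p.tRoot n i ∨ a = -(p.tRoot n i : ℂ)⁻¹ := by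
    have : (a - p.tRoot n i) * (a + (p.tRoot n i : ℂ)⁻¹) = 0 := by
      rw [Params.c] at hq'
      linear_combination hq' - mul_inv_cancel₀ ht
    rcases mul_eq_zero.1 this with h | h
    · exact Or.inl (sub_eq_zero.1 h)
    · exact Or.inr (eq_neg_of_add_eq_zero_left h)
  rcases index_cases i with rfl | ⟨k, hk, rfl⟩ | rfl
  · exact hi rfl
  · have hy := congrArg (fun x => noumiRep p x (koorn hp μ)) (heckeT_mul_yE_mid (p := p) hk)
    simp only [map_add, map_mul, map_smul, LinearMap.add_apply, Module.End.mul_apply,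
      LinearMap.smul_apply, h, yE_koorn, smul_smul, ← add_smul] at hy
    have hy' := smul_left_injective ℂ hP hy
    have hne : μ ⟨k, by omega⟩ ≠ μ ⟨k + 1, hk⟩ := by
      intro e
      refine hμ ?_
      rw [sRefl_apply, pairing_coroot_mid hk]
      dsimp only
      rw [e, sub_self, zero_smul, sub_zero]
    have et : p.tRoot n ⟨k + 1, by omega⟩ = p.t := by rw [← idx_eq hk.le, tRoot_mid p hk]
    rw [et] at ha ht
    rw [Params.c, et] at hy'
    have g0 := Units.ne_zero (gam p μ ⟨k, by omega⟩)
    have h1 := hp.gam_ne_t_sq hne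
    have h2 := hp.gam_ne_t_sq hne.symm
    rcases ha with rfl | rfl
    · refine h1 (Units.ext ?_)
      push_cast
      field_simp at hy'
      rw [zpow_ofNat]
      linear_combination hy'
    · refine h2 (Units.ext ?_)
      push_cast
      field_simp at hy'
      rw [zpow_ofNat]
      linear_combination hy'
  · have hy := congrArg (fun x => noumiRep p x (koorn hp μ)) (heckeT_mul_yE_last (p := p) (n := n))
    simp only [map_add, map_mul, map_smul, map_one, LinearMap.add_apply, Module.End.mul_apply,
      LinearMap.smul_apply, Module.End.one_apply, h, yE_koorn, yE_inv_koorn, smul_smul,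
      ← add_smul] at hy
    have hy' := smul_left_injective ℂ hP hy
    have hne : μ (lstIdx n) ≠ 0 := by
      intro e
      refine hμ ?_
      rw [sRefl_apply, pairing_coroot_last]
      dsimp only
      rw [e, zero_smul, sub_zero]
    obtain ⟨h1, h2, h3, h4⟩ := hp.gam_ne_last hne
    have et : p.tRoot n (Fin.last n) = p.tn := by rw [← idx_last, tRoot_last]
    rw [et] at ha ht
    simp only [Params.c, et, tRoot_zero] at hy'
    have g0 := Units.ne_zero (gam p μ (lstIdx n))
    have t0 := Units.ne_zero p.t0
    rcases ha with rfl | rfl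
    -- For the scalar t_n the relation is a quadratic in the Y_n-eigenvalue with roots t_0 t_n and
    -- -t_n/t_0. For -t_n⁻¹ the roots are (t_0 t_n)⁻¹ and -t_0/t_n.
    · have e : ((gam p μ (lstIdx n) : ℂ) - p.t0 * p.tn) * (gam p μ (lstIdx n) * p.t0 + p.tn) = 0 := by
        field_simp at hy'
        linear_combination hy'
      rcases mul_eq_zero.1 e with e | e
      · exact h1 (Units.ext (by push_cast; exact sub_eq_zero.1 e))
      · refine h4 (Units.ext ?_)
        push_cast
        field_simp
        linear_combination e
    · have e : ((gam p μ (lstIdx n) : ℂ) * p.t0 * p.tn - 1) * (gam p μ (lstIdx n) * p.tn + p.t0) = 0 := by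
        field_simp at hy'
        linear_combination -hy'
      rcases mul_eq_zero.1 e with e | e
      · refine h2 (Units.ext ?_)
        push_cast
        field_simp
        linear_combination e
      · refine h3 (Units.ext ?_)
        push_cast
        field_simp
        linear_combination e

lemma exists_heckeT_koorn_of_ne {i : Fin (n + 1)} (hi : i ≠ 0) {μ : Weight n}
    (hμ : (sRefl i (μ, 0)).1 ≠ μ) :
    ∃ a b : ℂ, b ≠ 0 ∧ noumiRep p (heckeT n p i) (koorn hp μ) =
        a • koorn hp μ + b • koorn hp (sRefl i (μ, 0)).1 ∧
      gam p μ = refPt p i (gam p (sRefl i (μ, 0)).1) := by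
  obtain ⟨a, b, h, h'⟩ := exists_heckeT_koorn hp hi μ
  have hb : b ≠ 0 := by
    rintro rfl
    rw [zero_smul, add_zero] at h
    exact heckeT_koorn_ne_smul hp hi hμ a h
  exact ⟨a, b, hb, h, h' hb⟩

end Intertwine

end

section

/-! ### Connectedness of orbits -/

section Orbits

variable {n : ℕ} [hn : Fact (2 ≤ n)]

lemma sRefl_fst_sRefl_fst {i : Fin (n + 1)} (hi : i ≠ 0) (κ : Weight n) :
    (sRefl i ((sRefl i (κ, 0)).1, 0)).1 = κ := by
  rw [show ((sRefl i (κ, (0 : ℤ))).1, (0 : ℤ)) = sRefl i (κ, 0) from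
    Prod.ext rfl (sRefl_snd hi (κ, 0)).symm, ← LinearEquiv.mul_apply, sRefl_mul_self]
  rfl

lemma psum_simpleRoot_nonneg {i : Fin (n + 1)} (hi : i ≠ 0) (m : ℕ) :
    0 ≤ psum (simpleRoot n i).1 m := by
  rcases index_cases i with rfl | ⟨k, hk, rfl⟩ | rfl
  · exact absurd rfl hi
  · rw [simpleRoot_mid hk]
    dsimp only
    rw [psum_sub, psum_single, psum_single]
    dsimp only
    split_ifs <;> omega
  · rw [simpleRoot_last]
    dsimp only
    rw [two_smul, psum_add, psum_single]
    split_ifs <;> omega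

lemma sRefl_prec {i : Fin (n + 1)} (hi : i ≠ 0) {κ : Weight n}
    (h : 0 < pairing (simpleCoroot n i) (κ, 0)) : Prec (sRefl i (κ, 0)).1 κ := by
  have e : (sRefl i (κ, 0)).1 = κ - pairing (simpleCoroot n i) (κ, 0) • (simpleRoot n i).1 := by
    rw [sRefl_apply]; rfl
  refine prec_of_inOrbit (inOrbit_sRefl i (κ, 0)).symm ?_ fun m => ?_
  · intro h'
    rw [e, sub_eq_self, smul_eq_zero] at h'
    obtain ⟨_, _, _, _, _, h0⟩ := isRt_simpleRoot i
    exact h'.elim h.ne' h0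
  · rw [e, psum_sub, psum_smul]
    have := mul_nonneg h.le (psum_simpleRoot_nonneg hi m)
    omega

lemma isDominant_neg_of_pairing {κ : Weight n}
    (h : ∀ i : Fin (n + 1), i ≠ 0 → pairing (simpleCoroot n i) (κ, 0) ≤ 0) :
    IsDominant (-κ) := by
  have h2 := hn.out
  have h1 : ∀ d k : ℕ, ∀ hk : k + d < n, κ ⟨k, by omega⟩ ≤ κ ⟨k + d, hk⟩ := by
    intro d k
    induction d with
    | zero => exact fun _ => le_rfl
    | succ d ih =>
      intro hk
      refine (ih (by omega)).trans ?_
      have := h ⟨k + d + 1, by omega⟩ (by simp [Fin.ext_iff])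
      rw [pairing_coroot_mid (k := k + d) (by omega)] at this
      exact sub_nonpos.1 this
  have hm : Monotone κ := fun a b hab => by
    have hab' : (a : ℕ) + (b - a) = b := Nat.add_sub_of_le hab
    refine (h1 (b - a) a (hab'.trans_lt b.2)).trans_eq (congrArg κ (Fin.ext hab'))
  refine ⟨fun a b hab => neg_le_neg (hm hab), fun j => ?_⟩
  have h3 := h (Fin.last n) (by simp [Fin.ext_iff]; omega)
  rw [pairing_coroot_last] at h3
  have h4 : κ j ≤ κ (lstIdx n) := hm (by rw [Fin.le_def]; have := j.2; simp only [lstIdx]; omega)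
  rw [Pi.neg_apply]
  dsimp only at h3
  omega

lemma inOrbit_neg (κ : Weight n) : InOrbit κ (-κ) :=
  ⟨1, -1, by ext j; simp [weylAct]⟩

/-- Induction principle for orbits: stability under the finite simple reflections is enough. -/
lemma mem_of_inOrbit {S : Set (Weight n)}
    (hS : ∀ κ ∈ S, ∀ i : Fin (n + 1), i ≠ 0 → (sRefl i (κ, 0)).1 ∈ S) {κ μ : Weight n}
    (hκ : κ ∈ S) (h : InOrbit κ μ) : μ ∈ S := by
  -- Reflections in simple roots with positive pairing lower ν for ≺ until the antidominant weight
  -- of the orbit is reached, and each step can be undone inside S.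
  have key : ∀ ν : Weight n, ν ∈ S ↔ -dom ν ∈ S := by
    intro ν
    induction ν using prec_induction with
    | step ν ih =>
      by_cases hν : ∃ i : Fin (n + 1), i ≠ 0 ∧ 0 < pairing (simpleCoroot n i) (ν, 0)
      · obtain ⟨i, hi, hpos⟩ := hν
        have h1 := ih _ (sRefl_prec hi hpos)
        rw [← inOrbit_iff.1 (inOrbit_sRefl i (ν, 0))] at h1
        refine Iff.trans ⟨fun h => hS _ h i hi, fun h => ?_⟩ h1
        have := hS _ h i hi
        rwa [sRefl_fst_sRefl_fst hi] at this
      · have hd := isDominant_neg_of_pairing (κ := ν) fun i hi => not_lt.1 fun h' => hν ⟨i, hi, h'⟩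
        rw [dom_eq hd (inOrbit_neg ν), neg_neg]
  rw [key, ← inOrbit_iff.1 h, ← key]
  exact hκ

end Orbits

/-! ### The submodules of the polynomial representation -/

section Submodules

variable {n : ℕ} [hn : Fact (2 ≤ n)] {p : Params}

lemma adjoin_heckeT : Algebra.adjoin ℂ (Set.range (heckeT n p)) = ⊤ := by
  have h := congrArg (Subalgebra.map (RingQuot.mkAlgHom ℂ (HeckeRel n p)))
    (FreeAlgebra.adjoin_range_ι (R := ℂ) (X := Fin (n + 1)))
  rw [AlgHom.map_adjoin, Algebra.map_top, (AlgHom.range_eq_top _).2 (RingQuot.mkAlgHom_surjective _ _),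
    ← Set.range_comp] at h
  exact h

/-- T_0 is recovered from Y^{ε_1} and the other T_i by solving `yE_zero`. Working with units keeps
the required inverses in the subalgebra. -/
lemma subalgebra_eq_top {B : Subalgebra ℂ (AffineHecke n p)}
    (hT : ∀ i : Fin (n + 1), i ≠ 0 → heckeT n p i ∈ B) (hY : ∀ f, yA p f ∈ B) : B = ⊤ := by
  have h2 := hn.out
  have hU : ∀ i : Fin (n + 1), i ≠ 0 → uT p i ∈ B.toSubmonoid.units := fun i hi =>
    (Submonoid.mem_units_iff _ _).2 ⟨hT i hi, by
      rw [coe_uT_inv]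
      exact B.sub_mem (hT i hi) (B.smul_mem B.one_mem _)⟩
  have hi : ∀ k, k + 1 ≤ n → idx n (k + 1) ≠ 0 := fun k hk h => by
    have := congrArg Fin.val h
    rw [val_idx hk] at this
    simp at this
  have hd : ∀ k, k ≤ n → prodDown n p k ∈ B.toSubmonoid.units := by
    intro k hk
    induction k with
    | zero => exact one_mem _
    | succ k ih => exact mul_mem (hU _ (hi k hk)) (ih (by omega))
  have hu : ∀ k, k ≤ n → prodUp n p k ∈ B.toSubmonoid.units := by
    intro k hk
    induction k with
    | zero => exact one_mem _
    | succ k ih => exact mul_mem (ih (by omega)) (hU _ (hi k hk))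
  have hn0 : idx n n ≠ 0 := by
    have := hi (n - 1) (by omega)
    rwa [Nat.sub_add_cancel (by omega)] at this
  have hyE : yE p (fstIdx n) ∈ B.toSubmonoid.units := by
    refine (Submonoid.mem_units_iff _ _).2 ⟨?_, ?_⟩
    · rw [yE, ← yA_single_one]; exact hY _
    · rw [yE, ← yU_neg, ← yA_single_one]; exact hY _
  have h0 : uT p 0 ∈ B.toSubmonoid.units := by
    have : uT p 0 = (prodUp n p (n - 1) * uT p (idx n n) * prodDown n p (n - 1))⁻¹ *
        yE p (fstIdx n) := by rw [yE_zero, inv_mul_cancel_left]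
    rw [this]
    exact mul_mem (inv_mem (mul_mem (mul_mem (hu _ (by omega)) (hU _ hn0)) (hd _ (by omega)))) hyE
  rw [← top_le_iff, ← adjoin_heckeT, Algebra.adjoin_le_iff]
  rintro _ ⟨i, rfl⟩
  by_cases h : i = 0
  · subst h; exact ((Submonoid.mem_units_iff _ _).1 h0).1
  · exact hT i h

/-- The `H`-module structure of the Noumi representation. -/
abbrev noumiModule (p : Params) : Module (AffineHecke n p) (Laurent n) := repModule (noumiRep p)

attribute [local instance] noumiModule

lemma hecke_smul_def (h : AffineHecke n p) (v : Laurent n) : h • v = noumiRep p h v := rfl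

instance isScalarTower_noumi : IsScalarTower ℂ (AffineHecke n p) (Laurent n) :=
  ⟨fun c h v => by rw [hecke_smul_def, hecke_smul_def, map_smul, LinearMap.smul_apply]⟩

variable (hp : p.IsGeneric n)

/-- The span of the `P_μ`, `μ ∈ S`. -/
def koornSpan (S : Set (Weight n)) : Submodule ℂ (Laurent n) :=
  Submodule.span ℂ (koornBasis hp '' S)

lemma mem_koornSpan {S : Set (Weight n)} {v : Laurent n} :
    v ∈ koornSpan hp S ↔ ∀ κ, (koornBasis hp).repr v κ ≠ 0 → κ ∈ S := by
  rw [koornSpan, Module.Basis.mem_span_image]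
  exact ⟨fun h κ hκ => h (Finsupp.mem_support_iff.2 hκ),
    fun h κ hκ => h κ (Finsupp.mem_support_iff.1 hκ)⟩

lemma koorn_mem_koornSpan {S : Set (Weight n)} {μ : Weight n} :
    koorn hp μ ∈ koornSpan hp S ↔ μ ∈ S := by
  rw [mem_koornSpan, ← koornBasis_apply, Module.Basis.repr_self]
  refine ⟨fun h => h μ (by simp), fun h κ hκ => ?_⟩
  rcases eq_or_ne κ μ with rfl | hne
  · exact h
  · exact absurd (Finsupp.single_eq_of_ne hne) hκ

/-- The span of the `P_μ`, `μ ∈ S`, for a `W`-stable set `S`, as an `H`-submodule. -/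
def koornSubmodule (S : Set (Weight n))
    (hS : ∀ κ ∈ S, ∀ i : Fin (n + 1), i ≠ 0 → (sRefl i (κ, 0)).1 ∈ S) :
    Submodule (AffineHecke n p) (Laurent n) where
  __ := (koornSpan hp S).toAddSubmonoid
  smul_mem' := by
    -- The stabiliser of the span is a subalgebra containing the T_i, i ≠ 0, and all f(Y), hence
    -- everything. No condition involving s_0 is needed.
    let B : Subalgebra ℂ (AffineHecke n p) :=
      { carrier := {h | ∀ v ∈ koornSpan hp S, noumiRep p h v ∈ koornSpan hp S}
        mul_mem' := fun {a b} ha hb v hv => by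
          rw [map_mul]; exact ha _ (hb v hv)
        add_mem' := fun {a b} ha hb v hv => by
          rw [map_add]; exact add_mem (ha v hv) (hb v hv)
        algebraMap_mem' := fun c v hv => by
          rw [AlgHom.commutes]; exact Submodule.smul_mem _ c hv }
    have hgen : ∀ h, (∀ μ ∈ S, noumiRep p h (koorn hp μ) ∈ koornSpan hp S) → h ∈ B := by
      intro h hh v hv
      refine Submodule.span_induction ?_ ?_ ?_ ?_ hv
      · rintro _ ⟨μ, hμ, rfl⟩
        rw [koornBasis_apply]; exact hh μ hμ
      · rw [map_zero]; exact zero_mem _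
      · intro x y _ _ hx hy
        rw [map_add]; exact add_mem hx hy
      · intro a x _ hx
        rw [map_smul]; exact Submodule.smul_mem _ _ hx
    have hB : B = ⊤ := by
      refine subalgebra_eq_top (fun i hi => hgen _ fun μ hμ => ?_) fun f => hgen _ fun μ hμ => ?_
      · obtain ⟨a, b, h, -⟩ := exists_heckeT_koorn hp hi μ
        rw [h]
        exact add_mem (Submodule.smul_mem _ _ ((koorn_mem_koornSpan hp).2 hμ))
          (Submodule.smul_mem _ _ ((koorn_mem_koornSpan hp).2 (hS μ hμ i hi)))
      · rw [yA_koorn]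
        exact Submodule.smul_mem _ _ ((koorn_mem_koornSpan hp).2 hμ)
    intro h v hv
    exact (hB ▸ Algebra.mem_top : h ∈ B) v hv

/-- The submodule `𝒜(λ)`. -/
def orbitSubmodule (lam : Weight n) : Submodule (AffineHecke n p) (Laurent n) :=
  koornSubmodule hp {μ | InOrbit lam μ} fun κ hκ i _ => hκ.trans (inOrbit_sRefl i (κ, 0))

lemma koorn_mem_orbitSubmodule {lam μ : Weight n} :
    koorn hp μ ∈ orbitSubmodule hp lam ↔ InOrbit lam μ := koorn_mem_koornSpan hp

lemma mem_orbitSubmodule {lam : Weight n} {v : Laurent n} :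
    v ∈ orbitSubmodule hp lam ↔ ∀ κ, (koornBasis hp).repr v κ ≠ 0 → InOrbit lam κ :=
  mem_koornSpan hp

lemma complex_smul_mem (M : Submodule (AffineHecke n p) (Laurent n)) (c : ℂ) {v : Laurent n}
    (hv : v ∈ M) : c • v ∈ M := M.smul_of_tower_mem c hv

lemma isInternal_orbitSubmodule :
    DirectSum.IsInternal fun lam : DominantWeight n => orbitSubmodule hp lam.1 := by
  refine DirectSum.isInternal_submodule_of_iSupIndep_of_iSup_eq_top (fun lam => ?_) ?_
  -- The other summands all lie in the span of the P_μ outside the orbit of λ, which meets 𝒜(λ)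
  -- trivially.
  · have h : ⨆ mu, ⨆ (_ : mu ≠ lam), orbitSubmodule hp mu.1 ≤
        koornSubmodule hp {μ | ¬ InOrbit lam.1 μ} fun κ hκ i _ h =>
          hκ (h.trans (inOrbit_sRefl i (κ, 0)).symm) := by
      refine iSup₂_le fun mu hmu v hv => (mem_koornSpan hp).2 fun κ hκ hlam => hmu ?_
      exact Subtype.ext (mu.2.eq_of_inOrbit lam.2
        (((mem_orbitSubmodule hp).1 hv κ hκ).trans hlam.symm))
    refine Disjoint.mono_right h (Submodule.disjoint_def.2 fun v hv hv' => ?_)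
    refine (koornBasis hp).repr.map_eq_zero_iff.1 (Finsupp.ext fun κ => ?_)
    by_contra hκ
    exact (mem_koornSpan hp).1 hv' κ hκ ((mem_orbitSubmodule hp).1 hv κ hκ)
  · refine eq_top_iff.2 fun v _ => ?_
    rw [← (koornBasis hp).linearCombination_repr v, Finsupp.linearCombination_apply]
    refine sum_mem fun κ _ => complex_smul_mem _ _ ?_
    rw [koornBasis_apply]
    exact Submodule.mem_iSup_of_mem (⟨dom κ, isDominant_dom κ⟩ : DominantWeight n)
      ((koorn_mem_orbitSubmodule hp).2 (inOrbit_dom κ).symm)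

/-- A polynomial in Y separating κ from the rest of the support of v projects v onto a nonzero
multiple of P_κ. -/
lemma koorn_mem_of_repr_ne_zero {M : Submodule (AffineHecke n p) (Laurent n)} {v : Laurent n}
    (hv : v ∈ M) {κ : Weight n} (hκ : (koornBasis hp).repr v κ ≠ 0) : koorn hp κ ∈ M := by
  classical
  obtain ⟨f, h1, h2⟩ := exists_separating hp (((koornBasis hp).repr v).support.erase κ)
    (Finset.notMem_erase κ _)
  have h3 : noumiRep p (yA p f) v = (koornBasis hp).repr v κ • koorn hp κ := by
    refine (koornBasis hp).repr.injective (Finsupp.ext fun ν => ?_)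
    rw [repr_yA, map_smul, ← koornBasis_apply, Module.Basis.repr_self, Finsupp.smul_single,
      smul_eq_mul, mul_one]
    rcases eq_or_ne ν κ with rfl | hne
    · rw [h1, one_mul, Finsupp.single_eq_same]
    · rw [Finsupp.single_eq_of_ne hne]
      by_cases h0 : (koornBasis hp).repr v ν = 0
      · rw [h0, mul_zero]
      · rw [h2 ν (Finset.mem_erase.2 ⟨hne, Finsupp.mem_support_iff.2 h0⟩), zero_mul]
  have h4 : noumiRep p (yA p f) v ∈ M := M.smul_mem (yA p f) hv
  rw [h3] at h4
  have h5 := complex_smul_mem M ((koornBasis hp).repr v κ)⁻¹ h4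
  rwa [smul_smul, inv_mul_cancel₀ hκ, one_smul] at h5

/-- A nonzero submodule contains some P_κ. The nonzero off-diagonal coefficient of T_i then yields
P_{s_i κ}, and so every P_μ in the orbit. -/
lemma isSimpleModule_orbitSubmodule (lam : Weight n) :
    IsSimpleModule (AffineHecke n p) (orbitSubmodule hp lam) := by
  refine isSimpleModule_iff_isAtom.2 ⟨fun h => ?_, fun M hM => ?_⟩
  · have := (koorn_mem_orbitSubmodule hp).2 (inOrbit_refl lam)
    rw [h, Submodule.mem_bot] at this
    exact ne_zero_of_sub_mem (koorn_sub_mem hp lam) this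
  · by_contra hne
    obtain ⟨v, hv, h0⟩ := Submodule.exists_mem_ne_zero_of_ne_bot hne
    obtain ⟨κ, hκ⟩ : ∃ κ, (koornBasis hp).repr v κ ≠ 0 := by
      have : (koornBasis hp).repr v ≠ 0 := by simpa using h0
      exact Finsupp.ne_iff.1 this
    have hκM := koorn_mem_of_repr_ne_zero hp hv hκ
    have hS : ∀ μ, koorn hp μ ∈ M → ∀ i : Fin (n + 1), i ≠ 0 →
        koorn hp (sRefl i (μ, 0)).1 ∈ M := by
      intro μ hμ i hi
      by_cases e : (sRefl i (μ, 0)).1 = μ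
      · rwa [e]
      · obtain ⟨a, b, hb, h, -⟩ := exists_heckeT_koorn_of_ne hp hi e
        have h1 : noumiRep p (heckeT n p i) (koorn hp μ) ∈ M := M.smul_mem (heckeT n p i) hμ
        have h2 := M.sub_mem h1 (complex_smul_mem M a hμ)
        rw [h, add_sub_cancel_left] at h2
        have h3 := complex_smul_mem M b⁻¹ h2
        rwa [smul_smul, inv_mul_cancel₀ hb, one_smul] at h3
    refine hM.not_ge fun w hw => ?_
    rw [← (koornBasis hp).linearCombination_repr w, Finsupp.linearCombination_apply]
    refine sum_mem fun μ hμ => complex_smul_mem _ _ ?_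
    rw [koornBasis_apply]
    have hlam := (mem_orbitSubmodule hp).1 (hM.le hv) κ hκ
    exact mem_of_inOrbit (S := {μ | koorn hp μ ∈ M}) hS hκM
      (hlam.symm.trans ((mem_orbitSubmodule hp).1 hw μ (Finsupp.mem_support_iff.1 hμ)))

/-- An isomorphism sends P_λ to a joint eigenvector with the same spectral point, that is, to a
multiple of P_λ, which then lies in both submodules. -/
lemma isEmpty_orbitSubmodule_equiv {lam mu : DominantWeight n} (hne : lam ≠ mu) :
    IsEmpty (orbitSubmodule hp lam.1 ≃ₗ[AffineHecke n p] orbitSubmodule hp mu.1) := by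
  refine ⟨fun e => hne ?_⟩
  set P : orbitSubmodule hp lam.1 :=
    ⟨koorn hp lam.1, (koorn_mem_orbitSubmodule hp).2 (inOrbit_refl _)⟩ with hP
  have h0 : (e P : Laurent n) ≠ 0 := by
    intro h
    have := e.map_eq_zero_iff.1 (Subtype.ext h)
    exact ne_zero_of_sub_mem (koorn_sub_mem hp lam.1) (congrArg Subtype.val this)
  obtain ⟨κ, hκ, c, hc, hv⟩ := eigenvector_eq hp (y := gam p lam.1) h0 fun j => by
    have h1 : (yE p j).val • P = (algebraMap ℂ (AffineHecke n p) (gam p lam.1 j)) • P := by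
      refine Subtype.ext ?_
      rw [Submodule.coe_smul, Submodule.coe_smul, algebraMap_smul]
      exact yE_koorn hp j lam.1
    have h2 := congrArg e h1
    rw [map_smul, map_smul] at h2
    have h3 := congrArg Subtype.val h2
    rwa [Submodule.coe_smul, Submodule.coe_smul, algebraMap_smul] at h3
  obtain rfl := hp.gam_injective hκ
  have h3 : (koornBasis hp).repr (e P : Laurent n) lam.1 ≠ 0 := by
    rw [hv, map_smul, ← koornBasis_apply, Module.Basis.repr_self]
    simpa using hc
  have h4 := (mem_orbitSubmodule hp).1 (e P).2 _ h3
  exact Subtype.ext (lam.2.eq_of_inOrbit mu.2 h4.symm)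

end Submodules

end

section

/-! ### Density of the regular part of the spectrum -/

section Density

variable {n : ℕ} [hn : Fact (2 ≤ n)] {p : Params}

/-- Regular dominant weights. -/
def IsRegular (v : Weight n) : Prop := StrictAnti v ∧ ∀ j, 0 < v j

lemma IsRegular.below {v : Weight n} (hv : IsRegular v) {i j : Fin n} : Below v i j ↔ j < i := by
  have hi := hv.2 i
  have hj := hv.2 j
  rcases lt_trichotomy i j with h | rfl | h
  · have := hv.1 h
    simp only [Below, h.not_gt, iff_false]
    omega
  · simp [Below.irrefl]
  · have := hv.1 h
    simp only [Below, h, iff_true]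
    omega

/-- The value of `γ_λ / q^λ` for regular dominant `λ`. -/
def gamBase (p : Params) (j : Fin n) : ℂˣ :=
  p.t0 * p.tn * p.t ^ (2 * ((Finset.univ.filter fun i => j < i).card : ℤ))

lemma IsRegular.gam_eq {v : Weight n} (hv : IsRegular v) (j : Fin n) :
    gam p v j = gamBase p j * p.q ^ v j := by
  have h1 : sgn (v j) = 1 := if_pos (hv.2 j).le
  have h2 : rk v j = (Finset.univ.filter fun i => j < i).card := by
    rw [rk]
    congr 1
    ext i
    simp [hv.below]
  rw [Koornwinder.gam_eq, h1, h2, gamBase, one_mul, zpow_one]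

/-- The weight `∑ (m_i + 1) ω_i`. -/
def regWeight (m : Fin n → ℕ) : Weight n := fun j => ∑ i, if j ≤ i then (m i + 1 : ℤ) else 0

lemma isRegular_regWeight (m : Fin n → ℕ) : IsRegular (regWeight m) := by
  refine ⟨fun i j hij => ?_, fun j => ?_⟩
  · refine Finset.sum_lt_sum (fun k _ => ?_) ⟨i, Finset.mem_univ i, ?_⟩
    · by_cases h : j ≤ k
      · rw [if_pos h, if_pos (hij.le.trans h)]
      · rw [if_neg h]; split_ifs <;> omega
    · rw [if_neg hij.not_ge, if_pos le_rfl]; omega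
  · refine Finset.sum_pos' (fun k _ => ?_) ⟨j, Finset.mem_univ j, ?_⟩
    · split_ifs <;> omega
    · rw [if_pos le_rfl]; omega

lemma dot_regWeight (v : Weight n) (m : Fin n → ℕ) :
    ∑ j, regWeight m j * v j = ∑ i, (m i + 1 : ℤ) * psum v (i + 1) := by
  simp only [regWeight, psum, Finset.sum_mul, Finset.mul_sum]
  rw [Finset.sum_comm]
  refine Finset.sum_congr rfl fun i _ => Finset.sum_congr rfl fun j _ => ?_
  by_cases h : j ≤ i
  · rw [if_pos h, if_pos (Nat.lt_succ_of_le h)]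
  · rw [if_neg h, if_neg (by rw [Fin.le_def] at h; omega), zero_mul, mul_zero]

/-- On regular dominant weights γ_λ is a fixed vector times q^λ. For λ = ∑ (m_i + 1) ω_i the
monomials become, up to constants, characters of the monoid ℕ^n. They are distinct because q is not
a root of unity, hence linearly independent. -/
lemma eq_zero_of_evalA_gam (hp : p.IsGeneric n) {f : Laurent n}
    (h : ∀ v, IsRegular v → evalA (gam p v) f = 0) : f = 0 := by
  let Φ : Weight n → (Multiplicative (Fin n → ℕ) →* ℂ) := fun v =>
    { toFun := fun m => ((p.q ^ (∑ i, (m.toAdd i : ℤ) * psum v (i + 1)) : ℂˣ) : ℂ)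
      map_one' := by simp
      map_mul' := fun m m' => by
        rw [← Units.val_mul, ← zpow_add, ← Finset.sum_add_distrib]
        simp [add_mul] }
  have hΦ : Function.Injective Φ := by
    intro v w hvw
    have h1 : ∀ i : Fin n, psum v (i + 1) = psum w (i + 1) := by
      intro i
      have := DFunLike.congr_fun hvw (Multiplicative.ofAdd (Pi.single i 1))
      simp only [Φ, MonoidHom.coe_mk, OneHom.coe_mk, Units.val_inj, toAdd_ofAdd] at this
      rw [Finset.sum_eq_single i, Finset.sum_eq_single i] at this
      · simp only [Pi.single_eq_same, Nat.cast_one, one_mul] at this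
        by_contra hne
        refine hp.q_pow_ne _ (sub_ne_zero.2 hne) ?_
        rw [zpow_sub, this, mul_inv_cancel]
      all_goals simp +contextual
    ext j
    have h2 := psum_succ v j
    have h3 := psum_succ w j
    have h4 : psum v j = psum w j := by
      rcases Nat.eq_zero_or_pos (j : ℕ) with h0 | h0
      · rw [h0]; simp [psum]
      · have := h1 ⟨j - 1, by omega⟩
        simpa [Nat.sub_add_cancel h0] using this
    have := h1 j
    omega
  -- This factor absorbs the fixed vector and the shift by one in m_i + 1.
  let C : Weight n → ℂˣ := fun v =>
    (∏ j, gamBase p j ^ v j) * p.q ^ (∑ i : Fin n, psum v (i + 1))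
  have hz : ∀ a : Fin n → ℤ, ∏ j, p.q ^ a j = p.q ^ ∑ j, a j := fun a =>
    (map_prod (zpowersHom ℂˣ p.q) (fun j => Multiplicative.ofAdd (a j)) Finset.univ).symm
  have hC : ∀ (v : Weight n) (m : Fin n → ℕ), ((∏ j, gam p (regWeight m) j ^ v j : ℂˣ) : ℂ) =
      C v * Φ v (Multiplicative.ofAdd m) := by
    intro v m
    simp only [Φ, MonoidHom.coe_mk, OneHom.coe_mk, toAdd_ofAdd, C]
    rw [← Units.val_mul, mul_assoc, ← zpow_add, ← Finset.sum_add_distrib]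
    congr 1
    rw [Finset.prod_congr rfl fun j _ => by
      rw [(isRegular_regWeight m).gam_eq, mul_zpow, ← zpow_mul], Finset.prod_mul_distrib,
      hz, dot_regWeight]
    congr 2
    refine Finset.sum_congr rfl fun i _ => ?_
    ring
  have hli := (linearIndependent_monoidHom (Multiplicative (Fin n → ℕ)) ℂ).comp Φ hΦ
  rw [linearIndependent_iff'] at hli
  have h0 := hli f.coeff.support (fun v => f.coeff v * C v) (by
    ext m
    have := h _ (isRegular_regWeight m.toAdd)
    rw [evalA_eq, evalAt, Finsupp.sum] at this
    simp only [hC, ofAdd_toAdd] at this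
    simpa [mul_assoc] using this)
  refine AddMonoidAlgebra.coeff_injective (Finsupp.ext fun v => ?_)
  by_contra hv
  exact hv ((mul_eq_zero.1 (h0 v (Finsupp.mem_support_iff.2 hv))).resolve_right (Units.ne_zero _))

end Density

/-! ### Invariant Laurent polynomials give central elements -/

section Invariants

variable {n : ℕ} [hn : Fact (2 ≤ n)] {p : Params}

lemma exists_weylAct_eq {i : Fin (n + 1)} (hi : i ≠ 0) :
    ∃ (σ : Equiv.Perm (Fin n)) (e : Fin n → ℤˣ), ∀ v, (sRefl i (v, 0)).1 = weylAct σ e v := by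
  rcases index_cases i with rfl | ⟨k, hk, rfl⟩ | rfl
  · exact absurd rfl hi
  · refine ⟨Equiv.swap ⟨k, by omega⟩ ⟨k + 1, hk⟩, 1, fun v => ?_⟩
    rw [sRefl_mid hk]
    ext j
    simp [weylAct]
  · refine ⟨1, fun j => if j = lstIdx n then -1 else 1, fun v => ?_⟩
    rw [sRefl_last]
    ext j
    simp only [weylAct]
    split_ifs <;> simp

lemma weylAct_injective (σ : Equiv.Perm (Fin n)) (e : Fin n → ℤˣ) :
    Function.Injective (weylAct σ e) :=
  Function.LeftInverse.injective (weylAct_symm σ e)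

lemma mem_weylInvariants_iff {f : Laurent n} : f ∈ weylInvariants n ↔
    ∀ (σ : Equiv.Perm (Fin n)) (e : Fin n → ℤˣ) (v : Weight n),
      f.coeff (weylAct σ e v) = f.coeff v := by
  constructor
  · intro h σ e v
    conv_lhs => rw [← h σ e]
    exact Finsupp.mapDomain_apply (weylAct_injective σ e) _ _
  · intro h σ e
    refine AddMonoidAlgebra.coeff_injective (Finsupp.ext fun v => ?_)
    obtain ⟨w, rfl⟩ : ∃ w, v = weylAct σ e w := ⟨_, by
      have := weylAct_symm σ⁻¹ (fun j => e (σ⁻¹ j)) v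
      rw [inv_inv] at this
      refine this.symm.trans ?_
      congr 1
      ext j
      simp⟩
    rw [h]
    exact Finsupp.mapDomain_apply (weylAct_injective σ e) _ _

lemma reflAct_coeff {i : Fin (n + 1)} (hi : i ≠ 0) (f : Laurent n) (v : Weight n) :
    (reflAct p i f).coeff (sRefl i (v, 0)).1 = f.coeff v := by
  obtain ⟨σ, e, h⟩ := exists_weylAct_eq hi
  have : reflAct p i = AddMonoidAlgebra.mapDomainLinearMap ℂ ℂ (weylAct σ e) :=
    laurent_hom_ext fun w => by
      rw [reflAct_single hi, h]
      exact AddMonoidAlgebra.mapDomain_single.symm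
  rw [this, h]
  exact Finsupp.mapDomain_apply (weylAct_injective σ e) _ _

lemma mem_weylInvariants_iff_reflAct {f : Laurent n} :
    f ∈ weylInvariants n ↔ ∀ i : Fin (n + 1), i ≠ 0 → reflAct p i f = f := by
  rw [mem_weylInvariants_iff]
  constructor
  · intro h i hi
    obtain ⟨σ, e, hσ⟩ := exists_weylAct_eq hi
    refine AddMonoidAlgebra.coeff_injective (Finsupp.ext fun v => ?_)
    rw [← sRefl_fst_sRefl_fst hi v, reflAct_coeff hi, hσ (sRefl i (v, 0)).1, h]
  · intro h σ e v
    refine mem_of_inOrbit (S := {μ | f.coeff μ = f.coeff v}) (fun κ hκ i hi => ?_) (κ := v) rfl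
      ⟨σ, e, rfl⟩
    have := reflAct_coeff (p := p) hi f κ
    rw [h i hi] at this
    exact this.trans hκ

variable (hp : p.IsGeneric n)
include hp

lemma yA_injective : Function.Injective (yA (n := n) p) := by
  refine (injective_iff_map_eq_zero _).2 fun f hf => eq_zero_of_evalA_gam hp fun v _ => ?_
  have := yA_koorn hp f v
  rw [hf, map_zero, LinearMap.zero_apply] at this
  exact (smul_eq_zero.1 this.symm).resolve_right (ne_zero_of_sub_mem (koorn_sub_mem hp v))

/-- The commutator is some g(Y). Its diagonal coefficient at P_v vanishes, as for any commutator
with an operator that is diagonal in this basis, so g(γ_v) = 0 for all v. -/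
lemma heckeT_comm_yA {f : Laurent n} {i : Fin (n + 1)} (hi : i ≠ 0) (hf : reflAct p i f = f) :
    heckeT n p i * yA p f = yA p f * heckeT n p i := by
  obtain ⟨g, hg⟩ := exists_bernstein (p := p) hi f
  rw [hf] at hg
  suffices g = 0 by rw [hg, this, map_zero, add_zero]
  refine eq_zero_of_evalA_gam hp fun v _ => ?_
  have h1 := congrArg (fun x => (koornBasis hp).repr (noumiRep p x (koorn hp v)) v) hg
  simp only [map_add, map_mul, LinearMap.add_apply, Module.End.mul_apply, Finsupp.add_apply,
    repr_yA, yA_koorn, map_smul, Finsupp.smul_apply, smul_eq_mul] at h1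
  rw [← koornBasis_apply hp v, Module.Basis.repr_self, Finsupp.single_eq_same, mul_one] at h1
  linear_combination -h1

lemma yA_mem_center {f : Laurent n} (hf : f ∈ weylInvariants n) :
    yA p f ∈ Subalgebra.center ℂ (AffineHecke n p) := by
  have h : Subalgebra.centralizer ℂ {yA p f} = ⊤ := by
    refine subalgebra_eq_top (fun i hi => ?_) fun g => ?_
    · rw [Subalgebra.mem_centralizer_iff]
      rintro _ rfl
      exact (heckeT_comm_yA hp hi ((mem_weylInvariants_iff_reflAct (p := p)).1 hf i hi)).symm
    · rw [Subalgebra.mem_centralizer_iff]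
      rintro _ rfl
      rw [← map_mul, ← map_mul, mul_comm]
  rw [Subalgebra.mem_center_iff]
  intro x
  have hx : x ∈ Subalgebra.centralizer ℂ {yA p f} := h ▸ Algebra.mem_top
  exact ((Subalgebra.mem_centralizer_iff ℂ).1 hx _ rfl).symm

/-- If s_i ν ≠ ν, the nonzero off-diagonal coefficient of T_i forces γ_ν = s_i γ_{s_i ν}, and f does
not see s_i. -/
lemma evalA_gam_of_inOrbit {f : Laurent n} (hf : f ∈ weylInvariants n) {κ μ : Weight n}
    (h : InOrbit κ μ) : evalA (gam p μ) f = evalA (gam p κ) f := by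
  refine mem_of_inOrbit (S := {μ | evalA (gam p μ) f = evalA (gam p κ) f}) (fun ν hν i hi => ?_)
    (κ := κ) rfl h
  by_cases e : (sRefl i (ν, 0)).1 = ν
  · rwa [e]
  · obtain ⟨_, _, _, _, h'⟩ := exists_heckeT_koorn_of_ne hp hi e
    have h1 : evalA (gam p ν) f = evalA (gam p κ) f := hν
    rw [h', ← evalA_reflAct, (mem_weylInvariants_iff_reflAct (p := p)).1 hf i hi] at h1
    exact h1

attribute [local instance] noumiModule

lemma yA_smul_of_mem_orbitSubmodule {f : Laurent n} (hf : f ∈ weylInvariants n) {lam : Weight n}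
    {v : Laurent n} (hv : v ∈ orbitSubmodule hp lam) :
    yA p f • v = evalA (gam p lam) f • v := by
  refine (koornBasis hp).repr.injective (Finsupp.ext fun κ => ?_)
  rw [hecke_smul_def, repr_yA, map_smul, Finsupp.smul_apply, smul_eq_mul]
  by_cases h : (koornBasis hp).repr v κ = 0
  · rw [h, mul_zero, mul_zero]
  · rw [evalA_gam_of_inOrbit hp hf ((mem_orbitSubmodule hp).1 hv κ h)]

end Invariants

end

section

/-! ### The finite Weyl group and the Bernstein basis -/

section FiniteWeyl

variable {n : ℕ} [hn : Fact (2 ≤ n)] {p : Params}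

/-- Words in the finite simple reflections. -/
def FinWord (l : List (Fin (n + 1))) : Prop := ∀ i ∈ l, i ≠ 0

/-- Elements of the finite Weyl group. -/
def InW0 (u : AffWeight n ≃ₗ[ℤ] AffWeight n) : Prop := ∃ l, FinWord l ∧ wprod l = u

/-- Words in the finite simple reflections that are shortest among all such words. -/
def FinRed (l : List (Fin (n + 1))) : Prop :=
  FinWord l ∧ ∀ l', FinWord l' → wprod l' = wprod l → l.length ≤ l'.length

lemma InW0.exists_finRed {u : AffWeight n ≃ₗ[ℤ] AffWeight n} (hu : InW0 u) :
    ∃ l, FinRed l ∧ wprod l = u := by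
  classical
  obtain ⟨l, hl, rfl⟩ := hu
  have h : ∃ r, ∃ l', FinWord l' ∧ wprod l' = wprod l ∧ l'.length = r := ⟨_, l, hl, rfl, rfl⟩
  obtain ⟨l', h1, h2, h3⟩ := Nat.find_spec h
  exact ⟨l', ⟨h1, fun m hm hm' => h3 ▸ Nat.find_min' h ⟨m, hm, hm'.trans h2, rfl⟩⟩, h2⟩

lemma FinWord.tail {i : Fin (n + 1)} {l : List (Fin (n + 1))} (h : FinWord (i :: l)) : FinWord l :=
  fun j hj => h j (List.mem_cons_of_mem _ hj)

lemma FinWord.head {i : Fin (n + 1)} {l : List (Fin (n + 1))} (h : FinWord (i :: l)) : i ≠ 0 :=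
  h i List.mem_cons_self

lemma FinWord.cons {i : Fin (n + 1)} {l : List (Fin (n + 1))} (h : FinWord l) (hi : i ≠ 0) :
    FinWord (i :: l) := List.forall_mem_cons.2 ⟨hi, h⟩

lemma FinRed.tail {i : Fin (n + 1)} {l : List (Fin (n + 1))} (h : FinRed (i :: l)) : FinRed l := by
  refine ⟨h.1.tail, fun l' hl' hw => ?_⟩
  have := h.2 (i :: l') (hl'.cons h.1.head) (by rw [wprod_cons, wprod_cons, hw])
  simpa using this

/-- Exchange deletes letters and introduces none, so it stays within finite words. Minimality among
these words is therefore enough for T to be multiplicative along them. -/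
lemma FinRed.pos {i : Fin (n + 1)} {l : List (Fin (n + 1))} (h : FinRed (i :: l)) :
    Pos ((wprod l)⁻¹ (simpleRoot n i)) := by
  have hr : IsRt ((wprod l)⁻¹ (simpleRoot n i)) := InW.isRt (InW.inv ⟨l, rfl⟩) (isRt_simpleRoot i)
  refine hr.pos_or.resolve_right fun h' => ?_
  obtain ⟨l1, k, l2, rfl, h2⟩ := exists_split (isRt_simpleRoot i) (pos_simpleRoot i) l h'
  have h3 := conj_sRefl (u := wprod l1) ⟨l1, rfl⟩ (i := i) (j := k) (by rw [← h2]; simp)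
  have h4 := h.2 (l1 ++ l2)
    (fun j hj => h.1.tail j (by
      rcases List.mem_append.1 hj with hj | hj
      · exact List.mem_append_left _ hj
      · exact List.mem_append_right _ (List.mem_cons_of_mem _ hj)))
    (by rw [wprod_cons, wprod_append, wprod_append, wprod_cons, ← mul_assoc (wprod l1), h3,
      mul_assoc, ← mul_assoc (sRefl i), sRefl_mul_self, one_mul])
  simp at h4

lemma FinWord.exists_weylAct {l : List (Fin (n + 1))} (hl : FinWord l) :
    ∃ (σ : Equiv.Perm (Fin n)) (e : Fin n → ℤˣ), ∀ g, wprod l g = (weylAct σ e g.1, g.2) := by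
  induction l with
  | nil => exact ⟨1, 1, fun g => Prod.ext (weylAct_one _).symm rfl⟩
  | cons i l ih =>
    obtain ⟨σ, e, h⟩ := ih hl.tail
    obtain ⟨σ', e', h'⟩ := exists_weylAct_eq hl.head
    refine ⟨σ * σ', fun j => e' j * e (σ' j), fun g => ?_⟩
    rw [wprod_cons, LinearEquiv.mul_apply, h]
    refine Prod.ext ?_ (sRefl_snd hl.head _)
    refine (sRefl_fst_of_fst_eq (h := (weylAct σ e g.1, 0)) rfl).trans ?_
    rw [h', weylAct_weylAct]

/-- Regular weights have trivial stabilizer. -/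
lemma IsRegular.wprod_eq {lam : Weight n} (hlam : IsRegular lam) {l l' : List (Fin (n + 1))}
    (hl : FinWord l) (hl' : FinWord l') (h : (wprod l (lam, 0)).1 = (wprod l' (lam, 0)).1) :
    wprod l = wprod l' := by
  obtain ⟨σ, e, hσ⟩ := hl.exists_weylAct
  obtain ⟨σ', e', hσ'⟩ := hl'.exists_weylAct
  rw [hσ, hσ'] at h
  have h1 : ∀ j, σ j = σ' j ∧ e j = e' j := by
    intro j
    have h2 := congrFun h j
    simp only [weylAct] at h2
    have h3 := hlam.2 (σ j)
    have h4 := hlam.2 (σ' j)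
    rcases Int.units_eq_one_or (e j) with h5 | h5 <;>
      rcases Int.units_eq_one_or (e' j) with h6 | h6 <;> rw [h5, h6] at h2 ⊢ <;> simp at h2
    · exact ⟨hlam.1.injective h2, rfl⟩
    · omega
    · omega
    · exact ⟨hlam.1.injective h2, rfl⟩
  refine LinearEquiv.ext fun g => ?_
  rw [hσ, hσ', Equiv.ext fun j => (h1 j).1, funext fun j => (h1 j).2]

/-- The element `T_u`. -/
def heckeW (p : Params) (u : AffWeight n ≃ₗ[ℤ] AffWeight n) : AffineHecke n p :=
  (tProd (uT p) u).val

lemma heckeW_one : heckeW p (1 : AffWeight n ≃ₗ[ℤ] AffWeight n) = 1 := by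
  rw [heckeW, tProd_one (braidRel_uT p), Units.val_one]

lemma heckeW_mul_left {u : AffWeight n ≃ₗ[ℤ] AffWeight n} (hu : InW u) {i : Fin (n + 1)}
    (h : Pos (u⁻¹ (simpleRoot n i))) :
    heckeW p (sRefl i * u) = heckeT n p i * heckeW p u := by
  rw [heckeW, tProd_mul_left (braidRel_uT p) hu h, Units.val_mul, coe_uT, heckeW]

/-- `T_{s_i u}` is `T_i T_u` or `(T_i - t_i + t_i⁻¹) T_u`. -/
lemma exists_heckeW_mul_left {u : AffWeight n ≃ₗ[ℤ] AffWeight n} (hu : InW u) (i : Fin (n + 1)) :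
    ∃ d : ℂ, heckeW p (sRefl i * u) = heckeT n p i * heckeW p u + d • heckeW p u := by
  rcases (hu.inv.isRt (isRt_simpleRoot i)).pos_or with h | h
  · exact ⟨0, by rw [heckeW_mul_left hu h, zero_smul, add_zero]⟩
  · refine ⟨-p.c n i, ?_⟩
    have h1 : tProd (uT p) (sRefl i * u) = (uT p i)⁻¹ * tProd (uT p) u := by
      conv_rhs => rw [tProd_mul_left_of_neg (braidRel_uT p) hu h]
      rw [inv_mul_cancel_left]
    rw [heckeW, h1, Units.val_mul, coe_uT_inv, sub_mul, smul_mul_assoc, one_mul, ← heckeW]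
    module

/-- The span of the elements `T_u f(Y)`. -/
def bernsteinSpan (n : ℕ) [hn : Fact (2 ≤ n)] (p : Params) : Submodule ℂ (AffineHecke n p) :=
  Submodule.span ℂ {x | ∃ (u : AffWeight n ≃ₗ[ℤ] AffWeight n) (f : Laurent n),
    InW0 u ∧ x = heckeW p u * yA p f}

lemma heckeW_mul_yA_mem {u : AffWeight n ≃ₗ[ℤ] AffWeight n} (hu : InW0 u) (f : Laurent n) :
    heckeW p u * yA p f ∈ bernsteinSpan n p := Submodule.subset_span ⟨u, f, hu, rfl⟩

lemma InW0.sRefl_mul {u : AffWeight n ≃ₗ[ℤ] AffWeight n} (hu : InW0 u) {i : Fin (n + 1)}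
    (hi : i ≠ 0) : InW0 (sRefl i * u) := by
  obtain ⟨l, hl, rfl⟩ := hu
  exact ⟨i :: l, hl.cons hi, wprod_cons i l⟩

lemma InW0.inW {u : AffWeight n ≃ₗ[ℤ] AffWeight n} (hu : InW0 u) : InW u := by
  obtain ⟨l, -, rfl⟩ := hu
  exact ⟨l, rfl⟩

lemma mul_bernsteinSpan {h : AffineHecke n p}
    (hh : ∀ (u : AffWeight n ≃ₗ[ℤ] AffWeight n) (f : Laurent n), InW0 u →
      h * (heckeW p u * yA p f) ∈ bernsteinSpan n p) {x : AffineHecke n p}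
    (hx : x ∈ bernsteinSpan n p) : h * x ∈ bernsteinSpan n p := by
  refine Submodule.span_induction ?_ ?_ ?_ ?_ hx
  · rintro _ ⟨u, f, hu, rfl⟩
    exact hh u f hu
  · rw [mul_zero]; exact zero_mem _
  · intro x y _ _ hx hy
    rw [mul_add]; exact add_mem hx hy
  · intro a x _ hx
    rw [mul_smul_comm]; exact Submodule.smul_mem _ _ hx

lemma heckeT_mul_bernsteinSpan {i : Fin (n + 1)} (hi : i ≠ 0) {x : AffineHecke n p}
    (hx : x ∈ bernsteinSpan n p) : heckeT n p i * x ∈ bernsteinSpan n p := by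
  refine mul_bernsteinSpan (fun u f hu => ?_) hx
  obtain ⟨d, hd⟩ := exists_heckeW_mul_left (p := p) hu.inW i
  have h1 := heckeW_mul_yA_mem (p := p) (hu.sRefl_mul hi) f
  rw [hd, add_mul, smul_mul_assoc, mul_assoc] at h1
  have h2 := sub_mem h1 (Submodule.smul_mem _ d (heckeW_mul_yA_mem (p := p) hu f))
  rwa [add_sub_cancel_right] at h2

lemma yA_mul_bernsteinSpan (f : Laurent n) {x : AffineHecke n p}
    (hx : x ∈ bernsteinSpan n p) : yA p f * x ∈ bernsteinSpan n p := by
  refine mul_bernsteinSpan (fun u g hu => ?_) hx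
  obtain ⟨l, hl, rfl⟩ := hu
  induction l generalizing f with
  | nil =>
    have : heckeW p (wprod ([] : List (Fin (n + 1)))) = 1 := heckeW_one
    rw [this, one_mul, ← map_mul]
    have h1 := heckeW_mul_yA_mem (p := p) (u := wprod []) ⟨[], hl, rfl⟩ (f * g)
    rwa [this, one_mul] at h1
  | cons i l ih =>
    obtain ⟨d, hd⟩ := exists_heckeW_mul_left (p := p) (u := wprod l) ⟨l, rfl⟩ i
    -- The relation is taken for s_i f, so that it expresses f(Y) T_i with T_i on the left, which is
    -- the order used in the span.
    obtain ⟨g', hg'⟩ := exists_bernstein (p := p) hl.head (reflAct p i f)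
    rw [reflAct_reflAct] at hg'
    have h1 := heckeT_mul_bernsteinSpan hl.head (ih (reflAct p i f) hl.tail)
    have h2 := ih (d • f - g') hl.tail
    have h3 := add_mem h1 h2
    rw [wprod_cons, hd]
    convert h3 using 1
    rw [map_sub, map_smul, ← mul_assoc (heckeT n p i), hg']
    simp only [add_mul, mul_add, sub_mul, smul_mul_assoc, mul_smul_comm, mul_assoc]
    abel

/-- The span is stable under left multiplication by generators and contains 1. Linear independence
of the T_u f(Y) is not needed. -/
lemma bernsteinSpan_eq_top : bernsteinSpan n p = ⊤ := by
  let B : Subalgebra ℂ (AffineHecke n p) :=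
    { carrier := {h | ∀ x ∈ bernsteinSpan n p, h * x ∈ bernsteinSpan n p}
      mul_mem' := fun {a b} ha hb x hx => by
        rw [mul_assoc]; exact ha _ (hb x hx)
      add_mem' := fun {a b} ha hb x hx => by
        rw [add_mul]; exact add_mem (ha x hx) (hb x hx)
      algebraMap_mem' := fun c x hx => by
        rw [← Algebra.smul_def]; exact Submodule.smul_mem _ c hx }
  have hB : B = ⊤ := subalgebra_eq_top (fun i hi x hx => heckeT_mul_bernsteinSpan hi hx)
    fun f x hx => yA_mul_bernsteinSpan f hx
  refine eq_top_iff.2 fun h _ => ?_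
  have hW : InW0 (1 : AffWeight n ≃ₗ[ℤ] AffWeight n) :=
    ⟨[], fun _ h => absurd h List.not_mem_nil, rfl⟩
  have h1 := heckeW_mul_yA_mem (p := p) hW 1
  rw [heckeW_one, map_one, mul_one] at h1
  have := (hB ▸ Algebra.mem_top : h ∈ B) 1 h1
  rwa [mul_one] at this

lemma exists_bernstein_sum (h : AffineHecke n p) :
    ∃ F : (AffWeight n ≃ₗ[ℤ] AffWeight n) →₀ Laurent n, (∀ u ∈ F.support, InW0 u) ∧
      h = F.sum fun u f => heckeW p u * yA p f := by
  classical
  have hh : h ∈ bernsteinSpan n p := by rw [bernsteinSpan_eq_top]; exact Submodule.mem_top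
  refine Submodule.span_induction ?_ ?_ ?_ ?_ hh
  · rintro _ ⟨u, f, hu, rfl⟩
    refine ⟨Finsupp.single u f, fun v hv => ?_, ?_⟩
    · rwa [Finset.mem_singleton.1 (Finsupp.support_single_subset hv)]
    · rw [Finsupp.sum_single_index (by simp)]
  · exact ⟨0, by simp, by simp⟩
  · rintro _ _ _ _ ⟨F, hF, rfl⟩ ⟨G, hG, rfl⟩
    refine ⟨F + G, fun u hu => ?_, ?_⟩
    · rcases Finset.mem_union.1 (Finsupp.support_add hu) with hu | hu
      · exact hF u hu
      · exact hG u hu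
    · rw [Finsupp.sum_add_index' (by simp) (by simp [mul_add])]
  · rintro a _ _ ⟨F, hF, rfl⟩
    refine ⟨a • F, fun u hu => hF u (Finsupp.support_smul hu), ?_⟩
    rw [Finsupp.sum_smul_index' (by simp), Finsupp.smul_sum]
    simp

end FiniteWeyl

/-! ### The center -/

section Center

variable {n : ℕ} [hn : Fact (2 ≤ n)] {p : Params} (hp : p.IsGeneric n)
include hp

lemma heckeT_koornSpan {S S' : Set (Weight n)} {i : Fin (n + 1)} (hi : i ≠ 0)
    (hS : ∀ κ ∈ S, κ ∈ S' ∧ (sRefl i (κ, 0)).1 ∈ S') {v : Laurent n} (hv : v ∈ koornSpan hp S) :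
    noumiRep p (heckeT n p i) v ∈ koornSpan hp S' := by
  refine Submodule.span_induction ?_ ?_ ?_ ?_ hv
  · rintro _ ⟨μ, hμ, rfl⟩
    obtain ⟨a, b, h, -⟩ := exists_heckeT_koorn hp hi μ
    rw [koornBasis_apply, h]
    exact add_mem (Submodule.smul_mem _ _ ((koorn_mem_koornSpan hp).2 (hS μ hμ).1))
      (Submodule.smul_mem _ _ ((koorn_mem_koornSpan hp).2 (hS μ hμ).2))
  · rw [map_zero]; exact zero_mem _
  · intro x y _ _ hx hy
    rw [map_add]; exact add_mem hx hy
  · intro a x _ hx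
    rw [map_smul]; exact Submodule.smul_mem _ _ hx

omit hp in
/-- The weights obtained from `λ` by words of length less than `r`. -/
def shortOrbit (lam : Weight n) (r : ℕ) : Set (Weight n) :=
  {κ | ∃ l, FinWord l ∧ l.length < r ∧ κ = (wprod l (lam, 0)).1}

/-- `T_u P_λ` has leading term `P_{uλ}`. -/
lemma heckeW_koorn {lam : Weight n} (hlam : IsRegular lam) {l : List (Fin (n + 1))}
    (hl : FinRed l) : ∃ c : ℂ, c ≠ 0 ∧
      noumiRep p (heckeW p (wprod l)) (koorn hp lam) - c • koorn hp (wprod l (lam, 0)).1 ∈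
        koornSpan hp (shortOrbit lam l.length) := by
  induction l with
  | nil =>
    refine ⟨1, one_ne_zero, ?_⟩
    rw [show wprod ([] : List (Fin (n + 1))) = 1 from rfl, heckeW_one, map_one, Module.End.one_apply,
      one_smul, LinearEquiv.coe_one, id, sub_self]
    exact zero_mem _
  | cons i l ih =>
    obtain ⟨c, hc, h⟩ := ih hl.tail
    set κ := (wprod l (lam, 0)).1 with hκ
    have e1 : (wprod (i :: l) (lam, 0)).1 = (sRefl i (κ, 0)).1 := by
      rw [wprod_cons, LinearEquiv.mul_apply]
      exact sRefl_fst_of_fst_eq rfl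
    -- Regular weights have trivial stabilizer, so equality would give a shorter word for the same
    -- element.
    have hne : (sRefl i (κ, 0)).1 ≠ κ := by
      intro h'
      rw [← e1, hκ] at h'
      have h1 := hl.2 l hl.1.tail (hlam.wprod_eq hl.1 hl.1.tail h').symm
      simp at h1
    obtain ⟨a, b, hb, hT, -⟩ := exists_heckeT_koorn_of_ne hp hl.1.head hne
    refine ⟨c * b, mul_ne_zero hc hb, ?_⟩
    rw [wprod_cons, heckeW_mul_left ⟨l, rfl⟩ hl.pos, map_mul, Module.End.mul_apply, ← wprod_cons, e1]
    have h1 := heckeT_koornSpan hp (S' := shortOrbit lam (i :: l).length) hl.1.head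
      (fun ν hν => by
        obtain ⟨m, hm, hm', rfl⟩ := hν
        refine ⟨⟨m, hm, hm'.trans (by simp), rfl⟩, ⟨i :: m, hm.cons hl.1.head, by simpa using hm', ?_⟩⟩
        rw [wprod_cons, LinearEquiv.mul_apply]
        exact sRefl_fst_of_fst_eq rfl) h
    have h2 : koorn hp κ ∈ koornSpan hp (shortOrbit lam (i :: l).length) :=
      (koorn_mem_koornSpan hp).2 ⟨l, hl.1.tail, by simp, rfl⟩
    have h3 := add_mem h1 (Submodule.smul_mem _ (c * a) h2)
    convert h3 using 1
    rw [map_sub, map_smul, hT]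
    module

/-- z commutes with all f(Y), whose joint spectrum is simple, so z is diagonal in the basis P_μ. -/
lemma repr_center {z : AffineHecke n p} (hz : z ∈ Subalgebra.center ℂ (AffineHecke n p))
    {μ κ : Weight n} (hne : κ ≠ μ) : (koornBasis hp).repr (noumiRep p z (koorn hp μ)) κ = 0 := by
  by_contra h
  refine hne (hp.gam_injective (evalA_injective p fun f => ?_))
  have h1 := congrArg (fun x => (koornBasis hp).repr (noumiRep p x (koorn hp μ)) κ)
    (Subalgebra.mem_center_iff.1 hz (yA p f))
  simp only [map_mul, Module.End.mul_apply, repr_yA, yA_koorn, map_smul, Finsupp.smul_apply,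
    smul_eq_mul] at h1
  exact mul_right_cancel₀ h h1

/-- Expand z in the T_u f_u(Y) and take u ≠ 1 of maximal length in the support. On P_λ with λ
regular, no other term reaches P_{uλ}, and z is diagonal. Hence f_u(γ_λ) = 0 for all regular λ, so
f_u = 0, a contradiction. -/
lemma exists_yA_of_mem_center {z : AffineHecke n p}
    (hz : z ∈ Subalgebra.center ℂ (AffineHecke n p)) : ∃ f, yA p f = z := by
  classical
  obtain ⟨F, hF, hzF⟩ := exists_bernstein_sum z
  choose! w hw hw' using fun u hu => (hF u hu).exists_finRed
  have h1 : ∀ u ∈ F.support, u = 1 := by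
    by_contra hcon
    push Not at hcon
    obtain ⟨u0, hu0, hne0⟩ := hcon
    obtain ⟨u, hu, hmax⟩ := (F.support.filter (· ≠ 1)).exists_max_image (fun u => (w u).length)
      ⟨u0, Finset.mem_filter.2 ⟨hu0, hne0⟩⟩
    obtain ⟨hu, hne⟩ := Finset.mem_filter.1 hu
    -- The identity has the empty word, so the longest nontrivial element is longest in the whole
    -- support.
    have hmax' : ∀ u' ∈ F.support, (w u').length ≤ (w u).length := by
      intro u' hu'
      by_cases h : u' = 1
      · have := (hw u' hu').2 [] (fun _ h => absurd h List.not_mem_nil)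
          (by rw [hw' u' hu', h]; rfl)
        exact this.trans (Nat.zero_le _)
      · exact hmax u' (Finset.mem_filter.2 ⟨hu', h⟩)
    refine Finsupp.mem_support_iff.1 hu (eq_zero_of_evalA_gam hp fun lam hlam => ?_)
    have hterm : ∀ u' ∈ F.support, ∃ c : ℂ, c ≠ 0 ∧
        (koornBasis hp).repr (noumiRep p (heckeW p u' * yA p (F u')) (koorn hp lam))
          (u (lam, 0)).1 = if u' = u then c * evalA (gam p lam) (F u') else 0 := by
      intro u' hu'
      obtain ⟨c, hc, h⟩ := heckeW_koorn hp hlam (hw u' hu')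
      rw [hw' u' hu'] at h
      refine ⟨c, hc, ?_⟩
      -- The lower terms of T_{u'} P_λ come from words shorter than that of u', hence shorter than a
      -- minimal word for u, and by regularity such words cannot produce uλ.
      have h2 : (koornBasis hp).repr (noumiRep p (heckeW p u') (koorn hp lam) -
          c • koorn hp (u' (lam, 0)).1) (u (lam, 0)).1 = 0 := by
        by_contra h3
        obtain ⟨m, hm, hm', e⟩ := (mem_koornSpan hp).1 h _ h3
        rw [← hw' u hu] at e
        have h4 := hlam.wprod_eq (hw u hu).1 hm e
        have h5 := (hw u hu).2 m hm h4.symm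
        have h6 := hmax' u' hu'
        omega
      rw [map_sub, map_smul, ← koornBasis_apply, ← koornBasis_apply, Module.Basis.repr_self,
        Finsupp.sub_apply, Finsupp.smul_apply, sub_eq_zero, koornBasis_apply] at h2
      rw [map_mul, Module.End.mul_apply, yA_koorn, map_smul, map_smul, Finsupp.smul_apply, h2]
      split_ifs with e
      · rw [e, Finsupp.single_eq_same, smul_eq_mul, smul_eq_mul]; ring
      · rw [Finsupp.single_eq_of_ne, smul_zero, smul_zero]
        intro h7
        rw [← hw' u hu, ← hw' u' hu'] at h7
        refine e ?_
        rw [← hw' u' hu', ← hw' u hu]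
        exact (hlam.wprod_eq (hw u hu).1 (hw u' hu').1 h7).symm
    choose! c hc hcc using hterm
    have hsum : (koornBasis hp).repr (noumiRep p z (koorn hp lam)) (u (lam, 0)).1 =
        c u * evalA (gam p lam) (F u) := by
      rw [hzF, Finsupp.sum, map_sum, LinearMap.sum_apply, map_sum, Finsupp.finsetSum_apply,
        Finset.sum_congr rfl hcc, Finset.sum_ite_eq' _ u, if_pos hu]
    rw [repr_center hp hz] at hsum
    · exact (mul_eq_zero.1 hsum.symm).resolve_left (hc u hu)
    · intro h
      refine hne ?_
      rw [← hw' u hu] at h ⊢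
      exact hlam.wprod_eq (l' := []) (hw u hu).1 (fun _ h => absurd h List.not_mem_nil) h
  refine ⟨F 1, ?_⟩
  rw [hzF, Finsupp.sum, Finset.sum_eq_single 1]
  · rw [heckeW_one, one_mul]
  · intro u hu hne
    exact absurd (h1 u hu) hne
  · intro h
    rw [Finsupp.notMem_support_iff.1 h, map_zero, mul_zero]

omit hp in
lemma IsRegular.sRefl_ne {lam : Weight n} (hlam : IsRegular lam) {i : Fin (n + 1)} (hi : i ≠ 0) :
    (sRefl i (lam, 0)).1 ≠ lam := by
  intro h
  rw [sRefl_apply] at h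
  have h' : pairing (simpleCoroot n i) (lam, 0) • (simpleRoot n i).1 = 0 := sub_eq_self.1 h
  obtain ⟨_, _, _, _, _, h0⟩ := isRt_simpleRoot i
  have h1 := (smul_eq_zero.1 h').resolve_right h0
  rcases index_cases i with rfl | ⟨k, hk, rfl⟩ | rfl
  · exact hi rfl
  · rw [pairing_coroot_mid hk] at h1
    have := hlam.1 (show (⟨k, by omega⟩ : Fin n) < ⟨k + 1, hk⟩ from Nat.lt_succ_self k)
    dsimp only at h1
    omega
  · rw [pairing_coroot_last] at h1
    have := hlam.2 (lstIdx n)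
    dsimp only at h1
    omega

/-- The coefficients of P_{s_i λ} in f(Y) T_i P_λ = T_i f(Y) P_λ give f(γ_{s_i λ}) = f(γ_λ) for
regular λ, and density of these points finishes. -/
lemma mem_weylInvariants_of_yA_mem_center {f : Laurent n}
    (hf : yA p f ∈ Subalgebra.center ℂ (AffineHecke n p)) : f ∈ weylInvariants n := by
  refine (mem_weylInvariants_iff_reflAct (p := p)).2 fun i hi => sub_eq_zero.1 ?_
  refine eq_zero_of_evalA_gam hp fun lam hlam => ?_
  obtain ⟨a, b, hb, h, h'⟩ := exists_heckeT_koorn_of_ne hp hi (hlam.sRefl_ne hi)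
  have h1 := congrArg (fun x => (koornBasis hp).repr (noumiRep p x (koorn hp lam))
    (sRefl i (lam, 0)).1) (Subalgebra.mem_center_iff.1 hf (heckeT n p i))
  simp only [map_mul, Module.End.mul_apply, repr_yA, yA_koorn, map_smul, Finsupp.smul_apply,
    smul_eq_mul] at h1
  have h2 : (koornBasis hp).repr (noumiRep p (heckeT n p i) (koorn hp lam)) (sRefl i (lam, 0)).1 =
      b := by
    rw [h, map_add, map_smul, map_smul, ← koornBasis_apply, ← koornBasis_apply,
      Module.Basis.repr_self, Module.Basis.repr_self, Finsupp.add_apply, Finsupp.smul_apply,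
      Finsupp.smul_apply, Finsupp.single_eq_same, Finsupp.single_eq_of_ne (hlam.sRefl_ne hi),
      smul_zero, zero_add, smul_eq_mul, mul_one]
  rw [h2] at h1
  rw [map_sub, evalA_reflAct, mul_right_cancel₀ hb h1, h', refPt_refPt, sub_self]

lemma center_eq : (Subalgebra.center ℂ (AffineHecke n p) : Set (AffineHecke n p)) =
    yA p '' weylInvariants n := by
  refine Set.Subset.antisymm (fun z hz => ?_) ?_
  · obtain ⟨f, rfl⟩ := exists_yA_of_mem_center hp hz
    exact ⟨f, mem_weylInvariants_of_yA_mem_center hp hz, rfl⟩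
  · rintro _ ⟨f, hf, rfl⟩
    exact yA_mem_center hp hf

end Center

end

section

/-! ### Isotypic components of a module that decomposes into lines -/

section Lines

open Submodule

/-- Equal multisets of values mean fibres of equal cardinality, and bijections between the fibres
glue to a permutation. -/
lemma exists_perm_of_map_eq {α β : Type*} [Fintype α] {f g : α → β}
    (h : Finset.univ.val.map f = Finset.univ.val.map g) : ∃ σ : Equiv.Perm α, ∀ x, f x = g (σ x) := by
  classical
  have e : ∀ b, Nonempty ({x // f x = b} ≃ {x // g x = b}) := fun b => by
    refine ⟨Fintype.equivOfCardEq ?_⟩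
    have h1 := congrArg (Multiset.count b) h
    rw [Multiset.count_map, Multiset.count_map] at h1
    rw [Fintype.card_subtype, Fintype.card_subtype]
    simp only [eq_comm (b := b)]
    exact h1
  let σ : Equiv.Perm α := (Equiv.sigmaFiberEquiv f).symm.trans
    ((Equiv.sigmaCongrRight fun b => (e b).some).trans (Equiv.sigmaFiberEquiv g))
  exact ⟨σ, fun x => ((e (f x)).some ⟨x, rfl⟩).2.symm⟩

variable {R V ι : Type*} [Ring R] [AddCommGroup V] [Module R V] [Module ℂ V]
  {N : ι → Submodule R V} {χ : ι → R → ℂ} (hχ : ∀ i r, ∀ v ∈ N i, r • v = χ i r • v)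
include hχ

lemma nonempty_span_singleton_equiv {i : ι} {v w : V} (hv : v ∈ N i) (hv0 : v ≠ 0) (hw : w ∈ N i)
    (hw0 : w ≠ 0) : Nonempty (span R {v} ≃ₗ[R] span R {w}) := by
  have h : Ideal.torsionOf R V v = Ideal.torsionOf R V w := by
    ext r
    rw [Ideal.mem_torsionOf_iff, Ideal.mem_torsionOf_iff, hχ i r v hv, hχ i r w hw, smul_eq_zero,
      smul_eq_zero, or_iff_left hv0, or_iff_left hw0]
  exact ⟨(Ideal.quotTorsionOfEquivSpanSingleton R V v).symm.trans
    ((Submodule.quotEquivOfEq _ _ h).trans (Ideal.quotTorsionOfEquivSpanSingleton R V w))⟩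

variable (hc : ∀ c : ℂ, ∃ r : R, ∀ v : V, r • v = c • v)
include hc

lemma isSimpleModule_span_singleton {i : ι} {v : V} (hv : v ∈ N i) (h0 : v ≠ 0) :
    IsSimpleModule R (span R {v}) := by
  refine isSimpleModule_iff_isAtom.2 ⟨fun h => h0 (span_singleton_eq_bot.1 h), fun M hM => ?_⟩
  by_contra hne
  obtain ⟨w, hw, hw0⟩ := exists_mem_ne_zero_of_ne_bot hne
  obtain ⟨r, rfl⟩ := mem_span_singleton.1 (hM.le hw)
  rw [hχ i r v hv] at hw hw0
  have hr : χ i r ≠ 0 := fun h => hw0 (by rw [h, zero_smul])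
  obtain ⟨s, hs⟩ := hc (χ i r)⁻¹
  refine hM.not_ge (span_le.2 (Set.singleton_subset_iff.2 ?_))
  have := M.smul_mem s hw
  rwa [hs, smul_smul, inv_mul_cancel₀ hr, one_smul] at this

lemma isotypicComponent_span_singleton
    (hsep : ∀ i x, (∀ r : R, r • x = χ i r • x) → x ∈ N i) {i : ι} {v : V} (hv : v ∈ N i)
    (h0 : v ≠ 0) : isotypicComponent R V (span R {v}) = N i := by
  refine le_antisymm (sSup_le ?_) fun w hw => ?_
  · rintro M ⟨e⟩ x hx
    refine hsep i x fun r => ?_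
    obtain ⟨s, hs⟩ := hc (χ i r)
    have h1 : (e ⟨x, hx⟩ : V) ∈ N i := span_le.2 (Set.singleton_subset_iff.2 hv) (e ⟨x, hx⟩).2
    have h2 : r • (⟨x, hx⟩ : M) = s • ⟨x, hx⟩ := by
      refine e.injective (Subtype.ext ?_)
      rw [map_smul, map_smul, coe_smul, coe_smul, hs, hχ i r _ h1]
    have h3 := congrArg Subtype.val h2
    rwa [coe_smul, coe_smul, hs] at h3
  · by_cases hw0 : w = 0
    · rw [hw0]; exact zero_mem _
    · exact mem_sSup_of_mem (nonempty_span_singleton_equiv hχ hw hw0 hv h0)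
        (mem_span_singleton_self w)

/-- R acts on N i through the character χ i, so the cyclic submodules of nonzero vectors of N i are
simple and mutually isomorphic, and `hsep` makes N i exhaust their type. By `hproj` every simple
submodule contains a nonzero vector of some N i and is generated by it. -/
lemma range_eq_isotypicComponents (hN : ∀ i, N i ≠ ⊥)
    (hsep : ∀ i x, (∀ r : R, r • x = χ i r • x) → x ∈ N i)
    (hproj : ∀ x : V, x ≠ 0 → ∃ (r : R) (i : ι), r • x ∈ N i ∧ r • x ≠ 0) :
    Set.range N = isotypicComponents R V := by
  refine Set.Subset.antisymm ?_ ?_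
  · rintro _ ⟨i, rfl⟩
    obtain ⟨v, hv, h0⟩ := exists_mem_ne_zero_of_ne_bot (hN i)
    exact ⟨_, isSimpleModule_span_singleton hχ hc hv h0,
      (isotypicComponent_span_singleton hχ hc hsep hv h0).symm⟩
  · rintro _ ⟨S, hS, rfl⟩
    have hat := isSimpleModule_iff_isAtom.1 hS
    obtain ⟨x, hx, hx0⟩ := exists_mem_ne_zero_of_ne_bot hat.1
    obtain ⟨r, i, hi, h0⟩ := hproj x hx0
    refine ⟨i, ?_⟩
    have h1 := (hat.le_iff.1 (span_le.2 (Set.singleton_subset_iff.2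
      (S.smul_mem r hx)))).resolve_left fun h => h0 (span_singleton_eq_bot.1 h)
    rw [← h1, isotypicComponent_span_singleton hχ hc hsep hi h0]

end Lines

/-! ### The isotypic decomposition over the center -/

section Isotypic

variable {n : ℕ} [hn : Fact (2 ≤ n)] {p : Params}

/-- The invariant Laurent polynomial `∏ (c - x_j - x_j⁻¹)`. -/
def symProd (c : ℂ) : Laurent n :=
  ∏ j : Fin n, (algebraMap ℂ _ c - AddMonoidAlgebra.single (Pi.single j 1) 1 -
    AddMonoidAlgebra.single (-Pi.single j 1) 1)

lemma evalA_symProd (p : Params) (y : Fin n → ℂˣ) (c : ℂ) :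
    evalA y (symProd c) = ∏ j, (c - (y j + (y j : ℂ)⁻¹)) := by
  rw [symProd, map_prod]
  refine Finset.prod_congr rfl fun j _ => ?_
  rw [map_sub, map_sub, AlgHom.commutes, ← affMonomial_fst p, ← affMonomial_fst p,
    evalA_affMonomial, evalA_affMonomial,
    show ((-Pi.single j 1 : Weight n), (0 : ℤ)) = -(Pi.single j 1, 0) by rw [Prod.neg_mk, neg_zero],
    chr_neg, chr_single, Units.val_inv_eq_inv_val, Algebra.algebraMap_self_apply]
  ring

lemma symProd_mem (p : Params) (c : ℂ) : symProd c ∈ weylInvariants n := by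
  refine (mem_weylInvariants_iff_reflAct (p := p)).2 fun i hi =>
    sub_eq_zero.1 <| eq_zero_of_evalA fun y => ?_
  rw [map_sub, evalA_reflAct, sub_eq_zero, evalA_symProd p, evalA_symProd p]
  rcases index_cases i with rfl | ⟨k, hk, rfl⟩ | rfl
  · exact absurd rfl hi
  · simp only [refPt_mid hk]
    exact Equiv.prod_comp (Equiv.swap ⟨k, by omega⟩ ⟨k + 1, hk⟩)
      fun j => c - ((y j : ℂ) + (y j : ℂ)⁻¹)
  · refine Finset.prod_congr rfl fun j _ => ?_
    rw [refPt_last]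
    split_ifs
    · rw [Units.val_inv_eq_inv_val, inv_inv]; ring
    · rfl

variable (hp : p.IsGeneric n)
include hp

/-- As polynomials in c, the values of ∏ (c - x_j - x_j⁻¹) at the two points have the same roots γ_j
+ γ_j⁻¹. After a permutation each entry of γ_μ is an entry of γ_κ or its inverse, and genericity
turns this into μ_j = ±κ_{σ(j)}. -/
lemma inOrbit_of_forall_evalA {κ μ : Weight n}
    (h : ∀ f ∈ weylInvariants n, evalA (gam p κ) f = evalA (gam p μ) f) : InOrbit κ μ := by
  let u : Weight n → Fin n → ℂ := fun ν j => gam p ν j + (gam p ν j : ℂ)⁻¹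
  let Q : Weight n → Polynomial ℂ := fun ν =>
    ((Finset.univ.val.map (u ν)).map fun a => Polynomial.X - Polynomial.C a).prod
  have hQ : ∀ ν c, (Q ν).eval c = evalA (gam p ν) (symProd c) := by
    intro ν c
    rw [evalA_symProd p]
    simp only [Q, Multiset.map_map]
    change Polynomial.eval c (∏ j, (Polynomial.X - Polynomial.C (u ν j))) = _
    simp [Polynomial.eval_prod, u]
  have h1 : Q κ = Q μ := Polynomial.funext fun c => by
    rw [hQ, hQ, h _ (symProd_mem p c)]
  have h2 := congrArg Polynomial.roots h1
  simp only [Q, Polynomial.roots_multiset_prod_X_sub_C] at h2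
  obtain ⟨σ, hσ⟩ := exists_perm_of_map_eq h2.symm
  have h3 : ∀ j, ∃ e : ℤˣ, μ j = e * κ (σ j) := by
    intro j
    have h4 := hσ j
    simp only [u] at h4
    have a0 := Units.ne_zero (gam p μ j)
    have b0 := Units.ne_zero (gam p κ (σ j))
    have h5 : ((gam p μ j : ℂ) - gam p κ (σ j)) * (gam p μ j * gam p κ (σ j) - 1) = 0 := by
      field_simp at h4
      linear_combination h4
    rcases mul_eq_zero.1 h5 with h6 | h6
    · exact ⟨1, by rw [hp.gam_inj (Units.ext (sub_eq_zero.1 h6))]; simp⟩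
    · refine ⟨-1, ?_⟩
      have : gam p μ j = (gam p κ (σ j))⁻¹ := by
        rw [eq_inv_iff_mul_eq_one]
        exact Units.ext (sub_eq_zero.1 h6)
      rw [hp.gam_inj_inv this]; simp
  choose e he using h3
  exact ⟨σ, e, funext he⟩

attribute [local instance] noumiModule

/-- For each ν in the support of x outside the orbit of κ, a factor f_ν - f_ν(γ_ν) with f_ν
invariant kills P_ν without killing P_κ. The product of these factors evaluated at Y is central. -/
lemma exists_center_smul_mem {x : Laurent n} (hx : x ≠ 0) :
    ∃ (z : Subalgebra.center ℂ (AffineHecke n p)) (lam : DominantWeight n),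
      z • x ∈ orbitSubmodule hp lam.1 ∧ z • x ≠ 0 := by
  classical
  obtain ⟨κ, hκ⟩ : ∃ κ, (koornBasis hp).repr x κ ≠ 0 := by
    have : (koornBasis hp).repr x ≠ 0 := by simpa using hx
    exact Finsupp.ne_iff.1 this
  have h1 : ∀ ν, ¬ InOrbit κ ν → ∃ f ∈ weylInvariants n,
      evalA (gam p κ) f ≠ evalA (gam p ν) f := by
    intro ν hν
    by_contra hcon
    push Not at hcon
    exact hν (inOrbit_of_forall_evalA hp hcon)
  choose! f hf hne using h1
  set T := ((koornBasis hp).repr x).support.filter fun ν => ¬ InOrbit κ ν with hT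
  set g : Laurent n := ∏ ν ∈ T, (f ν - algebraMap ℂ _ (evalA (gam p ν) (f ν))) with hg
  have hz : yA p g ∈ Subalgebra.center ℂ (AffineHecke n p) := by
    rw [← Subalgebra.mem_comap]
    exact prod_mem fun ν hν => sub_mem
      ((Subalgebra.mem_comap _ _ _).2 (yA_mem_center hp (hf ν (Finset.mem_filter.1 hν).2)))
      (Subalgebra.algebraMap_mem _ _)
  refine ⟨⟨yA p g, hz⟩, ⟨dom κ, isDominant_dom κ⟩, ?_⟩
  change noumiRep p (yA p g) x ∈ _ ∧ noumiRep p (yA p g) x ≠ 0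
  constructor
  · refine (mem_orbitSubmodule hp).2 fun ν hν => ?_
    refine (inOrbit_dom κ).symm.trans ?_
    by_contra hcon
    rw [repr_yA] at hν
    obtain ⟨h2, h3⟩ := mul_ne_zero_iff.1 hν
    have hνT : ν ∈ T := Finset.mem_filter.2 ⟨Finsupp.mem_support_iff.2 h3, hcon⟩
    refine h2 ?_
    rw [hg, map_prod]
    refine Finset.prod_eq_zero hνT ?_
    rw [map_sub, AlgHom.commutes, Algebra.algebraMap_self_apply, sub_self]
  · intro h
    have h2 := congrArg (fun v => (koornBasis hp).repr v κ) h
    simp only [repr_yA, map_zero, Finsupp.coe_zero, Pi.zero_apply] at h2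
    have h3 := (mul_eq_zero.1 h2).resolve_right hκ
    rw [hg, map_prod, Finset.prod_eq_zero_iff] at h3
    obtain ⟨ν, hν, h4⟩ := h3
    rw [map_sub, AlgHom.commutes, Algebra.algebraMap_self_apply, sub_eq_zero] at h4
    exact hne ν (Finset.mem_filter.1 hν).2 h4

lemma range_orbitSubmodule : Set.range (fun lam : DominantWeight n =>
      (orbitSubmodule hp lam.1).restrictScalars (Subalgebra.center ℂ (AffineHecke n p))) =
    isotypicComponents (Subalgebra.center ℂ (AffineHecke n p)) (Laurent n) := by
  have hZ : ∀ z : Subalgebra.center ℂ (AffineHecke n p), ∃ f ∈ weylInvariants n,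
      yA p f = (z : AffineHecke n p) := fun z => by
    have h : (z : AffineHecke n p) ∈ yA p '' weylInvariants n := center_eq hp ▸ z.2
    exact h
  choose F hF hFz using hZ
  refine range_eq_isotypicComponents (χ := fun lam z => evalA (gam p lam.1) (F z))
    (fun lam z v hv => ?_) (fun c => ⟨algebraMap ℂ _ c, fun v => ?_⟩) (fun lam h => ?_)
    (fun lam x h => ?_) (fun x hx => exists_center_smul_mem hp hx)
  · change (z : AffineHecke n p) • v = _
    rw [← hFz, yA_smul_of_mem_orbitSubmodule hp (hF z) hv]
  · change algebraMap ℂ (AffineHecke n p) c • v = _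
    rw [algebraMap_smul]
  · have h1 : koorn hp lam.1 ∈ (orbitSubmodule hp lam.1).restrictScalars
        (Subalgebra.center ℂ (AffineHecke n p)) :=
      (koorn_mem_orbitSubmodule hp).2 (inOrbit_refl lam.1)
    have h2 : koorn hp lam.1 ∈ (⊥ : Submodule (Subalgebra.center ℂ (AffineHecke n p)) (Laurent n)) :=
      h ▸ h1
    exact ne_zero_of_sub_mem (koorn_sub_mem hp lam.1) h2
  · refine (mem_orbitSubmodule hp).2 fun κ hκ => inOrbit_of_forall_evalA hp fun f hf => ?_
    have h1 := h ⟨yA p f, yA_mem_center hp hf⟩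
    have h2 : F ⟨yA p f, yA_mem_center hp hf⟩ = f := yA_injective hp (hFz _)
    rw [h2] at h1
    have h3 : noumiRep p (yA p f) x = evalA (gam p lam.1) f • x := h1
    have h4 := congrArg (fun w => (koornBasis hp).repr w κ) h3
    simp only [repr_yA, map_smul, Finsupp.smul_apply, smul_eq_mul] at h4
    exact (mul_right_cancel₀ hκ h4).symm

end Isotypic

end

end

end Koornwinder

theorem mainTheorem12 (n : ℕ) (hn : 2 ≤ n) (p : Koornwinder.Params) (hp : p.IsGeneric n) :
    ∃ π : Koornwinder.AffineHecke n p →ₐ[ℂ] Module.End ℂ (Koornwinder.Laurent n),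
      Koornwinder.IsNoumiRep n p π ∧
      (∀ π', Koornwinder.IsNoumiRep n p π' → π' = π) ∧
      ∃ P : Module.Basis (Koornwinder.Weight n) ℂ (Koornwinder.Laurent n),
        Koornwinder.IsKoornwinderBasis π P ∧
        (∀ P', Koornwinder.IsKoornwinderBasis π P' → P' = P) ∧
        letI : Module (Koornwinder.AffineHecke n p) (Koornwinder.Laurent n) :=
          Koornwinder.repModule π
        ∃ N : Koornwinder.DominantWeight n →
            Submodule (Koornwinder.AffineHecke n p) (Koornwinder.Laurent n),
          (∀ lam, (N lam : Set (Koornwinder.Laurent n)) =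
            Submodule.span ℂ (P '' {mu | Koornwinder.InOrbit lam.1 mu})) ∧
          -- multiplicity-free irreducible decomposition
          DirectSum.IsInternal N ∧
          (∀ lam, IsSimpleModule (Koornwinder.AffineHecke n p) (N lam)) ∧
          (∀ lam mu, lam ≠ mu → IsEmpty (N lam ≃ₗ[Koornwinder.AffineHecke n p] N mu)) ∧
          -- the center
          Function.Injective (Koornwinder.yMap n p) ∧
          (Subalgebra.center ℂ (Koornwinder.AffineHecke n p) :
              Set (Koornwinder.AffineHecke n p)) =
            Koornwinder.yMap n p '' Koornwinder.weylInvariants n ∧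
          -- isotypic decomposition and central characters
          Set.range (fun lam => (N lam).restrictScalars
              (Subalgebra.center ℂ (Koornwinder.AffineHecke n p))) =
            isotypicComponents (Subalgebra.center ℂ (Koornwinder.AffineHecke n p))
              (Koornwinder.Laurent n) ∧
          ∀ lam, ∀ f ∈ Koornwinder.weylInvariants n, ∀ v ∈ N lam,
            Koornwinder.yMap n p f • v =
              Koornwinder.evalAt (Koornwinder.gam p lam.1) f • v := by
  have : Fact (2 ≤ n) := ⟨hn⟩
  refine ⟨Koornwinder.noumiRep p, Koornwinder.isNoumiRep_noumiRep p,
    fun π' h => Koornwinder.noumiRep_unique p h, Koornwinder.koornBasis hp,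
    Koornwinder.isKoornwinderBasis_koornBasis hp,
    fun P' h => Koornwinder.koornBasis_unique hp h,
    fun lam => Koornwinder.orbitSubmodule hp lam.1, fun lam => rfl,
    Koornwinder.isInternal_orbitSubmodule hp,
    fun lam => Koornwinder.isSimpleModule_orbitSubmodule hp lam.1,
    fun lam mu h => Koornwinder.isEmpty_orbitSubmodule_equiv hp h, ?_, ?_,
    Koornwinder.range_orbitSubmodule hp, fun lam f hf v hv => ?_⟩
  · rw [show (Koornwinder.yMap n p : _ → _) = Koornwinder.yA p from
      funext (Koornwinder.yMap_eq p)]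
    exact Koornwinder.yA_injective hp
  · rw [show (Koornwinder.yMap n p : _ → _) = Koornwinder.yA p from
      funext (Koornwinder.yMap_eq p)]
    exact Koornwinder.center_eq hp
  · rw [Koornwinder.yMap_eq, ← Koornwinder.evalA_eq]
    exact Koornwinder.yA_smul_of_mem_orbitSubmodule hp hf hv
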